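/- **Conventions.** An $N$-qubit $\mathsf{QAC}$ circuit (no ancillas) is an alternation of layers of arbitrary single-qubit gates and layers of $CZ$ gates of unbounded width acting on disjoint sets of qubits; its depth is its number of $CZ$ layers. For $N$-qubit operators, $\mathcal D_F(U,V)=2^{-N}\|U-V\|_F^2$, and for unitaries $\mathcal D_{\rm avg}(U,V)=\mathbb E_{\psi}\bigl[1-|\langle U\psi,V\psi\rangle|^2\bigr]$ with $\psi$ Haar-random. For an $n$-qubit unitary $C$, a qubit $i$ and $P\in\{X,Y,Z\}$, let $O_{P_i}=C^\dagger P_iC$. Let $\lg n=\lfloor\log_2(n+2)\rfloor$. A learner is a probabilistic program (in a fixed language over binary trees with unit-cost elementary operations and fair coins) with query access to an unknown $C$: a query prepares a product of single-qubit Pauli eigenstates, applies $C$ or $C^\dagger$, measures every qubit in a Pauli basis, returns the $n$ outcomes, and costs time $n+1$. Outputs are written explicitly; single-qubit gates are written as nonzero integer quaternions, which stand for the unitaries $(aI+i(bZ+cY+dX))/\sqrt{a^2+b^2+c^2+d^2}$. **Theorem.** For all constants $d,k\in\mathbb N$ there are a learner and a constant $K$ such that for all $n\ge1$, every $n$-qubit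 $\mathsf{QAC}$ circuit of depth at most $d$, with unitary $C$, and every $t\in\mathbb N$: on input $(n,t)$ in unary and with query access to $C$, the learner always halts within time $2^{K(\lg n)^K}(t+1)$, and with probability at least $1-2^{-t}$ it outputs observables $\widetilde O_{P_i}$ (as lists of Pauli strings with rational coefficients), $2n$-qubit circuits $C_i^*$, an ordering of $\{1,\dots,n\}$, and a $2n$-qubit $\mathsf{QAC}$ circuit, with unitary $C^*_{\rm sew}$, such that 1. $\mathcal D_F(C^*_{\rm sew},C\otimes C^\dagger)\le n^{-k}$ and $\mathcal D_{\rm avg}(C^*_{\rm sew},C\otimes C^\dagger)\le n^{-k}$; 2. the circuit for $C^*_{\rm sew}$ has depth at most $K(\lg n)^K$; 3. $C^*_{\rm sew}=\mathrm{SWAP}^{\otimes n}\prod_i C_i^*$, the product taken in the output ordering, where $\mathrm{SWAP}^{\otimes n}$ exchanges the first and last $n$ qubits and circuits are identified with their unitaries; 4. for every $i$: the circuit $C_i^*$ has depth at most $K$; there is a set $A$ of at most $K(\lg n)^d$ of the first $n$ qubits such that the three observables $\widetilde O_{P_i}$ are supported on $A$ and $C^*_i$ is supported on $A\cup\{n+i\}$;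 one has $\mathcal D_F(\widetilde O_{P_i},O_{P_i})\le n^{-k}$ for $P\in\{X,Y,Z\}$; and $\mathcal D_F(W_i,C_i^*)\le n^{-k}$ for every unitary $W_i$ closest in Frobenius norm to $\frac12 I\otimes I+\frac12\sum_{P}\widetilde O_{P_i}\otimes P_i$. -/

import Mathlib

open scoped ENNReal Matrix

noncomputable section

namespace QACLearn

/-! ### Qubits, operators and tensor products

Computational basis states of `N` qubits are functions `Fin N → Bool` (`true` is the state `1`). -/

/-- Operators on `N` qubits, as matrices in the computational basis. -/
abbrev Op (N : ℕ) := Matrix (Fin N → Bool) (Fin N → Bool) ℂ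

/-- The group of single-qubit gates. -/
abbrev U2 := Matrix.unitaryGroup Bool ℂ

/-- The group of unitaries on `N` qubits. -/
abbrev UN (N : ℕ) := Matrix.unitaryGroup (Fin N → Bool) ℂ

/-- The tensor product of `N` single-qubit operators. -/
def tensor {N : ℕ} (u : Fin N → Matrix Bool Bool ℂ) : Op N :=
  Matrix.of fun x y => ∏ i, u i (x i) (y i)

theorem tensor_mul {N : ℕ} (u v : Fin N → Matrix Bool Bool ℂ) :
    tensor u * tensor v = tensor fun i => u i * v i := by
  ext x y
  simp only [tensor, Matrix.mul_apply, Matrix.of_apply]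
  rw [Finset.prod_univ_sum, Fintype.piFinset_univ]
  exact Finset.sum_congr rfl fun z _ => Finset.prod_mul_distrib.symm

theorem tensor_one {N : ℕ} : tensor (fun _ : Fin N => (1 : Matrix Bool Bool ℂ)) = 1 := by
  ext x y
  simp only [tensor, Matrix.of_apply, Matrix.one_apply]
  by_cases h : x = y
  · simp [h]
  · rw [if_neg h]
    obtain ⟨i, hi⟩ := Function.ne_iff.mp h
    exact Finset.prod_eq_zero (Finset.mem_univ i) (if_neg hi)

theorem tensor_star {N : ℕ} (u : Fin N → Matrix Bool Bool ℂ) :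
    star (tensor u) = tensor fun i => star (u i) := by
  ext x y
  simp [tensor, Matrix.star_apply, Matrix.of_apply]

/-- A layer of single-qubit gates, one on each qubit. -/
def tensorU {N : ℕ} (u : Fin N → U2) : UN N :=
  ⟨tensor fun i => (u i : Matrix Bool Bool ℂ), by
    rw [Matrix.mem_unitaryGroup_iff, tensor_star, tensor_mul, ← tensor_one]
    congr 1
    funext i
    exact Matrix.mem_unitaryGroup_iff.mp (u i).2⟩

/-- The operator `A ⊗ B` on `n + n` qubits, with `A` on the first `n` and `B` on the last `n`. -/
def tensor2 {n : ℕ} (A B : Op n) : Op (n + n) :=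
  Matrix.of fun x y =>
    A (fun i => x (Fin.castAdd n i)) (fun i => y (Fin.castAdd n i)) *
      B (fun i => x (Fin.natAdd n i)) (fun i => y (Fin.natAdd n i))

/-- `SWAP^{⊗ n}`: exchanges the first `n` qubits with the last `n` qubits. -/
def swapAll (n : ℕ) : Op (n + n) :=
  Matrix.of fun x y =>
    if (∀ i : Fin n, x (Fin.castAdd n i) = y (Fin.natAdd n i) ∧
      x (Fin.natAdd n i) = y (Fin.castAdd n i)) then 1 else 0

/-- `M` acts trivially outside the set `S` of qubits: `M = A ⊗ I` with `A` acting on `S`. -/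
def SupportedOn {N : ℕ} (S : Finset (Fin N)) (M : Op N) : Prop :=
  ∃ A : Matrix (S → Bool) (S → Bool) ℂ, ∀ x y : Fin N → Bool,
    M x y = if (∀ i, i ∉ S → x i = y i) then A (fun i => x i) (fun i => y i) else 0

/-! ### QAC circuits -/

/-- A product of `CZ` gates of unbounded width acting on disjoint sets of qubits, given by a
labelling: for each nonzero label `l` that occurs, one `CZ` gate acts on the set of all qubits
labelled `l`; qubits labelled `0` are not acted upon. -/
def czSign {N : ℕ} (label : Fin N → ℕ) (x : Fin N → Bool) : ℂ :=
  ∏ l ∈ (Finset.univ.image label).erase 0, if (∀ i, label i = l → x i = true) then -1 else 1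

theorem czSign_sq {N : ℕ} (label : Fin N → ℕ) (x : Fin N → Bool) :
    czSign label x * star (czSign label x) = 1 := by
  unfold czSign
  rw [star_prod, ← Finset.prod_mul_distrib]
  exact Finset.prod_eq_one fun l _ => by split_ifs <;> simp

/-- The unitary of a layer of disjoint `CZ` gates. -/
def czU {N : ℕ} (label : Fin N → ℕ) : UN N :=
  ⟨Matrix.diagonal (czSign label), by
    rw [Matrix.mem_unitaryGroup_iff, Matrix.star_eq_conjTranspose,
      Matrix.diagonal_conjTranspose, Matrix.diagonal_mul_diagonal, ← Matrix.diagonal_one]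
    congr 1
    funext x
    exact czSign_sq label x⟩

/-- Circuits on `N` qubits without ancillas whose single-qubit gates are (names of gates) in `G`:
alternating layers of single-qubit gates and layers of disjoint `CZ` gates of any width, closed by
a layer of single-qubit gates. The first entry of `layers` is applied first. -/
structure Circuit (G : Type) (N : ℕ) where
  layers : List ((Fin N → G) × (Fin N → ℕ))
  last : Fin N → G

/-- The number of layers of `CZ` gates. (All layers, single-qubit ones included, number
`2 * depth + 1`; the number of `CZ` gates is at most `depth * N`.) -/
def Circuit.depth {G : Type} {N : ℕ} (C : Circuit G N) : ℕ := C.layers.length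

/-- The unitary of a list of layers. -/
def layersUnitary {G : Type} {N : ℕ} (sem : G → U2) :
    List ((Fin N → G) × (Fin N → ℕ)) → UN N
  | [] => 1
  | l :: ls => layersUnitary sem ls * (czU l.2 * tensorU fun i => sem (l.1 i))

/-- The unitary that a circuit implements, where `sem` interprets the single-qubit gates. -/
def Circuit.unitaryOf {G : Type} {N : ℕ} (sem : G → U2) (C : Circuit G N) : UN N :=
  (tensorU fun i => sem (C.last i)) * layersUnitary sem C.layers

/-- Circuits with arbitrary single-qubit gates. -/
abbrev QACCircuit (N : ℕ) := Circuit U2 N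

/-- The unitary implemented by a circuit. -/
def QACCircuit.unitary {N : ℕ} (C : QACCircuit N) : UN N := C.unitaryOf id

/-- A finite description of a single-qubit gate: a nonzero integer quaternion. -/
structure Gate where
  a : ℤ
  b : ℤ
  c : ℤ
  d : ℤ
  pos : 0 < a ^ 2 + b ^ 2 + c ^ 2 + d ^ 2

/-- The norm of the quaternion of a gate. -/
def Gate.norm (g : Gate) : ℝ := Real.sqrt ((g.a ^ 2 + g.b ^ 2 + g.c ^ 2 + g.d ^ 2 : ℤ) : ℝ)

/-- The gate `(a I + i (b Z + c Y + d X)) / √(a² + b² + c² + d²)`. -/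
def Gate.matrix (g : Gate) : Matrix Bool Bool ℂ :=
  ((g.norm : ℂ))⁻¹ • Matrix.of fun x y => match x, y with
    | false, false => (g.a : ℂ) + g.b * Complex.I
    | false, true => (g.c : ℂ) + g.d * Complex.I
    | true, false => -(g.c : ℂ) + g.d * Complex.I
    | true, true => (g.a : ℂ) - g.b * Complex.I

theorem Gate.matrix_mem (g : Gate) : g.matrix ∈ Matrix.unitaryGroup Bool ℂ := by
  have hp : (0 : ℝ) < ((g.a ^ 2 + g.b ^ 2 + g.c ^ 2 + g.d ^ 2 : ℤ) : ℝ) := by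
    exact_mod_cast g.pos
  have hn : (g.norm : ℂ) ≠ 0 := by
    exact_mod_cast (Real.sqrt_pos.mpr hp).ne'
  have hs : (g.norm : ℂ) * g.norm = (g.a : ℂ) ^ 2 + g.b ^ 2 + g.c ^ 2 + g.d ^ 2 := by
    have h : g.norm * g.norm = ((g.a ^ 2 + g.b ^ 2 + g.c ^ 2 + g.d ^ 2 : ℤ) : ℝ) :=
      Real.mul_self_sqrt hp.le
    have h2 := congrArg (fun r : ℝ => (r : ℂ)) h
    push_cast at h2
    exact h2
  have hI : Complex.I ^ 2 = -1 := Complex.I_sq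
  rw [Matrix.mem_unitaryGroup_iff]
  ext x y
  have key : ∀ z w : ℂ, z = w * ((g.norm : ℂ) * g.norm) →
      ((g.norm : ℂ))⁻¹ * ((g.norm : ℂ))⁻¹ * z = w := by
    intro z w h
    rw [h]
    field_simp
  cases x <;> cases y <;>
    simp [Gate.matrix, Matrix.mul_apply, Matrix.star_apply]
  · rw [← key _ 1 (by rw [hs, one_mul])]
    linear_combination ((g.norm : ℂ))⁻¹ * ((g.norm : ℂ))⁻¹ * (-(g.b : ℂ) ^ 2 - g.d ^ 2) * hI
  · ring
  · ring
  · rw [← key _ 1 (by rw [hs, one_mul])]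
    linear_combination ((g.norm : ℂ))⁻¹ * ((g.norm : ℂ))⁻¹ * (-(g.b : ℂ) ^ 2 - g.d ^ 2) * hI

/-- The unitary of a gate description. -/
def Gate.toU2 (g : Gate) : U2 := ⟨g.matrix, g.matrix_mem⟩

/-- Finite descriptions of circuits. -/
abbrev CircuitCode (N : ℕ) := Circuit Gate N

/-- The unitary implemented by a described circuit. -/
def CircuitCode.unitary {N : ℕ} (C : CircuitCode N) : UN N := C.unitaryOf Gate.toU2

/-! ### Pauli operators, distances, sewing -/

/-- The three nontrivial Pauli operators. -/
inductive Pauli where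
  | X
  | Y
  | Z

instance : Fintype Pauli where
  elems := ⟨{Pauli.X, Pauli.Y, Pauli.Z}, by simp⟩
  complete := by intro p; cases p <;> simp

/-- The matrix of a Pauli operator. -/
def Pauli.matrix (p : Pauli) : Matrix Bool Bool ℂ :=
  Matrix.of fun x y => match p, x, y with
    | .X, false, true => 1
    | .X, true, false => 1
    | .Y, false, true => -Complex.I
    | .Y, true, false => Complex.I
    | .Z, false, false => 1
    | .Z, true, true => -1
    | _, _, _ => 0

/-- A Pauli string; `none` stands for the identity. -/
abbrev PauliString (n : ℕ) := Fin n → Option Pauli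

/-- The operator of a Pauli string. -/
def PauliString.op {n : ℕ} (Q : PauliString n) : Op n :=
  tensor fun i => (Q i).elim 1 Pauli.matrix

/-- The operator `P_i`: the Pauli operator `P` on qubit `i`. -/
def pauliAt {n : ℕ} (P : Pauli) (i : Fin n) : Op n :=
  PauliString.op fun j => if j = i then some P else none

/-- The Heisenberg-evolved observable `O_{P_i} = C† P_i C`. -/
def heisenberg {n : ℕ} (C : Op n) (P : Pauli) (i : Fin n) : Op n := Cᴴ * pauliAt P i * C

/-- The squared Frobenius norm. -/
def frobSq {N : ℕ} (M : Op N) : ℝ := ∑ x, ∑ y, ‖M x y‖ ^ 2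

/-- The normalized Frobenius distance `‖U - V‖_F² / 2^N`. -/
def distF {N : ℕ} (U V : Op N) : ℝ := frobSq (U - V) / 2 ^ N

/-- Pure states of `N` qubits. -/
abbrev PureState (N : ℕ) := Metric.sphere (0 : EuclideanSpace ℂ (Fin N → Bool)) 1

/-- The surface measure on the unit sphere of `ℂ^(2^N)`; normalized, it is the Haar measure on
pure states. -/
def sphereMeasure (N : ℕ) : MeasureTheory.Measure (PureState N) :=
  (MeasureTheory.Measure.addHaar :
    MeasureTheory.Measure (EuclideanSpace ℂ (Fin N → Bool))).toSphere

/-- The fidelity `|⟨Uψ, Vψ⟩|²` of the pure states that `U` and `V` produce from `ψ`. -/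
def fidelity {N : ℕ} (U V : Op N) (ψ : PureState N) : ℝ :=
  ‖star (U *ᵥ ψ.1.ofLp) ⬝ᵥ (V *ᵥ ψ.1.ofLp)‖ ^ 2

/-- The average-case distance of the unitary channels of `U` and `V`: the average of
`1 - fidelity` over Haar-random pure input states. -/
def distAvg {N : ℕ} (U V : Op N) : ℝ :=
  ⨍ ψ, (1 - fidelity U V ψ) ∂(sphereMeasure N)

/-- The operator `(1/2) I ⊗ I + (1/2) ∑_P A_P ⊗ P_i` on `n + n` qubits. -/
def sewOp {n : ℕ} (A : Pauli → Op n) (i : Fin n) : Op (n + n) :=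
  (1 / 2 : ℂ) • (1 + ∑ P, tensor2 (A P) (pauliAt P i))

/-- `W` is a projection of `A` onto the unitaries: a unitary closest to `A` in Frobenius norm. -/
def IsProjU {N : ℕ} (A W : Op N) : Prop :=
  W ∈ Matrix.unitaryGroup (Fin N → Bool) ℂ ∧
    ∀ B ∈ Matrix.unitaryGroup (Fin N → Bool) ℂ, frobSq (A - W) ≤ frobSq (A - B)

/-! ### Data and programs

The machine model is a small language over binary trees with unit-cost elementary operations
(constructing a pair, projecting, testing for the empty tree), extended by a coin and by a query
instruction. Every such program is a fixed finite object. -/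

/-- Binary trees. -/
inductive Data where
  | nil
  | cons (l r : Data)

namespace Data

/-- Left subtree (the empty tree for the empty tree). -/
def left : Data → Data
  | nil => nil
  | cons l _ => l

/-- Right subtree (the empty tree for the empty tree). -/
def right : Data → Data
  | nil => nil
  | cons _ r => r

/-- Test for the empty tree. -/
def isNil : Data → Bool
  | nil => true
  | cons _ _ => false

/-- A list of trees as a tree. -/
def ofList : List Data → Data
  | [] => nil
  | x :: xs => cons x (ofList xs)

/-- A family of trees indexed by `Fin n`, as a list. -/
def ofFn {n : ℕ} (f : Fin n → Data) : Data := ofList (List.ofFn f)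

/-- Natural numbers in unary. -/
def ofNat : ℕ → Data
  | 0 => nil
  | n + 1 => cons nil (ofNat n)

/-- Truth values. -/
def ofBool : Bool → Data
  | false => nil
  | true => cons nil nil

/-- Integers: a sign and an absolute value. -/
def ofInt (z : ℤ) : Data := cons (ofBool (decide (z < 0))) (ofNat z.natAbs)

/-- The entry with index `i` of a list. -/
def get (x : Data) : ℕ → Data
  | 0 => x.left
  | i + 1 => x.right.get i

/-- Reading a Pauli operator: `0`, `1` and anything else stand for `X`, `Y` and `Z`. -/
def toPauli : Data → Pauli
  | nil => .X
  | cons _ nil => .Y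
  | cons _ (cons _ _) => .Z

end Data

/-- Programs. Each takes a tree to a (random) tree. -/
inductive Prog where
  /-- the input -/
  | id
  /-- the empty tree -/
  | nil
  /-- left subtree of the input -/
  | left
  /-- right subtree of the input -/
  | right
  /-- run both on the input and pair the results -/
  | cons (p q : Prog)
  /-- run the first, then the second on its result -/
  | comp (p q : Prog)
  /-- run `c` on the input; if the result is nonempty run `p` on the input, else run `q` on it -/
  | cond (c p q : Prog)
  /-- while `c` gives a nonempty result, replace the current tree by the result of `p` -/
  | loop (c p : Prog)
  /-- a fair coin -/
  | coin
  /-- a query to the unknown unitary, described by the input -/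
  | query

/-- `Exec O q p x μ`: on input `x`, the program `p` terminates for all outcomes of its coins and
queries, and `μ` is the joint distribution of its result and its running time. A query on input
`x` is answered by a sample of `O x` and takes time `q`; each other elementary step takes time
`1`. -/
inductive Exec (O : Data → PMF Data) (q : ℕ) : Prog → Data → PMF (Data × ℕ) → Prop where
  | id (x) : Exec O q .id x (PMF.pure (x, 1))
  | nil (x) : Exec O q .nil x (PMF.pure (.nil, 1))
  | left (x) : Exec O q .left x (PMF.pure (x.left, 1))
  | right (x) : Exec O q .right x (PMF.pure (x.right, 1))
  | cons {p p' x μ ν} (h : Exec O q p x μ) (h' : Exec O q p' x ν) :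
      Exec O q (.cons p p') x
        (μ.bind fun r => ν.map fun s => (.cons r.1 s.1, r.2 + s.2 + 1))
  | comp {p p' x μ} {ν : Data × ℕ → PMF (Data × ℕ)} (h : Exec O q p x μ)
      (h' : ∀ r ∈ μ.support, Exec O q p' r.1 (ν r)) :
      Exec O q (.comp p p') x (μ.bind fun r => (ν r).map fun s => (s.1, r.2 + s.2 + 1))
  | cond {c p p' x μ} {ν : Data × ℕ → PMF (Data × ℕ)} (h : Exec O q c x μ)
      (h' : ∀ r ∈ μ.support, Exec O q (if r.1.isNil then p' else p) x (ν r)) :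
      Exec O q (.cond c p p') x (μ.bind fun r => (ν r).map fun s => (s.1, r.2 + s.2 + 1))
  | loop {c p x μ} {ν : Data × ℕ → PMF (Data × ℕ)} (h : Exec O q c x μ)
      (h' : ∀ r ∈ μ.support,
        Exec O q (if r.1.isNil then .id else .comp p (.loop c p)) x (ν r)) :
      Exec O q (.loop c p) x (μ.bind fun r => (ν r).map fun s => (s.1, r.2 + s.2 + 1))
  | coin (x) : Exec O q .coin x
      ((PMF.uniformOfFintype Bool).map fun b => (Data.ofBool b, 1))
  | query (x) : Exec O q .query x ((O x).map fun y => (y, q))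

/-! ### Queries: Pauli eigenstates in, the unknown unitary or its inverse, Pauli measurements -/

/-- The unitary whose column `false` (`true`) is the eigenvector of a Pauli operator with
eigenvalue `1` (`-1`). -/
def eigenbasis (p : Pauli) : Matrix Bool Bool ℂ :=
  match p with
  | .X => ((Real.sqrt 2 : ℂ))⁻¹ • Matrix.of fun x y => if x && y then -1 else 1
  | .Y => ((Real.sqrt 2 : ℂ))⁻¹ • Matrix.of fun x y =>
      (if x then Complex.I else 1) * (if x && y then -1 else 1)
  | .Z => 1

theorem sqrt_two_inv_sq : ((Real.sqrt 2 : ℂ))⁻¹ * ((Real.sqrt 2 : ℂ))⁻¹ = 1 / 2 := by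
  rw [← mul_inv, ← Complex.ofReal_mul, Real.mul_self_sqrt (by norm_num)]
  norm_num

theorem eigenbasis_mem (p : Pauli) : eigenbasis p ∈ Matrix.unitaryGroup Bool ℂ := by
  have h2 := sqrt_two_inv_sq
  have hI : Complex.I ^ 2 = -1 := Complex.I_sq
  rw [Matrix.mem_unitaryGroup_iff]
  ext x y
  cases p <;> cases x <;> cases y <;>
    simp [eigenbasis, Matrix.mul_apply, Matrix.star_apply] <;>
    first
      | linear_combination 2 * h2
      | linear_combination 2 * h2 -
          2 * ((Real.sqrt 2 : ℂ))⁻¹ * ((Real.sqrt 2 : ℂ))⁻¹ * hI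

/-- An eigenbasis as a unitary. -/
def eigenbasisU (p : Pauli) : U2 := ⟨eigenbasis p, eigenbasis_mem p⟩

/-- The amplitudes `⟨b, U s⟩`, where `s` runs through the products of eigenstates of the Paulis
`prep` and `b` through the products of eigenstates of the Paulis `meas`. -/
def amplitudes {n : ℕ} (U : UN n) (prep meas : Fin n → Pauli) : UN n :=
  star (tensorU fun i => eigenbasisU (meas i)) * U * tensorU fun i => eigenbasisU (prep i)

theorem sum_column {n : ℕ} (M : UN n) (s : Fin n → Bool) :
    ∑ b, ENNReal.ofReal (‖(M : Op n) b s‖ ^ 2) = 1 := by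
  have h := Matrix.mem_unitaryGroup_iff'.mp M.2
  have h1 := congrFun (congrFun h s) s
  rw [Matrix.mul_apply, Matrix.one_apply_eq] at h1
  have h2 : ∑ b, ‖(M : Op n) b s‖ ^ 2 = 1 := by
    have : ((∑ b, ‖(M : Op n) b s‖ ^ 2 : ℝ) : ℂ) = 1 := by
      rw [← h1]
      push_cast
      refine Finset.sum_congr rfl fun b _ => ?_
      rw [Matrix.star_apply, Complex.star_def, Complex.conj_mul']
    exact_mod_cast this
  rw [← ENNReal.ofReal_sum_of_nonneg fun b _ => sq_nonneg _, h2, ENNReal.ofReal_one]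

/-- The distribution of the outcome: prepare on each qubit `i` the eigenstate of `prep i` with
eigenvalue `(-1)^(s i)`, apply `U`, and measure each qubit `i` in the eigenbasis of `meas i`. -/
def outcome {n : ℕ} (U : UN n) (prep : Fin n → Pauli) (s : Fin n → Bool) (meas : Fin n → Pauli) :
    PMF (Fin n → Bool) :=
  PMF.ofFintype (fun b => ENNReal.ofReal (‖(amplitudes U prep meas : Op n) b s‖ ^ 2))
    (sum_column _ s)

/-- The query oracle for an unknown unitary `U`. The query `(v, (prep, meas))` consists of a flag
`v` (empty: apply `U`, nonempty: apply `U†`), a list `prep` whose entry `i` is a pair of a Pauli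
operator and a sign (empty: `+`, nonempty: `-`), the state to prepare on qubit `i`, and a list
`meas` of Pauli operators to measure. The answer is the list of the `n` outcome bits. -/
def oracle {n : ℕ} (U : UN n) (x : Data) : PMF Data :=
  (outcome (if x.left.isNil then U else star U)
    (fun i => (x.right.left.get i).left.toPauli)
    (fun i => !(x.right.left.get i).right.isNil)
    (fun i => (x.right.right.get i).toPauli)).map
      fun b => Data.ofFn fun i => Data.ofBool (b i)

/-! ### The output of the learner -/

/-- A finite description of a learned observable: the operator `∑ (c / denom) Q` over the listed
pairs of a Pauli string `Q` and an integer `c`. -/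
structure ObsCode (n : ℕ) where
  terms : List (PauliString n × ℤ)
  denom : ℕ

/-- The described operator. -/
def ObsCode.op {n : ℕ} (A : ObsCode n) : Op n :=
  (A.terms.map fun t => ((t.2 : ℂ) / (A.denom : ℂ)) • t.1.op).sum

/-- What the learner outputs: learned observables `Õ_{P_i}`, compiled circuits `C*_i`, the order
in which they are sewn, and the sewn circuit. -/
structure Output (n : ℕ) where
  obs : Fin n → Pauli → ObsCode n
  part : Fin n → CircuitCode (n + n)
  order : Equiv.Perm (Fin n)
  sewn : CircuitCode (n + n)

/-- Encoding of a gate. -/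
def Gate.data (g : Gate) : Data :=
  .ofList [.ofInt g.a, .ofInt g.b, .ofInt g.c, .ofInt g.d]

/-- Encoding of a circuit. -/
def CircuitCode.data {N : ℕ} (C : CircuitCode N) : Data :=
  .cons
    (.ofList (C.layers.map fun l =>
      .cons (.ofFn fun i => (l.1 i).data) (.ofFn fun i => .ofNat (l.2 i))))
    (.ofFn fun i => (C.last i).data)

/-- Encoding of the entries of a Pauli string. -/
def pauliData : Option Pauli → Data
  | none => .ofNat 0
  | some .X => .ofNat 1
  | some .Y => .ofNat 2
  | some .Z => .ofNat 3

/-- Encoding of a learned observable. -/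
def ObsCode.data {n : ℕ} (A : ObsCode n) : Data :=
  .cons (.ofList (A.terms.map fun t => .cons (.ofFn fun i => pauliData (t.1 i)) (.ofInt t.2)))
    (.ofNat A.denom)

/-- Encoding of an output. -/
def Output.data {n : ℕ} (o : Output n) : Data :=
  .ofList
    [.ofFn fun i => .ofList [(o.obs i .X).data, (o.obs i .Y).data, (o.obs i .Z).data],
      .ofFn fun i => (o.part i).data,
      .ofFn fun i => .ofNat (o.order i),
      o.sewn.data]

/-- `⌊log₂ (n + 2)⌋`, at least `1`. -/
def lg (n : ℕ) : ℕ := Nat.log 2 (n + 2)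

/-- The output is correct for the unitary `C`, for the depth `d`, the accuracy `ε` and the
constant `K`. -/
structure Output.Correct {n : ℕ} (o : Output n) (C : Op n) (d K : ℕ) (ε : ℝ) : Prop where
  /-- `C*_sew` is close to `C ⊗ C†` in normalized Frobenius distance, -/
  distF_le : distF (o.sewn.unitary : Op (n + n)) (tensor2 C Cᴴ) ≤ ε
  /-- and in average-case distance; -/
  distAvg_le : distAvg (o.sewn.unitary : Op (n + n)) (tensor2 C Cᴴ) ≤ ε
  /-- the circuit for it has polylogarithmic depth; -/
  depth_le : o.sewn.depth ≤ K * lg n ^ K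
  /-- it is sewn from the circuits `C*_i`; -/
  sewn_eq : (o.sewn.unitary : Op (n + n)) =
    swapAll n * (List.ofFn fun j => ((o.part (o.order j)).unitary : Op (n + n))).prod
  /-- these have constant depth; -/
  part_depth_le : ∀ i, (o.part i).depth ≤ K
  /-- the learned observables and the circuit for qubit `i` act on `O(log^d n)` qubits; -/
  support : ∀ i, ∃ A : Finset (Fin n), A.card ≤ K * lg n ^ d ∧
    (∀ P, SupportedOn A (o.obs i P).op) ∧
    SupportedOn (insert (Fin.natAdd n i) (A.map (Fin.castAddEmb n)))
      ((o.part i).unitary : Op (n + n))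
  /-- the learned observables are close to the Heisenberg-evolved observables; -/
  obs_close : ∀ i P, distF (o.obs i P).op (heisenberg C P i) ≤ ε
  /-- `C*_i` is close to the learned unitary `W_i`. -/
  part_close : ∀ i, ∀ W, IsProjU (sewOp (fun P => (o.obs i P).op) i) W →
    distF W ((o.part i).unitary : Op (n + n)) ≤ ε

end QACLearn

end

namespace QACLearn

/-! ### Running programs -/

/-- The program `p` halts on `x` within time `T`, and its result has distribution `f`. -/
def Runs (O : Data → PMF Data) (q : ℕ) (p : Prog) (x : Data) (f : PMF Data) (T : ℕ) : Prop :=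
  ∃ μ, Exec O q p x μ ∧ μ.map Prod.fst = f ∧ ∀ r ∈ μ.support, r.2 ≤ T

theorem pmf_bind_congr {α β : Type*} (μ : PMF α) {f g : α → PMF β}
    (h : ∀ a ∈ μ.support, f a = g a) : μ.bind f = μ.bind g := by
  ext b
  simp only [PMF.bind_apply]
  refine tsum_congr fun a => ?_
  by_cases ha : a ∈ μ.support
  · rw [h a ha]
  · rw [(PMF.apply_eq_zero_iff μ a).mpr ha, zero_mul, zero_mul]

section Runs

variable {O : Data → PMF Data} {q : ℕ}

theorem Runs.mono {p : Prog} {x : Data} {f : PMF Data} {T T' : ℕ} (h : Runs O q p x f T)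
    (hT : T ≤ T') : Runs O q p x f T' := by
  obtain ⟨μ, h1, h2, h3⟩ := h
  exact ⟨μ, h1, h2, fun r hr => (h3 r hr).trans hT⟩

theorem Runs.of_pure {p : Prog} {x y : Data} {T : ℕ} (h : Exec O q p x (PMF.pure (y, T))) :
    Runs O q p x (PMF.pure y) T :=
  ⟨_, h, PMF.pure_map _ _, fun r hr => by
    rw [PMF.support_pure, Set.mem_singleton_iff] at hr; simp [hr]⟩

theorem Runs.id (x : Data) : Runs O q .id x (PMF.pure x) 1 := .of_pure (.id x)
theorem Runs.nil (x : Data) : Runs O q .nil x (PMF.pure .nil) 1 := .of_pure (.nil x)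
theorem Runs.left (x : Data) : Runs O q .left x (PMF.pure x.left) 1 := .of_pure (.left x)
theorem Runs.right (x : Data) : Runs O q .right x (PMF.pure x.right) 1 := .of_pure (.right x)

theorem Runs.coin (x : Data) :
    Runs O q .coin x ((PMF.uniformOfFintype Bool).map Data.ofBool) 1 := by
  refine ⟨_, .coin x, ?_, fun r hr => ?_⟩
  · rw [PMF.map_comp]; rfl
  · obtain ⟨b, -, rfl⟩ := (PMF.mem_support_map_iff _ _ _).mp hr
    exact le_rfl

theorem Runs.query (x : Data) : Runs O q .query x (O x) q := by
  refine ⟨_, .query x, ?_, fun r hr => ?_⟩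
  · rw [PMF.map_comp]; exact PMF.map_id _
  · obtain ⟨b, -, rfl⟩ := (PMF.mem_support_map_iff _ _ _).mp hr
    exact le_rfl

theorem Runs.cons {p p' : Prog} {x : Data} {f g : PMF Data} {T T' : ℕ} (h : Runs O q p x f T)
    (h' : Runs O q p' x g T') :
    Runs O q (.cons p p') x (f.bind fun a => g.map fun b => .cons a b) (T + T' + 1) := by
  obtain ⟨μ, h1, rfl, h3⟩ := h
  obtain ⟨ν, k1, rfl, k3⟩ := h'
  refine ⟨_, .cons h1 k1, ?_, fun r hr => ?_⟩
  · rw [PMF.map_bind, PMF.bind_map]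
    refine pmf_bind_congr _ fun a _ => ?_
    simp only [PMF.map_comp, Function.comp_apply]
    rfl
  · obtain ⟨a, ha, hr⟩ := (PMF.mem_support_bind_iff _ _ _).mp hr
    obtain ⟨b, hb, rfl⟩ := (PMF.mem_support_map_iff _ _ _).mp hr
    have := h3 a ha
    have := k3 b hb
    dsimp only
    omega

theorem runs_seq {μ : PMF (Data × ℕ)} {g : Data → PMF Data} {T T' : ℕ}
    {E : Data × ℕ → PMF (Data × ℕ) → Prop} (hT : ∀ r ∈ μ.support, r.2 ≤ T)
    (h : ∀ r ∈ μ.support, ∃ ν, E r ν ∧ ν.map Prod.fst = g r.1 ∧ ∀ s ∈ ν.support, s.2 ≤ T') :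
    ∃ ν : Data × ℕ → PMF (Data × ℕ), (∀ r ∈ μ.support, E r (ν r)) ∧
      (μ.bind fun r => (ν r).map fun s => (s.1, r.2 + s.2 + 1)).map Prod.fst =
        (μ.map Prod.fst).bind g ∧
      ∀ r ∈ (μ.bind fun r => (ν r).map fun s => (s.1, r.2 + s.2 + 1)).support,
        r.2 ≤ T + T' + 1 := by
  have h' : ∀ r, ∃ ν : PMF (Data × ℕ), r ∈ μ.support →
      (E r ν ∧ ν.map Prod.fst = g r.1 ∧ ∀ s ∈ ν.support, s.2 ≤ T') := by
    intro r
    by_cases hr : r ∈ μ.support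
    · obtain ⟨ν, hν⟩ := h r hr
      exact ⟨ν, fun _ => hν⟩
    · exact ⟨PMF.pure (.nil, 0), fun h => (hr h).elim⟩
  choose ν hν using h'
  refine ⟨ν, fun r hr => (hν r hr).1, ?_, fun r hr => ?_⟩
  · rw [PMF.map_bind, PMF.bind_map]
    refine pmf_bind_congr _ fun a ha => ?_
    rw [Function.comp_apply, ← (hν a ha).2.1, PMF.map_comp]
    rfl
  · obtain ⟨a, ha, hr⟩ := (PMF.mem_support_bind_iff _ _ _).mp hr
    obtain ⟨b, hb, rfl⟩ := (PMF.mem_support_map_iff _ _ _).mp hr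
    have := hT a ha
    have := (hν a ha).2.2 b hb
    dsimp only
    omega

theorem mem_support_map_fst {μ : PMF (Data × ℕ)} {r : Data × ℕ} (hr : r ∈ μ.support) :
    r.1 ∈ (μ.map Prod.fst).support :=
  (PMF.mem_support_map_iff _ _ _).mpr ⟨r, hr, rfl⟩

theorem Runs.comp {p p' : Prog} {x : Data} {f : PMF Data} {g : Data → PMF Data} {T T' : ℕ}
    (h : Runs O q p x f T) (h' : ∀ a ∈ f.support, Runs O q p' a (g a) T') :
    Runs O q (.comp p p') x (f.bind g) (T + T' + 1) := by
  obtain ⟨μ, h1, rfl, h3⟩ := h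
  obtain ⟨ν, k1, k2, k3⟩ := runs_seq (E := fun r ν => Exec O q p' r.1 ν) h3
    fun r hr => h' r.1 (mem_support_map_fst hr)
  exact ⟨_, .comp h1 k1, k2, k3⟩

theorem eq_of_map_fst_pure {μ : PMF (Data × ℕ)} {b : Data} (h : μ.map Prod.fst = PMF.pure b)
    {r : Data × ℕ} (hr : r ∈ μ.support) : r.1 = b := by
  have := mem_support_map_fst hr
  rw [h, PMF.support_pure, Set.mem_singleton_iff] at this
  exact this

theorem Runs.cond {c p p' : Prog} {x b : Data} {f : PMF Data} {T T' : ℕ}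
    (h : Runs O q c x (PMF.pure b) T) (h' : Runs O q (if b.isNil then p' else p) x f T') :
    Runs O q (.cond c p p') x f (T + T' + 1) := by
  obtain ⟨μ, h1, h2, h3⟩ := h
  obtain ⟨ν, k1, k2, k3⟩ := runs_seq
    (E := fun r ν => Exec O q (if r.1.isNil then p' else p) x ν) (g := fun _ => f) h3
    fun r hr => by rw [eq_of_map_fst_pure h2 hr]; exact h'
  exact ⟨_, .cond h1 k1, by rw [k2, PMF.bind_const], k3⟩

theorem Runs.loop_aux {c p : Prog} {x b : Data} {f : PMF Data} {T T' : ℕ}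
    (h : Runs O q c x (PMF.pure b) T)
    (h' : Runs O q (if b.isNil then .id else .comp p (.loop c p)) x f T') :
    Runs O q (.loop c p) x f (T + T' + 1) := by
  obtain ⟨μ, h1, h2, h3⟩ := h
  obtain ⟨ν, k1, k2, k3⟩ := runs_seq
    (E := fun r ν => Exec O q (if r.1.isNil then .id else .comp p (.loop c p)) x ν)
    (g := fun _ => f) h3
    fun r hr => by rw [eq_of_map_fst_pure h2 hr]; exact h'
  exact ⟨_, .loop h1 k1, by rw [k2, PMF.bind_const], k3⟩

theorem Runs.loop_done {c p : Prog} {x : Data} {T : ℕ} (h : Runs O q c x (PMF.pure .nil) T) :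
    Runs O q (.loop c p) x (PMF.pure x) (T + 2) :=
  Runs.loop_aux h (T' := 1) (Runs.id x)

theorem Runs.loop_step {c p : Prog} {x a b : Data} {f : PMF Data} {g : Data → PMF Data}
    {T T₁ T₂ : ℕ} (h : Runs O q c x (PMF.pure (.cons a b)) T) (hp : Runs O q p x f T₁)
    (hl : ∀ y ∈ f.support, Runs O q (.loop c p) y (g y) T₂) :
    Runs O q (.loop c p) x (f.bind g) (T + T₁ + T₂ + 2) :=
  (Runs.loop_aux h (Runs.comp hp hl)).mono (by omega)

/-- A deterministic run. -/
abbrev RunsTo (O : Data → PMF Data) (q : ℕ) (p : Prog) (x y : Data) (T : ℕ) : Prop :=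
  Runs O q p x (PMF.pure y) T

theorem RunsTo.cons {p p' : Prog} {x y z : Data} {T T' : ℕ} (h : RunsTo O q p x y T)
    (h' : RunsTo O q p' x z T') : RunsTo O q (.cons p p') x (.cons y z) (T + T' + 1) := by
  have := Runs.cons h h'
  rwa [PMF.pure_bind, PMF.pure_map] at this

theorem RunsTo.comp {p p' : Prog} {x y : Data} {f : PMF Data} {T T' : ℕ} (h : RunsTo O q p x y T)
    (h' : Runs O q p' y f T') : Runs O q (.comp p p') x f (T + T' + 1) := by
  have := Runs.comp (g := fun _ => f) h (T' := T') fun a ha => by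
    rw [PMF.support_pure, Set.mem_singleton_iff] at ha; rwa [ha]
  rwa [PMF.pure_bind] at this

end Runs

/-! ### Encodings -/

/-- Types whose elements are written as trees. -/
class Enc (α : Type) where
  enc : α → Data
  inj : Function.Injective enc

open Enc (enc)

theorem Data.ofList_injective : Function.Injective Data.ofList := by
  intro l
  induction l with
  | nil => intro l' h; cases l' with
    | nil => rfl
    | cons b l' => simp [Data.ofList] at h
  | cons a l ih => intro l' h; cases l' with
    | nil => simp [Data.ofList] at h
    | cons b l' =>
      simp only [Data.ofList, Data.cons.injEq] at h
      rw [h.1, ih h.2]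

theorem Data.ofNat_eq (n : ℕ) : Data.ofNat n = Data.ofList (List.replicate n .nil) := by
  induction n with
  | zero => rfl
  | succ n ih => rw [Data.ofNat, ih]; rfl

theorem Data.ofNat_injective : Function.Injective Data.ofNat := by
  intro a b h
  rw [Data.ofNat_eq, Data.ofNat_eq] at h
  simpa using congrArg List.length (Data.ofList_injective h)

theorem Data.ofBool_injective : Function.Injective Data.ofBool := by
  intro a b h
  cases a <;> cases b <;> simp_all [Data.ofBool]

instance : Enc Unit := ⟨fun _ => .nil, fun _ _ _ => rfl⟩
instance : Enc ℕ := ⟨Data.ofNat, Data.ofNat_injective⟩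
instance : Enc Bool := ⟨Data.ofBool, Data.ofBool_injective⟩
instance : Enc ℤ := ⟨Data.ofInt, fun a b h => by
  simp only [Data.ofInt, Data.cons.injEq] at h
  have h1 := Data.ofBool_injective h.1
  have h2 := Data.ofNat_injective h.2
  rw [decide_eq_decide] at h1
  omega⟩
instance {α β : Type} [Enc α] [Enc β] : Enc (α × β) := ⟨fun x => .cons (enc x.1) (enc x.2),
  fun a b h => by
    simp only [Data.cons.injEq] at h
    exact Prod.ext (Enc.inj h.1) (Enc.inj h.2)⟩
instance {α : Type} [Enc α] : Enc (List α) := ⟨fun l => .ofList (l.map enc), fun _ _ h =>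
  List.map_injective_iff.mpr Enc.inj (Data.ofList_injective h)⟩
instance : Enc GaussianInt := ⟨fun z => enc (z.re, z.im), fun a b h => by
  have := Enc.inj h
  simp only [Prod.mk.injEq] at this
  exact Zsqrtd.ext this.1 this.2⟩

/-- The number of nodes of a tree. -/
def Data.size : Data → ℕ
  | .nil => 0
  | .cons l r => l.size + r.size + 1

/-- The size of the encoding. -/
def sz {α : Type} [Enc α] (a : α) : ℕ := (enc a).size

theorem sz_nat (n : ℕ) : sz n = n := by
  induction n with
  | zero => rfl
  | succ n ih =>
    change (0 + sz n + 1) = n + 1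
    omega

theorem sz_bool (b : Bool) : sz b ≤ 1 := by cases b <;> simp [sz, Enc.enc, Data.ofBool, Data.size]

theorem sz_prod {α β : Type} [Enc α] [Enc β] (x : α × β) : sz x = sz x.1 + sz x.2 + 1 := rfl

theorem sz_pair {α β : Type} [Enc α] [Enc β] (a : α) (b : β) : sz (a, b) = sz a + sz b + 1 := rfl

theorem sz_nil {α : Type} [Enc α] : sz ([] : List α) = 0 := rfl

theorem sz_cons {α : Type} [Enc α] (a : α) (l : List α) : sz (a :: l) = sz a + sz l + 1 := rfl

theorem sz_int_le (z : ℤ) : sz z ≤ z.natAbs + 2 := by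
  have h1 : sz z = sz (decide (z < 0)) + sz z.natAbs + 1 := rfl
  have := sz_bool (decide (z < 0))
  rw [sz_nat] at h1
  omega

theorem natAbs_le_sz (z : ℤ) : z.natAbs ≤ sz z := by
  have h1 : sz z = sz (decide (z < 0)) + sz z.natAbs + 1 := rfl
  rw [sz_nat] at h1
  omega

theorem length_le_sz {α : Type} [Enc α] (l : List α) : l.length ≤ sz l := by
  induction l with
  | nil => simp
  | cons a l ih => rw [sz_cons, List.length_cons]; omega

theorem sz_mem {α : Type} [Enc α] {l : List α} {a : α} (h : a ∈ l) : sz a < sz l := by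
  induction l with
  | nil => simp at h
  | cons b l ih =>
    rw [sz_cons]
    rcases List.mem_cons.mp h with rfl | h
    · omega
    · have := ih h; omega

theorem sz_append {α : Type} [Enc α] (l l' : List α) : sz (l ++ l') = sz l + sz l' := by
  induction l with
  | nil => simp [sz_nil]
  | cons a l ih => simp only [List.cons_append, sz_cons, ih]; omega

theorem sz_list_le {α : Type} [Enc α] (l : List α) (B : ℕ) (h : ∀ a ∈ l, sz a ≤ B) :
    sz l ≤ l.length * (B + 1) := by
  induction l with
  | nil => simp [sz_nil]
  | cons a l ih =>
    rw [sz_cons, List.length_cons, add_mul]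
    have := h a (by simp)
    have := ih fun b hb => h b (by simp [hb])
    omega

theorem sz_reverse {α : Type} [Enc α] (l : List α) : sz l.reverse = sz l := by
  induction l with
  | nil => rfl
  | cons a l ih => simp only [List.reverse_cons, sz_append, sz_cons, sz_nil, ih]; omega

/-! ### Loops over lists -/

/-- A random fold. -/
noncomputable def rfold {σ β : Type} (step : σ → β → PMF σ) : List β → σ → PMF σ
  | [], s => PMF.pure s
  | b :: l, s => (step s b).bind (rfold step l)

/-- The body of `foldProg`. -/
def foldBody (p : Prog) : Prog :=
  .cons (.comp .left .right) (.cons (.comp .right .left)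
    (.comp (.cons (.comp .right .left) (.cons (.comp .right .right) (.comp .left .left))) p))

/-- The loop that folds `p` over a list: on input `(l, (x, s))` the state `s` is replaced by
the result of `p` on `(x, (s, b))`, for each `b` in `l`. -/
def foldProg (p : Prog) : Prog :=
  .comp (.loop .left (foldBody p))
    (.comp .right .right)

/-- Lifting a kernel on encoded states to trees. -/
noncomputable def liftK {α β : Type} [Enc α] [Enc β] (g : α → PMF β) (x : Data) : PMF Data := by
  classical
  exact if h : ∃ a : α, enc a = x then (g h.choose).map enc else PMF.pure .nil

theorem liftK_enc {α β : Type} [Enc α] [Enc β] (g : α → PMF β) (a : α) :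
    liftK g (enc a) = (g a).map enc := by
  have h : ∃ a' : α, enc a' = enc a := ⟨a, rfl⟩
  rw [liftK, dif_pos h, Enc.inj h.choose_spec]

theorem map_bind_liftK {α β : Type} [Enc α] [Enc β] (f : PMF α) (g : α → PMF β) :
    (f.map enc).bind (liftK g) = (f.bind g).map enc := by
  rw [PMF.bind_map, PMF.map_bind]
  exact pmf_bind_congr _ fun a _ => liftK_enc g a

section Fold

variable {O : Data → PMF Data} {q : ℕ}

theorem Runs.comp_enc {α β : Type} [Enc α] [Enc β] {p p' : Prog} {x : Data} {f : PMF α}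
    {g : α → PMF β} {T T' : ℕ} (h : Runs O q p x (f.map enc) T)
    (h' : ∀ a ∈ f.support, Runs O q p' (enc a) ((g a).map enc) T') :
    Runs O q (.comp p p') x ((f.bind g).map enc) (T + T' + 1) := by
  rw [← map_bind_liftK]
  refine Runs.comp h fun y hy => ?_
  obtain ⟨a, ha, rfl⟩ := (PMF.mem_support_map_iff _ _ _).mp hy
  rw [liftK_enc]
  exact h' a ha

theorem runs_foldLoop {σ β : Type} [Enc σ] [Enc β] {p : Prog} {x : Data} {step : σ → β → PMF σ}
    {T : ℕ} (I : List β → σ → Prop) (l : List β)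
    (hp : ∀ s b l', I (b :: l') s →
      Runs O q p (.cons x (.cons (enc s) (enc b))) ((step s b).map enc) T ∧
      ∀ s' ∈ (step s b).support, I l' s') (s : σ) (hs : I l s) :
    Runs O q (.loop .left (foldBody p))
      (.cons (enc l) (.cons x (enc s)))
      ((rfold step l s).map fun s' => .cons .nil (.cons x (enc s'))) (l.length * (T + 24) + 3) := by
  induction l generalizing s with
  | nil =>
    rw [rfold, PMF.pure_map]
    exact (Runs.loop_done (Runs.left _)).mono (by simp)
  | cons b l ih =>
    have hb := hp s b l hs
    have e : ((rfold step (b :: l) s).map fun s' => Data.cons .nil (.cons x (enc s'))) =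
        (((step s b).map enc).map fun y => Data.cons (enc l) (.cons x y)).bind
          fun y => (liftK (rfold step l) y.right.right).map fun y' =>
            Data.cons .nil (.cons x y') := by
      rw [rfold, PMF.map_bind, PMF.map_comp, PMF.bind_map]
      refine pmf_bind_congr _ fun a _ => ?_
      simp only [Function.comp_apply, Data.right, liftK_enc, PMF.map_comp]
      rfl
    rw [e]
    have hbody : Runs O q (foldBody p) (.cons (enc (b :: l)) (.cons x (enc s)))
      (((step s b).map enc).map fun y => Data.cons (enc l) (.cons x y)) (T + 20) := by
      have h1 : RunsTo O q (.comp .left .right) (.cons (enc (b :: l)) (.cons x (enc s)))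
        (enc l) 3 := RunsTo.comp (Runs.left _) (Runs.right _)
      have h2 : RunsTo O q (.comp .right .left) (.cons (enc (b :: l)) (.cons x (enc s)))
        x 3 := RunsTo.comp (Runs.right _) (Runs.left _)
      have h3 : RunsTo O q (.comp .right .right) (.cons (enc (b :: l)) (.cons x (enc s)))
        (enc s) 3 := RunsTo.comp (Runs.right _) (Runs.right _)
      have h4 : RunsTo O q (.comp .left .left) (.cons (enc (b :: l)) (.cons x (enc s)))
        (enc b) 3 := RunsTo.comp (Runs.left _) (Runs.left _)
      have := Runs.cons h1 (Runs.cons h2 (RunsTo.comp (RunsTo.cons h2 (RunsTo.cons h3 h4)) hb.1))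
      simp only [PMF.pure_bind, PMF.map_comp] at this ⊢
      exact this.mono (by omega)
    have hl : ∀ y ∈ (((step s b).map enc).map fun y => Data.cons (enc l) (.cons x y)).support,
        Runs O q (.loop .left (foldBody p)) y ((liftK (rfold step l) y.right.right).map fun y' =>
            Data.cons .nil (.cons x y')) (l.length * (T + 24) + 3) := by
      intro y hy
      obtain ⟨z, hz, rfl⟩ := (PMF.mem_support_map_iff _ _ _).mp hy
      obtain ⟨s', hs', rfl⟩ := (PMF.mem_support_map_iff _ _ _).mp hz
      have := ih s' (hb.2 s' hs')
      simp only [Data.right, liftK_enc, PMF.map_comp]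
      exact this
    refine (Runs.loop_step (Runs.left _) hbody hl).mono ?_
    rw [List.length_cons, add_mul]
    omega

theorem runs_foldProg {σ β : Type} [Enc σ] [Enc β] {p : Prog} {x : Data} {step : σ → β → PMF σ}
    {T : ℕ} (I : List β → σ → Prop) (l : List β)
    (hp : ∀ s b l', I (b :: l') s →
      Runs O q p (.cons x (.cons (enc s) (enc b))) ((step s b).map enc) T ∧
      ∀ s' ∈ (step s b).support, I l' s') (s : σ) (hs : I l s) :
    Runs O q (foldProg p) (.cons (enc l) (.cons x (enc s)))
      ((rfold step l s).map enc) (l.length * (T + 24) + 7) := by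
  have h := runs_foldLoop I l hp s hs
  have h2 := Runs.comp (g := fun y => PMF.pure y.right.right) h (T' := 3)
    fun y _ => RunsTo.comp (Runs.right _) (Runs.right _)
  have e : (((rfold step l s).map fun s' => Data.cons .nil (.cons x (enc s'))).bind
      fun y => PMF.pure y.right.right) = (rfold step l s).map enc := by
    rw [PMF.bind_map]
    exact pmf_bind_congr _ fun a _ => rfl
  rw [e] at h2
  exact h2.mono (by omega)

theorem rfold_pure {σ β : Type} (f : σ → β → σ) (l : List β) (s : σ) :
    rfold (fun s b => PMF.pure (f s b)) l s = PMF.pure (l.foldl f s) := by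
  induction l generalizing s with
  | nil => rfl
  | cons b l ih => rw [rfold, PMF.pure_bind, ih, List.foldl_cons]

end Fold

/-! ### Polynomial time -/

/-- Polynomially bounded functions. -/
def PB {α : Type} [Enc α] (T : α → ℕ) : Prop := ∃ k, ∀ a, T a ≤ (sz a + 2) ^ k

section PB

variable {α β : Type} [Enc α] [Enc β]

theorem PB.mono {T T' : α → ℕ} (h : PB T) (h' : ∀ a, T' a ≤ T a) : PB T' :=
  h.imp fun _ hk a => (h' a).trans (hk a)

theorem PB.const (c : ℕ) : PB fun _ : α => c :=
  ⟨c, fun a => (Nat.lt_pow_self (by omega)).le.trans (Nat.pow_le_pow_left (by omega : 2 ≤ _) c)⟩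

theorem PB.sz : PB (sz : α → ℕ) := ⟨1, fun a => by simp⟩

theorem PB.add {T T' : α → ℕ} (h : PB T) (h' : PB T') : PB fun a => T a + T' a := by
  obtain ⟨k, hk⟩ := h
  obtain ⟨k', hk'⟩ := h'
  refine ⟨max k k' + 1, fun a => ?_⟩
  have h1 := Nat.pow_le_pow_right (n := QACLearn.sz a + 2) (by omega) (le_max_left k k')
  have h2 := Nat.pow_le_pow_right (n := QACLearn.sz a + 2) (by omega) (le_max_right k k')
  have := hk a
  have := hk' a
  calc T a + T' a ≤ (QACLearn.sz a + 2) ^ max k k' * 2 := by omega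
    _ ≤ _ := by rw [pow_succ]; exact Nat.mul_le_mul_left _ (by omega)

theorem PB.mul {T T' : α → ℕ} (h : PB T) (h' : PB T') : PB fun a => T a * T' a := by
  obtain ⟨k, hk⟩ := h
  obtain ⟨k', hk'⟩ := h'
  exact ⟨k + k', fun a => by rw [pow_add]; exact Nat.mul_le_mul (hk a) (hk' a)⟩

theorem PB.pow {T : α → ℕ} (h : PB T) (j : ℕ) : PB fun a => T a ^ j := by
  obtain ⟨k, hk⟩ := h
  exact ⟨k * j, fun a => by rw [pow_mul]; exact Nat.pow_le_pow_left (hk a) j⟩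

theorem PB.comp {T : β → ℕ} {f : α → β} (h : PB T) (hf : PB fun a => QACLearn.sz (f a)) :
    PB fun a => T (f a) := by
  obtain ⟨k, hk⟩ := h
  exact (PB.pow (hf.add (PB.const 2)) k).mono fun a => hk (f a)

end PB

/-- Functions that a program computes in polynomial time, with output of polynomial size. -/
@[fun_prop]
def FP {α β : Type} [Enc α] [Enc β] (f : α → β) : Prop :=
  ∃ (p : Prog) (T : α → ℕ), PB T ∧ PB (fun a => sz (f a)) ∧
    ∀ O q a, RunsTo O q p (enc a) (enc (f a)) (T a)

section FP

variable {α β γ σ : Type} [Enc α] [Enc β] [Enc γ] [Enc σ]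

theorem FP.pb {f : α → β} (h : FP f) : PB fun a => sz (f a) := by
  obtain ⟨_, _, _, h, _⟩ := h
  exact h

theorem FP.of_enc {δ : Type} [Enc δ] {f : α → β} {g : γ → δ} (hf : FP f) (e : γ → α)
    (he : ∀ c, enc (e c) = enc c) (h : ∀ c, enc (f (e c)) = enc (g c)) : FP g := by
  obtain ⟨p, T, hT, hs, hp⟩ := hf
  have hsz : ∀ c, sz (e c) = sz c := fun c => congrArg Data.size (he c)
  have hpb : PB fun c : γ => sz (e c) := PB.sz.mono fun c => (hsz c).le
  refine ⟨p, fun c => T (e c), hT.comp hpb, (PB.comp (T := fun a => sz (f a)) hs hpb).mono fun c => ?_, fun O q c => ?_⟩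
  · exact (congrArg Data.size (h c)).ge
  · have := hp O q (e c)
    rwa [he c, h c] at this

@[fun_prop]
theorem FP.id : FP fun a : α => a := ⟨.id, _, PB.const 1, PB.sz, fun _ _ _ => Runs.id _⟩

theorem exists_prog_const (y : Data) : ∃ p T, ∀ O q x, RunsTo O q p x y T := by
  induction y with
  | nil => exact ⟨.nil, 1, fun _ _ _ => Runs.nil _⟩
  | cons l r hl hr =>
    obtain ⟨p, T, hp⟩ := hl
    obtain ⟨p', T', hp'⟩ := hr
    exact ⟨.cons p p', _, fun O q x => RunsTo.cons (hp O q x) (hp' O q x)⟩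

@[fun_prop]
theorem FP.const (b : β) : FP fun _ : α => b := by
  obtain ⟨p, T, hp⟩ := exists_prog_const (enc b)
  exact ⟨p, _, PB.const T, PB.const _, fun O q a => hp O q _⟩

@[fun_prop]
theorem FP.comp {f : β → γ} {g : α → β} (hf : FP f) (hg : FP g) : FP fun a => f (g a) := by
  obtain ⟨p, T, hT, hs, hp⟩ := hf
  obtain ⟨p', T', hT', hs', hp'⟩ := hg
  exact ⟨.comp p' p, fun a => T' a + T (g a) + 1, (hT'.add (hT.comp hs')).add (PB.const 1),
    PB.comp (T := fun b => sz (f b)) hs hs', fun O q a => RunsTo.comp (hp' O q a) (hp O q (g a))⟩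

@[fun_prop]
theorem FP.pair {f : α → β} {g : α → γ} (hf : FP f) (hg : FP g) : FP fun a => (f a, g a) := by
  obtain ⟨p, T, hT, hs, hp⟩ := hf
  obtain ⟨p', T', hT', hs', hp'⟩ := hg
  exact ⟨.cons p p', fun a => T a + T' a + 1, (hT.add hT').add (PB.const 1),
    (hs.add hs').add (PB.const 1), fun O q a => RunsTo.cons (hp O q a) (hp' O q a)⟩

theorem FP.fst' : FP (Prod.fst : α × β → α) :=
  ⟨.left, _, PB.const 1, PB.sz.mono fun a => by rw [sz_prod]; omega, fun _ _ _ => Runs.left _⟩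

theorem FP.snd' : FP (Prod.snd : α × β → β) :=
  ⟨.right, _, PB.const 1, PB.sz.mono fun a => by rw [sz_prod]; omega, fun _ _ _ => Runs.right _⟩

@[fun_prop]
theorem FP.fst {f : α → β × γ} (hf : FP f) : FP fun a => (f a).1 := FP.comp FP.fst' hf

@[fun_prop]
theorem FP.snd {f : α → β × γ} (hf : FP f) : FP fun a => (f a).2 := FP.comp FP.snd' hf

@[fun_prop]
theorem FP.cond {c : α → Bool} {f g : α → β} (hc : FP c) (hf : FP f) (hg : FP g) :
    FP fun a => bif c a then f a else g a := by
  obtain ⟨p, T, hT, hs, hp⟩ := hf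
  obtain ⟨p', T', hT', hs', hp'⟩ := hg
  obtain ⟨r, R, hR, -, hr⟩ := hc
  refine ⟨.cond r p p', fun a => R a + (T a + T' a) + 1, (hR.add (hT.add hT')).add (PB.const 1),
    (hs.add hs').mono fun a => ?_, fun O q a => Runs.cond (hr O q a) ?_⟩
  · cases h : c a <;> simp only [h, cond_true, cond_false] <;> omega
  · cases h : c a
    · simpa only [h, cond_false] using! (hp' O q a).mono (Nat.le_add_left _ (T a))
    · simpa only [h, cond_true] using! (hp O q a).mono (Nat.le_add_right _ (T' a))

@[fun_prop]
theorem FP.cons {f : α → β} {g : α → List β} (hf : FP f) (hg : FP g) : FP fun a => f a :: g a :=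
  FP.of_enc (FP.pair hf hg) (fun a => a) (fun _ => rfl) fun _ => rfl

theorem isEmpty_aux : FP fun l : List β => l.isEmpty :=
  ⟨.cond .id .nil (.cons .nil .nil), _, PB.const 10,
    (PB.const 1).mono fun _ => sz_bool _, fun O q l => by
      refine (Runs.cond (T' := 5) (Runs.id _) ?_).mono (by omega)
      cases l with
      | nil => exact (RunsTo.cons (Runs.nil _) (Runs.nil _)).mono (by omega)
      | cons b l => exact (Runs.nil _).mono (by omega)⟩

@[fun_prop]
theorem FP.isEmpty {f : α → List β} (hf : FP f) : FP fun a => (f a).isEmpty :=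
  FP.comp isEmpty_aux hf

theorem headD_aux : FP fun p : List β × β => p.1.headD p.2 :=
  ⟨.cond .left (.comp .left .left) .right, _, PB.const 10, PB.sz.mono fun p => by
      rcases p with ⟨_ | ⟨b, l⟩, d⟩ <;> simp only [sz_pair, sz_cons, List.headD] <;> omega,
    fun O q p => by
      refine (Runs.cond (T' := 5) (Runs.left _) ?_).mono (by omega)
      rcases p with ⟨_ | ⟨b, l⟩, d⟩
      · exact (Runs.right _).mono (by omega)
      · exact (RunsTo.comp (Runs.left _) (Runs.left _)).mono (by omega)⟩

@[fun_prop]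
theorem FP.headD {f : α → List β} {g : α → β} (hf : FP f) (hg : FP g) :
    FP fun a => (f a).headD (g a) :=
  FP.comp headD_aux (FP.pair hf hg)

theorem tail_aux : FP fun l : List β => l.tail :=
  ⟨.right, _, PB.const 1, PB.sz.mono fun l => by
    cases l
    · exact le_rfl
    · simp only [sz_cons, List.tail_cons]; omega, fun O q l => by
      cases l <;> exact Runs.right _⟩

@[fun_prop]
theorem FP.tail {f : α → List β} (hf : FP f) : FP fun a => (f a).tail :=
  FP.comp tail_aux hf

/-! ### Folds -/

theorem FP.foldl_bdd {l : α → List β} {s : α → σ} {step : α → σ → β → σ} (hl : FP l) (hs : FP s)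
    (hstep : FP fun p : α × σ × β => step p.1 p.2.1 p.2.2) {S : α → ℕ} (hS : PB S)
    (hb : ∀ a l', l' <+: l a → sz (l'.foldl (step a) (s a)) ≤ S a) :
    FP fun a => (l a).foldl (step a) (s a) := by
  obtain ⟨pl, Tl, hTl, hsl, hpl⟩ := hl
  obtain ⟨ps, Ts, hTs, hss, hps⟩ := hs
  obtain ⟨pf, Tf, ⟨k, hk⟩, -, hpf⟩ := hstep
  refine ⟨.comp (.cons pl (.cons .id ps)) (foldProg pf),
    fun a => (Tl a + (1 + Ts a + 1) + 1) +
      (sz (l a) * ((sz a + S a + sz (l a) + 4) ^ k + 24) + 7) + 1, ?_,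
    hS.mono fun a => hb a (l a) List.prefix_rfl, fun O q a => ?_⟩
  · have h1 := PB.pow (((PB.sz.add hS).add hsl).add (PB.const (α := α) 4)) k
    exact (((hTl.add (((PB.const 1).add hTs).add (PB.const 1))).add (PB.const 1)).add
      ((hsl.mul (h1.add (PB.const 24))).add (PB.const 7))).add (PB.const 1)
  · refine RunsTo.comp (RunsTo.cons (hpl O q a) (RunsTo.cons (Runs.id _) (hps O q a))) ?_
    have := runs_foldProg (O := O) (q := q) (p := pf) (x := enc a)
      (T := (sz a + S a + sz (l a) + 4) ^ k)
      (step := fun s b => PMF.pure (step a s b))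
      (fun rem s' => ∃ pre, pre ++ rem = l a ∧ s' = pre.foldl (step a) (s a)) (l a) ?_ (s a)
      ⟨[], rfl, rfl⟩
    · rw [rfold_pure, PMF.pure_map] at this
      refine this.mono ?_
      have := length_le_sz (l a)
      gcongr
    · rintro s' b l' ⟨pre, h1, h2⟩
      refine ⟨?_, fun s'' hs'' => ⟨pre ++ [b], by simp [h1], ?_⟩⟩
      · rw [PMF.pure_map]
        refine (hpf O q (a, s', b)).mono ((hk _).trans ?_)
        have h3 := hb a pre ⟨_, h1⟩
        have h4 : sz b < sz (l a) := sz_mem (by rw [← h1]; simp)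
        rw [← h2] at h3
        simp only [sz_pair]
        exact Nat.pow_le_pow_left (by omega) k
      · rw [PMF.support_pure, Set.mem_singleton_iff] at hs''
        rw [hs'', h2, List.foldl_append]
        rfl

theorem FP.foldl_add {l : α → List β} {s : α → σ} {step : α → σ → β → σ} (hl : FP l) (hs : FP s)
    (hstep : FP fun p : α × σ × β => step p.1 p.2.1 p.2.2) {S : α × β → ℕ} (hS : PB S)
    (hb : ∀ a s b, sz (step a s b) ≤ sz s + S (a, b)) :
    FP fun a => (l a).foldl (step a) (s a) := by
  obtain ⟨k, hk⟩ := hS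
  have hS' : PB fun a => sz (s a) + sz (l a) * (sz a + sz (l a) + 3) ^ k :=
    hs.pb.add (hl.pb.mul (PB.pow ((PB.sz.add hl.pb).add (PB.const 3)) k))
  refine FP.foldl_bdd hl hs hstep hS' fun a l' hl' => ?_
  have key : ∀ (l' : List β) (s' : σ), (∀ b ∈ l', sz b ≤ sz (l a)) →
      sz (l'.foldl (step a) s') ≤ sz s' + l'.length * (sz a + sz (l a) + 3) ^ k := by
    intro l'
    induction l' with
    | nil => intro s' _; simp
    | cons b l' ih =>
      intro s' h
      have h1 := ih (step a s' b) fun b hb => h b (by simp [hb])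
      have h2 := (hb a s' b).trans (Nat.add_le_add_left (hk (a, b)) _)
      have h3 : (sz (a, b) + 2) ^ k ≤ (sz a + sz (l a) + 3) ^ k := by
        have := h b (by simp)
        rw [sz_pair]
        exact Nat.pow_le_pow_left (by omega) k
      rw [List.foldl_cons, List.length_cons, add_mul]
      omega
  refine (key l' (s a) fun b hb' => (sz_mem (hl'.subset hb')).le).trans ?_
  have := hl'.length_le.trans (length_le_sz (l a))
  gcongr

@[fun_prop]
theorem FP.reverse {l : α → List β} (hl : FP l) : FP fun a => (l a).reverse := by
  have := FP.foldl_add (step := fun (_ : α) (s : List β) b => b :: s) hl (FP.const [])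
    (by fun_prop) (S := fun p => sz p.2 + 1)
    ((PB.sz.mono fun p => by rw [sz_prod]; omega).add (PB.const 1))
    fun a s b => by simp only [sz_cons]; omega
  have e : ∀ l acc : List β, l.foldl (fun s b => b :: s) acc = l.reverse ++ acc := by
    intro l
    induction l with
    | nil => simp
    | cons b l ih => intro acc; simp [ih]
  simpa only [e, List.append_nil] using this

@[fun_prop]
theorem FP.map {l : α → List β} {g : α → β → γ} (hl : FP l)
    (hg : FP fun p : α × β => g p.1 p.2) : FP fun a => (l a).map (g a) := by
  have := FP.foldl_add (step := fun (a : α) (s : List γ) b => g a b :: s) hl.reverse (FP.const [])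
    (FP.cons (FP.comp hg (by fun_prop : FP fun p : α × List γ × β => (p.1, p.2.2))) (by fun_prop))
    (S := fun p => sz (g p.1 p.2) + 1) (hg.pb.add (PB.const 1))
    fun a s b => by simp only [sz_cons]; omega
  have e : ∀ (a : α) (l : List β) (acc : List γ),
      l.reverse.foldl (fun s b => g a b :: s) acc = l.map (g a) ++ acc := by
    intro a l
    induction l with
    | nil => simp
    | cons b l ih => intro acc; simp [ih]
  simpa only [e, List.append_nil] using this

@[fun_prop]
theorem FP.append {f g : α → List β} (hf : FP f) (hg : FP g) : FP fun a => f a ++ g a := by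
  have := FP.foldl_add (step := fun (_ : α) (s : List β) b => b :: s) hf.reverse hg
    (by fun_prop) (S := fun p => sz p.2 + 1)
    ((PB.sz.mono fun p => by rw [sz_prod]; omega).add (PB.const 1))
    fun a s b => by simp only [sz_cons]; omega
  have e : ∀ l acc : List β, l.reverse.foldl (fun s b => b :: s) acc = l ++ acc := by
    intro l
    induction l with
    | nil => simp
    | cons b l ih => intro acc; simp [ih]
  simpa only [e] using this

@[fun_prop]
theorem FP.flatMap {l : α → List β} {g : α → β → List γ} (hl : FP l)
    (hg : FP fun p : α × β => g p.1 p.2) : FP fun a => (l a).flatMap (g a) := by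
  have := FP.foldl_add (step := fun (a : α) (s : List γ) b => g a b ++ s) hl.reverse (FP.const [])
    (FP.append (FP.comp hg (by fun_prop : FP fun p : α × List γ × β => (p.1, p.2.2)))
      (by fun_prop)) (S := fun p => sz (g p.1 p.2)) hg.pb
    fun a s b => by simp only [sz_append]; omega
  have e : ∀ (a : α) (l : List β) (acc : List γ),
      l.reverse.foldl (fun s b => g a b ++ s) acc = l.flatMap (g a) ++ acc := by
    intro a l
    induction l with
    | nil => simp
    | cons b l ih => intro acc; simp [ih]
  simpa only [e, List.append_nil] using this

@[fun_prop]
theorem FP.filter {l : α → List β} {g : α → β → Bool} (hl : FP l)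
    (hg : FP fun p : α × β => g p.1 p.2) : FP fun a => (l a).filter (g a) := by
  have : FP fun a => (l a).flatMap fun b => bif g a b then [b] else [] :=
    FP.flatMap hl (FP.cond hg (by fun_prop) (by fun_prop))
  have e : ∀ (a : α) (l : List β),
      (l.flatMap fun b => bif g a b then [b] else []) = l.filter (g a) := by
    intro a l
    induction l with
    | nil => simp
    | cons b l ih => rw [List.flatMap_cons, ih, List.filter_cons]; cases g a b <;> rfl
  simpa only [e] using this

@[fun_prop]
theorem FP.not {f : α → Bool} (hf : FP f) : FP fun a => !f a := by
  have : FP fun a => bif f a then false else true := by fun_prop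
  convert this using 2 with a
  cases f a <;> rfl

@[fun_prop]
theorem FP.and {f g : α → Bool} (hf : FP f) (hg : FP g) : FP fun a => f a && g a := by
  have : FP fun a => bif f a then g a else false := by fun_prop
  convert this using 2 with a
  cases f a <;> rfl

@[fun_prop]
theorem FP.or {f g : α → Bool} (hf : FP f) (hg : FP g) : FP fun a => f a || g a := by
  have : FP fun a => bif f a then true else g a := by fun_prop
  convert this using 2 with a
  cases f a <;> rfl

@[fun_prop]
theorem FP.xor {f g : α → Bool} (hf : FP f) (hg : FP g) : FP fun a => f a ^^ g a := by
  have : FP fun a => bif f a then !(g a) else g a := by fun_prop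
  convert this using 2 with a
  cases f a <;> simp

theorem FP.foldl_bool {l : α → List β} {s : α → Bool} {step : α → Bool → β → Bool} (hl : FP l)
    (hs : FP s) (hstep : FP fun p : α × Bool × β => step p.1 p.2.1 p.2.2) :
    FP fun a => (l a).foldl (step a) (s a) :=
  FP.foldl_bdd hl hs hstep (PB.const 1) fun _ _ _ => sz_bool _

@[fun_prop]
theorem FP.any {l : α → List β} {g : α → β → Bool} (hl : FP l)
    (hg : FP fun p : α × β => g p.1 p.2) : FP fun a => (l a).any (g a) := by
  have : FP fun a => !((l a).filter (g a)).isEmpty := by fun_prop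
  convert this using 2 with a
  rw [Bool.eq_iff_iff]
  simp

@[fun_prop]
theorem FP.all {l : α → List β} {g : α → β → Bool} (hl : FP l)
    (hg : FP fun p : α × β => g p.1 p.2) : FP fun a => (l a).all (g a) := by
  have : FP fun a => ((l a).filter (fun b => !g a b)).isEmpty := by fun_prop
  convert this using 2 with a
  rw [Bool.eq_iff_iff]
  simp

omit [Enc β] [Enc γ] in
theorem zip_fold {c : γ} (l : List β) (r : List γ) (acc : List (β × γ)) :
    (l.foldl (fun (s : List γ × List (β × γ)) b =>
      (bif s.1.isEmpty then s else (s.1.tail, (b, s.1.headD c) :: s.2))) (r, acc)).2.reverse =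
      acc.reverse ++ l.zip r := by
  induction l generalizing r acc with
  | nil => simp
  | cons b l ih =>
    cases r with
    | nil =>
      rw [List.foldl_cons]
      simp only [List.isEmpty_nil, cond_true, List.zip_nil_right, List.append_nil]
      rw [ih]
      simp
    | cons d r =>
      rw [List.foldl_cons]
      simp only [List.isEmpty_cons, cond_false, List.tail_cons, List.headD_cons, ih]
      simp

@[fun_prop]
theorem FP.zip {l : α → List β} {r : α → List γ} (hl : FP l) (hr : FP r) :
    FP fun a => (l a).zip (r a) := by
  rcases isEmpty_or_nonempty γ with h | ⟨⟨c⟩⟩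
  · have : ∀ a, (l a).zip (r a) = [] := fun a => by
      cases h' : r a with
      | nil => simp
      | cons c _ => exact h.elim c
    simp only [this]
    fun_prop
  have := FP.foldl_add (s := fun a => (r a, ([] : List (β × γ))))
    (step := fun (_ : α) (s : List γ × List (β × γ)) b =>
      (bif s.1.isEmpty then s else (s.1.tail, (b, s.1.headD c) :: s.2))) hl (by fun_prop)
    (by fun_prop) (S := fun p => sz p.2 + 2)
    ((PB.sz.mono fun p => by rw [sz_prod]; omega).add (PB.const 2))
    fun a s b => by
      rcases s with ⟨_ | ⟨d, s⟩, t⟩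
      · simp
      · simp only [List.isEmpty_cons, cond_false, List.tail_cons, List.headD_cons, sz_pair,
          sz_cons]
        omega
  have h2 := this.snd.reverse
  simpa only [zip_fold, List.reverse_nil, List.nil_append] using h2

/-! ### Natural numbers -/

@[fun_prop]
theorem FP.units {f : α → ℕ} (hf : FP f) : FP fun a => List.replicate (f a) () := by
  refine FP.of_enc hf (fun a => a) (fun _ => rfl) fun a => ?_
  change Data.ofNat (f a) = Data.ofList _
  rw [Data.ofNat_eq, List.map_replicate]
  rfl

@[fun_prop]
theorem FP.succ {f : α → ℕ} (hf : FP f) : FP fun a => f a + 1 :=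
  FP.of_enc (FP.cons (FP.const ()) hf.units) (fun a => a) (fun _ => rfl) fun a => by
    change Data.ofList _ = Data.ofNat _
    rw [Data.ofNat_eq, ← List.replicate_succ, List.map_replicate]
    rfl

@[fun_prop]
theorem FP.pred {f : α → ℕ} (hf : FP f) : FP fun a => f a - 1 :=
  FP.of_enc hf.units.tail (fun a => a) (fun _ => rfl) fun a => by
    change Data.ofList _ = Data.ofNat _
    rw [Data.ofNat_eq, List.tail_replicate, List.map_replicate]
    rfl

@[fun_prop]
theorem FP.length {l : α → List β} (hl : FP l) : FP fun a => (l a).length :=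
  FP.of_enc (hl.map (g := fun _ _ => ()) (by fun_prop)) (fun a => a) (fun _ => rfl) fun a => by
    change Data.ofList _ = Data.ofNat _
    rw [Data.ofNat_eq, List.map_map]
    congr 1
    exact List.map_const

@[fun_prop]
theorem FP.add {f g : α → ℕ} (hf : FP f) (hg : FP g) : FP fun a => f a + g a := by
  have : FP fun a => (List.replicate (f a) () ++ List.replicate (g a) ()).length := by fun_prop
  simpa using this

@[fun_prop]
theorem FP.mul {f g : α → ℕ} (hf : FP f) (hg : FP g) : FP fun a => f a * g a := by
  have : FP fun a => ((List.replicate (f a) ()).flatMap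
    fun _ => List.replicate (g a) ()).length := by fun_prop
  simpa using this

@[fun_prop]
theorem FP.sub {f g : α → ℕ} (hf : FP f) (hg : FP g) : FP fun a => f a - g a := by
  have := FP.foldl_add (step := fun (_ : α) (s : ℕ) (_ : Unit) => s - 1) hg.units hf
    (by fun_prop) (S := fun _ => 0) (PB.const 0) fun a s b => by simp only [sz_nat]; omega
  have e : ∀ n s : ℕ, (List.replicate n ()).foldl (fun (s : ℕ) (_ : Unit) => s - 1) s = s - n := by
    intro n
    induction n with
    | zero => simp
    | succ n ih => intro s; rw [List.replicate_succ, List.foldl_cons, ih]; omega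
  simpa only [e] using this

@[fun_prop]
theorem FP.ble {f g : α → ℕ} (hf : FP f) (hg : FP g) : FP fun a => Nat.ble (f a) (g a) := by
  have : FP fun a => (List.replicate (f a - g a) ()).isEmpty := by fun_prop
  convert this using 2 with a
  rw [Bool.eq_iff_iff, Nat.ble_eq, List.isEmpty_iff, List.replicate_eq_nil_iff]
  omega

@[fun_prop]
theorem FP.beq {f g : α → ℕ} (hf : FP f) (hg : FP g) : FP fun a => Nat.beq (f a) (g a) := by
  have : FP fun a => Nat.ble (f a) (g a) && Nat.ble (g a) (f a) := by fun_prop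
  convert this using 2 with a
  rw [Bool.eq_iff_iff, Nat.beq_eq, Bool.and_eq_true, Nat.ble_eq, Nat.ble_eq]
  omega

@[fun_prop]
theorem FP.npow {f : α → ℕ} (hf : FP f) (k : ℕ) : FP fun a => f a ^ k := by
  induction k with
  | zero => simpa only [pow_zero] using FP.const 1
  | succ k ih => simpa only [pow_succ] using ih.mul hf

@[fun_prop]
theorem FP.replicate {f : α → ℕ} {g : α → β} (hf : FP f) (hg : FP g) :
    FP fun a => List.replicate (f a) (g a) := by
  have : FP fun a => (List.replicate (f a) ()).map fun _ => g a := by fun_prop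
  simpa using this

@[fun_prop]
theorem FP.range {f : α → ℕ} (hf : FP f) : FP fun a => List.range (f a) := by
  have e : ∀ n, (List.replicate n ()).foldl (fun (s : List ℕ) (_ : Unit) => s ++ [s.length]) [] =
      List.range n := by
    intro n
    induction n with
    | zero => rfl
    | succ n ih => rw [List.replicate_succ', List.foldl_append, ih, List.range_succ]; simp
  have := FP.foldl_bdd (s := fun _ => ([] : List ℕ))
    (step := fun (_ : α) (s : List ℕ) (_ : Unit) => s ++ [s.length]) hf.units (by fun_prop)
    (by fun_prop) (S := fun a => f a * (f a + 1))
    ((hf.pb.mono fun a => by rw [sz_nat]).mul (hf.succ.pb.mono fun a => by rw [sz_nat]))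
    fun a l' hl' => by
      obtain ⟨m, hm, rfl⟩ : ∃ m, m ≤ f a ∧ l' = List.replicate m () := by
        refine ⟨l'.length, by simpa using hl'.length_le, ?_⟩
        exact List.eq_replicate_iff.mpr ⟨rfl, fun _ _ => rfl⟩
      rw [e]
      refine (sz_list_le _ (f a) fun b hb => ?_).trans ?_
      · rw [sz_nat]; exact (List.mem_range.mp hb).le.trans hm
      · rw [List.length_range]; gcongr
  simpa only [e] using this

omit [Enc β] in
theorem drop_aux (n : ℕ) (l : List β) :
    (List.replicate n ()).foldl (fun (s : List β) (_ : Unit) => s.tail) l = l.drop n := by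
  induction n generalizing l with
  | zero => rfl
  | succ n ih =>
    rw [List.replicate_succ, List.foldl_cons, ih, List.drop_tail]

@[fun_prop]
theorem FP.drop {n : α → ℕ} {l : α → List β} (hn : FP n) (hl : FP l) :
    FP fun a => (l a).drop (n a) := by
  have := FP.foldl_add (step := fun (_ : α) (s : List β) (_ : Unit) => s.tail) hn.units hl
    (by fun_prop) (S := fun _ => 0) (PB.const 0) fun a s b => by
      cases s
      · exact le_rfl
      · simp only [List.tail_cons, sz_cons]; omega
  simpa only [drop_aux] using this

@[fun_prop]
theorem FP.getD {n : α → ℕ} {l : α → List β} {d : α → β} (hl : FP l) (hn : FP n) (hd : FP d) :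
    FP fun a => (l a).getD (n a) (d a) := by
  have : FP fun a => ((l a).drop (n a)).headD (d a) := by fun_prop
  convert this using 2 with a
  simp [List.headD_eq_head?_getD, List.head?_drop]

@[fun_prop]
theorem FP.take {n : α → ℕ} {l : α → List β} (hn : FP n) (hl : FP l) :
    FP fun a => (l a).take (n a) := by
  have : FP fun a => ((l a).zip (List.replicate (n a) ())).map Prod.fst := by fun_prop
  convert this using 2 with a
  generalize l a = l
  generalize n a = n
  induction n generalizing l with
  | zero => simp
  | succ n ih => cases l <;> simp [List.replicate_succ, ih]

/-! ### Integers -/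

@[fun_prop]
theorem FP.natCast {f : α → ℕ} (hf : FP f) : FP fun a => (f a : ℤ) :=
  FP.of_enc (FP.pair (FP.const false) hf) (fun a => a) (fun _ => rfl) fun a => by
    change Data.cons _ _ = Data.cons _ _
    rw [Int.natAbs_natCast, decide_eq_false (by omega)]
    rfl

theorem isNeg_aux : FP fun z : ℤ => decide (z < 0) :=
  FP.of_enc (FP.fst' (α := Bool) (β := ℕ)) (fun z : ℤ => (decide (z < 0), z.natAbs))
    (fun _ => rfl) fun _ => rfl

theorem natAbs_aux : FP fun z : ℤ => z.natAbs :=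
  FP.of_enc (FP.snd' (α := Bool) (β := ℕ)) (fun z : ℤ => (decide (z < 0), z.natAbs))
    (fun _ => rfl) fun _ => rfl

@[fun_prop]
theorem FP.natAbs {f : α → ℤ} (hf : FP f) : FP fun a => (f a).natAbs := FP.comp natAbs_aux hf

@[fun_prop]
theorem FP.isNeg {f : α → ℤ} (hf : FP f) : FP fun a => decide (f a < 0) := FP.comp isNeg_aux hf

theorem negNat_aux : FP fun n : ℕ => -(n : ℤ) := by
  have : FP fun n : ℕ => bif Nat.beq n 0 then (false, n) else (true, n) := by fun_prop
  refine FP.of_enc this (fun a => a) (fun _ => rfl) fun a => ?_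
  rcases a with _ | a
  · rfl
  · change enc (true, a + 1) = Data.ofInt _
    rw [Data.ofInt, decide_eq_true (by omega), Int.natAbs_neg, Int.natAbs_natCast]
    rfl

@[fun_prop]
theorem FP.int_neg {f : α → ℤ} (hf : FP f) : FP fun a => -f a := by
  have h := FP.comp negNat_aux hf.natAbs
  have : FP fun a => bif decide (f a < 0) then ((f a).natAbs : ℤ) else -((f a).natAbs : ℤ) := by
    fun_prop
  convert this using 2 with a
  by_cases h : f a < 0 <;> simp only [h, decide_true, decide_false, cond_true, cond_false] <;> omega

@[fun_prop]
theorem FP.toNat {f : α → ℤ} (hf : FP f) : FP fun a => (f a).toNat := by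
  have : FP fun a => bif decide (f a < 0) then 0 else (f a).natAbs := by fun_prop
  convert this using 2 with a
  by_cases h : f a < 0 <;> simp only [h, decide_true, decide_false, cond_true, cond_false] <;> omega

theorem FP.subNat {f g : α → ℕ} (hf : FP f) (hg : FP g) : FP fun a => (f a : ℤ) - g a := by
  have : FP fun a => bif Nat.ble (g a) (f a) then ((f a - g a : ℕ) : ℤ) else
    -((g a - f a : ℕ) : ℤ) := by fun_prop
  convert this using 2 with a
  by_cases h : g a ≤ f a
  · rw [Nat.ble_eq.mpr h, cond_true]; omega
  · rw [Bool.eq_false_iff.mpr (mt Nat.ble_eq.mp h), cond_false]; omega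

@[fun_prop]
theorem FP.int_add {f g : α → ℤ} (hf : FP f) (hg : FP g) : FP fun a => f a + g a := by
  have := FP.subNat (hf.toNat.add hg.toNat) (hf.int_neg.toNat.add hg.int_neg.toNat)
  convert this using 2 with a
  omega

@[fun_prop]
theorem FP.int_sub {f g : α → ℤ} (hf : FP f) (hg : FP g) : FP fun a => f a - g a := by
  simpa only [sub_eq_add_neg] using hf.int_add hg.int_neg

@[fun_prop]
theorem FP.int_mul {f g : α → ℤ} (hf : FP f) (hg : FP g) : FP fun a => f a * g a := by
  have := FP.subNat ((hf.toNat.mul hg.toNat).add (hf.int_neg.toNat.mul hg.int_neg.toNat))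
    ((hf.toNat.mul hg.int_neg.toNat).add (hf.int_neg.toNat.mul hg.toNat))
  convert this using 2 with a
  have h : ∀ z : ℤ, z = (z.toNat : ℤ) - ((-z).toNat : ℤ) := fun z => by omega
  push_cast
  linear_combination g a * h (f a) + ((f a).toNat - (-f a).toNat : ℤ) * h (g a)

@[fun_prop]
theorem FP.int_le {f g : α → ℤ} (hf : FP f) (hg : FP g) : FP fun a => decide (f a ≤ g a) := by
  have : FP fun a => !decide (g a - f a < 0) := by fun_prop
  convert this using 2 with a
  rw [← decide_not, decide_eq_decide]
  omega

@[fun_prop]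
theorem FP.int_sum {l : α → List ℤ} (hl : FP l) : FP fun a => (l a).sum := by
  have := FP.foldl_add (s := fun _ => (0 : ℤ)) (step := fun (_ : α) (s : ℤ) b => s + b) hl
    (by fun_prop) (by fun_prop) (S := fun p => sz p.2 + 2)
    ((PB.sz.mono fun p => by rw [sz_prod]; omega).add (PB.const 2)) fun a s b => by
      have := sz_int_le (s + b)
      have := natAbs_le_sz s
      have := natAbs_le_sz b
      dsimp only
      omega
  simpa only [List.sum_eq_foldl] using this

/-! ### Gaussian integers -/

@[fun_prop]
theorem FP.mkG {f g : α → ℤ} (hf : FP f) (hg : FP g) : FP fun a => (⟨f a, g a⟩ : GaussianInt) :=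
  FP.of_enc (FP.pair hf hg) (fun a => a) (fun _ => rfl) fun _ => rfl

@[fun_prop]
theorem FP.re {f : α → GaussianInt} (hf : FP f) : FP fun a => (f a).re :=
  FP.comp (g := f) (f := fun z : GaussianInt => z.re) (FP.of_enc (FP.fst' (α := ℤ) (β := ℤ))
    (fun z : GaussianInt => (z.re, z.im)) (fun _ => rfl) fun _ => rfl) hf

@[fun_prop]
theorem FP.im {f : α → GaussianInt} (hf : FP f) : FP fun a => (f a).im :=
  FP.comp (g := f) (f := fun z : GaussianInt => z.im) (FP.of_enc (FP.snd' (α := ℤ) (β := ℤ))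
    (fun z : GaussianInt => (z.re, z.im)) (fun _ => rfl) fun _ => rfl) hf

@[fun_prop]
theorem FP.gmul {f g : α → GaussianInt} (hf : FP f) (hg : FP g) : FP fun a => f a * g a := by
  have : FP fun a => (⟨(f a).re * (g a).re + -1 * (f a).im * (g a).im,
    (f a).re * (g a).im + (f a).im * (g a).re⟩ : GaussianInt) := by fun_prop
  exact this

@[fun_prop]
theorem FP.gstar {f : α → GaussianInt} (hf : FP f) : FP fun a => star (f a) := by
  have : FP fun a => (⟨(f a).re, -(f a).im⟩ : GaussianInt) := by fun_prop
  exact this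

@[fun_prop]
theorem FP.gsum {l : α → List GaussianInt} (hl : FP l) : FP fun a => (l a).sum := by
  have : FP fun a => (⟨((l a).map fun z => z.re).sum, ((l a).map fun z => z.im).sum⟩ :
    GaussianInt) := by fun_prop
  convert this using 2 with a
  induction l a with
  | nil => rfl
  | cons b l ih =>
    rw [List.sum_cons, ih]
    rfl

end FP

/-! ### The deterministic parts of the learner -/

/-- `z`, unless it is larger than `N`. -/
def clipZ (N : ℕ) (z : ℤ) : ℤ := bif Nat.ble z.natAbs N then z else 0

/-- Clipping both coordinates. -/
def clipG (N : ℕ) (z : GaussianInt) : GaussianInt := ⟨clipZ N z.re, clipZ N z.im⟩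

/-- Products that are correct as long as they do not become larger than `N`. -/
def gprod (N : ℕ) (l : List GaussianInt) : GaussianInt := l.foldl (fun s z => clipG N (s * z)) 1

/-- All lists with an entry from each list in `L`; correct if there are at most `N` of them. -/
def secs {α : Type} (N : ℕ) (L : List (List α)) : List (List α) :=
  L.reverse.foldl (fun acc l => (l.flatMap fun a => acc.map fun v => a :: v).take N) [[]]

/-- The entries `full` at the positions in `A`, and `dflt` elsewhere. -/
def choices {α : Type} (n : ℕ) (A : List ℕ) (full : List α) (dflt : α) : List (List α) :=
  (List.range n).map fun j => bif A.any fun a => Nat.beq a j then full else [dflt]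

/-- Basis states that vanish outside of `A`. -/
def words (N n : ℕ) (A : List ℕ) : List (List Bool) := secs N (choices n A [false, true] false)

/-- Pauli strings that are trivial outside of `A`. -/
def pwords (N n : ℕ) (A : List ℕ) : List (List ℕ) := secs N (choices n A [0, 1, 2, 3] 0)

/-- The integers between `-b` and `b`. -/
def intRange (b : ℕ) : List ℤ := (List.range (2 * b + 1)).map fun j : ℕ => (j : ℤ) - (b : ℤ)

/-- The gates used in the search. -/
def gateList (b : ℕ) : List (List ℤ) :=
  (List.range (b + 1)).flatMap fun a => (intRange b).flatMap fun x => (intRange b).flatMap fun y =>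
    (intRange b).map fun z => [((a + 1 : ℕ) : ℤ), x, y, z]

/-- The identity gate. -/
def idGate : List ℤ := [1, 0, 0, 0]

/-- Layers of gates and labels. -/
abbrev RSlot := List (List ℤ) × List ℕ

/-- The layers that act on `A` only. -/
def slotList (N n b : ℕ) (A : List ℕ) : List RSlot :=
  (secs N (choices n A (gateList b) idGate)).flatMap fun g =>
    (secs N (choices n A (0 :: A.map fun a => a + 1) 0)).map fun l => (g, l)

/-- The circuits with `D` layers that act on `A` only. -/
def vcands (N n b : ℕ) (A : List ℕ) : ℕ → List (List RSlot)
  | 0 => [[]]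
  | D + 1 => (slotList N n b A).flatMap fun sl => (vcands N n b A D).map fun V => sl :: V

/-- The entries of the matrix of a gate, without normalization. -/
def gent (g : List ℤ) (x y : Bool) : GaussianInt :=
  bif x then (bif y then ⟨g.getD 0 0, -g.getD 1 0⟩ else ⟨-g.getD 2 0, g.getD 3 0⟩)
  else (bif y then ⟨g.getD 2 0, g.getD 3 0⟩ else ⟨g.getD 0 0, g.getD 1 0⟩)

/-- The entries of a Pauli matrix. -/
def pent (p : ℕ) (x y : Bool) : GaussianInt :=
  bif Nat.beq p 0 then (bif x ^^ y then ⟨0, 0⟩ else ⟨1, 0⟩)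
  else bif Nat.beq p 1 then (bif x ^^ y then ⟨1, 0⟩ else ⟨0, 0⟩)
  else bif Nat.beq p 2 then (bif x ^^ y then (bif x then ⟨0, 1⟩ else ⟨0, -1⟩) else ⟨0, 0⟩)
  else (bif x ^^ y then ⟨0, 0⟩ else (bif x then ⟨-1, 0⟩ else ⟨1, 0⟩))

/-- The entries of a layer of gates. -/
def tgate (N : ℕ) (g : List (List ℤ)) (x y : List Bool) : GaussianInt :=
  gprod N ((g.zip (x.zip y)).map fun p => gent p.1 p.2.1 p.2.2)

/-- The entries of a Pauli string. -/
def tpauli (N : ℕ) (Q : List ℕ) (x y : List Bool) : GaussianInt :=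
  gprod N ((Q.zip (x.zip y)).map fun p => pent p.1 p.2.1 p.2.2)

/-- The sum of bits modulo `2`. -/
def parity (l : List Bool) : Bool := l.foldl (fun s b => s ^^ b) false

/-- The sign of a layer of `CZ` gates. -/
def sgn (n : ℕ) (labels : List ℕ) (x : List Bool) : GaussianInt :=
  bif parity ((List.range n).map fun l => (labels.any fun m => Nat.beq m (l + 1)) &&
    (labels.zip x).all fun p => !(Nat.beq p.1 (l + 1)) || p.2) then ⟨-1, 0⟩ else ⟨1, 0⟩

/-- The entries of a circuit, by a sum over the basis states in `W`. -/
def vent (N n : ℕ) (W : List (List Bool)) :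
    ℕ → List RSlot → List Bool → List Bool → GaussianInt
  | 0, _, x, y => tpauli N (x.map fun _ => 0) x y
  | D + 1, V, x, y => (W.map fun z => vent N n W D V.tail x z *
      (sgn n (V.headD ([], [])).2 z * tgate N (V.headD ([], [])).1 z y)).sum

/-- The Pauli string with entry `P` at `i`. -/
def pauliWord (n i P : ℕ) : List ℕ := (List.range n).map fun j => bif Nat.beq j i then P else 0

/-- The entries of `V† P_i V`. -/
def hent (N n : ℕ) (W : List (List Bool)) (D : ℕ) (V : List RSlot) (i P : ℕ) (x y : List Bool) :
    GaussianInt :=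
  (W.map fun z => (W.map fun z' => star (vent N n W D V z x) *
    (tpauli N (pauliWord n i P) z z' * vent N n W D V z' y)).sum).sum

/-- The trace of `Q V† P_i V`. -/
def coef (N n : ℕ) (W : List (List Bool)) (D : ℕ) (V : List RSlot) (i P : ℕ) (Q : List ℕ) : ℤ :=
  ((W.map fun x => (W.map fun y => tpauli N Q x y * hent N n W D V i P y x).sum).sum).re

/-- The normalization of `coef`. -/
def denomOf (N n : ℕ) (W : List (List Bool)) (D : ℕ) (V : List RSlot) (i : ℕ) : ℤ :=
  coef N n W D V i 0 (pauliWord n 0 0)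

section FP

variable {α β : Type} [Enc α] [Enc β]

theorem clip_sz (N : ℕ) (z : ℤ) : sz (clipZ N z) ≤ N + 2 := by
  unfold clipZ
  by_cases h : z.natAbs ≤ N
  · rw [Nat.ble_eq.mpr h, cond_true]; have := sz_int_le z; omega
  · rw [Bool.eq_false_iff.mpr (mt Nat.ble_eq.mp h), cond_false]; have := sz_int_le 0; simp at this; omega

@[fun_prop]
theorem FP.clipG {N : α → ℕ} {z : α → GaussianInt} (hN : FP N) (hz : FP z) :
    FP fun a => clipG (N a) (z a) := by
  unfold QACLearn.clipG clipZ
  fun_prop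

@[fun_prop]
theorem FP.gprod {N : α → ℕ} {l : α → List GaussianInt} (hN : FP N) (hl : FP l) :
    FP fun a => gprod (N a) (l a) := by
  refine FP.foldl_bdd (s := fun _ => (1 : GaussianInt))
    (step := fun a s z => QACLearn.clipG (N a) (s * z)) hl (by fun_prop)
    (by fun_prop) (S := fun a => 2 * N a + 10) ?_ fun a l' _ => ?_
  · exact ((PB.const 2).mul (hN.pb.mono fun a => by rw [sz_nat])).add (PB.const 10)
  · rcases List.eq_nil_or_concat' l' with rfl | ⟨l', b, rfl⟩
    · have h : sz (1 : GaussianInt) = sz (1 : ℤ) + sz (0 : ℤ) + 1 := rfl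
      have := sz_int_le 1
      have := sz_int_le 0
      rw [List.foldl_nil, h]
      simp at *
      omega
    · rw [List.foldl_append, List.foldl_cons, List.foldl_nil]
      generalize List.foldl _ _ _ * b = z
      have h : sz (QACLearn.clipG (N a) z) = sz (clipZ (N a) z.re) + sz (clipZ (N a) z.im) + 1 :=
        rfl
      have := clip_sz (N a) z.re
      have := clip_sz (N a) z.im
      omega

theorem secs_inv (N : ℕ) (L : List (List β)) :
    let R := L.foldl (fun acc l => (l.flatMap fun a => acc.map fun v => a :: v).take N) [[]]
    R.length ≤ N + 1 ∧ ∀ v ∈ R, sz v ≤ sz L := by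
  induction L using List.reverseRecOn with
  | nil => simp [sz_nil]
  | append_singleton L l ih =>
    obtain ⟨-, h⟩ := ih
    rw [List.foldl_append, List.foldl_cons, List.foldl_nil]
    refine ⟨by rw [List.length_take]; omega, fun v hv => ?_⟩
    obtain ⟨a, ha, hv⟩ := List.mem_flatMap.mp (List.mem_of_mem_take hv)
    obtain ⟨v', hv', rfl⟩ := List.mem_map.mp hv
    have := h v' hv'
    have := sz_mem ha
    simp only [sz_cons, sz_append, sz_nil]
    omega

@[fun_prop]
theorem FP.secs {N : α → ℕ} {L : α → List (List β)} (hN : FP N) (hL : FP L) :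
    FP fun a => secs (N a) (L a) := by
  refine FP.foldl_bdd (s := fun _ => [[]])
    (step := fun a acc l => (l.flatMap fun b => acc.map fun v => b :: v).take (N a)) hL.reverse
    (by fun_prop) (by fun_prop) (S := fun a => (N a + 1) * (sz (L a) + 1)) ?_ fun a l' hl' => ?_
  · exact ((hN.pb.mono fun a => by rw [sz_nat]).add (PB.const 1)).mul (hL.pb.add (PB.const 1))
  · obtain ⟨h1, h2⟩ := secs_inv (N a) l'
    refine (sz_list_le _ _ h2).trans ?_
    obtain ⟨r, hr⟩ := hl'
    have : sz l' ≤ sz (L a) := by rw [← sz_reverse (L a), ← hr, sz_append]; omega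
    gcongr

@[fun_prop]
theorem FP.choices {n : α → ℕ} {A : α → List ℕ} {f : α → List β} {e : α → β} (hn : FP n)
    (hA : FP A) (hf : FP f) (he : FP e) : FP fun a => choices (n a) (A a) (f a) (e a) := by
  unfold QACLearn.choices
  fun_prop

@[fun_prop]
theorem FP.words {N n : α → ℕ} {A : α → List ℕ} (hN : FP N) (hn : FP n) (hA : FP A) :
    FP fun a => words (N a) (n a) (A a) := by
  unfold QACLearn.words
  fun_prop

@[fun_prop]
theorem FP.pwords {N n : α → ℕ} {A : α → List ℕ} (hN : FP N) (hn : FP n) (hA : FP A) :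
    FP fun a => pwords (N a) (n a) (A a) := by
  unfold QACLearn.pwords
  fun_prop

@[fun_prop]
theorem FP.gateList {b : α → ℕ} (hb : FP b) : FP fun a => gateList (b a) := by
  unfold QACLearn.gateList intRange
  fun_prop

@[fun_prop]
theorem FP.slotList {N n b : α → ℕ} {A : α → List ℕ} (hN : FP N) (hn : FP n) (hb : FP b)
    (hA : FP A) : FP fun a => slotList (N a) (n a) (b a) (A a) := by
  unfold QACLearn.slotList
  fun_prop

@[fun_prop]
theorem FP.vcands {N n b : α → ℕ} {A : α → List ℕ} (hN : FP N) (hn : FP n) (hb : FP b)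
    (hA : FP A) (D : ℕ) : FP fun a => vcands (N a) (n a) (b a) (A a) D := by
  induction D with
  | zero => unfold QACLearn.vcands; fun_prop
  | succ D ih =>
    unfold QACLearn.vcands
    exact FP.flatMap (by fun_prop) (FP.map (FP.comp ih FP.fst') (by fun_prop))

@[fun_prop]
theorem FP.gent {g : α → List ℤ} {x y : α → Bool} (hg : FP g) (hx : FP x) (hy : FP y) :
    FP fun a => gent (g a) (x a) (y a) := by
  unfold QACLearn.gent
  fun_prop

@[fun_prop]
theorem FP.pent {p : α → ℕ} {x y : α → Bool} (hp : FP p) (hx : FP x) (hy : FP y) :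
    FP fun a => pent (p a) (x a) (y a) := by
  unfold QACLearn.pent
  fun_prop

@[fun_prop]
theorem FP.tgate {N : α → ℕ} {g : α → List (List ℤ)} {x y : α → List Bool} (hN : FP N)
    (hg : FP g) (hx : FP x) (hy : FP y) : FP fun a => tgate (N a) (g a) (x a) (y a) := by
  unfold QACLearn.tgate
  fun_prop

@[fun_prop]
theorem FP.tpauli {N : α → ℕ} {g : α → List ℕ} {x y : α → List Bool} (hN : FP N)
    (hg : FP g) (hx : FP x) (hy : FP y) : FP fun a => tpauli (N a) (g a) (x a) (y a) := by
  unfold QACLearn.tpauli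
  fun_prop

@[fun_prop]
theorem FP.parity {l : α → List Bool} (hl : FP l) : FP fun a => parity (l a) :=
  FP.foldl_bool (s := fun _ => false) (step := fun _ s b => s ^^ b) hl (by fun_prop) (by fun_prop)

@[fun_prop]
theorem FP.sgn {n : α → ℕ} {l : α → List ℕ} {x : α → List Bool} (hn : FP n) (hl : FP l)
    (hx : FP x) : FP fun a => sgn (n a) (l a) (x a) := by
  unfold QACLearn.sgn
  fun_prop

theorem vent_aux (D : ℕ) : FP fun p : (ℕ × ℕ × List (List Bool)) × List RSlot × List Bool ×
    List Bool => vent p.1.1 p.1.2.1 p.1.2.2 D p.2.1 p.2.2.1 p.2.2.2 := by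
  induction D with
  | zero => unfold vent; fun_prop
  | succ D ih =>
    unfold vent
    refine FP.gsum (FP.map (by fun_prop) (FP.gmul ?_ (by fun_prop)))
    exact FP.comp ih (g := fun p : ((ℕ × ℕ × List (List Bool)) × List RSlot × List Bool ×
      List Bool) × List Bool => (p.1.1, p.1.2.1.tail, p.1.2.2.1, p.2)) (by fun_prop)

@[fun_prop]
theorem FP.vent {N n : α → ℕ} {W : α → List (List Bool)} {V : α → List RSlot}
    {x y : α → List Bool} (hN : FP N) (hn : FP n) (hW : FP W) (D : ℕ) (hV : FP V) (hx : FP x)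
    (hy : FP y) : FP fun a => vent (N a) (n a) (W a) D (V a) (x a) (y a) :=
  FP.comp (vent_aux D) (g := fun a => ((N a, n a, W a), V a, x a, y a)) (by fun_prop)

@[fun_prop]
theorem FP.pauliWord {n i P : α → ℕ} (hn : FP n) (hi : FP i) (hP : FP P) :
    FP fun a => pauliWord (n a) (i a) (P a) := by
  unfold QACLearn.pauliWord
  fun_prop

@[fun_prop]
theorem FP.hent {N n i P : α → ℕ} {W : α → List (List Bool)} {V : α → List RSlot}
    {x y : α → List Bool} (hN : FP N) (hn : FP n) (hW : FP W) (D : ℕ) (hV : FP V) (hi : FP i)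
    (hP : FP P) (hx : FP x) (hy : FP y) :
    FP fun a => hent (N a) (n a) (W a) D (V a) (i a) (P a) (x a) (y a) := by
  unfold QACLearn.hent
  fun_prop

@[fun_prop]
theorem FP.coef {N n i P : α → ℕ} {W : α → List (List Bool)} {V : α → List RSlot}
    {Q : α → List ℕ} (hN : FP N) (hn : FP n) (hW : FP W) (D : ℕ) (hV : FP V) (hi : FP i)
    (hP : FP P) (hQ : FP Q) :
    FP fun a => coef (N a) (n a) (W a) D (V a) (i a) (P a) (Q a) := by
  unfold QACLearn.coef
  fun_prop

@[fun_prop]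
theorem FP.denomOf {N n i : α → ℕ} {W : α → List (List Bool)} {V : α → List RSlot}
    (hN : FP N) (hn : FP n) (hW : FP W) (D : ℕ) (hV : FP V) (hi : FP i) :
    FP fun a => denomOf (N a) (n a) (W a) D (V a) (i a) := by
  unfold QACLearn.denomOf
  fun_prop

end FP

/-! ### Testing and selecting candidates -/

/-- A candidate: a qubit, the qubits on which the circuit acts, and the circuit. -/
abbrev Cand := (ℕ × List ℕ) × List RSlot

/-- Estimates for the Pauli coefficients `(P, Q)`. -/
abbrev Table := List ((ℕ × List ℕ) × List ((ℕ × List ℕ) × ℕ))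

/-- The pairs of a qubit and a set of qubits. -/
def groups (N n s : ℕ) : List (ℕ × List ℕ) :=
  (List.range n).flatMap fun i => (secs N (List.replicate s (List.range n))).map fun A => (i, i :: A)

/-- The Pauli coefficients to estimate for a group. -/
def items (N n : ℕ) (A : List ℕ) : List (ℕ × List ℕ) :=
  [1, 2, 3].flatMap fun P => (pwords N n A).map fun Q => (P, Q)

/-- The estimated overlap of `V† P_i V` with the unknown observables. -/
def score (N n D G : ℕ) (W : List (List Bool)) (V : List RSlot) (i : ℕ)
    (e : List ((ℕ × List ℕ) × ℕ)) : ℤ :=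
  (e.map fun r => coef N n W D V i r.1.1 r.1.2 * (2 * (r.2 : ℤ) - (G : ℤ))).sum

/-- The test of a candidate. -/
def passes (N n D G E : ℕ) (g : (ℕ × List ℕ) × List ((ℕ × List ℕ) × ℕ)) (V : List RSlot) : Bool :=
  decide ((3 * (E : ℤ) - 1) * denomOf N n (words N n g.1.2) D V g.1.1 * (G : ℤ) ≤
    (E : ℤ) * score N n D G (words N n g.1.2) V g.1.1 g.2)

/-- The candidates that pass the test. -/
def passList (N n D b G E : ℕ) (t : Table) : List Cand :=
  t.flatMap fun g => ((vcands N n b g.1.2 D).filter fun V => passes N n D G E g V).map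
    fun V => (g.1, V)

/-- Disjointness of lists. -/
def disj (A A' : List ℕ) : Bool := A.all fun a => !(A'.any fun b => Nat.beq b a)

/-- Whether `c` is for a new qubit and disjoint from the candidates in `r`. -/
def isFree (prev r : List Cand) (c : Cand) : Bool :=
  (!(prev.any fun c' => Nat.beq c'.1.1 c.1.1)) && r.all fun c' => disj c.1.2 c'.1.2

/-- A maximal set of new candidates that act on disjoint sets of qubits. -/
def greedy (pass prev : List Cand) : List Cand :=
  pass.foldl (fun r c => bif isFree prev r c then c :: r else r) []

/-- All rounds of the selection, the last one first. -/
def rounds (pass : List Cand) (R : ℕ) : List (List Cand) :=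
  (List.replicate R ()).foldl (fun acc _ => greedy pass (acc.flatMap fun r => r) :: acc) []

/-! ### Compiling the circuits -/

/-- The inverse of a gate. -/
def ginv (g : List ℤ) : List ℤ := [g.getD 0 0, -g.getD 1 0, -g.getD 2 0, -g.getD 3 0]

/-- A layer on `n` qubits as a layer on `n + n` qubits. -/
def ext (n : ℕ) (sl : RSlot) : RSlot :=
  (sl.1 ++ List.replicate n idGate, sl.2 ++ List.replicate n 0)

/-- Two layers that implement the inverse of a layer. -/
def invSlots (sl : RSlot) : List RSlot :=
  [(sl.1.map fun _ => idGate, sl.2), (sl.1.map fun g => ginv g, sl.1.map fun _ => 0)]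

/-- The gates `g` at the qubits in `I`, and `h` at the same qubits of the second half. -/
def swapGates (n : ℕ) (I : List ℕ) (g h : List ℤ) : List (List ℤ) :=
  ((List.range n).map fun q => bif I.any fun a => Nat.beq a q then g else idGate) ++
    (List.range n).map fun q => bif I.any fun a => Nat.beq a q then h else idGate

/-- Labels for `CZ` gates between the two halves. -/
def swapLabels (n : ℕ) (I : List ℕ) : List ℕ :=
  ((List.range n).map fun q => bif I.any fun a => Nat.beq a q then q + 1 else 0) ++
    (List.range n).map fun q => bif I.any fun a => Nat.beq a q then q + 1 else 0

/-- The Hadamard gate, up to a phase. -/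
def hadGate : List ℤ := [0, 1, 0, 1]

/-- The inverse of `hadGate`. -/
def hadInv : List ℤ := [0, -1, 0, -1]

/-- Layers that exchange the qubits in `I` with those of the second half. -/
def swapSlots (n : ℕ) (I : List ℕ) : List RSlot :=
  [(swapGates n I idGate hadGate, swapLabels n I),
    (swapGates n I hadGate hadInv, swapLabels n I),
    (swapGates n I hadInv hadGate, swapLabels n I),
    (swapGates n I idGate hadInv, List.replicate (n + n) 0)]

/-- Layers that implement `V† SWAP_i V`. -/
def partSlots (n : ℕ) (c : Cand) : List RSlot :=
  (c.2.map fun sl => ext n sl) ++ (swapSlots n [c.1.1] ++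
    (c.2.reverse.flatMap fun sl => (invSlots sl).map fun sl => ext n sl))

/-- Whether the candidate acts on the qubit `q` of `n + n` qubits. -/
def owns (n : ℕ) (c : Cand) (q : ℕ) : Bool := (c.1.2.any fun a => Nat.beq a q) || Nat.beq q (n + c.1.1)

/-- The parallel composition of disjoint candidates. -/
def mergeSlots (n M : ℕ) (r : List Cand) : List RSlot :=
  (List.range M).map fun m =>
    ((List.range (n + n)).map fun q => ((r.filter fun c => owns n c q).map fun c =>
      ((partSlots n c).getD m ([], [])).1.getD q idGate).headD idGate,
    (List.range (n + n)).map fun q => ((r.filter fun c => owns n c q).map fun c =>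
      ((partSlots n c).getD m ([], [])).2.getD q 0).headD 0)

/-- The layers of the sewn circuit. -/
def sewnSlots (n M : ℕ) (rs : List (List Cand)) : List RSlot :=
  (rs.reverse.flatMap fun r => mergeSlots n M r) ++ swapSlots n (List.range n)

/-- A circuit from its layers. -/
def toCircuit (n : ℕ) (l : List RSlot) : List RSlot × List (List ℤ) :=
  (l, List.replicate (n + n) idGate)

/-- The chosen candidate for the qubit `i`. -/
def candFor (chosen : List Cand) (i : ℕ) : Cand :=
  (chosen.filter fun c => Nat.beq c.1.1 i).headD ((0, []), [])

/-- The learned observable. -/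
def obsOf (N n D : ℕ) (c : Cand) (P : ℕ) : List (List ℕ × ℤ) × ℕ :=
  ((pwords N n c.1.2).map fun Q => (Q, coef N n (words N n c.1.2) D c.2 c.1.1 P Q),
    (denomOf N n (words N n c.1.2) D c.2 c.1.1).toNat)

/-- The output, from the rounds of the selection. -/
def outputOf (N n D : ℕ) (rs : List (List Cand)) :
    List (List (List (List ℕ × ℤ) × ℕ)) × List (List RSlot × List (List ℤ)) × List ℕ ×
      (List RSlot × List (List ℤ)) × Unit :=
  ((List.range n).map fun i => [1, 2, 3].map fun P => obsOf N n D (candFor (rs.flatMap fun r => r) i) P,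
    (List.range n).map fun i => toCircuit n (partSlots n (candFor (rs.flatMap fun r => r) i)),
    (rs.flatMap fun r => r).map fun c => c.1.1,
    toCircuit n (sewnSlots n (D + 4 + 2 * D) rs), ())

section FP

variable {α β : Type} [Enc α] [Enc β]

@[fun_prop]
theorem FP.groups {N n s : α → ℕ} (hN : FP N) (hn : FP n) (hs : FP s) :
    FP fun a => groups (N a) (n a) (s a) := by
  unfold QACLearn.groups
  fun_prop

@[fun_prop]
theorem FP.items {N n : α → ℕ} {A : α → List ℕ} (hN : FP N) (hn : FP n) (hA : FP A) :
    FP fun a => items (N a) (n a) (A a) := by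
  unfold QACLearn.items
  fun_prop

@[fun_prop]
theorem FP.passList {N n b G E : α → ℕ} {t : α → Table} (hN : FP N) (hn : FP n) (D : ℕ)
    (hb : FP b) (hG : FP G) (hE : FP E) (ht : FP t) :
    FP fun a => passList (N a) (n a) D (b a) (G a) (E a) (t a) := by
  unfold QACLearn.passList passes score
  fun_prop

theorem greedy_sz (pass prev : List Cand) : sz (greedy pass prev) ≤ sz pass := by
  suffices h : ∀ (l r : List Cand), sz (l.foldl (fun r c =>
      bif isFree prev r c then c :: r else r) r) ≤ sz r + sz l by
    simpa [sz_nil, greedy] using h pass []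
  intro l
  induction l with
  | nil => intro r; simp [sz_nil]
  | cons c l ih =>
    intro r
    rw [List.foldl_cons]
    refine (ih _).trans ?_
    rw [sz_cons]
    cases isFree prev r c
    · rw [cond_false]; omega
    · rw [cond_true, sz_cons]; omega

@[fun_prop]
theorem FP.greedy {pass prev : α → List Cand} (hp : FP pass) (hq : FP prev) :
    FP fun a => greedy (pass a) (prev a) := by
  refine FP.foldl_add (s := fun _ => ([] : List Cand)) (step := fun a r c =>
    bif isFree (prev a) r c then c :: r else r) hp (by fun_prop) (by unfold isFree disj; fun_prop) (S := fun p => sz p.2 + 1)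
    ((PB.sz.mono fun p => by rw [sz_prod p]; omega).add (PB.const 1)) fun a s c => ?_
  dsimp only
  cases isFree (prev a) s c
  · rw [cond_false]; omega
  · rw [cond_true, sz_cons]; omega

@[fun_prop]
theorem FP.rounds {pass : α → List Cand} {R : α → ℕ} (hp : FP pass) (hR : FP R) :
    FP fun a => rounds (pass a) (R a) := by
  refine FP.foldl_add (s := fun _ => ([] : List (List Cand))) (step := fun a acc (_ : Unit) =>
    QACLearn.greedy (pass a) (acc.flatMap fun r => r) :: acc) hR.units (by fun_prop) (by fun_prop)
    (S := fun p => sz (pass p.1) + 1) ((FP.comp hp FP.fst').pb.add (PB.const 1)) fun a s c => ?_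
  have := greedy_sz (pass a) (s.flatMap fun r => r)
  dsimp only
  rw [sz_cons]
  omega

@[fun_prop]
theorem FP.swapSlots {n : α → ℕ} {I : α → List ℕ} (hn : FP n) (hI : FP I) :
    FP fun a => swapSlots (n a) (I a) := by
  unfold QACLearn.swapSlots swapGates swapLabels
  fun_prop

@[fun_prop]
theorem FP.ext {n : α → ℕ} {s : α → RSlot} (hn : FP n) (hs : FP s) :
    FP fun a => ext (n a) (s a) := by
  unfold QACLearn.ext
  fun_prop

@[fun_prop]
theorem FP.invSlots {s : α → RSlot} (hs : FP s) : FP fun a => invSlots (s a) := by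
  unfold QACLearn.invSlots ginv
  fun_prop

@[fun_prop]
theorem FP.partSlots {n : α → ℕ} {c : α → Cand} (hn : FP n) (hc : FP c) :
    FP fun a => partSlots (n a) (c a) := by
  unfold QACLearn.partSlots
  fun_prop

@[fun_prop]
theorem FP.mergeSlots {n M : α → ℕ} {r : α → List Cand} (hn : FP n) (hM : FP M) (hr : FP r) :
    FP fun a => mergeSlots (n a) (M a) (r a) := by
  unfold QACLearn.mergeSlots owns
  fun_prop

@[fun_prop]
theorem FP.obsOf {N n P : α → ℕ} {c : α → Cand} (hN : FP N) (hn : FP n) (D : ℕ) (hc : FP c)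
    (hP : FP P) : FP fun a => obsOf (N a) (n a) D (c a) (P a) := by
  unfold QACLearn.obsOf
  fun_prop

@[fun_prop]
theorem FP.candFor {i : α → ℕ} {c : α → List Cand} (hc : FP c) (hi : FP i) :
    FP fun a => candFor (c a) (i a) := by
  unfold QACLearn.candFor
  fun_prop

@[fun_prop]
theorem FP.outputOf {N n : α → ℕ} {r : α → List (List Cand)} (hN : FP N) (hn : FP n) (D : ℕ)
    (hr : FP r) : FP fun a => outputOf (N a) (n a) D (r a) := by
  unfold QACLearn.outputOf toCircuit sewnSlots
  fun_prop

/-! ### Logarithms -/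

theorem log_fold (m j : ℕ) (hm : m ≠ 0) : (List.replicate j ()).foldl
    (fun (s : ℕ × ℕ) (_ : Unit) => bif Nat.ble (2 * s.1) m then (2 * s.1, s.2 + 1) else s) (1, 0) =
      (2 ^ min j (Nat.log 2 m), min j (Nat.log 2 m)) := by
  induction j with
  | zero => simp
  | succ j ih =>
    rw [List.replicate_succ', List.foldl_append, ih]
    simp only [List.foldl_cons, List.foldl_nil]
    by_cases h : j < Nat.log 2 m
    · rw [min_eq_left h.le, min_eq_left (Nat.succ_le_of_lt h), ← pow_succ',
        Nat.ble_eq.mpr (Nat.pow_le_of_le_log hm h), cond_true]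
    · rw [min_eq_right (by omega), min_eq_right (by omega), ← pow_succ',
        Bool.eq_false_iff.mpr (fun h' => absurd (Nat.ble_eq.mp h') ?_), cond_false]
      exact not_le.mpr (Nat.lt_pow_succ_log_self (by norm_num) m)

@[fun_prop]
theorem FP.lg {n : α → ℕ} (hn : FP n) : FP fun a => lg (n a) := by
  have := FP.foldl_bdd (l := fun a => List.replicate (n a + 2) ()) (s := fun _ => (1, 0))
    (step := fun (a : α) (s : ℕ × ℕ) (_ : Unit) =>
      bif Nat.ble (2 * s.1) (n a + 2) then (2 * s.1, s.2 + 1) else s) (by fun_prop) (by fun_prop)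
    (by fun_prop) (S := fun a => (n a + 2) + (n a + 2) + 1)
    ((hn.add (FP.const 2)).add (hn.add (FP.const 2)) |>.pb.mono (fun a => by rw [sz_nat])
      |>.add (PB.const 1)) fun a l' _ => by
      obtain ⟨m, rfl⟩ : ∃ m, l' = List.replicate m () :=
        ⟨l'.length, List.eq_replicate_iff.mpr ⟨rfl, fun _ _ => rfl⟩⟩
      rw [log_fold _ _ (by omega), sz_pair, sz_nat, sz_nat]
      have h1 := (Nat.pow_le_pow_right (n := 2) (by omega)
        (min_le_right m (Nat.log 2 (n a + 2)))).trans (Nat.pow_log_le_self 2 (by omega))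
      have h2 := (min_le_right m (Nat.log 2 (n a + 2))).trans (Nat.log_le_self 2 (n a + 2))
      omega
  have h2 := this.snd
  convert h2 using 2 with a
  rw [log_fold _ _ (by omega), QACLearn.lg]
  exact (min_eq_right (Nat.log_le_self 2 _)).symm

end FP

/-! ### Random programs -/

theorem rfold_append {σ β : Type} (step : σ → β → PMF σ) (l l' : List β) (s : σ) :
    rfold step (l ++ l') s = (rfold step l s).bind (rfold step l') := by
  induction l generalizing s with
  | nil => rw [List.nil_append, rfold, PMF.pure_bind]
  | cons b l ih =>
    rw [List.cons_append, rfold, rfold, PMF.bind_bind]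
    exact pmf_bind_congr _ fun a _ => ih a

theorem rfold_map {σ τ β : Type} {step : σ → β → PMF σ} {step' : τ → β → PMF τ} (h : σ → τ)
    (hh : ∀ s b, step' (h s) b = (step s b).map h) (l : List β) (s : σ) :
    rfold step' l (h s) = (rfold step l s).map h := by
  induction l generalizing s with
  | nil => rw [rfold, rfold, PMF.pure_map]
  | cons b l ih => rw [rfold, rfold, hh, PMF.bind_map, PMF.map_bind]; simp only [Function.comp_def, ih]

theorem rfold_nested {σ : Type} (step : σ → Unit → PMF σ) (G m : ℕ) (s : σ) :
    rfold (fun s (_ : Unit) => rfold step (List.replicate m ()) s) (List.replicate G ()) s =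
      rfold step (List.replicate (G * m) ()) s := by
  induction G generalizing s with
  | zero => simp [rfold]
  | succ G ih =>
    rw [List.replicate_succ, rfold, add_mul, one_mul, add_comm (G * m), List.replicate_add,
      rfold_append]
    exact pmf_bind_congr _ fun a _ => ih a

/-- Independent samples for the elements of a list. -/
noncomputable def mapK {β γ : Type} (g : β → PMF γ) : List β → PMF (List γ)
  | [] => PMF.pure []
  | b :: l => (mapK g l).bind fun r => (g b).map fun c => c :: r

theorem rfold_mapK {β γ : Type} (g : β → PMF γ) (l : List β) :
    rfold (fun (r : List γ) b => (g b).map fun c => c :: r) l.reverse [] = mapK g l := by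
  induction l with
  | nil => rfl
  | cons b l ih =>
    rw [List.reverse_cons, rfold_append, ih, mapK]
    refine pmf_bind_congr _ fun r _ => ?_
    rw [rfold]
    exact PMF.bind_pure _

theorem mapK_support {β γ : Type} {g : β → PMF γ} {l : List β} {r : List γ}
    (h : r ∈ (mapK g l).support) : List.Forall₂ (fun b c => c ∈ (g b).support) l r := by
  induction l generalizing r with
  | nil =>
    rw [mapK, PMF.support_pure, Set.mem_singleton_iff] at h
    rw [h]; exact List.Forall₂.nil
  | cons b l ih =>
    rw [mapK] at h
    obtain ⟨r', hr', h⟩ := (PMF.mem_support_bind_iff _ _ _).mp h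
    obtain ⟨c, hc, rfl⟩ := (PMF.mem_support_map_iff _ _ _).mp h
    exact List.Forall₂.cons hc (ih hr')

theorem FP.runs {α β : Type} [Enc α] [Enc β] {f : α → β} (h : FP f) :
    ∃ (p : Prog) (k : ℕ), ∀ O q a, RunsTo O q p (enc a) (enc (f a)) ((sz a + 2) ^ k) := by
  obtain ⟨p, T, ⟨k, hk⟩, -, hp⟩ := h
  exact ⟨p, k, fun O q a => (hp O q a).mono (hk a)⟩

section Random

variable {O : Data → PMF Data} {q : ℕ} {α β γ : Type} [Enc α] [Enc β] [Enc γ]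

theorem Runs.keep {p : Prog} {a : α} {f : PMF β} {T : ℕ} (h : Runs O q p (enc a) (f.map enc) T) :
    Runs O q (.cons .id p) (enc a) ((f.map fun b => (a, b)).map enc) (T + 2) := by
  have := Runs.cons (Runs.id (enc a)) h
  rw [PMF.pure_bind, PMF.map_comp] at this
  rw [PMF.map_comp]
  exact this.mono (by omega)

/-- The program that applies a random program `r` to each element of a list. -/
def mapProg (r : Prog) : Prog :=
  foldProg (.cons (.comp (.cons .left (.comp .right .right)) r) (.comp .right .left))

theorem runs_mapProg {r : Prog} {a : α} {g : β → PMF γ} {T : ℕ} (l : List β)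
    (h : ∀ b ∈ l, Runs O q r (enc (a, b)) ((g b).map enc) T) :
    Runs O q (mapProg r) (enc (l.reverse, a, ([] : List γ))) ((mapK g l).map enc)
      (l.length * (T + 40) + 7) := by
  have := runs_foldProg (O := O) (q := q) (x := enc a) (T := T + 16)
    (step := fun (r : List γ) b => (g b).map fun c => c :: r)
    (p := .cons (.comp (.cons .left (.comp .right .right)) r) (.comp .right .left))
    (fun rem _ => ∀ b ∈ rem, b ∈ l) l.reverse ?_ [] (fun b hb => List.mem_reverse.mp hb)
  · rw [rfold_mapK, List.length_reverse] at this
    exact this.mono (by rw [add_assoc T])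
  · intro s b l' hl'
    refine ⟨?_, fun _ _ b hb => hl' b (by simp [hb])⟩
    have h1 : RunsTo O q (.cons .left (.comp .right .right))
        (.cons (enc a) (.cons (enc s) (enc b))) (enc (a, b)) 5 :=
      (RunsTo.cons (Runs.left _) (RunsTo.comp (Runs.right _) (Runs.right _))).mono (by omega)
    have h2 : RunsTo O q (.comp .right .left)
        (.cons (enc a) (.cons (enc s) (enc b))) (enc s) 3 :=
      RunsTo.comp (Runs.right _) (Runs.left _)
    have := Runs.cons (RunsTo.comp h1 (h b (hl' b (by simp)))) h2
    rw [PMF.bind_map] at this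
    rw [PMF.map_comp]
    refine Runs.mono (T := _) ?_ (?_ : 5 + T + 1 + 3 + 1 ≤ T + 16)
    · convert this using 1
      rw [PMF.map]
      refine pmf_bind_congr _ fun c _ => ?_
      simp only [Function.comp_apply, PMF.pure_map]
      rfl
    · omega

/-! ### Estimating a Pauli coefficient -/

/-- What is needed to estimate a Pauli coefficient: a Pauli string, the Pauli operators to measure,
and a qubit. -/
abbrev Exper := List ℕ × List ℕ × ℕ

/-- Random eigenstates of the entries of a Pauli string. -/
noncomputable def prepK (Q : List ℕ) : PMF (List (ℕ × Bool)) :=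
  mapK (fun P => (PMF.uniformOfFintype Bool).map fun s => (P - 1, s)) Q

/-- The Pauli operator written as `k`. -/
def pauliOf (k : ℕ) : Pauli := (Data.ofNat k).toPauli

/-- The answer to a query. -/
noncomputable def ansK {n : ℕ} (U : UN n) (prep : List (ℕ × Bool)) (meas : List ℕ) :
    PMF (List Bool) :=
  (outcome U (fun j => pauliOf (prep.getD j (0, false)).1) (fun j => (prep.getD j (0, false)).2)
    (fun j => pauliOf (meas.getD j 0))).map fun b => List.ofFn b

/-- The bit computed from the answer to a query: whether an even number of the relevant bits
is set. -/
def postBit (c : Exper) (prep : List (ℕ × Bool)) (ans : List Bool) : Bool :=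
  !(parity ((c.1.zip prep).map fun p => !(Nat.beq p.1 0) && p.2.2) ^^ ans.getD c.2.2 false)

/-- One sample. -/
noncomputable def bitK {n : ℕ} (U : UN n) (c : Exper) : PMF Bool :=
  (prepK c.1).bind fun prep => (ansK U prep c.2.1).map (postBit c prep)

theorem Data.get_enc (l : List α) (j : ℕ) : Data.get (enc l) j = (l.map enc).getD j .nil := by
  induction l generalizing j with
  | nil =>
    have : ∀ j, Data.get .nil j = .nil := by
      intro j
      induction j with
      | zero => rfl
      | succ j ih => exact ih
    exact this j
  | cons a l ih =>
    cases j with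
    | zero => rfl
    | succ j => simpa using! ih j

theorem oracle_enc {n : ℕ} (U : UN n) (prep : List (ℕ × Bool)) (meas : List ℕ) :
    oracle U (enc ((), prep, meas)) = (ansK U prep meas).map enc := by
  have h1 : ∀ j, (Data.get (enc prep) j).left = Data.ofNat (prep.getD j (0, false)).1 := by
    intro j
    rw [Data.get_enc, List.getD_eq_getElem?_getD, List.getD_eq_getElem?_getD, List.getElem?_map]
    cases prep[j]? <;> rfl
  have h2 : ∀ j, (!(Data.get (enc prep) j).right.isNil) = (prep.getD j (0, false)).2 := by
    intro j
    rw [Data.get_enc, List.getD_eq_getElem?_getD, List.getD_eq_getElem?_getD, List.getElem?_map]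
    cases prep[j]? with
    | none => rfl
    | some x => rcases x with ⟨_, _ | _⟩ <;> rfl
  have h3 : ∀ j, (Data.get (enc meas) j) = Data.ofNat (meas.getD j 0) := by
    intro j
    rw [Data.get_enc, List.getD_eq_getElem?_getD, List.getD_eq_getElem?_getD, List.getElem?_map]
    cases meas[j]? <;> rfl
  rw [oracle, ansK, PMF.map_comp]
  have e : (fun b : Fin n → Bool => Data.ofFn fun i => Data.ofBool (b i)) =
      (enc ∘ fun b : Fin n → Bool => List.ofFn b) := by
    funext b
    change Data.ofList _ = Data.ofList _
    rw [List.map_ofFn]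
    rfl
  rw [e]
  change (outcome U (fun i : Fin n => (Data.get (enc prep) i).left.toPauli)
    (fun i : Fin n => !(Data.get (enc prep) i).right.isNil)
    (fun i : Fin n => (Data.get (enc meas) i).toPauli)).map _ = _
  simp only [h1, h2, h3]
  rfl

theorem FP.postBit : FP fun p : (Exper × List (ℕ × Bool)) × List Bool =>
    postBit p.1.1 p.1.2 p.2 := by
  unfold QACLearn.postBit
  fun_prop

theorem sz_prep {Q : List ℕ} {prep : List (ℕ × Bool)} (h : prep ∈ (prepK Q).support) :
    sz prep ≤ 3 * sz Q := by
  have := mapK_support h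
  clear h
  induction this with
  | nil => simp [sz_nil]
  | cons h _ ih =>
    obtain ⟨s, -, rfl⟩ := (PMF.mem_support_map_iff _ _ _).mp h
    have := sz_bool s
    simp only [sz_cons, sz_pair, sz_nat] at *
    omega

theorem sz_ans {n : ℕ} {U : UN n} {prep : List (ℕ × Bool)} {meas : List ℕ} {ans : List Bool}
    (h : ans ∈ (ansK U prep meas).support) : sz ans ≤ n * 2 := by
  obtain ⟨b, -, rfl⟩ := (PMF.mem_support_map_iff _ _ _).mp h
  have := sz_list_le (List.ofFn b) 1 fun a _ => sz_bool a
  rwa [List.length_ofFn] at this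

theorem exists_bitProg : ∃ (p : Prog) (k : ℕ), ∀ (q n : ℕ) (U : UN n) (c : Exper),
    n ≤ c.2.1.length →
    Runs (oracle U) q p (enc c) ((bitK U c).map enc) ((sz c + 2) ^ k + q) := by
  obtain ⟨p₁, k₁, h₁⟩ := (FP.pair (FP.reverse (FP.fst FP.id))
    (FP.pair (FP.const ()) (FP.const []) : FP fun _ : Exper => ((), ([] : List (ℕ × Bool))))).runs
  obtain ⟨p₂, k₂, h₂⟩ := FP.postBit.runs
  obtain ⟨p₄, k₄, h₄⟩ := (by fun_prop :
    FP fun x : Exper × List (ℕ × Bool) => ((), x.2, x.1.2.1)).runs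
  obtain ⟨p₃, k₃, h₃⟩ := (by fun_prop : FP fun x : Unit × ℕ => x.2 - 1).runs
  let r : Prog := .cons (.comp .id p₃) .coin
  obtain ⟨k, hk⟩ : PB fun c : Exper => (sz c + 2) ^ k₁ + (7 * sz c + 20) ^ k₂ +
      (7 * sz c + 20) ^ k₄ + (sz c * ((sz c + 20) ^ k₃ + 50)) + 50 := by
    have h7 : PB fun c : Exper => 7 * sz c + 20 := ((PB.const 7).mul PB.sz).add (PB.const 20)
    exact (((((PB.sz.add (PB.const 2)).pow k₁).add (h7.pow k₂)).add (h7.pow k₄)).add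
      (PB.sz.mul (((PB.sz.add (PB.const 20)).pow k₃).add (PB.const 50)))).add (PB.const 50)
  refine ⟨.comp (.cons .id (.comp p₁ (mapProg r))) (.comp (.cons .id (.comp p₄ .query)) p₂), k,
    fun q n U c hn => ?_⟩
  have hc : sz c = sz c.1 + (sz c.2.1 + sz c.2.2 + 1) + 1 := rfl
  have hlen := length_le_sz c.2.1
  have hlen1 := length_le_sz c.1
  have s1 : Runs (oracle U) q (.comp p₁ (mapProg r)) (enc c) ((prepK c.1).map enc)
      ((sz c + 2) ^ k₁ + (sz c * ((sz c + 20) ^ k₃ + 46) + 7) + 1) := by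
    refine RunsTo.comp (h₁ _ q c) ((runs_mapProg (α := Unit) (T := (sz c + 20) ^ k₃ + 6)
      c.1 fun P hP => ?_).mono ?_)
    · have e1 : RunsTo (oracle U) q (.comp .id p₃) (enc ((), P)) (enc (P - 1))
          (1 + (sz c + 20) ^ k₃ + 1) := RunsTo.comp (Runs.id _) ((h₃ _ q ((), P)).mono (by
        refine Nat.pow_le_pow_left ?_ _
        have := sz_mem hP
        rw [sz_pair]
        have : sz () = 0 := rfl
        omega))
      have := Runs.cons e1 (Runs.coin _)
      rw [PMF.pure_bind, PMF.map_comp] at this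
      rw [PMF.map_comp]
      exact this.mono (by omega)
    · have : c.1.length ≤ sz c := by omega
      exact Nat.add_le_add_right (Nat.mul_le_mul_right ((sz c + 20) ^ k₃ + 46) this) 7
  have s2 := s1.keep
  have s3 : ∀ x ∈ ((prepK c.1).map fun b => (c, b)).support,
      Runs (oracle U) q (.comp (.cons .id (.comp p₄ .query)) p₂) (enc x)
        (((ansK U x.2 c.2.1).map (postBit c x.2)).map enc)
        ((7 * sz c + 20) ^ k₄ + q + 4 + (7 * sz c + 20) ^ k₂) := by
    intro x hx
    obtain ⟨prep, hprep, rfl⟩ := (PMF.mem_support_map_iff _ _ _).mp hx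
    have hs := sz_prep hprep
    have t1 : Runs (oracle U) q (.comp p₄ .query) (enc (c, prep))
        ((ansK U prep c.2.1).map enc) ((7 * sz c + 20) ^ k₄ + q + 1) := by
      have := (h₄ (oracle U) q (c, prep)).comp (Runs.query _)
      rw [oracle_enc] at this
      refine this.mono ?_
      have : (sz (c, prep) + 2) ^ k₄ ≤ (7 * sz c + 20) ^ k₄ :=
        Nat.pow_le_pow_left (by rw [sz_pair]; omega) _
      omega
    have t2 := t1.keep.comp_enc (g := fun y : (Exper × List (ℕ × Bool)) × List Bool =>
      PMF.pure (postBit y.1.1 y.1.2 y.2)) (p' := p₂) (T' := (7 * sz c + 20) ^ k₂) fun y hy => by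
        obtain ⟨ans, hans, rfl⟩ := (PMF.mem_support_map_iff _ _ _).mp hy
        rw [PMF.pure_map]
        refine (h₂ (oracle U) q _).mono (Nat.pow_le_pow_left ?_ _)
        have := sz_ans hans
        rw [sz_pair, sz_pair]
        omega
    rw [PMF.bind_map] at t2
    refine Runs.mono (T := _) ?_ (?_ : (7 * sz c + 20) ^ k₄ + q + 1 + 2 +
      (7 * sz c + 20) ^ k₂ + 1 ≤ _)
    · exact t2
    · omega
  have s4 := s2.comp_enc s3
  rw [PMF.bind_map] at s4
  refine Runs.mono (T := _) s4 ?_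
  have := hk c
  have e : sz c * ((sz c + 20) ^ k₃ + 50) = sz c * ((sz c + 20) ^ k₃ + 46) + 4 * sz c := by ring
  dsimp only at this
  omega

end Random

/-! ### Counting -/

/-- Updating a counter: `quo` increases after each `m` increments. -/
def tick (m : ℕ) (s : ℕ × ℕ) (b : Bool) : ℕ × ℕ :=
  bif b then (bif Nat.beq (s.1 - 1) 0 then (m, s.2 + 1) else (s.1 - 1, s.2)) else s

/-- The state of a counter after `k` increments. -/
def tickState (m k : ℕ) : ℕ × ℕ := (m - k % m, k / m)

theorem tick_tickState {m : ℕ} (hm : 0 < m) (k : ℕ) (b : Bool) :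
    tick m (tickState m k) b = tickState m (bif b then k + 1 else k) := by
  cases b
  · rfl
  · simp only [tick, tickState, cond_true]
    have h1 := Nat.mod_lt k hm
    have h2 := Nat.div_add_mod k m
    by_cases h : k % m + 1 = m
    · have h3 : k + 1 = m * (k / m + 1) := by rw [mul_add]; omega
      rw [h3, Nat.mul_mod_right, Nat.mul_div_cancel_left _ hm,
        Nat.beq_eq.mpr (by omega : m - k % m - 1 = 0), cond_true]
      rfl
    · have h3 : k + 1 = (k % m + 1) + m * (k / m) := by omega
      have e1 : (k + 1) % m = k % m + 1 := by
        rw [h3, Nat.add_mul_mod_self_left, Nat.mod_eq_of_lt (a := k % m + 1) (by omega)]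
      have e2 : (k + 1) / m = k / m := by
        rw [h3, Nat.add_mul_div_left _ _ hm, Nat.div_eq_of_lt (a := k % m + 1) (by omega),
          zero_add]
      rw [Bool.eq_false_iff.mpr (fun h' => absurd (Nat.beq_eq.mp h') (by omega)), cond_false, e1,
        e2]
      congr 1

/-- The number of successes in `M` trials. -/
noncomputable def cntK (f : PMF Bool) (M : ℕ) : PMF ℕ :=
  rfold (fun k (_ : Unit) => f.map fun b => bif b then k + 1 else k) (List.replicate M ()) 0

/-- The estimate from `G * m` trials. -/
noncomputable def estK (f : PMF Bool) (G m : ℕ) : PMF ℕ := (cntK f (G * m)).map fun k => k / m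

/-- The program that updates a counter, on input `(b, (m, s))`. -/
def tickProg : Prog :=
  .cond .left
    (.cond (.comp .right (.comp .right (.comp .left .right)))
      (.cons (.comp .right (.comp .right (.comp .left .right)))
        (.comp .right (.comp .right .right)))
      (.cons (.comp .right .left) (.cons .nil (.comp .right (.comp .right .right)))))
    (.comp .right .right)

section Random

variable {O : Data → PMF Data} {q : ℕ} {α β γ : Type} [Enc α] [Enc β] [Enc γ]

theorem runs_tickProg (b : Bool) (m : ℕ) (s : ℕ × ℕ) :
    RunsTo O q tickProg (enc (b, m, s)) (enc (tick m s b)) 50 := by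
  rcases s with ⟨u, v⟩
  have r2 : ∀ y, RunsTo O q (.comp .right .right) y y.right.right 3 := fun y =>
    RunsTo.comp (Runs.right _) (Runs.right _)
  have h1 : RunsTo O q (.comp .right (.comp .right (.comp .left .right))) (enc (b, m, (u, v)))
      (enc (u - 1)) 7 := by
    have e : (enc u : Data).right = enc (u - 1) := by cases u <;> rfl
    rw [← e]
    exact RunsTo.comp (Runs.right _) (RunsTo.comp (Runs.right _)
      (RunsTo.comp (Runs.left _) (Runs.right _)))
  have h2 : RunsTo O q (.comp .right (.comp .right .right)) (enc (b, m, (u, v))) (enc v) 5 :=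
    RunsTo.comp (Runs.right _) (RunsTo.comp (Runs.right _) (Runs.right _))
  have h3 : RunsTo O q (.comp .right .left) (enc (b, m, (u, v))) (enc m) 3 :=
    RunsTo.comp (Runs.right _) (Runs.left _)
  refine (Runs.cond (T' := 40) (Runs.left _) ?_).mono (by omega)
  cases b
  · exact (RunsTo.comp (Runs.right _) (Runs.right _)).mono (by omega)
  · refine Runs.mono (T := _) (Runs.cond (T' := 20) h1 ?_) (by omega)
    rcases hu : u - 1 with _ | w
    · have := RunsTo.cons h3 (RunsTo.cons (Runs.nil _) h2)
      simp only [tick, hu]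
      exact this.mono (by omega)
    · have := RunsTo.cons h1 h2
      simp only [tick, hu]
      rw [hu] at this
      exact this.mono (by omega)

/-- The program that estimates by repeated trials `p`, on input `(G, (x, m))`. -/
def estProg (p : Prog) : Prog :=
  .comp (.comp (.cons .left (.cons .right (.cons (.comp .right .right) .nil)))
    (foldProg (.comp (.cons (.comp .left .right) (.cons .left (.comp .right .left)))
      (foldProg (.comp (.cons (.comp (.comp .left .left) p)
        (.cons (.comp .left .right) (.comp .right .left))) tickProg))))) .right

theorem runs_estProg {p : Prog} {a : α} {f : PMF Bool} {T : ℕ}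
    (hp : Runs O q p (enc a) (f.map enc) T) (G m : ℕ) (hm : 0 < m) :
    Runs O q (estProg p) (enc (G, a, m)) ((estK f G m).map enc)
      (G * (m * (T + 100) + 50) + 30) := by
  let step : ℕ × ℕ → Unit → PMF (ℕ × ℕ) := fun s _ => f.map fun b => tick m s b
  have h1 : ∀ s : ℕ × ℕ, Runs O q (foldProg (.comp (.cons (.comp (.comp .left .left) p)
        (.cons (.comp .left .right) (.comp .right .left))) tickProg))
      (.cons (enc (List.replicate m ())) (.cons (enc (a, m)) (enc s)))
      ((rfold step (List.replicate m ()) s).map enc) (m * (T + 100) + 7) := by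
    intro s
    have := runs_foldProg (O := O) (q := q) (x := enc (a, m)) (T := T + 70) (step := step)
      (p := .comp (.cons (.comp (.comp .left .left) p)
        (.cons (.comp .left .right) (.comp .right .left))) tickProg)
      (fun _ _ => True) (List.replicate m ()) ?_ s trivial
    · rw [List.length_replicate] at this
      exact this.mono (Nat.add_le_add_right (Nat.mul_le_mul_left m (by omega)) 7)
    · intro s b l' _
      refine ⟨?_, fun _ _ => trivial⟩
      have g1 : RunsTo O q (.comp .left .left) (.cons (enc (a, m)) (.cons (enc s) (enc b)))
          (enc a) 3 := RunsTo.comp (Runs.left _) (Runs.left _)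
      have g2 : RunsTo O q (.comp .left .right) (.cons (enc (a, m)) (.cons (enc s) (enc b)))
          (enc m) 3 := RunsTo.comp (Runs.left _) (Runs.right _)
      have g3 : RunsTo O q (.comp .right .left) (.cons (enc (a, m)) (.cons (enc s) (enc b)))
          (enc s) 3 := RunsTo.comp (Runs.right _) (Runs.left _)
      have g4 := Runs.cons (g1.comp hp) (g2.cons g3)
      have g5 : Runs O q (.cons (.comp (.comp .left .left) p)
          (.cons (.comp .left .right) (.comp .right .left)))
          (.cons (enc (a, m)) (.cons (enc s) (enc b)))
          ((f.map fun b => (b, m, s)).map enc) (T + 13) := by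
        simp only [PMF.pure_map] at g4
        refine Runs.mono (T := _) ?_ (?_ : 3 + T + 1 + (3 + 3 + 1) + 1 ≤ T + 13)
        · rw [PMF.bind_map] at g4
          rw [PMF.map_comp]
          exact g4
        · omega
      have g6 := g5.comp_enc (p' := tickProg) (g := fun y : Bool × ℕ × ℕ × ℕ =>
        PMF.pure (tick m s y.1)) (T' := 50) fun y hy => by
          obtain ⟨b', -, rfl⟩ := (PMF.mem_support_map_iff _ _ _).mp hy
          rw [PMF.pure_map]
          exact runs_tickProg _ _ _
      rw [PMF.bind_map] at g6
      exact Runs.mono (T := _) g6 (by omega)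
  have h2 := runs_foldProg (O := O) (q := q) (x := enc (a, m)) (T := m * (T + 100) + 17)
    (step := fun s (_ : Unit) => rfold step (List.replicate m ()) s)
    (p := .comp (.cons (.comp .left .right) (.cons .left (.comp .right .left)))
      (foldProg (.comp (.cons (.comp (.comp .left .left) p)
        (.cons (.comp .left .right) (.comp .right .left))) tickProg)))
    (fun _ _ => True) (List.replicate G ()) (fun s b l' _ => by
      refine ⟨?_, fun _ _ => trivial⟩
      have g2 : RunsTo O q (.comp .left .right) (.cons (enc (a, m)) (.cons (enc s) (enc b)))
          (enc (List.replicate m ())) 3 := by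
        have : (enc (List.replicate m ()) : Data) = enc m := by
          change Data.ofList _ = Data.ofNat _
          rw [Data.ofNat_eq, List.map_replicate]; rfl
        rw [this]
        exact RunsTo.comp (Runs.left _) (Runs.right _)
      have g3 : RunsTo O q (.comp .right .left) (.cons (enc (a, m)) (.cons (enc s) (enc b)))
          (enc s) 3 := RunsTo.comp (Runs.right _) (Runs.left _)
      exact (RunsTo.comp (g2.cons (RunsTo.cons (Runs.left _) g3)) (h1 s)).mono (by omega))
    (m, 0) trivial
  have h0 : RunsTo O q (.cons .left (.cons .right (.cons (.comp .right .right) .nil)))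
      (enc (G, a, m)) (.cons (enc (List.replicate G ())) (.cons (enc (a, m)) (enc (m, 0)))) 10 := by
    have : (enc (List.replicate G ()) : Data) = enc G := by
      change Data.ofList _ = Data.ofNat _
      rw [Data.ofNat_eq, List.map_replicate]; rfl
    rw [this]
    exact (RunsTo.cons (Runs.left _) (RunsTo.cons (Runs.right _)
      (RunsTo.cons (RunsTo.comp (Runs.right _) (Runs.right _)) (Runs.nil _)))).mono (by omega)
  have h3 := (h0.comp h2).comp_enc (p' := .right) (g := fun y : ℕ × ℕ => PMF.pure y.2) (T' := 1)
    fun y _ => by rw [PMF.pure_map]; exact Runs.right _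
  have e : (rfold (fun s (_ : Unit) => rfold step (List.replicate m ()) s)
      (List.replicate G ()) (m, 0)).bind (fun y => PMF.pure y.2) = estK f G m := by
    have h4 : ((m, 0) : ℕ × ℕ) = tickState m 0 := by simp [tickState]
    rw [rfold_nested, h4, rfold_map (step := fun k (_ : Unit) =>
      f.map fun b => bif b then k + 1 else k) (tickState m), PMF.bind_map]
    · rfl
    · intro k _
      rw [PMF.map_comp]
      simp only [step, tick_tickState hm]
      rfl
  rw [e, List.length_replicate] at h3
  refine h3.mono ?_
  have : G * (m * (T + 100) + 17 + 24) ≤ G * (m * (T + 100) + 50) :=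
    Nat.mul_le_mul_left G (by omega)
  omega

end Random

/-! ### The learner -/

/-- The experiment for the Pauli coefficient `it = (P, Q)` of a group `g`. -/
def mkExper (n : ℕ) (g it : ℕ × List ℕ) : Exper := (it.2, List.replicate n (it.1 - 1), g.1)

/-- Groups with the Pauli coefficients to estimate. -/
abbrev Plan := List ((ℕ × List ℕ) × List (ℕ × List ℕ))

/-- The estimates for one group. -/
noncomputable def rowK {n : ℕ} (U : UN n) (G m : ℕ) (g : (ℕ × List ℕ) × List (ℕ × List ℕ)) :
    PMF ((ℕ × List ℕ) × List ((ℕ × List ℕ) × ℕ)) :=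
  (mapK (fun it => (estK (bitK U (mkExper n g.1 it)) G m).map fun e => (it, e)) g.2).map
    fun r => (g.1, r)

/-- The table of all estimates. -/
noncomputable def tableK {n : ℕ} (U : UN n) (G m : ℕ) (L : Plan) : PMF Table :=
  mapK (rowK U G m) L

theorem cntK_le {f : PMF Bool} {M k : ℕ} (h : k ∈ (cntK f M).support) : k ≤ M := by
  suffices h : ∀ M k₀ k, k ∈ (rfold (fun k (_ : Unit) => f.map fun b => bif b then k + 1 else k)
      (List.replicate M ()) k₀).support → k ≤ k₀ + M by simpa using h M 0 k ‹_›
  intro M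
  induction M with
  | zero =>
    intro k₀ k h
    rw [List.replicate_zero, rfold, PMF.support_pure, Set.mem_singleton_iff] at h
    omega
  | succ M ih =>
    intro k₀ k h
    rw [List.replicate_succ, rfold] at h
    obtain ⟨k₁, h₁, h⟩ := (PMF.mem_support_bind_iff _ _ _).mp h
    obtain ⟨b, -, rfl⟩ := (PMF.mem_support_map_iff _ _ _).mp h₁
    have := ih _ _ h
    cases b <;> simp only [cond_true, cond_false] at this <;> omega

theorem estK_le {f : PMF Bool} {G m k : ℕ} (h : k ∈ (estK f G m).support) : k ≤ G := by
  obtain ⟨k', h', rfl⟩ := (PMF.mem_support_map_iff _ _ _).mp h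
  have := cntK_le h'
  rcases Nat.eq_zero_or_pos m with rfl | hm
  · simp
  · exact Nat.div_le_of_le_mul (by rw [mul_comm]; exact this)

theorem sz_forall₂ {β γ : Type} [Enc β] [Enc γ] {l : List β} {r : List γ} {B : ℕ}
    (h : List.Forall₂ (fun b c => sz c ≤ (sz b + 1) * B) l r) : sz r ≤ sz l * (B + 1) := by
  induction h with
  | nil => simp [sz_nil]
  | cons h _ ih =>
    rw [sz_cons, sz_cons]
    rename_i b c l r _
    have : (sz b + sz l + 1) * (B + 1) = (sz b + 1) * B + sz l * (B + 1) + sz b + 1 := by ring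
    omega

theorem sz_table {n : ℕ} {U : UN n} {G m : ℕ} {L : Plan} {T : Table}
    (h : T ∈ (tableK U G m L).support) : sz T ≤ sz L * (G + 4) := by
  refine sz_forall₂ (B := G + 3) ((mapK_support h).imp ?_)
  intro g r hr
  obtain ⟨r', hr', rfl⟩ := (PMF.mem_support_map_iff _ _ _).mp hr
  have h1 : sz r' ≤ sz g.2 * (G + 2) := by
    refine sz_forall₂ (B := G + 1) ((mapK_support hr').imp ?_)
    intro it c hc
    obtain ⟨e, he, rfl⟩ := (PMF.mem_support_map_iff _ _ _).mp hc
    have h2 := estK_le he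
    rw [sz_pair, sz_nat]
    nlinarith [Nat.zero_le (sz it * G)]
  rw [sz_pair, sz_prod g]
  nlinarith [Nat.zero_le (sz g.1 * G)]

section Learner

theorem FP.mkExper : FP fun x : ℕ × (ℕ × List ℕ) × ℕ × List ℕ => mkExper x.1 x.2.1 x.2.2 := by
  unfold QACLearn.mkExper
  fun_prop

theorem exists_tableProg : ∃ (p : Prog) (K : ℕ), ∀ (n : ℕ) (U : UN n) (G m : ℕ) (L : Plan) (B : ℕ),
    0 < m → n ≤ B → G ≤ B → sz L ≤ B →
    Runs (oracle U) (n + 1) p (enc (L.reverse, (n, G, m), ([] : Table)))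
      ((tableK U G m L).map enc) ((B + 2) ^ K * (m + 1)) := by
  obtain ⟨pb, kb, hb⟩ := exists_bitProg
  obtain ⟨pE, kE, hE⟩ := FP.mkExper.runs
  obtain ⟨kS, hS⟩ := FP.mkExper.pb
  obtain ⟨pr, kr, hr⟩ := (by fun_prop : FP fun l : List (ℕ × List ℕ) => l.reverse).runs
  let r1 : Prog := .cons .right (.comp (.cons (.comp (.comp .left .left) (.comp .right .left))
    (.cons (.comp (.cons (.comp .left (.comp .left .left)) (.cons (.comp .left .right) .right)) pE)
      (.comp (.comp .left .left) (.comp .right .right)))) (estProg pb))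
  let r2 : Prog := .cons (.comp .right .left) (.comp (.cons (.comp (.comp .right .right) pr)
    (.cons (.cons .left (.comp .right .left)) .nil)) (mapProg r1))
  obtain ⟨X, heX⟩ : ∃ X : ℕ → ℕ, ∀ B, X B = ((2 * B + 4) ^ kS + 2) ^ kb + B + 1 := ⟨_, fun _ => rfl⟩
  obtain ⟨T1, heT1⟩ : ∃ T1 : ℕ → ℕ, ∀ B, T1 B = B * (X B + 150) + (2 * B + 4) ^ kE + 100 := ⟨_, fun _ => rfl⟩
  obtain ⟨T2, heT2⟩ : ∃ T2 : ℕ → ℕ, ∀ B, T2 B = B * (T1 B + 40) + (B + 2) ^ kr + 100 := ⟨_, fun _ => rfl⟩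
  obtain ⟨K, hK⟩ : PB fun B : ℕ => B * (T2 B + 40) + 7 := by
    have hB : PB fun B : ℕ => B := PB.sz.mono fun B => (sz_nat B).ge
    have h2 : PB fun B : ℕ => 2 * B + 4 := ((PB.const 2).mul hB).add (PB.const 4)
    have hX : PB X :=
      ((((h2.pow kS).add (PB.const 2)).pow kb).add hB |>.add (PB.const 1)).mono fun B => (heX B).le
    have h1 : PB T1 := (((hB.mul (hX.add (PB.const 150))).add (h2.pow kE)).add
      (PB.const 100)).mono fun B => (heT1 B).le
    have h3 : PB T2 := (((hB.mul (h1.add (PB.const 40))).add ((hB.add (PB.const 2)).pow kr)).add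
      (PB.const 100)).mono fun B => (heT2 B).le
    exact (hB.mul (h3.add (PB.const 40))).add (PB.const 7)
  refine ⟨mapProg r2, K, fun n U G m L B hm hn hG hL => ?_⟩
  have key1 : ∀ g ∈ L, ∀ it ∈ g.2, Runs (oracle U) (n + 1) r1 (enc (((n, G, m), g.1), it))
      (((estK (bitK U (mkExper n g.1 it)) G m).map fun e => (it, e)).map enc)
      (T1 B * (m + 1)) := by
    intro g hg it hit
    have hsz : sz (n, g.1, it) + 2 ≤ 2 * B + 4 := by
      have h1 := sz_mem hg
      have h2 := sz_mem hit
      rw [sz_prod g] at h1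
      rw [sz_pair, sz_pair, sz_nat]
      omega
    have g1 : RunsTo (oracle U) (n + 1) (.comp (.comp .left .left) (.comp .right .left))
        (enc (((n, G, m), g.1), it)) (enc G) 7 :=
      RunsTo.comp (RunsTo.comp (Runs.left _) (Runs.left _))
        (RunsTo.comp (Runs.right _) (Runs.left _))
    have g2 : RunsTo (oracle U) (n + 1) (.comp (.comp .left .left) (.comp .right .right))
        (enc (((n, G, m), g.1), it)) (enc m) 7 :=
      RunsTo.comp (RunsTo.comp (Runs.left _) (Runs.left _))
        (RunsTo.comp (Runs.right _) (Runs.right _))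
    have g3 : RunsTo (oracle U) (n + 1) (.cons (.comp .left (.comp .left .left))
        (.cons (.comp .left .right) .right)) (enc (((n, G, m), g.1), it)) (enc (n, g.1, it)) 11 :=
      RunsTo.cons (RunsTo.comp (Runs.left _) (RunsTo.comp (Runs.left _) (Runs.left _)))
        (RunsTo.cons (RunsTo.comp (Runs.left _) (Runs.right _)) (Runs.right _))
    have g4 := RunsTo.cons g1 (RunsTo.cons (RunsTo.comp g3 (hE (oracle U) (n + 1) (n, g.1, it))) g2)
    have g5 := runs_estProg (hb (n + 1) n U (mkExper n g.1 it) (by simp [mkExper])) G m hm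
    have g6 := Runs.cons (Runs.right (enc (((n, G, m), g.1), it))) (g4.comp g5)
    rw [PMF.pure_bind, PMF.map_comp] at g6
    rw [PMF.map_comp]
    refine Runs.mono (T := _) g6 ?_
    have e1 : (sz (n, g.1, it) + 2) ^ kE ≤ (2 * B + 4) ^ kE := Nat.pow_le_pow_left hsz _
    have e2 : sz (mkExper n g.1 it) ≤ (2 * B + 4) ^ kS :=
      (hS (n, g.1, it)).trans (Nat.pow_le_pow_left hsz _)
    have e3 : (sz (mkExper n g.1 it) + 2) ^ kb + (n + 1) ≤ X B := by
      have : (sz (mkExper n g.1 it) + 2) ^ kb ≤ ((2 * B + 4) ^ kS + 2) ^ kb :=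
        Nat.pow_le_pow_left (by omega) _
      simp only [heX]
      omega
    have e4 : G * (m * ((sz (mkExper n g.1 it) + 2) ^ kb + (n + 1) + 100) + 50) ≤
        B * (m * (X B + 100) + 50) := by gcongr
    have e5 : T1 B * (m + 1) = B * (m * (X B + 100) + 50) + B * (50 * m + (X B + 100)) +
        (2 * B + 4) ^ kE * m + 100 * m + (2 * B + 4) ^ kE + 100 := by simp only [heT1]; ring
    rw [e5]
    omega
  have key2 : ∀ g ∈ L, Runs (oracle U) (n + 1) r2 (enc ((n, G, m), g))
      ((rowK U G m g).map enc) (T2 B * (m + 1)) := by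
    intro g hg
    have hg1 := sz_mem hg
    have g1 : RunsTo (oracle U) (n + 1) (.comp (.comp .right .right) pr)
        (enc ((n, G, m), g)) (enc g.2.reverse) (3 + (B + 2) ^ kr + 1) :=
      RunsTo.comp (RunsTo.comp (Runs.right _) (Runs.right _))
        ((hr (oracle U) (n + 1) g.2).mono (Nat.pow_le_pow_left (by
          rw [sz_prod] at hg1; omega) _))
    have g2 := RunsTo.cons g1 (RunsTo.cons (RunsTo.cons (Runs.left _)
      (RunsTo.comp (Runs.right _) (Runs.left _))) (Runs.nil _))
    have g3 := runs_mapProg g.2 (key1 g hg)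
    have g4 := Runs.cons (RunsTo.comp (Runs.right _) (Runs.left _)) (g2.comp g3)
    rw [PMF.pure_bind, PMF.map_comp] at g4
    rw [rowK, PMF.map_comp]
    refine Runs.mono (T := _) g4 ?_
    have e1 : g.2.length * (T1 B * (m + 1) + 40) ≤ B * (T1 B * (m + 1) + 40) := by
      have := length_le_sz g.2
      rw [sz_prod] at hg1
      gcongr
      omega
    have e2 : T2 B * (m + 1) = B * (T1 B * (m + 1) + 40) + 40 * (B * m) +
        (B + 2) ^ kr * m + 100 * m + (B + 2) ^ kr + 100 := by simp only [heT2]; ring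
    rw [e2]
    omega
  refine (runs_mapProg L key2).mono ?_
  have e1 : L.length * (T2 B * (m + 1) + 40) ≤ B * (T2 B * (m + 1) + 40) := by
    have := length_le_sz L
    gcongr
    omega
  have e2 : (B * (T2 B + 40) + 7) * (m + 1) ≤ (B + 2) ^ K * (m + 1) := by
    gcongr
    have := hK B
    rwa [sz_nat] at this
  have e3 : (B * (T2 B + 40) + 7) * (m + 1) = B * (T2 B * (m + 1) + 40) + 40 * (B * m) + 7 * m + 7 := by
    ring
  omega

/-- The fuel, quasi-polynomial in `n`. -/
def fuel (c d n : ℕ) : ℕ := 2 ^ (c * lg n ^ (d + 1))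

theorem lg_pos (n : ℕ) : 0 < lg n := Nat.log_pos (by norm_num) (by omega)

theorem add_two_lt (n : ℕ) : n + 2 < 2 ^ (lg n + 1) := Nat.lt_pow_succ_log_self (by norm_num) _

theorem le_fuel {c d : ℕ} (hc : 2 ≤ c) (n : ℕ) : n + 2 ≤ fuel c d n := by
  refine (add_two_lt n).le.trans (Nat.pow_le_pow_right (by norm_num) ?_)
  have := lg_pos n
  have : lg n ≤ lg n ^ (d + 1) := Nat.le_self_pow (by omega) _
  nlinarith

theorem exists_fuelProg (c d : ℕ) (hc : 2 ≤ c) : ∃ (p : Prog) (K : ℕ), ∀ O q n,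
    RunsTo O q p (enc n) (enc (fuel c d n)) ((fuel c d n + 2) ^ K) := by
  obtain ⟨pe, ke, he⟩ := (by fun_prop : FP fun n : ℕ => List.replicate (c * lg n ^ (d + 1)) ()).runs
  obtain ⟨p2, k2, h2⟩ := (by fun_prop : FP fun x : Unit × ℕ × Unit => x.2.1 + x.2.1).runs
  obtain ⟨K, hK⟩ : PB fun N : ℕ => (N + 2) ^ ke + (N * ((N + 4) ^ k2 + 24) + 7) + 20 := by
    have hB : PB fun B : ℕ => B := PB.sz.mono fun B => (sz_nat B).ge
    exact ((((hB.add (PB.const 2)).pow ke).add ((hB.mul (((hB.add (PB.const 4)).pow k2).add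
      (PB.const 24))).add (PB.const 7)))).add (PB.const 20)
  refine ⟨.comp (.cons pe (.cons .nil (.cons .nil .nil))) (foldProg p2), K, fun O q n => ?_⟩
  set e := c * lg n ^ (d + 1)
  have e1 : fuel c d n = 2 ^ e := rfl
  have h1 := RunsTo.cons (he O q n) (RunsTo.cons (Runs.nil _) (RunsTo.cons (Runs.nil _) (Runs.nil _)))
  have hn := le_fuel (d := d) hc n
  have hexp : e ≤ 2 ^ e := Nat.lt_two_pow_self.le
  have h3 := runs_foldProg (O := O) (q := q) (x := .nil) (T := (2 ^ e + 4) ^ k2)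
    (step := fun (s : ℕ) (_ : Unit) => PMF.pure (s + s)) (p := p2)
    (fun rem s => s * 2 ^ rem.length = 2 ^ e) (List.replicate e ()) (fun s b l' hs => by
      rw [List.length_cons, pow_succ] at hs
      refine ⟨?_, fun s' hs' => ?_⟩
      · rw [PMF.pure_map]
        refine (h2 O q ((), s, ())).mono (Nat.pow_le_pow_left ?_ _)
        have h4 : 0 < 2 ^ l'.length := by positivity
        have h5 : sz ((), s, ()) = 0 + (s + 0 + 1) + 1 := by
          rw [sz_pair, sz_pair, sz_nat]; rfl
        rw [h5]
        nlinarith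
      · rw [PMF.support_pure, Set.mem_singleton_iff] at hs'
        rw [hs', ← hs]; ring) 1 (by simp)
  rw [rfold_pure, PMF.pure_map] at h3
  have h4 : ∀ j s : ℕ, (List.replicate j ()).foldl (fun (s : ℕ) (_ : Unit) => s + s) s =
      s * 2 ^ j := by
    intro j
    induction j with
    | zero => simp
    | succ j ih => intro s; rw [List.replicate_succ, List.foldl_cons, ih]; ring
  rw [h4, one_mul, List.length_replicate] at h3
  refine Runs.mono (T := _) (h1.comp h3) ?_
  have := hK (2 ^ e)
  have h5 : (sz n + 2) ^ ke ≤ (2 ^ e + 2) ^ ke := Nat.pow_le_pow_left (by rw [sz_nat]; omega) _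
  have h6 : e * ((2 ^ e + 4) ^ k2 + 24) ≤ 2 ^ e * ((2 ^ e + 4) ^ k2 + 24) :=
    Nat.mul_le_mul_right _ hexp
  rw [sz_nat] at this
  dsimp only at this
  rw [e1]
  omega

theorem exists_learner {β : Type} [Enc β] (c d : ℕ) (hc : 2 ≤ c) {L : ℕ → ℕ → Plan}
    {F : ℕ → ℕ → Table → β} (hL : FP fun x : ℕ × ℕ => L x.1 x.2)
    (hF : FP fun x : ℕ × ℕ × Table => F x.1 x.2.1 x.2.2) :
    ∃ (p : Prog) (K : ℕ), ∀ (n : ℕ) (U : UN n) (t : ℕ),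
      Runs (oracle U) (n + 1) p (.cons (.ofNat n) (.ofNat t))
        (((tableK U (fuel c d n ^ 2) (t + fuel c d n) (L n (fuel c d n))).map
          (F n (fuel c d n))).map enc) (2 ^ (K * lg n ^ K) * (t + 1)) := by
  obtain ⟨pf, kf, hf⟩ := exists_fuelProg c d hc
  obtain ⟨pt, kt, ht⟩ := exists_tableProg
  obtain ⟨pL, kL, hpL⟩ := (hL.reverse.pair (FP.npow FP.snd' 2)).runs
  obtain ⟨kS, hkS⟩ := hL.pb
  obtain ⟨pF, kF, hpF⟩ := hF.runs
  let pm : Prog := .comp (.cons .right (.cons .nil (.comp .left .right)))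
    (foldProg (.cons .nil (.comp .right .left)))
  let p1 : Prog := .cons .id (.comp .left pf)
  let p2 : Prog := .cons .id pm
  let pn : Prog := .comp .left (.comp .left .left)
  let p3 : Prog := .comp (.cons .id (.comp (.cons pn (.comp .left .right)) pL))
    (.comp (.cons (.comp .right .left)
      (.cons (.cons (.comp .left pn) (.cons (.comp .right .right) (.comp .left .right))) .nil)) pt)
  let p4 : Prog := .comp (.cons (.comp .left pn) (.cons (.comp .left (.comp .left .right)) .right)) pF
  obtain ⟨BB, heBB⟩ : ∃ BB : ℕ → ℕ, ∀ N, BB N = (2 * N + 3) ^ kS + N ^ 2 + N := ⟨_, fun _ => rfl⟩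
  obtain ⟨SS, heSS⟩ : ∃ SS : ℕ → ℕ, ∀ N, SS N = BB N * (N ^ 2 + 4) := ⟨_, fun _ => rfl⟩
  obtain ⟨K0, hK0⟩ : PB fun N : ℕ => (N + 2) ^ kf + N * 60 + (2 * N + 3) ^ kL +
      (BB N + 2) ^ kt * (N + 1) + (2 * N + 3 + SS N) ^ kF + 200 := by
    have hB : PB fun B : ℕ => B := PB.sz.mono fun B => (sz_nat B).ge
    have h2 : PB fun B : ℕ => 2 * B + 3 := ((PB.const 2).mul hB).add (PB.const 3)
    have hBB : PB BB := (((h2.pow kS).add (hB.pow 2)).add hB).mono fun N => (heBB N).le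
    have hSS : PB SS := (hBB.mul ((hB.pow 2).add (PB.const 4))).mono fun N => (heSS N).le
    exact ((((((hB.add (PB.const 2)).pow kf).add (hB.mul (PB.const 60))).add (h2.pow kL)).add
      (((hBB.add (PB.const 2)).pow kt).mul (hB.add (PB.const 1)))).add ((h2.add hSS).pow kF)).add
        (PB.const 200)
  refine ⟨.comp (.comp (.comp p1 p2) (.cons .id p3)) p4, (c + 2) * K0 + (d + 1), fun n U t => ?_⟩
  set N := fuel c d n with hN
  have hn : n + 2 ≤ N := le_fuel hc n
  set m := t + N with hm
  have s1 : RunsTo (oracle U) (n + 1) p1 (enc (n, t)) (enc ((n, t), N)) ((N + 2) ^ kf + 4) :=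
    (RunsTo.cons (Runs.id _) (RunsTo.comp (Runs.left _) (hN ▸ hf _ _ n))).mono (by omega)
  have s2 : RunsTo (oracle U) (n + 1) p2 (enc ((n, t), N)) (enc (((n, t), N), m)) (N * 30 + 20) := by
    have g1 : RunsTo (oracle U) (n + 1) (.cons .right (.cons .nil (.comp .left .right)))
        (enc ((n, t), N)) (.cons (enc (List.replicate N ())) (.cons .nil (enc t))) 8 := by
      have : (enc (List.replicate N ()) : Data) = enc N := by
        change Data.ofList _ = Data.ofNat _
        rw [Data.ofNat_eq, List.map_replicate]; rfl
      rw [this]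
      exact (RunsTo.cons (Runs.right _) (RunsTo.cons (Runs.nil _)
        (RunsTo.comp (Runs.left _) (Runs.right _)))).mono (by omega)
    have g2 := runs_foldProg (O := oracle U) (q := n + 1) (x := .nil) (T := 5)
      (step := fun (s : ℕ) (_ : Unit) => PMF.pure (s + 1)) (p := .cons .nil (.comp .right .left))
      (fun _ _ => True) (List.replicate N ()) (fun s b l' hs => by
        refine ⟨?_, fun _ _ => trivial⟩
        rw [PMF.pure_map]
        exact RunsTo.cons (Runs.nil _) (RunsTo.comp (Runs.right _) (Runs.left _))) t trivial
    have g3 : ∀ j s : ℕ, (List.replicate j ()).foldl (fun (s : ℕ) (_ : Unit) => s + 1) s =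
        s + j := by
      intro j
      induction j with
      | zero => simp
      | succ j ih => intro s; rw [List.replicate_succ, List.foldl_cons, ih]; omega
    rw [rfold_pure, PMF.pure_map, g3, List.length_replicate] at g2
    exact (RunsTo.cons (Runs.id _) (g1.comp g2)).mono (by omega)
  have hsz : sz (n, N) + 2 ≤ 2 * N + 3 := by rw [sz_pair, sz_nat, sz_nat]; omega
  have hsL : sz (L n N) ≤ (2 * N + 3) ^ kS := (hkS (n, N)).trans (Nat.pow_le_pow_left hsz _)
  have s3 : Runs (oracle U) (n + 1) p3 (enc (((n, t), N), m))
      ((tableK U (N ^ 2) m (L n N)).map enc)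
      ((2 * N + 3) ^ kL + (BB N + 2) ^ kt * (m + 1) + 80) := by
    have hpn : ∀ x : (ℕ × ℕ) × ℕ, RunsTo (oracle U) (n + 1) pn (enc (x, m)) (enc x.1.1) 5 :=
      fun x => RunsTo.comp (Runs.left _) (RunsTo.comp (Runs.left _) (Runs.left _))
    have g1 := RunsTo.cons (Runs.id _) (RunsTo.comp (RunsTo.cons (hpn ((n, t), N))
      (RunsTo.comp (Runs.left _) (Runs.right _))) ((hpL (oracle U) (n + 1) (n, N)).mono
        (Nat.pow_le_pow_left hsz _)))
    have g2 : RunsTo (oracle U) (n + 1) (.cons (.comp .right .left)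
      (.cons (.cons (.comp .left pn) (.cons (.comp .right .right) (.comp .left .right))) .nil))
      (enc ((((n, t), N), m), (L n N).reverse, N ^ 2))
      (enc ((L n N).reverse, (n, N ^ 2, m), ([] : Table))) 30 :=
      (RunsTo.cons (RunsTo.comp (Runs.right _) (Runs.left _)) (RunsTo.cons (RunsTo.cons
        (RunsTo.comp (Runs.left _) (hpn ((n, t), N))) (RunsTo.cons
          (RunsTo.comp (Runs.right _) (Runs.right _)) (RunsTo.comp (Runs.left _) (Runs.right _))))
            (Runs.nil _))).mono (by omega)
    have g3 := ht n U (N ^ 2) m (L n N) (BB N) (by omega) (by simp only [heBB]; omega)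
      (by simp only [heBB]; omega) (by simp only [heBB]; omega)
    exact Runs.mono (T := _) (RunsTo.comp g1 (g2.comp g3)) (by omega)
  have s4 := (RunsTo.comp (RunsTo.comp s1 s2) s3.keep).comp_enc (p' := p4)
    (g := fun x => PMF.pure (F n N x.2)) (T' := 30 + (2 * N + 3 + SS N) ^ kF) fun x hx => by
      obtain ⟨T, hT, rfl⟩ := (PMF.mem_support_map_iff _ _ _).mp hx
      rw [PMF.pure_map]
      have g1 : RunsTo (oracle U) (n + 1) (.cons (.comp .left pn)
          (.cons (.comp .left (.comp .left .right)) .right)) (enc ((((n, t), N), m), T))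
          (enc (n, N, T)) 20 :=
        (RunsTo.cons (RunsTo.comp (Runs.left _) (RunsTo.comp (Runs.left _)
          (RunsTo.comp (Runs.left _) (Runs.left _)))) (RunsTo.cons (RunsTo.comp (Runs.left _)
            (RunsTo.comp (Runs.left _) (Runs.right _))) (Runs.right _))).mono (by omega)
      have g2 : sz (n, N, T) + 2 ≤ 2 * N + 3 + SS N := by
        have h1 := sz_table hT
        have h2 : sz (L n N) * (N ^ 2 + 4) ≤ SS N :=
          by
          rw [heSS]; exact Nat.mul_le_mul_right _ (by simp only [heBB]; omega)
        rw [sz_pair, sz_pair, sz_nat, sz_nat]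
        omega
      exact (RunsTo.comp g1 ((hpF (oracle U) (n + 1) (n, N, T)).mono
        (Nat.pow_le_pow_left g2 _))).mono (by omega)
  rw [PMF.bind_map] at s4
  refine Runs.mono (T := _) s4 ?_
  have hK := hK0 N
  rw [sz_nat] at hK
  dsimp only at hK
  have hpow : (N + 2) ^ K0 ≤ 2 ^ (((c + 2) * K0 + (d + 1)) * lg n ^ ((c + 2) * K0 + (d + 1))) := by
    have h1 : N + 2 ≤ 2 ^ ((c + 2) * lg n ^ (d + 1)) := by
      have h2 : 1 ≤ lg n ^ (d + 1) := Nat.one_le_pow _ _ (lg_pos n)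
      have h3 : 2 ^ (c * lg n ^ (d + 1)) * 2 ^ 2 ≤ 2 ^ ((c + 2) * lg n ^ (d + 1)) := by
        rw [← pow_add]; exact Nat.pow_le_pow_right (by norm_num) (by nlinarith)
      have h4 : N = 2 ^ (c * lg n ^ (d + 1)) := rfl
      omega
    refine (Nat.pow_le_pow_left h1 K0).trans ?_
    rw [← pow_mul]
    refine Nat.pow_le_pow_right (by norm_num) ?_
    have h5 : lg n ^ (d + 1) ≤ lg n ^ ((c + 2) * K0 + (d + 1)) :=
      Nat.pow_le_pow_right (lg_pos n) (by omega)
    calc (c + 2) * lg n ^ (d + 1) * K0 = ((c + 2) * K0) * lg n ^ (d + 1) := by ring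
      _ ≤ _ := Nat.mul_le_mul (by omega) h5
  refine le_trans ?_ (Nat.mul_le_mul_right (t + 1) (hK.trans hpow))
  have e1 : (BB N + 2) ^ kt * (m + 1) ≤ (BB N + 2) ^ kt * (N + 1) * (t + 1) := by
    rw [mul_assoc]
    refine Nat.mul_le_mul_left _ ?_
    rw [hm]
    nlinarith
  nlinarith [Nat.zero_le ((N + 2) ^ kf * t), Nat.zero_le (N * t), Nat.zero_le ((2 * N + 3) ^ kL * t),
    Nat.zero_le ((2 * N + 3 + SS N) ^ kF * t)]

end Learner

/-! ### Failure probabilities -/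

/-- The probability that `G` does not hold is at most `ε`. -/
def Fails {α : Type*} (μ : PMF α) (G : α → Prop) (ε : ℝ≥0∞) : Prop :=
  μ.toOuterMeasure {x | ¬ G x} ≤ ε

section Fails

variable {α β : Type*}

theorem Fails.pure {G : α → Prop} {a : α} (h : G a) : Fails (PMF.pure a) G 0 := by
  rw [Fails, PMF.toOuterMeasure_pure_apply, if_neg (by simpa using h)]

theorem Fails.mono {μ : PMF α} {G H : α → Prop} {ε δ : ℝ≥0∞} (h : Fails μ G ε)
    (hG : ∀ a, G a → H a) (hε : ε ≤ δ) : Fails μ H δ :=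
  (MeasureTheory.measure_mono (fun a (ha : ¬ H a) => mt (hG a) ha)).trans (h.trans hε)

theorem Fails.map {μ : PMF α} {f : α → β} {G : β → Prop} {ε : ℝ≥0∞}
    (h : Fails μ (fun a => G (f a)) ε) : Fails (μ.map f) G ε := by
  rw [Fails, PMF.toOuterMeasure_map_apply]
  exact h

theorem Fails.bind {μ : PMF α} {f : α → PMF β} {G : α → Prop} {H : β → Prop} {ε δ : ℝ≥0∞}
    (h : Fails μ G ε) (hf : ∀ a, G a → Fails (f a) H δ) : Fails (μ.bind f) H (ε + δ) := by
  classical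
  rw [Fails, PMF.toOuterMeasure_bind_apply]
  calc ∑' a, μ a * (f a).toOuterMeasure {x | ¬ H x}
      ≤ ∑' a, ({a | ¬ G a}.indicator μ a + μ a * δ) := by
        refine ENNReal.tsum_le_tsum fun a => ?_
        by_cases ha : G a
        · exact (mul_le_mul_right (hf a ha) _).trans (le_add_left le_rfl)
        · rw [Set.indicator_of_mem (by exact ha)]
          refine le_add_right ?_
          calc _ ≤ μ a * 1 := mul_le_mul_right (by
                have := (f a).toOuterMeasure.mono (Set.subset_univ {x | ¬ H x})
                exact this.trans
                  ((PMF.toOuterMeasure_apply_eq_one_iff _ _).mpr (Set.subset_univ _)).le) _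
            _ = μ a := mul_one _
    _ = μ.toOuterMeasure {a | ¬ G a} + δ := by
        rw [ENNReal.tsum_add, ENNReal.tsum_mul_right, PMF.tsum_coe, one_mul,
          PMF.toOuterMeasure_apply]
    _ ≤ ε + δ := add_le_add_left h _

theorem Fails.mapK {β γ : Type} {g : β → PMF γ} {R : β → γ → Prop} {l : List β} {ε : β → ℝ≥0∞}
    (h : ∀ b ∈ l, Fails (g b) (R b) (ε b)) :
    Fails (mapK g l) (List.Forall₂ R l) (l.map ε).sum := by
  induction l with
  | nil => exact Fails.pure List.Forall₂.nil
  | cons b l ih =>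
    rw [QACLearn.mapK, List.map_cons, List.sum_cons, add_comm]
    exact (ih fun b hb => h b (by simp [hb])).bind fun r hr =>
      Fails.map ((h b (by simp)).mono (fun c hc => List.Forall₂.cons hc hr) le_rfl)

end Fails

/-! ### A tail bound -/

theorem bool_sum (f : PMF Bool) : (f false).toReal = 1 - (f true).toReal := by
  have h := f.tsum_coe
  rw [tsum_fintype, Fintype.sum_bool] at h
  have := congrArg ENNReal.toReal h
  rw [ENNReal.toReal_add (f.apply_ne_top _) (f.apply_ne_top _), ENNReal.toReal_one] at this
  linarith

theorem one_step_mgf (p x : ℝ) (hp : 0 ≤ p) (hp1 : p ≤ 1) (hx : |x| ≤ 1) :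
    p * Real.exp x + (1 - p) ≤ Real.exp (p * x + x ^ 2) := by
  have h1 := (abs_le.mp (Real.abs_exp_sub_one_sub_id_le hx)).2
  have h2 := Real.add_one_le_exp (p * x + x ^ 2)
  nlinarith [sq_nonneg x]

theorem rfold_tail (f : PMF Bool) (x a : ℝ) (hx : |x| ≤ 1) (M k₀ : ℕ) :
    (rfold (fun k (_ : Unit) => f.map fun b => bif b then k + 1 else k)
      (List.replicate M ()) k₀).toOuterMeasure {k | x * a ≤ x * k} ≤
      ENNReal.ofReal (Real.exp (x * k₀ - x * a + M * ((f true).toReal * x + x ^ 2))) := by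
  induction M generalizing k₀ with
  | zero =>
    rw [List.replicate_zero, rfold, PMF.toOuterMeasure_pure_apply]
    split_ifs with h
    · rw [← ENNReal.ofReal_one]
      refine ENNReal.ofReal_le_ofReal (Real.one_le_exp ?_)
      simp only [Set.mem_ofPred_eq] at h
      simp only [Nat.cast_zero]
      linarith
    · exact zero_le
  | succ M ih =>
    set p := (f true).toReal
    have hp : 0 ≤ p := ENNReal.toReal_nonneg
    have hp1 : p ≤ 1 := ENNReal.toReal_le_of_le_ofReal zero_le_one (by simpa using f.coe_le_one true)
    rw [List.replicate_succ, rfold, PMF.bind_map, PMF.toOuterMeasure_bind_apply, tsum_fintype,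
      Fintype.sum_bool]
    simp only [Function.comp_apply, cond_true, cond_false]
    calc _ ≤ f true * ENNReal.ofReal (Real.exp (x * (k₀ + 1 : ℕ) - x * a + M * (p * x + x ^ 2))) +
          f false * ENNReal.ofReal (Real.exp (x * k₀ - x * a + M * (p * x + x ^ 2))) :=
          add_le_add (mul_le_mul_right (ih _) _) (mul_le_mul_right (ih _) _)
      _ = ENNReal.ofReal ((p * Real.exp x + (1 - p)) *
            Real.exp (x * k₀ - x * a + M * (p * x + x ^ 2))) := by
          rw [← ENNReal.ofReal_toReal (f.apply_ne_top true),
            ← ENNReal.ofReal_toReal (f.apply_ne_top false), bool_sum,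
            ← ENNReal.ofReal_mul hp, ← ENNReal.ofReal_mul (by linarith),
            ← ENNReal.ofReal_add (by positivity) (mul_nonneg (by linarith) (Real.exp_pos _).le)]
          congr 1
          have : x * (k₀ + 1 : ℕ) - x * a + M * (p * x + x ^ 2) =
              x + (x * k₀ - x * a + M * (p * x + x ^ 2)) := by push_cast; ring
          rw [this, Real.exp_add]
          ring
      _ ≤ _ := by
          refine ENNReal.ofReal_le_ofReal ?_
          refine (mul_le_mul_of_nonneg_right (one_step_mgf p x hp hp1 hx)
            (Real.exp_pos _).le).trans_eq ?_
          rw [← Real.exp_add]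
          congr 1
          push_cast
          ring

theorem cntK_fails (f : PMF Bool) (M : ℕ) (δ : ℝ) (h0 : 0 < δ) (h1 : δ ≤ 2) :
    Fails (cntK f M) (fun k => |(k : ℝ) - M * (f true).toReal| ≤ M * δ)
      (2 * ENNReal.ofReal (Real.exp (-(M * δ ^ 2 / 4)))) := by
  set p := (f true).toReal
  have hx : |δ / 2| ≤ 1 := by rw [abs_of_pos (by positivity)]; linarith
  have u := rfold_tail f (δ / 2) (M * p + M * δ) hx M 0
  have l := rfold_tail f (-(δ / 2)) (M * p - M * δ) (by rwa [abs_neg]) M 0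
  have e1 : δ / 2 * (0 : ℕ) - δ / 2 * (M * p + M * δ) + M * (p * (δ / 2) + (δ / 2) ^ 2) =
      -(M * δ ^ 2 / 4) := by push_cast; ring
  have e2 : -(δ / 2) * (0 : ℕ) - -(δ / 2) * (M * p - M * δ) +
      M * (p * -(δ / 2) + (-(δ / 2)) ^ 2) = -(M * δ ^ 2 / 4) := by push_cast; ring
  rw [e1] at u
  rw [e2] at l
  rw [two_mul]
  refine le_trans (MeasureTheory.measure_mono ?_) ((MeasureTheory.measure_union_le _ _).trans
    (add_le_add u l))
  intro k hk
  simp only [Set.mem_ofPred_eq, not_le] at hk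
  simp only [Set.mem_union, Set.mem_ofPred_eq]
  rcases lt_abs.mp hk with h | h
  · left
    exact mul_le_mul_of_nonneg_left (by linarith) (by positivity)
  · right
    nlinarith

/-- The estimate `e` is good for the bit `f`. -/
def GoodEst (f : PMF Bool) (N e : ℕ) : Prop :=
  |2 * (e : ℝ) / (N : ℝ) ^ 2 - 1 - (2 * (f true).toReal - 1)| ≤ 10 / (N : ℝ)

theorem estK_fails (f : PMF Bool) (N t : ℕ) (hN : 2 ≤ N) :
    Fails (estK f (N ^ 2) (t + N)) (GoodEst f N) (2 * (2⁻¹ : ℝ≥0∞) ^ (4 * (t + N))) := by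
  have hN' : (2 : ℝ) ≤ N := by exact_mod_cast hN
  refine Fails.map ((cntK_fails f (N ^ 2 * (t + N)) (4 / N) (by positivity) ?_).mono ?_ ?_)
  · rw [div_le_iff₀ (by positivity)]; linarith
  · intro k hk
    unfold GoodEst
    have hm : (0 : ℝ) < t + N := by positivity
    have h1 : ((k / (t + N) : ℕ) : ℝ) * (t + N) ≤ k := by
      have := Nat.div_mul_le_self k (t + N)
      exact_mod_cast this
    have h2 : (k : ℝ) < (((k / (t + N) : ℕ) : ℝ) + 1) * (t + N) := by
      have := Nat.lt_div_mul_add (a := k) (b := t + N) (by omega)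
      have h3 : ((k : ℕ) : ℝ) < ((k / (t + N) * (t + N) + (t + N) : ℕ) : ℝ) := by exact_mod_cast this
      push_cast at h3
      linarith
    generalize ((k / (t + N) : ℕ) : ℝ) = e at h1 h2
    generalize (f true).toReal = p at hk
    push_cast at hk
    obtain ⟨h3, h4⟩ := abs_le.mp hk
    have e1 : (N : ℝ) ^ 2 * (t + N) * (4 / N) = 4 * N * (t + N) := by field_simp
    rw [e1] at h3 h4
    have h5 : e ≤ N ^ 2 * p + 4 * N := by
      by_contra h
      have := mul_lt_mul_of_pos_right (not_le.mp h) hm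
      nlinarith
    have h6 : N ^ 2 * p - 4 * N - 1 ≤ e := by
      by_contra h
      have := mul_lt_mul_of_pos_right (not_le.mp h) hm
      nlinarith
    have e2 : 2 * e / (N : ℝ) ^ 2 - 1 - (2 * p - 1) = (2 * (e - N ^ 2 * p)) / N ^ 2 := by
      field_simp; ring
    have e3 : (10 : ℝ) / N = 10 * N / N ^ 2 := by field_simp
    rw [e2, e3, abs_div, abs_of_pos (by positivity : (0 : ℝ) < (N : ℝ) ^ 2)]
    refine div_le_div_of_nonneg_right ?_ (by positivity)
    rw [abs_le]
    constructor <;> linarith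
  · refine mul_le_mul_right ?_ _
    have e : -(((N ^ 2 * (t + N) : ℕ) : ℝ) * (4 / N) ^ 2 / 4) = ((4 * (t + N) : ℕ) : ℝ) * -1 := by
      push_cast; field_simp
    rw [e, Real.exp_nat_mul, ENNReal.ofReal_pow (Real.exp_pos _).le]
    refine pow_le_pow_left' ?_ _
    have : (2⁻¹ : ℝ≥0∞) = ENNReal.ofReal (2⁻¹) := by
      rw [ENNReal.ofReal_inv_of_pos (by norm_num)]; norm_num
    rw [this]
    refine ENNReal.ofReal_le_ofReal ?_
    rw [Real.exp_neg]
    refine inv_anti₀ (by norm_num) ?_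
    have := Real.add_one_le_exp (1 : ℝ)
    linarith

/-- All estimates in the table are good. -/
def GoodTable {n : ℕ} (U : UN n) (N : ℕ) (L : Plan) (T : Table) : Prop :=
  List.Forall₂ (fun g r => r.1 = g.1 ∧ List.Forall₂ (fun it e => e.1 = it ∧
    GoodEst (bitK U (mkExper n g.1 it)) N e.2) g.2 r.2) L T

theorem tableK_fails {n : ℕ} (U : UN n) (N t a b : ℕ) (hN : 2 ≤ N) (L : Plan)
    (ha : L.length ≤ a) (hb : ∀ g ∈ L, g.2.length ≤ b) (hab : 2 * (a * b) ≤ 2 ^ (4 * N)) :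
    Fails (tableK U (N ^ 2) (t + N) L) (GoodTable U N L) ((2⁻¹ : ℝ≥0∞) ^ t) := by
  set ε := 2 * (2⁻¹ : ℝ≥0∞) ^ (4 * (t + N))
  refine (Fails.mapK (ε := fun g => (g.2.map fun _ => ε).sum) fun g _ => ?_).mono
    (fun _ h => h) ?_
  · refine Fails.map ((Fails.mapK (R := fun it e => e.1 = it ∧
      GoodEst (bitK U (mkExper n g.1 it)) N e.2) fun it _ => ?_).mono (fun _ h => ⟨rfl, h⟩) le_rfl)
    exact Fails.map ((estK_fails _ N t hN).mono (fun _ h => ⟨rfl, h⟩) le_rfl)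
  · have h1 : (L.map fun g => (g.2.map fun _ => ε).sum).sum ≤ (a * b : ℕ) * ε := by
      have h2 : (L.map fun g => (g.2.map fun _ => ε).sum).sum ≤ L.length • ((b : ℝ≥0∞) * ε) := by
        refine (List.sum_le_card_nsmul _ _ ?_).trans (by rw [List.length_map])
        intro x hx
        obtain ⟨g, hg, rfl⟩ := List.mem_map.mp hx
        rw [List.map_const', List.sum_replicate, nsmul_eq_mul]
        exact mul_le_mul_left (by exact_mod_cast hb g hg) _
      refine h2.trans ?_
      rw [nsmul_eq_mul, Nat.cast_mul, mul_assoc]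
      exact mul_le_mul_left (by exact_mod_cast ha) _
    refine h1.trans ?_
    calc ((a * b : ℕ) : ℝ≥0∞) * ε = ((2 * (a * b) : ℕ) : ℝ≥0∞) * (2⁻¹ : ℝ≥0∞) ^ (4 * (t + N)) := by
          simp only [ε]; push_cast; ring
      _ ≤ ((2 ^ (4 * N) : ℕ) : ℝ≥0∞) * (2⁻¹ : ℝ≥0∞) ^ (4 * (t + N)) :=
          mul_le_mul_left (by exact_mod_cast hab) _
      _ = (2⁻¹ : ℝ≥0∞) ^ (4 * t) := by
          rw [mul_add, pow_add, mul_comm, mul_assoc]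
          have : (2⁻¹ : ℝ≥0∞) ^ (4 * N) * ((2 ^ (4 * N) : ℕ) : ℝ≥0∞) = 1 := by
            push_cast
            rw [← mul_pow, ENNReal.inv_mul_cancel (by norm_num) (by norm_num), one_pow]
          rw [this, mul_one]
      _ ≤ (2⁻¹ : ℝ≥0∞) ^ t := pow_le_pow_right_of_le_one' (by norm_num) (by omega)

/-! ### Pauli words as operators -/

/-- The Pauli operator or identity written as `k`. -/
def optOf : ℕ → Option Pauli
  | 0 => none
  | k + 1 => some (pauliOf k)

/-- The Pauli string written as a list. -/
def strOf (n : ℕ) (Q : List ℕ) : PauliString n := fun j => optOf (Q.getD j 0)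

/-- The matrix of the Pauli operator or identity written as `k`. -/
def pmat (k : ℕ) : Matrix Bool Bool ℂ := (optOf k).elim 1 Pauli.matrix

theorem strOf_op (n : ℕ) (Q : List ℕ) :
    (strOf n Q).op = tensor fun j : Fin n => pmat (Q.getD j 0) := rfl

/-- The sign of a bit. -/
def bsign (b : Bool) : ℂ := bif b then -1 else 1

theorem Z_eq_diagonal : Pauli.Z.matrix = Matrix.diagonal bsign := by
  ext x y
  cases x <;> cases y <;> simp [Pauli.matrix, bsign]

theorem eigenbasis_conj (p : Pauli) :
    eigenbasis p * Pauli.Z.matrix * star (eigenbasis p) = p.matrix := by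
  have h2 := sqrt_two_inv_sq
  have hI : Complex.I ^ 2 = -1 := Complex.I_sq
  rw [Z_eq_diagonal]
  ext x y
  cases p <;> cases x <;> cases y <;>
    simp [eigenbasis, Matrix.mul_apply, Matrix.star_apply, bsign, Pauli.matrix, Matrix.diagonal] <;>
    first
      | linear_combination 2 * h2
      | linear_combination 2 * Complex.I * h2
      | linear_combination -2 * Complex.I * h2

theorem eigenbasis_mul_star (p : Pauli) : eigenbasis p * star (eigenbasis p) = 1 :=
  Matrix.mem_unitaryGroup_iff.mp (eigenbasis_mem p)

theorem tensor_diagonal {N : ℕ} (d : Fin N → Bool → ℂ) :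
    tensor (fun j => Matrix.diagonal (d j)) = Matrix.diagonal fun x => ∏ j, d j (x j) := by
  ext x y
  simp only [tensor, Matrix.of_apply]
  by_cases h : x = y
  · subst h
    simp
  · rw [Matrix.diagonal_apply_ne _ h]
    obtain ⟨j, hj⟩ := Function.ne_iff.mp h
    exact Finset.prod_eq_zero (Finset.mem_univ j) (Matrix.diagonal_apply_ne _ hj)

theorem pauliAt_eq {n : ℕ} (P : Pauli) (i : Fin n) :
    tensor (fun _ => eigenbasis P) * (tensor fun j => Matrix.diagonal fun b =>
      if j = i then bsign b else 1) * star (tensor fun _ => eigenbasis P) = pauliAt P i := by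
  rw [tensor_star, tensor_mul, tensor_mul, pauliAt, PauliString.op]
  congr 1
  funext j
  by_cases h : j = i
  · simp only [h, if_true, Option.elim_some]
    rw [← eigenbasis_conj, Z_eq_diagonal]
  · simp only [h, if_false, Option.elim_none]
    rw [Matrix.diagonal_one, mul_one, eigenbasis_mul_star]

theorem strOf_eq {n : ℕ} (q : Fin n → ℕ) :
    tensor (fun j => eigenbasis (pauliOf (q j - 1))) * (tensor fun j => Matrix.diagonal fun b =>
      if q j = 0 then 1 else bsign b) * star (tensor fun j => eigenbasis (pauliOf (q j - 1))) =
        tensor fun j => pmat (q j) := by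
  rw [tensor_star, tensor_mul, tensor_mul]
  congr 1
  funext j
  by_cases h : q j = 0
  · simp only [h, if_true]
    rw [Matrix.diagonal_one, mul_one, eigenbasis_mul_star]
    rfl
  · simp only [h, if_false]
    obtain ⟨k, hk⟩ := Nat.exists_eq_succ_of_ne_zero h
    rw [hk, pmat, Nat.succ_eq_add_one, Nat.add_sub_cancel, optOf, Option.elim_some,
      ← eigenbasis_conj, Z_eq_diagonal]

/-! ### The distribution of a sample -/

theorem parity_cons (b : Bool) (l : List Bool) : parity (b :: l) = (b ^^ parity l) := by
  have : ∀ (l : List Bool) (s : Bool), l.foldl (fun s b => s ^^ b) s = (s ^^ parity l) := by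
    intro l
    induction l with
    | nil => intro s; simp [parity]
    | cons b l ih =>
      intro s
      have : parity (b :: l) = l.foldl (fun s b => s ^^ b) (false ^^ b) := rfl
      rw [List.foldl_cons, ih, this, ih, Bool.false_xor, Bool.xor_assoc]
  rw [parity, List.foldl_cons, this, Bool.false_xor]

theorem bsign_parity (l : List Bool) : bsign (parity l) = (l.map bsign).prod := by
  induction l with
  | nil => rfl
  | cons b l ih =>
    rw [parity_cons, List.map_cons, List.prod_cons, ← ih]
    cases b <;> cases parity l <;> simp [bsign]

theorem zip_ofFn {α β : Type*} {n : ℕ} (f : Fin n → α) (g : Fin n → β) :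
    (List.ofFn f).zip (List.ofFn g) = List.ofFn fun i => (f i, g i) := by
  refine List.ext_getElem (by simp) fun i h1 h2 => ?_
  simp

theorem getD_ofFn {α : Type*} {n : ℕ} (f : Fin n → α) (i : Fin n) (d : α) :
    (List.ofFn f).getD i d = f i := by
  simp [List.getD_eq_getElem?_getD]

theorem uniform_succ (n : ℕ) : PMF.uniformOfFintype (Fin (n + 1) → Bool) =
    (PMF.uniformOfFintype (Fin n → Bool)).bind fun s =>
      (PMF.uniformOfFintype Bool).map fun b => (Fin.cons b s : Fin (n + 1) → Bool) := by
  classical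
  ext v
  rw [PMF.bind_apply, tsum_fintype, Finset.sum_eq_single (Fin.tail v)]
  · rw [PMF.map_apply, tsum_fintype, Finset.sum_eq_single (v 0)]
    · rw [if_pos (Fin.cons_self_tail v).symm]
      simp only [PMF.uniformOfFintype_apply]
      simp only [Fintype.card_fun, Fintype.card_bool, Fintype.card_fin, Nat.cast_pow,
        Nat.cast_ofNat]
      rw [pow_succ, ENNReal.mul_inv (by simp) (by simp)]
    · intro b _ hb
      rw [if_neg]
      rintro h
      exact hb (by rw [h, Fin.cons_zero])
    · simp
  · intro s _ hs
    rw [PMF.map_apply, ENNReal.tsum_eq_zero.mpr, mul_zero]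
    intro b
    rw [if_neg]
    rintro h
    exact hs (by rw [h, Fin.tail_cons])
  · simp

theorem prepK_eq {n : ℕ} (q : Fin n → ℕ) : prepK (List.ofFn q) =
    (PMF.uniformOfFintype (Fin n → Bool)).map fun s => List.ofFn fun j => (q j - 1, s j) := by
  induction n with
  | zero =>
    simp only [List.ofFn_zero]
    exact (PMF.map_const _ _).symm
  | succ n ih =>
    have e : prepK (List.ofFn q) = (prepK (List.ofFn fun j : Fin n => q j.succ)).bind
        fun r => ((PMF.uniformOfFintype Bool).map fun s => (q 0 - 1, s)).map fun c => c :: r := by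
      rw [List.ofFn_succ]; rfl
    rw [e, ih, PMF.bind_map, uniform_succ, PMF.map_bind]
    refine pmf_bind_congr _ fun s _ => ?_
    rw [Function.comp_apply, PMF.map_comp, PMF.map_comp]
    congr 1
    funext b
    simp [List.ofFn_succ]

theorem sum_norm_column {n : ℕ} (M : UN n) (s : Fin n → Bool) :
    ∑ b, ‖(M : Op n) b s‖ ^ 2 = 1 := by
  have h := sum_column M s
  rw [← ENNReal.ofReal_sum_of_nonneg fun b _ => sq_nonneg _] at h
  exact (ENNReal.ofReal_eq_one).mp h

theorem outcome_expect {n : ℕ} (U : UN n) (prep : Fin n → Pauli) (P : Pauli) (i : Fin n)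
    (s : Fin n → Bool) :
    ∑ b, bsign (b i) * ((‖(amplitudes U prep fun _ => P : Op n) b s‖ ^ 2 : ℝ) : ℂ) =
      (star (tensor fun j => eigenbasis (prep j)) * heisenberg (U : Op n) P i *
        tensor fun j => eigenbasis (prep j)) s s := by
  have e : star (tensor fun j => eigenbasis (prep j)) * heisenberg (U : Op n) P i *
      (tensor fun j => eigenbasis (prep j)) =
      star (amplitudes U prep fun _ => P : Op n) * (Matrix.diagonal fun b => bsign (b i)) *
        (amplitudes U prep fun _ => P : Op n) := by
    have e1 : (Matrix.diagonal fun b : Fin n → Bool => bsign (b i)) =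
        tensor fun j => Matrix.diagonal fun b => if j = i then bsign b else 1 := by
      rw [tensor_diagonal]
      congr 1
      funext x
      rw [Finset.prod_eq_single i]
      · simp
      · intro j _ hj; simp [hj]
      · simp
    have e2 : (amplitudes U prep fun _ => P : Op n) = star (tensor fun _ : Fin n => eigenbasis P) *
        (U : Op n) * tensor fun j => eigenbasis (prep j) := rfl
    rw [e1, e2, heisenberg, ← pauliAt_eq]
    simp only [star_mul, star_star, mul_assoc]
    rfl
  rw [e, Matrix.mul_apply]
  refine Finset.sum_congr rfl fun b _ => ?_
  rw [Matrix.mul_diagonal, Matrix.star_apply, Complex.star_def]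
  have := Complex.conj_mul' ((amplitudes U prep fun _ => P : Op n) b s)
  push_cast
  rw [← this]
  ring

theorem postBit_sign {n : ℕ} (q : Fin n → ℕ) (meas : List ℕ) (i : Fin n) (s b : Fin n → Bool) :
    bsign (!(postBit (List.ofFn q, meas, i) (List.ofFn fun j => (q j - 1, s j)) (List.ofFn b))) =
      (∏ j, if q j = 0 then 1 else bsign (s j)) * bsign (b i) := by
  have hx : ∀ x y, bsign (x ^^ y) = bsign x * bsign y := by
    intro x y; cases x <;> cases y <;> simp [bsign]
  rw [postBit, Bool.not_not, hx, bsign_parity]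
  dsimp only
  rw [getD_ofFn, zip_ofFn, List.map_ofFn, List.map_ofFn, List.prod_ofFn]
  congr 1
  refine Finset.prod_congr rfl fun j _ => ?_
  simp only [Function.comp_apply]
  by_cases h : q j = 0
  · simp [h, bsign]
  · have : Nat.beq (q j) 0 = false := by
      rw [Bool.eq_false_iff]; exact fun h' => h (Nat.beq_eq.mp h')
    simp [h, this]

theorem bitK_expect {n : ℕ} (U : UN n) (q : Fin n → ℕ) (i : Fin n) (P : ℕ) :
    ((2 * (bitK U (List.ofFn q, List.replicate n P, i) true).toReal - 1 : ℝ) : ℂ) =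
      ((2 : ℂ) ^ n)⁻¹ *
        ((tensor fun j => pmat (q j)) * heisenberg (U : Op n) (pauliOf P) i).trace := by
  classical
  set E := tensor fun j => eigenbasis (pauliOf (q j - 1))
  set O := heisenberg (U : Op n) (pauliOf P) i
  let A : (Fin n → Bool) → (Fin n → Bool) → ℝ := fun s b =>
    ‖(amplitudes U (fun j => pauliOf (q j - 1)) fun _ => pauliOf P : Op n) b s‖ ^ 2
  let F : (Fin n → Bool) → (Fin n → Bool) → Bool := fun s b =>
    postBit (List.ofFn q, List.replicate n P, i) (List.ofFn fun j => (q j - 1, s j)) (List.ofFn b)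
  have hA : ∀ s, ∑ b, A s b = 1 := fun s => sum_norm_column _ s
  have hans : ∀ s, ansK U (List.ofFn fun j => (q j - 1, s j)) (List.replicate n P) =
      (outcome U (fun j => pauliOf (q j - 1)) s fun _ => pauliOf P).map fun b => List.ofFn b := by
    intro s
    unfold ansK
    congr 2
    · funext j; rw [getD_ofFn]
    · funext j; rw [getD_ofFn]
    · funext j
      rw [List.getD_eq_getElem?_getD, List.getElem?_replicate, if_pos j.2, Option.getD_some]
  have h1 : (bitK U (List.ofFn q, List.replicate n P, i) true).toReal =
      (2 ^ n : ℝ)⁻¹ * ∑ s, ∑ b, if F s b then A s b else 0 := by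
    rw [bitK, prepK_eq, PMF.bind_map, PMF.bind_apply, tsum_fintype,
      ENNReal.toReal_sum fun s _ => ENNReal.mul_ne_top (PMF.apply_ne_top _ _)
        (PMF.apply_ne_top _ _), Finset.mul_sum]
    refine Finset.sum_congr rfl fun s _ => ?_
    rw [ENNReal.toReal_mul, PMF.uniformOfFintype_apply]
    congr 1
    · simp
    · rw [Function.comp_apply]
      dsimp only
      rw [hans, PMF.map_comp, PMF.map_apply, tsum_fintype]
      rw [ENNReal.toReal_sum fun b _ => by
        split_ifs
        · exact PMF.apply_ne_top _ _
        · exact ENNReal.zero_ne_top]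
      refine Finset.sum_congr rfl fun b _ => ?_
      rw [Function.comp_apply]
      by_cases h : F s b = true
      · rw [if_pos (by exact h.symm), if_pos h]
        change (ENNReal.ofReal (A s b)).toReal = _
        exact ENNReal.toReal_ofReal (sq_nonneg _)
      · rw [if_neg (fun h' => h (Eq.symm h')), if_neg h, ENNReal.toReal_zero]
  have h2 : ((2 * (bitK U (List.ofFn q, List.replicate n P, i) true).toReal - 1 : ℝ) : ℂ) =
      ((2 : ℂ) ^ n)⁻¹ * ∑ s, ∑ b, bsign (!(F s b)) * (A s b : ℂ) := by
    have h3 : ∀ s, ∑ b, bsign (!(F s b)) * (A s b : ℂ) =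
        ((2 * (∑ b, if F s b then A s b else 0) - 1 : ℝ) : ℂ) := by
      intro s
      rw [← hA s, Finset.mul_sum, ← Finset.sum_sub_distrib]
      push_cast
      refine Finset.sum_congr rfl fun b _ => ?_
      cases h : F s b <;> simp [bsign]; ring
    have h4 : (1 : ℝ) = (2 ^ n : ℝ)⁻¹ * ∑ s : Fin n → Bool, 1 := by
      simp
    rw [h1]
    simp only [h3]
    rw [← Complex.ofReal_sum, Finset.sum_sub_distrib, ← Finset.mul_sum]
    have h6 : (2 * ((2 ^ n : ℝ)⁻¹ * ∑ s, ∑ b, if F s b then A s b else 0) - 1 : ℝ) =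
        (2 ^ n : ℝ)⁻¹ * (2 * ∑ s, (∑ b, if F s b then A s b else 0) - ∑ _s : Fin n → Bool, 1) := by
      rw [mul_sub, ← h4]; ring
    rw [h6, Complex.ofReal_mul]
    norm_num
  rw [h2]
  congr 1
  have h5 : ∀ s, ∑ b, bsign (!(F s b)) * (A s b : ℂ) =
      (∏ j, if q j = 0 then 1 else bsign (s j)) * (star E * O * E) s s := by
    intro s
    rw [← outcome_expect, Finset.mul_sum]
    refine Finset.sum_congr rfl fun b _ => ?_
    simp only [F]
    rw [postBit_sign, mul_assoc]
  simp only [h5]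
  rw [← strOf_eq, tensor_diagonal]
  have h6 : (E * (Matrix.diagonal fun x : Fin n → Bool => ∏ j, if q j = 0 then 1 else bsign (x j)) *
      star E * O).trace = ((Matrix.diagonal fun x : Fin n → Bool =>
        ∏ j, if q j = 0 then 1 else bsign (x j)) * (star E * O * E)).trace := by
    rw [mul_assoc, mul_assoc, Matrix.trace_mul_comm]
    simp only [mul_assoc]
  rw [h6, Matrix.trace]
  refine Finset.sum_congr rfl fun s _ => ?_
  rw [Matrix.diag_apply, Matrix.diagonal_mul]

/-! ### The normalized Frobenius norm -/

section Frobenius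

attribute [local instance] Matrix.frobeniusNormedAddCommGroup Matrix.frobeniusNormedSpace

/-- The normalized Frobenius norm. -/
noncomputable def nrm {N : ℕ} (M : Op N) : ℝ := Real.sqrt (frobSq M / 2 ^ N)

variable {N : ℕ}

theorem frobSq_nonneg (M : Op N) : 0 ≤ frobSq M :=
  Finset.sum_nonneg fun _ _ => Finset.sum_nonneg fun _ _ => sq_nonneg _

theorem nrm_nonneg (M : Op N) : 0 ≤ nrm M := Real.sqrt_nonneg _

theorem nrm_sq (M : Op N) : nrm M ^ 2 = frobSq M / 2 ^ N :=
  Real.sq_sqrt (div_nonneg (frobSq_nonneg M) (by positivity))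

theorem distF_eq (U V : Op N) : distF U V = nrm (U - V) ^ 2 := (nrm_sq _).symm

theorem nrm_eq_norm (M : Op N) : nrm M = ‖M‖ / Real.sqrt (2 ^ N) := by
  rw [nrm, Real.sqrt_div (frobSq_nonneg M), Matrix.frobenius_norm_def, Real.sqrt_eq_rpow]
  congr 2
  simp [frobSq]

theorem nrm_add_le (A B : Op N) : nrm (A + B) ≤ nrm A + nrm B := by
  simp only [nrm_eq_norm, ← add_div]
  exact div_le_div_of_nonneg_right (norm_add_le A B) (Real.sqrt_nonneg _)

theorem nrm_neg (A : Op N) : nrm (-A) = nrm A := by simp only [nrm_eq_norm, norm_neg]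

theorem nrm_zero : nrm (0 : Op N) = 0 := by simp [nrm_eq_norm]

theorem nrm_sub_comm (A B : Op N) : nrm (A - B) = nrm (B - A) := by rw [← neg_sub, nrm_neg]

theorem nrm_sub_le (A B C : Op N) : nrm (A - C) ≤ nrm (A - B) + nrm (B - C) := by
  rw [← sub_add_sub_cancel A B C]
  exact nrm_add_le _ _

theorem nrm_smul (c : ℂ) (A : Op N) : nrm (c • A) = ‖c‖ * nrm A := by
  simp only [nrm_eq_norm, norm_smul, mul_div_assoc]

theorem eq_of_nrm_sub_eq_zero {A B : Op N} (h : frobSq (A - B) ≤ 0) : A = B := by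
  have h1 : nrm (A - B) = 0 := by
    rw [nrm, le_antisymm h (frobSq_nonneg _), zero_div, Real.sqrt_zero]
  rw [nrm_eq_norm, div_eq_zero_iff] at h1
  rcases h1 with h1 | h1
  · exact sub_eq_zero.mp (norm_eq_zero.mp h1)
  · exact absurd h1 (Real.sqrt_pos.mpr (by positivity)).ne'

theorem trace_eq_frobSq (M : Op N) : (Mᴴ * M).trace = (frobSq M : ℂ) := by
  rw [Matrix.trace, frobSq, Finset.sum_comm]
  push_cast
  refine Finset.sum_congr rfl fun y _ => ?_
  rw [Matrix.diag_apply, Matrix.mul_apply]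
  refine Finset.sum_congr rfl fun x _ => ?_
  rw [Matrix.conjTranspose_apply, Complex.star_def, Complex.conj_mul']

theorem nrm_conjTranspose (M : Op N) : nrm Mᴴ = nrm M := by
  simp only [nrm, frobSq, Matrix.conjTranspose_apply, norm_star]
  rw [Finset.sum_comm]

theorem nrm_unitary_mul (U : UN N) (M : Op N) : nrm ((U : Op N) * M) = nrm M := by
  have h : frobSq ((U : Op N) * M) = frobSq M := by
    have : ((frobSq ((U : Op N) * M) : ℝ) : ℂ) = frobSq M := by
      rw [← trace_eq_frobSq, ← trace_eq_frobSq, Matrix.conjTranspose_mul, mul_assoc,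
        ← mul_assoc _ (U : Op N) M]
      have := Matrix.mem_unitaryGroup_iff'.mp U.2
      rw [Matrix.star_eq_conjTranspose] at this
      rw [this, one_mul]
    exact_mod_cast this
  rw [nrm, h, nrm]

theorem nrm_mul_unitary (M : Op N) (U : UN N) : nrm (M * (U : Op N)) = nrm M := by
  rw [← nrm_conjTranspose, Matrix.conjTranspose_mul]
  exact (nrm_unitary_mul (star U) Mᴴ).trans (nrm_conjTranspose M)

theorem nrm_one : nrm (1 : Op N) = 1 := by
  have : frobSq (1 : Op N) = 2 ^ N := by
    have : ((frobSq (1 : Op N) : ℝ) : ℂ) = 2 ^ N := by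
      rw [← trace_eq_frobSq]
      simp
    exact_mod_cast this
  rw [nrm, this, div_self (by positivity), Real.sqrt_one]

theorem nrm_unitary (U : UN N) : nrm (U : Op N) = 1 := by
  rw [← mul_one (U : Op N), nrm_unitary_mul, nrm_one]

theorem nrm_mul_sub_mul_le (A B A' B' : UN N) :
    nrm ((A : Op N) * (B : Op N) - (A' : Op N) * (B' : Op N)) ≤
      nrm ((A : Op N) - (A' : Op N)) + nrm ((B : Op N) - (B' : Op N)) := by
  have e : (A : Op N) * (B : Op N) - (A' : Op N) * (B' : Op N) =
      ((A : Op N) - (A' : Op N)) * (B : Op N) + (A' : Op N) * ((B : Op N) - (B' : Op N)) := by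
    noncomm_ring
  rw [e]
  refine (nrm_add_le _ _).trans ?_
  rw [nrm_mul_unitary, nrm_unitary_mul]

theorem nrm_prod_sub_le (l : List (UN N × UN N)) :
    nrm ((l.map fun p => (p.1 : Op N)).prod - (l.map fun p => (p.2 : Op N)).prod) ≤
      (l.map fun p => nrm ((p.1 : Op N) - (p.2 : Op N))).sum := by
  have e : ∀ f : UN N × UN N → UN N, (l.map fun p => (f p : Op N)).prod =
      (((l.map f).prod : UN N) : Op N) := by
    intro f
    induction l with
    | nil => rfl
    | cons a l ih => rw [List.map_cons, List.prod_cons, ih, List.map_cons, List.prod_cons]; rfl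
  rw [e (fun p => p.1), e (fun p => p.2)]
  clear e
  induction l with
  | nil => simp [nrm_zero]
  | cons a l ih =>
    simp only [List.map_cons, List.prod_cons, List.sum_cons]
    exact (nrm_mul_sub_mul_le _ _ _ _).trans (by gcongr)

theorem nrm_conj_sub_le (A B M : UN N) :
    nrm ((A : Op N)ᴴ * (M : Op N) * (A : Op N) - (B : Op N)ᴴ * (M : Op N) * (B : Op N)) ≤
      2 * nrm ((A : Op N) - (B : Op N)) := by
  have h := nrm_mul_sub_mul_le (star A * M) A (star B * M) B
  have h2 := nrm_mul_sub_mul_le (star A) M (star B) M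
  have e : nrm (((star A : UN N) : Op N) - ((star B : UN N) : Op N)) = nrm ((A : Op N) - (B : Op N)) := by
    rw [← nrm_conjTranspose]
    congr 1
    change ((A : Op N)ᴴ - (B : Op N)ᴴ)ᴴ = _
    simp
  rw [e, sub_self, nrm_zero] at h2
  have h3 : (A : Op N)ᴴ * (M : Op N) * (A : Op N) - (B : Op N)ᴴ * (M : Op N) * (B : Op N) =
      ((star A * M : UN N) : Op N) * (A : Op N) - ((star B * M : UN N) : Op N) * (B : Op N) := rfl
  have h4 : nrm (((star A * M : UN N) : Op N) - ((star B * M : UN N) : Op N)) ≤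
      nrm ((A : Op N) - (B : Op N)) + 0 := h2
  rw [h3]
  linarith

/-- Distances of unitaries in terms of overlaps. -/
theorem distF_eq_overlap (A B : UN N) :
    distF (A : Op N) (B : Op N) = 2 - 2 * (((A : Op N)ᴴ * (B : Op N)).trace).re / 2 ^ N := by
  have h1 := nrm_sq (A : Op N)
  have h2 := nrm_sq (B : Op N)
  rw [nrm_unitary] at h1 h2
  have h3 : frobSq ((A : Op N) - (B : Op N)) = frobSq (A : Op N) + frobSq (B : Op N) -
      2 * (((A : Op N)ᴴ * (B : Op N)).trace).re := by
    have h4 : (((A : Op N) - (B : Op N))ᴴ * ((A : Op N) - (B : Op N))).trace = (frobSq (A : Op N) : ℂ) +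
        frobSq (B : Op N) - (((A : Op N)ᴴ * (B : Op N)).trace + star ((A : Op N)ᴴ * (B : Op N)).trace) := by
      rw [← trace_eq_frobSq, ← trace_eq_frobSq, ← Matrix.trace_conjTranspose,
        Matrix.conjTranspose_mul, Matrix.conjTranspose_conjTranspose, Matrix.conjTranspose_sub,
        sub_mul, mul_sub, mul_sub]
      simp only [Matrix.trace_sub]
      ring
    rw [trace_eq_frobSq] at h4
    have h5 := congrArg Complex.re h4
    simp only [Complex.add_re, Complex.sub_re, Complex.ofReal_re, Complex.star_def,
      Complex.conj_re] at h5
    linarith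
  rw [distF, h3, sub_div, add_div]
  linarith

theorem frobSq_tensor (u : Fin N → Matrix Bool Bool ℂ) :
    frobSq (tensor u) = ∏ j, ∑ a, ∑ b, ‖u j a b‖ ^ 2 := by
  simp only [frobSq, tensor, Matrix.of_apply, norm_prod, ← Finset.prod_pow]
  rw [Finset.prod_univ_sum, Fintype.piFinset_univ]
  refine Finset.sum_congr rfl fun x _ => ?_
  rw [Finset.prod_univ_sum, Fintype.piFinset_univ]

end Frobenius

theorem frobSq_tensor2 {n : ℕ} (A B : Op n) : frobSq (tensor2 A B) = frobSq A * frobSq B := by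
  have e : ∀ f : (Fin (n + n) → Bool) → ℝ, ∑ x, f x =
      ∑ x : Fin n → Bool, ∑ y : Fin n → Bool, f (Fin.append x y) := by
    intro f
    rw [← Fintype.sum_prod_type' (f := fun x y => f (Fin.append x y))]
    exact (Equiv.sum_comp (Fin.appendEquiv n n) f).symm
  simp only [frobSq]
  rw [e]
  simp only [e, tensor2, Matrix.of_apply, Fin.append_left, Fin.append_right, norm_mul, mul_pow]
  rw [Finset.sum_mul]
  refine Finset.sum_congr rfl fun x _ => ?_
  rw [Finset.mul_sum]
  refine Finset.sum_congr rfl fun y _ => ?_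
  rw [Finset.sum_mul]
  refine Finset.sum_congr rfl fun x' _ => ?_
  rw [Finset.mul_sum]

theorem nrm_tensor2 {n : ℕ} (A B : Op n) : nrm (tensor2 A B) = nrm A * nrm B := by
  rw [nrm, nrm, nrm, ← Real.sqrt_mul (div_nonneg (frobSq_nonneg A) (by positivity)),
    frobSq_tensor2, div_mul_div_comm, pow_add]

/-! ### The average-case distance -/

section Sphere

open MeasureTheory

variable {ι : Type} [Fintype ι]

theorem toSphere_map {E : Type*} [NormedAddCommGroup E] [NormedSpace ℝ E] [FiniteDimensional ℝ E]
    [MeasurableSpace E] [BorelSpace E] (μ : Measure E) [μ.IsAddHaarMeasure] (L : E ≃ₗᵢ[ℝ] E)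
    (T : Metric.sphere (0 : E) 1 → Metric.sphere (0 : E) 1) (hT : ∀ ψ, (T ψ : E) = L ψ) :
    Measurable T ∧ μ.toSphere.map T = μ.toSphere := by
  have hTc : Continuous T := by
    rw [continuous_induced_rng]
    have : (Subtype.val ∘ T) = fun ψ : Metric.sphere (0 : E) 1 => L ψ := funext hT
    rw [this]
    exact L.continuous.comp continuous_subtype_val
  refine ⟨hTc.measurable, ?_⟩
  ext s hs
  rw [Measure.map_apply hTc.measurable hs, Measure.toSphere_apply' _ hs,
    Measure.toSphere_apply' _ (hTc.measurable hs)]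
  congr 1
  have hdet : ∀ A : Set E, μ (L.symm '' A) = μ A := by
    have h := fun A : Set E => Measure.addHaar_image_linearMap μ (L.symm.toLinearEquiv : E →ₗ[ℝ] E) A
    have hb := h (Metric.ball 0 1)
    have e : (L.symm.toLinearEquiv : E →ₗ[ℝ] E) '' Metric.ball 0 1 = Metric.ball 0 1 := by
      change L.symm '' Metric.ball 0 1 = _
      rw [LinearIsometryEquiv.image_ball, map_zero]
    rw [e] at hb
    have h0 : μ (Metric.ball (0 : E) 1) ≠ 0 := (Metric.measure_ball_pos μ 0 one_pos).ne'
    have h1 : μ (Metric.ball (0 : E) 1) ≠ ⊤ := measure_ball_lt_top.ne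
    have h2 : ENNReal.ofReal |LinearMap.det (L.symm.toLinearEquiv : E →ₗ[ℝ] E)| = 1 := by
      refine (ENNReal.mul_left_inj h0 h1).mp ?_
      rw [one_mul]
      exact hb.symm
    intro A
    have := h A
    rw [h2, one_mul] at this
    exact this
  conv_rhs => rw [← hdet]
  congr 1
  ext v
  simp only [Set.mem_smul, Set.mem_image, Set.mem_preimage]
  constructor
  · rintro ⟨r, hr, _, ⟨ψ, hψ, rfl⟩, rfl⟩
    exact ⟨r • (T ψ : E), ⟨r, hr, T ψ, ⟨T ψ, hψ, rfl⟩, rfl⟩, by rw [hT]; simp⟩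
  · rintro ⟨_, ⟨r, hr, _, ⟨ψ, hψ, rfl⟩, rfl⟩, rfl⟩
    have hmem : L.symm (ψ : E) ∈ Metric.sphere (0 : E) 1 := by
      rw [mem_sphere_zero_iff_norm, LinearIsometryEquiv.norm_map]
      exact mem_sphere_zero_iff_norm.mp ψ.2
    refine ⟨r, hr, L.symm ψ, ⟨⟨L.symm ψ, hmem⟩, ?_, rfl⟩, by simp⟩
    have : T ⟨L.symm ψ, hmem⟩ = ψ := Subtype.ext (by rw [hT]; simp)
    rwa [this]

theorem integral_sphere_comp (μ : Measure (EuclideanSpace ℂ ι)) [μ.IsAddHaarMeasure]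
    (L : EuclideanSpace ℂ ι ≃ₗᵢ[ℝ] EuclideanSpace ℂ ι) (f : EuclideanSpace ℂ ι → ℂ)
    (hf : Continuous f) :
    ∫ ψ, f (L ψ.1) ∂μ.toSphere = ∫ ψ, f ψ.1 ∂μ.toSphere := by
  let T : Metric.sphere (0 : EuclideanSpace ℂ ι) 1 → Metric.sphere (0 : EuclideanSpace ℂ ι) 1 :=
    fun ψ => ⟨L ψ.1, by
      rw [mem_sphere_zero_iff_norm, LinearIsometryEquiv.norm_map]
      exact mem_sphere_zero_iff_norm.mp ψ.2⟩
  obtain ⟨hm, hmap⟩ := toSphere_map μ L T fun _ => rfl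
  conv_rhs => rw [← hmap]
  rw [integral_map hm.aemeasurable]
  exact (hf.comp continuous_subtype_val).aestronglyMeasurable

theorem integral_sphere_coord (μ : Measure (EuclideanSpace ℂ ι)) [μ.IsAddHaarMeasure]
    [DecidableEq ι] (x y : ι) (hxy : x ≠ y) :
    ∫ ψ, star (ψ.1 x) * ψ.1 y ∂μ.toSphere = 0 := by
  have h := integral_sphere_comp μ (LinearIsometryEquiv.piLpCongrRight 2 fun i : ι =>
    if i = x then LinearIsometryEquiv.neg ℝ else LinearIsometryEquiv.refl ℝ ℂ)
    (fun v => star (v x) * v y) (by fun_prop)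
  have e : ∀ v : EuclideanSpace ℂ ι, star ((LinearIsometryEquiv.piLpCongrRight 2 fun i : ι =>
      if i = x then LinearIsometryEquiv.neg ℝ else LinearIsometryEquiv.refl ℝ ℂ) v x) *
      (LinearIsometryEquiv.piLpCongrRight 2 fun i : ι =>
      if i = x then LinearIsometryEquiv.neg ℝ else LinearIsometryEquiv.refl ℝ ℂ) v y =
      -(star (v x) * v y) := by
    intro v
    simp [LinearIsometryEquiv.piLpCongrRight_apply, hxy.symm]
  simp only [e, integral_neg] at h
  exact self_eq_neg.mp h.symm

theorem integral_sphere_diag (μ : Measure (EuclideanSpace ℂ ι)) [μ.IsAddHaarMeasure]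
    [DecidableEq ι] (x y : ι) :
    ∫ ψ, star (ψ.1 x) * ψ.1 x ∂μ.toSphere = ∫ ψ, star (ψ.1 y) * ψ.1 y ∂μ.toSphere := by
  have h := integral_sphere_comp μ (LinearIsometryEquiv.piLpCongrLeft 2 ℝ ℂ (Equiv.swap x y))
    (fun v => star (v x) * v x) (by fun_prop)
  rw [← h]
  simp [LinearIsometryEquiv.piLpCongrLeft_apply, Equiv.piCongrLeft'_apply]

theorem integrable_sphere (μ : Measure (EuclideanSpace ℂ ι)) [μ.IsAddHaarMeasure]
    {F : Type} [NormedAddCommGroup F] (f : Metric.sphere (0 : EuclideanSpace ℂ ι) 1 → F)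
    (hf : Continuous f) : Integrable f μ.toSphere :=
  hf.integrable_of_hasCompactSupport (HasCompactSupport.of_compactSpace f)

theorem integral_sphere_form (μ : Measure (EuclideanSpace ℂ ι)) [μ.IsAddHaarMeasure]
    [DecidableEq ι] [Nonempty ι] (M : Matrix ι ι ℂ) :
    ∫ ψ, star ψ.1.ofLp ⬝ᵥ (M *ᵥ ψ.1.ofLp) ∂μ.toSphere =
      (μ.toSphere.real Set.univ : ℂ) * (M.trace / Fintype.card ι) := by
  have hsum : ∀ x : ι, ∫ ψ, star (ψ.1 x) * ψ.1 x ∂μ.toSphere =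
      (μ.toSphere.real Set.univ : ℂ) / Fintype.card ι := by
    intro x
    rw [eq_div_iff (Nat.cast_ne_zero.mpr Fintype.card_ne_zero)]
    have h1 : ∑ y : ι, ∫ ψ, star (ψ.1 y) * ψ.1 y ∂μ.toSphere =
        (μ.toSphere.real Set.univ : ℂ) := by
      rw [← integral_finsetSum _ fun y _ => integrable_sphere μ _ (by fun_prop)]
      have : ∀ ψ : Metric.sphere (0 : EuclideanSpace ℂ ι) 1,
          ∑ y, star (ψ.1 y) * ψ.1 y = (1 : ℂ) := by
        intro ψ
        have h := mem_sphere_zero_iff_norm.mp ψ.2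
        have h2 := EuclideanSpace.norm_sq_eq ψ.1
        rw [h] at h2
        have h3 := congrArg (fun r : ℝ => (r : ℂ)) h2
        push_cast at h3
        rw [one_pow] at h3
        rw [h3]
        refine Finset.sum_congr rfl fun y _ => ?_
        rw [Complex.star_def, Complex.conj_mul']
      rw [integral_congr_ae (Filter.Eventually.of_forall this), integral_const]
      simp
    rw [← h1, Finset.sum_congr rfl fun y _ => integral_sphere_diag μ y x]
    simp [mul_comm]
  have e : ∀ ψ : Metric.sphere (0 : EuclideanSpace ℂ ι) 1,
      star ψ.1.ofLp ⬝ᵥ (M *ᵥ ψ.1.ofLp) = ∑ x, ∑ y, M x y * (star (ψ.1 x) * ψ.1 y) := by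
    intro ψ
    simp only [dotProduct, Matrix.mulVec, Finset.mul_sum, Pi.star_apply]
    refine Finset.sum_congr rfl fun x _ => Finset.sum_congr rfl fun y _ => by ring
  simp only [e]
  rw [integral_finsetSum _ fun y _ => integrable_sphere μ _ (by fun_prop)]
  have e2 : ∀ x : ι, ∫ ψ, ∑ y, M x y * (star (ψ.1 x) * ψ.1 y) ∂μ.toSphere =
      M x x * ((μ.toSphere.real Set.univ : ℂ) / Fintype.card ι) := by
    intro x
    rw [integral_finsetSum _ fun y _ => integrable_sphere μ _ (by fun_prop),
      Finset.sum_eq_single x]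
    · rw [integral_const_mul, hsum]
    · intro y _ hy
      rw [integral_const_mul, integral_sphere_coord μ x y hy.symm, mul_zero]
    · simp
  rw [Finset.sum_congr rfl fun x _ => e2 x, ← Finset.sum_mul, Matrix.trace]
  simp only [Matrix.diag_apply]
  ring

/-- The average-case distance of unitaries is at most their normalized Frobenius distance. -/
theorem distAvg_le_distF {N : ℕ} (U V : UN N) :
    distAvg (U : Op N) (V : Op N) ≤ distF (U : Op N) (V : Op N) := by
  have hd : ∀ ψ : PureState N, star ((U : Op N) *ᵥ ψ.1.ofLp) ⬝ᵥ ((V : Op N) *ᵥ ψ.1.ofLp) =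
      star ψ.1.ofLp ⬝ᵥ (((U : Op N)ᴴ * (V : Op N)) *ᵥ ψ.1.ofLp) := by
    intro ψ
    rw [Matrix.star_mulVec, ← Matrix.mulVec_mulVec, Matrix.dotProduct_mulVec,
      Matrix.dotProduct_mulVec, Matrix.dotProduct_mulVec]
  have hc : Continuous fun ψ : PureState N =>
      star ψ.1.ofLp ⬝ᵥ (((U : Op N)ᴴ * (V : Op N)) *ᵥ ψ.1.ofLp) := by
    simp only [dotProduct, Matrix.mulVec, Pi.star_apply]
    fun_prop
  have hi := integrable_sphere MeasureTheory.Measure.addHaar _ hc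
  rw [distAvg, average_eq, distF_eq_overlap, smul_eq_mul]
  have hf : ∀ ψ : PureState N, 1 - fidelity (U : Op N) (V : Op N) ψ ≤
      2 - 2 * (star ψ.1.ofLp ⬝ᵥ (((U : Op N)ᴴ * (V : Op N)) *ᵥ ψ.1.ofLp)).re := by
    intro ψ
    rw [fidelity, hd, ← Complex.normSq_eq_norm_sq, Complex.normSq_apply]
    nlinarith [sq_nonneg ((star ψ.1.ofLp ⬝ᵥ (((U : Op N)ᴴ * (V : Op N)) *ᵥ ψ.1.ofLp)).re - 1),
      sq_nonneg (star ψ.1.ofLp ⬝ᵥ (((U : Op N)ᴴ * (V : Op N)) *ᵥ ψ.1.ofLp)).im]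
  have hfc : Continuous fun ψ : PureState N => 1 - fidelity (U : Op N) (V : Op N) ψ := by
    simp only [fidelity, hd]
    fun_prop
  have h1 := integral_mono (integrable_sphere MeasureTheory.Measure.addHaar _ hfc)
    (((integrable_const (2 : ℝ)).sub (hi.re.const_mul 2))) hf
  set v := (sphereMeasure N).real Set.univ with hv
  have h2 : ∫ ψ, (2 - 2 * (star ψ.1.ofLp ⬝ᵥ (((U : Op N)ᴴ * (V : Op N)) *ᵥ ψ.1.ofLp)).re)
      ∂(sphereMeasure N) =
      v * (2 - 2 * (((U : Op N)ᴴ * (V : Op N)).trace).re / 2 ^ N) := by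
    have h3 := integral_sphere_form (ι := Fin N → Bool) MeasureTheory.Measure.addHaar
      ((U : Op N)ᴴ * (V : Op N))
    have h4 := integral_re hi
    have h7 := integral_sub (integrable_const (μ := (MeasureTheory.Measure.addHaar :
      MeasureTheory.Measure (EuclideanSpace ℂ (Fin N → Bool))).toSphere) (2 : ℝ)) (hi.re.const_mul 2)
    refine h7.trans ?_
    rw [integral_const_mul]
    erw [h4]
    rw [h3, integral_const]
    have : ((MeasureTheory.Measure.addHaar :
        MeasureTheory.Measure (EuclideanSpace ℂ (Fin N → Bool))).toSphere.real Set.univ) = v := rfl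
    rw [this]
    have h5 : RCLike.re ((v : ℂ) * (((U : Op N)ᴴ * (V : Op N)).trace /
        (Fintype.card (Fin N → Bool) : ℂ))) = v * (((U : Op N)ᴴ * (V : Op N)).trace.re / 2 ^ N) := by
      have : (Fintype.card (Fin N → Bool) : ℂ) = ((2 ^ N : ℝ) : ℂ) := by simp
      rw [this]
      change ((v : ℂ) * _).re = _
      rw [Complex.re_ofReal_mul, Complex.div_ofReal_re]
    rw [h5, smul_eq_mul]
    change v * 2 - _ = _
    ring
  have h6 : ∫ ψ, (1 - fidelity (U : Op N) (V : Op N) ψ) ∂(sphereMeasure N) ≤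
      v * (2 - 2 * (((U : Op N)ᴴ * (V : Op N)).trace).re / 2 ^ N) := h2 ▸ h1
  have hn : 0 ≤ 2 - 2 * (((U : Op N)ᴴ * (V : Op N)).trace).re / 2 ^ N := by
    rw [← distF_eq_overlap]
    exact div_nonneg (frobSq_nonneg _) (by positivity)
  have hv0 : 0 ≤ v := measureReal_nonneg
  rcases hv0.eq_or_lt with h0 | h0
  · rw [← h0]; simpa using hn
  · rw [inv_mul_le_iff₀ h0]
    exact h6

end Sphere

/-! ### Local operators -/

section Loc

variable {N : ℕ}

/-- Tensor products that are trivial outside of `S`. -/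
def tens (S : Finset (Fin N)) : Submonoid (Op N) where
  carrier := {M | ∃ u : Fin N → Matrix Bool Bool ℂ, (∀ j, j ∉ S → u j = 1) ∧ tensor u = M}
  mul_mem' := by
    rintro _ _ ⟨u, hu, rfl⟩ ⟨v, hv, rfl⟩
    exact ⟨fun j => u j * v j, fun j hj => by
      change u j * v j = 1
      rw [hu j hj, hv j hj, one_mul],
      (tensor_mul u v).symm⟩
  one_mem' := ⟨fun _ => 1, fun _ _ => rfl, tensor_one⟩

/-- The algebra of the operators on the qubits in `S`. -/
def loc (S : Finset (Fin N)) : Subalgebra ℂ (Op N) := Algebra.adjoin ℂ (tens S)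

variable {S S' : Finset (Fin N)} {M M' : Op N}

theorem tensor_mem_loc {u : Fin N → Matrix Bool Bool ℂ} (h : ∀ j, j ∉ S → u j = 1) :
    tensor u ∈ loc S := Algebra.subset_adjoin ⟨u, h, rfl⟩

theorem loc_induction {p : Op N → Prop}
    (ht : ∀ u : Fin N → Matrix Bool Bool ℂ, (∀ j, j ∉ S → u j = 1) → p (tensor u))
    (ha : ∀ A B, p A → p B → p (A + B)) (hs : ∀ (c : ℂ) A, p A → p (c • A)) (hM : M ∈ loc S) :
    p M := by
  have h : M ∈ Submodule.span ℂ ((tens S : Submonoid (Op N)) : Set (Op N)) := by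
    rw [← Subalgebra.mem_toSubmodule, loc, Algebra.adjoin_eq_span, Submonoid.closure_eq] at hM
    exact hM
  clear hM
  induction h using Submodule.span_induction with
  | mem x hx => obtain ⟨u, hu, rfl⟩ := hx; exact ht u hu
  | zero => simpa using hs 0 _ (ht (fun _ => 1) fun _ _ => rfl)
  | add x y _ _ hx hy => exact ha x y hx hy
  | smul a x _ hx => exact hs a x hx

theorem loc_mono (h : S ⊆ S') : loc S ≤ loc S' := by
  refine Algebra.adjoin_mono ?_
  rintro _ ⟨u, hu, rfl⟩
  exact ⟨u, fun j hj => hu j fun hS => hj (h hS), rfl⟩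

theorem star_mem_loc (hM : M ∈ loc S) : star M ∈ loc S := by
  refine loc_induction (p := fun M => star M ∈ loc S) (fun u hu => ?_) (fun A B hA hB => ?_)
    (fun c A hA => ?_) hM
  · rw [tensor_star]
    exact tensor_mem_loc fun j hj => by rw [hu j hj, star_one]
  · rw [star_add]; exact add_mem hA hB
  · rw [star_smul]; exact Subalgebra.smul_mem _ hA _

theorem commute_of_disjoint (h : Disjoint S S') (hM : M ∈ loc S) (hM' : M' ∈ loc S') :
    M * M' = M' * M := by
  refine loc_induction (p := fun M => M * M' = M' * M) (fun u hu => ?_)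
    (fun A B hA hB => by rw [add_mul, mul_add, hA, hB])
    (fun c A hA => by rw [smul_mul_assoc, mul_smul_comm, hA]) hM
  refine loc_induction (p := fun M => tensor u * M = M * tensor u) (fun v hv => ?_)
    (fun A B hA hB => by rw [add_mul, mul_add, hA, hB])
    (fun c A hA => by rw [smul_mul_assoc, mul_smul_comm, hA]) hM'
  rw [tensor_mul, tensor_mul]
  congr 1
  funext j
  by_cases hj : j ∈ S
  · rw [hv j (Finset.disjoint_left.mp h hj), one_mul, mul_one]
  · rw [hu j hj, one_mul, mul_one]

theorem supportedOn_of_mem_loc (hM : M ∈ loc S) : SupportedOn S M := by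
  refine loc_induction (p := SupportedOn S) (fun u hu => ?_) (fun A B hA hB => ?_)
    (fun c A hA => ?_) hM
  · refine ⟨Matrix.of fun x y => ∏ i : S, u i (x i) (y i), fun x y => ?_⟩
    rw [tensor, Matrix.of_apply, Matrix.of_apply]
    split_ifs with h
    · refine Eq.trans ?_ (Finset.prod_coe_sort S fun i => (u i : Bool → Bool → ℂ) (x i) (y i)).symm
      refine (Finset.prod_subset (Finset.subset_univ S) fun i _ hi => ?_).symm
      rw [hu i hi, h i hi, Matrix.one_apply_eq]
    · push Not at h
      obtain ⟨i, hi, hxy⟩ := h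
      refine Finset.prod_eq_zero (Finset.mem_univ i) ?_
      rw [hu i hi, Matrix.one_apply_ne hxy]
  · obtain ⟨A', hA⟩ := hA
    obtain ⟨B', hB⟩ := hB
    refine ⟨A' + B', fun x y => ?_⟩
    rw [Matrix.add_apply, hA, hB]
    split_ifs <;> simp
  · obtain ⟨A', hA⟩ := hA
    refine ⟨c • A', fun x y => ?_⟩
    rw [Matrix.smul_apply, hA]
    split_ifs <;> simp

theorem entry_eq_zero_of_mem_loc (hM : M ∈ loc S) {x y : Fin N → Bool} {j : Fin N} (hj : j ∉ S)
    (h : x j ≠ y j) : M x y = 0 := by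
  obtain ⟨A, hA⟩ := supportedOn_of_mem_loc hM
  rw [hA, if_neg fun h' => h (h' j hj)]

theorem pauliAt_mem_loc (P : Pauli) (i : Fin N) : pauliAt P i ∈ loc {i} := by
  refine tensor_mem_loc fun j hj => ?_
  dsimp only
  rw [if_neg (by simpa using hj)]
  rfl

/-! ### Blocks of `CZ` layers -/

/-- The sets on which the `CZ` gates of a layer act. -/
def blocks (label : Fin N → ℕ) : Finset (Finset (Fin N)) :=
  (Finset.univ.filter fun j => label j ≠ 0).image fun j => Finset.univ.filter fun k =>
    label k = label j

/-- The sign of a `CZ` gate. -/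
def zs (B : Finset (Fin N)) (x : Fin N → Bool) : ℂ := if ∀ j ∈ B, x j = true then -1 else 1

theorem mem_blocks {label : Fin N → ℕ} {B : Finset (Fin N)} : B ∈ blocks label ↔
    ∃ j, label j ≠ 0 ∧ B = Finset.univ.filter fun k => label k = label j := by
  simp [blocks, eq_comm]

theorem czSign_eq (label : Fin N → ℕ) (x : Fin N → Bool) :
    czSign label x = ∏ B ∈ blocks label, zs B x := by
  have h : blocks label = ((Finset.univ.image label).erase 0).image
      fun l => Finset.univ.filter fun k => label k = l := by
    ext B
    simp only [mem_blocks, Finset.mem_image, Finset.mem_erase, Finset.mem_univ, true_and]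
    constructor
    · rintro ⟨j, hj, rfl⟩; exact ⟨label j, ⟨hj, j, rfl⟩, rfl⟩
    · rintro ⟨_, ⟨hj, j, rfl⟩, rfl⟩; exact ⟨j, hj, rfl⟩
  rw [h, Finset.prod_image]
  · refine Finset.prod_congr rfl fun l _ => ?_
    simp [zs]
  · intro l hl l' hl' e
    obtain ⟨-, hl⟩ := Finset.mem_erase.mp hl
    obtain ⟨j, -, rfl⟩ := Finset.mem_image.mp hl
    have : j ∈ Finset.univ.filter fun k => label k = l' := by
      dsimp only at e
      rw [← e]; simp
    simpa using this

theorem diagonal_zs (B : Finset (Fin N)) :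
    Matrix.diagonal (zs B) = (1 : Op N) - (2 : ℂ) • tensor fun j =>
      if j ∈ B then Matrix.diagonal fun b : Bool => if b then 1 else 0 else 1 := by
  ext x y
  rw [Matrix.sub_apply, Matrix.smul_apply, tensor, Matrix.of_apply]
  by_cases hxy : x = y
  · subst hxy
    rw [Matrix.diagonal_apply_eq, Matrix.one_apply_eq, zs]
    split_ifs with hB
    · rw [Finset.prod_eq_one]
      · norm_num
      · intro j _
        split_ifs with hj
        · simp [hB j hj]
        · simp
    · push Not at hB
      obtain ⟨j, hj, hx⟩ := hB
      rw [Finset.prod_eq_zero (Finset.mem_univ j)]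
      · simp
      · simp [hj, hx]
  · rw [Matrix.diagonal_apply_ne _ hxy, Matrix.one_apply_ne hxy]
    obtain ⟨j, hj⟩ := Function.ne_iff.mp hxy
    rw [Finset.prod_eq_zero (Finset.mem_univ j)]
    · simp
    · split_ifs
      · exact Matrix.diagonal_apply_ne _ hj
      · exact Matrix.one_apply_ne hj

theorem diagonal_zs_mem_loc {B : Finset (Fin N)} (h : B ⊆ S) :
    Matrix.diagonal (zs B) ∈ loc S := by
  rw [diagonal_zs]
  refine sub_mem (one_mem _) (Subalgebra.smul_mem _ (tensor_mem_loc fun j hj => ?_) _)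
  rw [if_neg fun hB => hj (h hB)]

theorem diagonal_prod_mem_loc (F : Finset (Finset (Fin N))) (h : ∀ B ∈ F, B ⊆ S) :
    Matrix.diagonal (fun x => ∏ B ∈ F, zs B x) ∈ loc S := by
  induction F using Finset.induction with
  | empty =>
    simp only [Finset.prod_empty]
    exact Matrix.diagonal_one (n := Fin N → Bool) (α := ℂ) ▸ one_mem _
  | insert B F hB ih =>
    simp only [Finset.prod_insert hB]
    rw [← Matrix.diagonal_mul_diagonal]
    exact mul_mem (diagonal_zs_mem_loc (h B (Finset.mem_insert_self _ _)))
      (ih fun B' hB' => h B' (Finset.mem_insert_of_mem hB'))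

theorem coe_czU (label : Fin N → ℕ) :
    (czU label : Op N) = Matrix.diagonal fun x => ∏ B ∈ blocks label, zs B x := by
  change Matrix.diagonal (czSign label) = _
  congr 1
  funext x
  exact czSign_eq label x

theorem coe_tensorU (u : Fin N → U2) :
    (tensorU u : Op N) = tensor fun j => (u j : Matrix Bool Bool ℂ) := rfl

theorem czU_mem_loc {label : Fin N → ℕ} (h : ∀ B ∈ blocks label, B ⊆ S) :
    (czU label : Op N) ∈ loc S := by
  rw [coe_czU]
  exact diagonal_prod_mem_loc _ h

theorem czU_congr {l l' : Fin N → ℕ} (h : blocks l = blocks l') : czU l = czU l' :=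
  Subtype.ext (by rw [coe_czU, coe_czU, h])

theorem czU_mul {l l₁ l₂ : Fin N → ℕ} (h : blocks l = blocks l₁ ∪ blocks l₂)
    (hd : Disjoint (blocks l₁) (blocks l₂)) : czU l = czU l₁ * czU l₂ := by
  refine Subtype.ext ?_
  change _ = (czU l₁ : Op N) * (czU l₂ : Op N)
  rw [coe_czU, coe_czU, coe_czU, Matrix.diagonal_mul_diagonal, h]
  congr 1
  funext x
  exact Finset.prod_union hd

/-- The labels that satisfy `p`. -/
def keepLabels (p : ℕ → Prop) [DecidablePred p] (l : Fin N → ℕ) : Fin N → ℕ :=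
  fun j => if p (l j) then l j else 0

theorem blocks_keepLabels (p : ℕ → Prop) [DecidablePred p] (l : Fin N → ℕ) (B : Finset (Fin N)) :
    B ∈ blocks (keepLabels p l) ↔
      ∃ j, l j ≠ 0 ∧ p (l j) ∧ B = Finset.univ.filter fun k => l k = l j := by
  rw [mem_blocks]
  refine exists_congr fun j => ?_
  unfold keepLabels
  by_cases hj : p (l j)
  · rw [if_pos hj]
    by_cases h0 : l j = 0
    · simp [h0]
    · have : (Finset.univ.filter fun k => (if p (l k) then l k else 0) = l j) =
          Finset.univ.filter fun k => l k = l j := by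
        ext k
        simp only [Finset.mem_filter, Finset.mem_univ, true_and]
        constructor
        · intro h
          by_cases hk : p (l k)
          · rwa [if_pos hk] at h
          · rw [if_neg hk] at h; exact absurd h.symm h0
        · intro h
          rw [h, if_pos hj]
      rw [this]
      simp [hj]
  · simp [hj]

theorem czU_split (p : ℕ → Prop) [DecidablePred p] (l : Fin N → ℕ) :
    czU l = czU (keepLabels p l) * czU (keepLabels (fun v => ¬ p v) l) := by
  refine czU_mul ?_ ?_
  · ext B
    rw [Finset.mem_union, blocks_keepLabels, blocks_keepLabels, mem_blocks]
    constructor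
    · rintro ⟨j, hj, rfl⟩
      by_cases h : p (l j)
      · exact Or.inl ⟨j, hj, h, rfl⟩
      · exact Or.inr ⟨j, hj, h, rfl⟩
    · rintro (⟨j, hj, -, rfl⟩ | ⟨j, hj, -, rfl⟩) <;> exact ⟨j, hj, rfl⟩
  · rw [Finset.disjoint_left]
    intro B h1 h2
    obtain ⟨j, -, h, rfl⟩ := (blocks_keepLabels _ _ _).mp h1
    obtain ⟨k, -, h', e⟩ := (blocks_keepLabels _ _ _).mp h2
    have : j ∈ Finset.univ.filter fun i => l i = l k := by rw [← e]; simp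
    rw [Finset.mem_filter] at this
    exact h' (this.2 ▸ h)

end Loc

/-! ### Light cones -/

section Cone

variable {N : ℕ}

/-- The layers of a circuit. -/
abbrev Slot (N : ℕ) := (Fin N → Gate) × (Fin N → ℕ)

/-- The identity gate. -/
def idG : Gate := ⟨1, 0, 0, 0, by norm_num⟩

theorem idG_toU2 : idG.toU2 = 1 := by
  refine Subtype.ext ?_
  change idG.matrix = 1
  ext x y
  cases x <;> cases y <;> simp [Gate.matrix, Gate.norm, idG]

/-- The unitary of a list of layers. -/
noncomputable abbrev slotsU (ls : List (Slot N)) : UN N := layersUnitary Gate.toU2 ls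

/-- The unitary of a layer. -/
noncomputable def slotU (sl : Slot N) : UN N := czU sl.2 * tensorU fun i => (sl.1 i).toU2

theorem slotsU_nil : slotsU ([] : List (Slot N)) = 1 := rfl

theorem slotsU_cons (sl : Slot N) (ls : List (Slot N)) :
    slotsU (sl :: ls) = slotsU ls * slotU sl := rfl

theorem slotsU_append (ls ls' : List (Slot N)) : slotsU (ls ++ ls') = slotsU ls' * slotsU ls := by
  induction ls with
  | nil => rw [List.nil_append, slotsU_nil, mul_one]
  | cons sl ls ih => rw [List.cons_append, slotsU_cons, ih, slotsU_cons, mul_assoc]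

/-- The qubits that share a `CZ` gate with a qubit in `S`, and `S` itself. -/
def nbr (l : Fin N → ℕ) (S : Finset (Fin N)) : Finset (Fin N) :=
  Finset.univ.filter fun k => ∃ j ∈ S, k = j ∨ (l j ≠ 0 ∧ l k = l j)

/-- The backward light cone of `S`. -/
def cone (S : Finset (Fin N)) : List (Slot N) → Finset (Fin N)
  | [] => S
  | sl :: ls => nbr sl.2 (cone S ls)

/-- The part of a layer that acts on `L`. -/
def restrictSlot (L : Finset (Fin N)) (sl : Slot N) : Slot N :=
  (fun j => if j ∈ L then sl.1 j else idG, keepLabels (fun v => ∀ k, sl.2 k = v → k ∈ L) sl.2)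

theorem subset_nbr (l : Fin N → ℕ) (S : Finset (Fin N)) : S ⊆ nbr l S := fun j hj => by
  simp only [nbr, Finset.mem_filter, Finset.mem_univ, true_and]
  exact ⟨j, hj, Or.inl rfl⟩

theorem conj_mul_of_commute {U A B : UN N} {M : Op N} (hU : U = B * A)
    (hB : M * (B : Op N) = (B : Op N) * M) :
    star (U : Op N) * M * (U : Op N) = star (A : Op N) * M * (A : Op N) := by
  have e : (U : Op N) = (B : Op N) * (A : Op N) := by rw [hU]; rfl
  have hs := Matrix.mem_unitaryGroup_iff'.mp B.2
  rw [e, star_mul, mul_assoc, mul_assoc, ← mul_assoc M, hB, mul_assoc (B : Op N),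
    ← mul_assoc (star (B : Op N)), hs, one_mul, mul_assoc]

theorem cz_conj {l : Fin N → ℕ} {S L : Finset (Fin N)} {M : Op N} (hM : M ∈ loc S)
    (hL : nbr l S ⊆ L) : star (czU l : Op N) * M * (czU l : Op N) =
      star (czU (keepLabels (fun v => ∀ k, l k = v → k ∈ L) l) : Op N) * M *
        (czU (keepLabels (fun v => ∀ k, l k = v → k ∈ L) l) : Op N) := by
  have hs := czU_split (fun v => ¬ ∀ k, l k = v → k ∈ L) l
  have e : keepLabels (fun v => ¬ ¬ ∀ k, l k = v → k ∈ L) l =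
      keepLabels (fun v => ∀ k, l k = v → k ∈ L) l := by
    funext j
    simp only [keepLabels, not_not]
  rw [e] at hs
  refine conj_mul_of_commute hs ?_
  refine commute_of_disjoint (S' := Sᶜ) disjoint_compl_right hM (czU_mem_loc fun B hB => ?_)
  obtain ⟨j, hj, hp, rfl⟩ := (blocks_keepLabels _ _ _).mp hB
  intro k hk
  rw [Finset.mem_compl]
  intro hkS
  refine hp fun k' hk' => hL ?_
  simp only [nbr, Finset.mem_filter, Finset.mem_univ, true_and] at hk ⊢
  exact ⟨k, hkS, Or.inr ⟨by rw [hk]; exact hj, by rw [hk', hk]⟩⟩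

theorem tensorU_mul (u v : Fin N → U2) : tensorU u * tensorU v = tensorU fun j => u j * v j :=
  Subtype.ext (tensor_mul _ _)

theorem tensorU_conj {u : Fin N → U2} {S L : Finset (Fin N)} {M : Op N} (hM : M ∈ loc S)
    (hL : S ⊆ L) : star (tensorU u : Op N) * M * (tensorU u : Op N) =
      star (tensorU (fun j => if j ∈ L then u j else 1) : Op N) * M *
        (tensorU (fun j => if j ∈ L then u j else 1) : Op N) := by
  have hs : tensorU u = tensorU (fun j => if j ∈ L then 1 else u j) *
      tensorU (fun j => if j ∈ L then u j else 1) := by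
    rw [tensorU_mul]
    congr 1
    funext j
    split_ifs <;> simp
  refine conj_mul_of_commute hs ?_
  refine commute_of_disjoint (S' := Sᶜ) disjoint_compl_right hM (tensor_mem_loc fun j hj => ?_)
  dsimp only
  rw [if_pos (hL (by simpa using hj))]
  rfl

theorem conj_mem_loc {S : Finset (Fin N)} {U M : Op N} (hU : U ∈ loc S) (hM : M ∈ loc S) :
    star U * M * U ∈ loc S := mul_mem (mul_mem (star_mem_loc hU) hM) hU

theorem keepLabels_blocks_subset {l : Fin N → ℕ} {L B : Finset (Fin N)}
    (h : B ∈ blocks (keepLabels (fun v => ∀ k, l k = v → k ∈ L) l)) : B ⊆ L := by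
  obtain ⟨j, -, hp, rfl⟩ := (blocks_keepLabels _ _ _).mp h
  intro k hk
  exact hp k (Finset.mem_filter.mp hk).2

/-- An observable on `S` evolves in the same way under a circuit and under the part of it that acts
on a set containing the light cone of `S`. -/
theorem conj_restrict {S L : Finset (Fin N)} {M : Op N} (hM : M ∈ loc S) (ls : List (Slot N))
    (hL : cone S ls ⊆ L) :
    star (slotsU ls : Op N) * M * (slotsU ls : Op N) =
      star (slotsU (ls.map (restrictSlot L)) : Op N) * M *
        (slotsU (ls.map (restrictSlot L)) : Op N) ∧
    star (slotsU ls : Op N) * M * (slotsU ls : Op N) ∈ loc (cone S ls) := by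
  induction ls with
  | nil =>
    refine ⟨rfl, ?_⟩
    rw [slotsU_nil]
    change star (1 : Op N) * M * 1 ∈ _
    simpa [cone] using hM
  | cons sl ls ih =>
    obtain ⟨h1, h2⟩ := ih ((subset_nbr _ _).trans hL)
    have e : ∀ (s : Slot N) (U : UN N), star ((U * slotU s : UN N) : Op N) * M *
        ((U * slotU s : UN N) : Op N) = star (tensorU fun i => (s.1 i).toU2 : Op N) *
          (star (czU s.2 : Op N) * (star (U : Op N) * M * (U : Op N)) * (czU s.2 : Op N)) *
          (tensorU fun i => (s.1 i).toU2 : Op N) := by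
      intro s U
      change star ((U : Op N) * ((czU s.2 : Op N) * (tensorU fun i => (s.1 i).toU2 : Op N))) * M *
        ((U : Op N) * ((czU s.2 : Op N) * (tensorU fun i => (s.1 i).toU2 : Op N))) = _
      rw [star_mul, star_mul]
      simp only [mul_assoc]
    have key : ∀ L', nbr sl.2 (cone S ls) ⊆ L' →
        star (slotsU (sl :: ls) : Op N) * M * (slotsU (sl :: ls) : Op N) =
        star ((slotsU ls * slotU (restrictSlot L' sl) : UN N) : Op N) * M *
          ((slotsU ls * slotU (restrictSlot L' sl) : UN N) : Op N) ∧
        star (slotsU (sl :: ls) : Op N) * M * (slotsU (sl :: ls) : Op N) ∈ loc L' := by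
      intro L' hL'
      have h3 : star (czU sl.2 : Op N) * (star (slotsU ls : Op N) * M * (slotsU ls : Op N)) *
          (czU sl.2 : Op N) ∈ loc (nbr sl.2 (cone S ls)) := by
        rw [cz_conj h2 subset_rfl]
        exact conj_mem_loc (czU_mem_loc fun B hB => keepLabels_blocks_subset hB)
          (loc_mono (subset_nbr _ _) h2)
      rw [slotsU_cons, e, e, tensorU_conj h3 hL', cz_conj h2 hL']
      have e2 : (fun i => ((restrictSlot L' sl).1 i).toU2) =
          fun j => if j ∈ L' then (sl.1 j).toU2 else 1 := by
        funext j
        simp only [restrictSlot]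
        split_ifs
        · rfl
        · exact idG_toU2
      rw [e2]
      refine ⟨rfl, ?_⟩
      refine conj_mem_loc (tensor_mem_loc fun j hj => by dsimp only; rw [if_neg hj]; rfl) ?_
      exact conj_mem_loc (czU_mem_loc fun B hB => keepLabels_blocks_subset hB)
        (loc_mono ((subset_nbr _ _).trans hL') h2)
    refine ⟨?_, (key _ subset_rfl).2⟩
    rw [(key L hL).1, List.map_cons, slotsU_cons, e, e, h1]

theorem card_nbr_le {l : Fin N → ℕ} {w : ℕ} (hw : 1 ≤ w)
    (h : ∀ B ∈ blocks l, B.card ≤ w) (S : Finset (Fin N)) : (nbr l S).card ≤ w * S.card := by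
  have e : nbr l S = S.biUnion fun j => nbr l {j} := by
    ext k
    simp [nbr]
  rw [e, mul_comm]
  refine Finset.card_biUnion_le_card_mul _ _ _ fun j _ => ?_
  by_cases hj : l j = 0
  · have : nbr l {j} = {j} := by
      ext k
      simp [nbr, hj]
    rw [this, Finset.card_singleton]
    exact hw
  · refine le_trans (Finset.card_le_card ?_) (h _ (mem_blocks.mpr ⟨j, hj, rfl⟩))
    intro k
    simp only [nbr, Finset.mem_filter, Finset.mem_univ, true_and, Finset.mem_singleton,
      exists_eq_left]
    rintro (rfl | h)
    · rfl
    · exact h.2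

theorem card_cone_le {w : ℕ} (hw : 1 ≤ w) (S : Finset (Fin N)) (ls : List (Slot N))
    (h : ∀ sl ∈ ls, ∀ B ∈ blocks sl.2, B.card ≤ w) :
    (cone S ls).card ≤ w ^ ls.length * S.card := by
  induction ls with
  | nil => simp [cone]
  | cons sl ls ih =>
    refine (card_nbr_le hw (h sl List.mem_cons_self) _).trans ?_
    rw [List.length_cons, pow_succ', mul_assoc]
    exact Nat.mul_le_mul_left _ (ih fun s hs => h s (List.mem_cons_of_mem _ hs))

theorem subset_cone (S : Finset (Fin N)) (ls : List (Slot N)) : S ⊆ cone S ls := by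
  induction ls with
  | nil => exact subset_rfl
  | cons sl ls ih => exact ih.trans (subset_nbr _ _)

theorem cone_append (S : Finset (Fin N)) (ls ls' : List (Slot N)) :
    cone S (ls ++ ls') = cone (cone S ls') ls := by
  induction ls with
  | nil => rfl
  | cons sl ls ih => rw [List.cons_append, cone, ih, cone]

theorem cone_zero (S : Finset (Fin N)) (ls : List (Slot N)) (h : ∀ sl ∈ ls, sl.2 = fun _ => 0) :
    cone S ls = S := by
  induction ls with
  | nil => rfl
  | cons sl ls ih =>
    rw [cone, ih fun s hs => h s (List.mem_cons_of_mem _ hs), h sl List.mem_cons_self]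
    ext k
    simp [nbr]

theorem card_load_le {w : ℕ} (hw : 1 ≤ w) (ls : List (Slot N))
    (h : ∀ sl ∈ ls, ∀ B ∈ blocks sl.2, B.card ≤ w) (q : Fin N) :
    (Finset.univ.filter fun i => q ∈ cone {i} ls).card ≤ w ^ ls.length := by
  induction ls generalizing q with
  | nil =>
    have : (Finset.univ.filter fun i => q ∈ cone {i} []) = {q} := by
      ext i; simp [cone, eq_comm]
    rw [this]; simp
  | cons sl ls ih =>
    have hs : (Finset.univ.filter fun i => q ∈ cone {i} (sl :: ls)) ⊆
        (nbr sl.2 {q}).biUnion fun q' => Finset.univ.filter fun i => q' ∈ cone {i} ls := by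
      intro i hi
      simp only [cone, nbr, Finset.mem_filter, Finset.mem_univ, true_and, Finset.mem_biUnion,
        Finset.mem_singleton, exists_eq_left] at hi ⊢
      obtain ⟨j, hj, h'⟩ := hi
      refine ⟨j, ?_, hj⟩
      rcases h' with h' | h'
      · exact Or.inl h'.symm
      · exact Or.inr ⟨by rw [h'.2]; exact h'.1, h'.2.symm⟩
    refine (Finset.card_le_card hs).trans ?_
    refine (Finset.card_biUnion_le_card_mul _ _ (w ^ ls.length) fun q' _ =>
      ih (fun s hs => h s (List.mem_cons_of_mem _ hs)) q').trans ?_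
    have := card_nbr_le hw (h sl List.mem_cons_self) {q}
    rw [Finset.card_singleton, mul_one] at this
    rw [List.length_cons, pow_succ']
    exact Nat.mul_le_mul_right _ this

end Cone

/-! ### Rounding of gates and truncation of `CZ` gates -/

section Approx

theorem unit_quaternion_round (a b c d : ℝ) (h : a ^ 2 + b ^ 2 + c ^ 2 + d ^ 2 = 1)
    (a' b' c' d' B r : ℝ) (hB : 4 ≤ B) (hr : r ^ 2 = a' ^ 2 + b' ^ 2 + c' ^ 2 + d' ^ 2)
    (hr0 : 0 ≤ r) (ha : |a' - B * a| ≤ 1) (hb : |b' - B * b| ≤ 1) (hc : |c' - B * c| ≤ 1)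
    (hd : |d' - B * d| ≤ 1) :
    (a - a' / r) ^ 2 + (b - b' / r) ^ 2 + (c - c' / r) ^ 2 + (d - d' / r) ^ 2 ≤ 8 / B ^ 2 := by
  have sq1 : ∀ x : ℝ, |x| ≤ 1 → x ^ 2 ≤ 1 := fun x hx => by
    rw [← sq_abs]; exact pow_le_one₀ (abs_nonneg _) hx
  have h1 := sq1 _ ha
  have h2 := sq1 _ hb
  have h3 := sq1 _ hc
  have h4 := sq1 _ hd
  set S := a' * a + b' * b + c' * c + d' * d with hS
  have h5 : r ^ 2 - 2 * B * S + B ^ 2 ≤ 4 := by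
    have : (a' - B * a) ^ 2 + (b' - B * b) ^ 2 + (c' - B * c) ^ 2 + (d' - B * d) ^ 2 =
        r ^ 2 - 2 * B * S + B ^ 2 * (a ^ 2 + b ^ 2 + c ^ 2 + d ^ 2) := by rw [hr, hS]; ring
    rw [h] at this
    linarith
  have hcs : S ≤ r := by
    have : S ^ 2 ≤ r ^ 2 := by
      have e : (a ^ 2 + b ^ 2 + c ^ 2 + d ^ 2) * (a' ^ 2 + b' ^ 2 + c' ^ 2 + d' ^ 2) - S ^ 2 =
        (a' * b - b' * a) ^ 2 + (a' * c - c' * a) ^ 2 + (a' * d - d' * a) ^ 2 +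
        (b' * c - c' * b) ^ 2 + (b' * d - d' * b) ^ 2 + (c' * d - d' * c) ^ 2 := by rw [hS]; ring
      rw [h, one_mul, ← hr] at e
      have : 0 ≤ r ^ 2 - S ^ 2 := by rw [e]; positivity
      linarith
    exact (abs_le_of_sq_le_sq' this hr0).2
  have hr1 : B / 2 ≤ r := by
    have : (B - r) ^ 2 ≤ 2 ^ 2 := by nlinarith
    have := (abs_le_of_sq_le_sq' this (by norm_num)).2
    linarith
  have hrp : 0 < r := by linarith
  have e : (a - a' / r) ^ 2 + (b - b' / r) ^ 2 + (c - c' / r) ^ 2 + (d - d' / r) ^ 2 =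
      2 - 2 * S / r := by
    have : (a - a' / r) ^ 2 + (b - b' / r) ^ 2 + (c - c' / r) ^ 2 + (d - d' / r) ^ 2 =
        (a ^ 2 + b ^ 2 + c ^ 2 + d ^ 2) - 2 * S / r +
          (a' ^ 2 + b' ^ 2 + c' ^ 2 + d' ^ 2) / r ^ 2 := by rw [hS]; ring
    rw [this, h, ← hr, div_self (by positivity)]
    ring
  rw [e, sub_le_iff_le_add, ← sub_le_iff_le_add', le_div_iff₀ hrp]
  have h6 : r ^ 2 + B ^ 2 - 4 ≤ 2 * B * S := by linarith
  have hB0 : 0 < B := by linarith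
  have h7 : (2 - 8 / B ^ 2) * r * B ≤ r ^ 2 + B ^ 2 - 4 := by
    have e2 : (2 - 8 / B ^ 2) * r * B = 2 * r * B - 8 * r / B := by field_simp
    have h8 : 4 ≤ 8 * r / B := by rw [le_div_iff₀ hB0]; linarith
    rw [e2]
    nlinarith [sq_nonneg (r - B)]
  have h9 : (2 - 8 / B ^ 2) * r * B ≤ (2 * S) * B := by linarith
  exact le_of_mul_le_mul_right h9 hB0

/-- The gates of the search. -/
def Gate.Bounded (B : ℕ) (g : Gate) : Prop :=
  1 ≤ g.a ∧ g.a ≤ B + 1 ∧ |g.b| ≤ B ∧ |g.c| ≤ B ∧ |g.d| ≤ B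

theorem floor_bound {B : ℕ} {x : ℝ} (h : |x| ≤ 1) : |⌊B * x⌋| ≤ (B : ℤ) ∧
    |(⌊B * x⌋ : ℝ) - B * x| ≤ 1 := by
  obtain ⟨h1, h2⟩ := abs_le.mp h
  have hB : (0 : ℝ) ≤ B := by positivity
  refine ⟨abs_le.mpr ⟨?_, ?_⟩, ?_⟩
  · rw [Int.le_floor]; push_cast; nlinarith
  · have : (⌊B * x⌋ : ℝ) ≤ B := (Int.floor_le _).trans (by nlinarith)
    exact_mod_cast this
  · rw [abs_le]
    have := Int.floor_le (B * x)
    have := Int.lt_floor_add_one (B * x)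
    constructor <;> linarith

theorem exists_special (u : U2) : ∃ (z : ℂ) (a b c d : ℝ), ‖z‖ = 1 ∧ 0 ≤ a ∧
    a ^ 2 + b ^ 2 + c ^ 2 + d ^ 2 = 1 ∧ ∀ x y, (u : Matrix Bool Bool ℂ) x y = z * (match x, y with
    | false, false => (a : ℂ) + b * Complex.I
    | false, true => (c : ℂ) + d * Complex.I
    | true, false => -(c : ℂ) + d * Complex.I
    | true, true => (a : ℂ) - b * Complex.I) := by
  obtain ⟨M, hM⟩ := u
  have h1 := Matrix.mem_unitaryGroup_iff.mp hM
  have h2 := Matrix.mem_unitaryGroup_iff'.mp hM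
  have e : ∀ x y, (M * star M) x y = M x false * star (M y false) + M x true * star (M y true) := by
    intro x y; simp [Matrix.mul_apply, Matrix.star_apply, add_comm]
  have eff : M false false * star (M false false) + M false true * star (M false true) = 1 := by
    rw [← e, h1, Matrix.one_apply_eq]
  have eft : M false false * star (M true false) + M false true * star (M true true) = 0 := by
    rw [← e, h1, Matrix.one_apply_ne (by simp)]
  have ett : M true false * star (M true false) + M true true * star (M true true) = 1 := by
    rw [← e, h1, Matrix.one_apply_eq]
  set D := M false false * M true true - M false true * M true false with hD
  have d1 : M true true = D * star (M false false) := by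
    have h3 := congrArg star eft
    simp only [star_add, star_mul', star_star, star_zero] at h3
    rw [hD]
    linear_combination (-M true true) * eff + (M false true) * h3
  have d2 : M true false = -D * star (M false true) := by
    have h3 := congrArg star eft
    simp only [star_add, star_mul', star_star, star_zero] at h3
    rw [hD]
    linear_combination (-M true false) * eff + (M false false) * h3
  have hDn : ‖D‖ = 1 := by
    have h3 : D * star D = 1 := by
      rw [d1, d2, star_mul', star_mul', star_neg, star_star, star_star] at ett
      linear_combination ett - D * star D * eff
    have h4 := congrArg norm h3
    rw [norm_mul, norm_star, norm_one] at h4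
    nlinarith [norm_nonneg D]
  obtain ⟨z, hz, hre⟩ : ∃ z : ℂ, z * z = D ∧ 0 ≤ (star z * M false false).re := by
    obtain ⟨z, hz⟩ := IsAlgClosed.exists_eq_mul_self D
    rcases le_total 0 (star z * M false false).re with h | h
    · exact ⟨z, hz.symm, h⟩
    · refine ⟨-z, by rw [neg_mul_neg, hz], ?_⟩
      rw [star_neg, neg_mul, Complex.neg_re]
      linarith
  have hzn : ‖z‖ = 1 := by
    rw [← hz, norm_mul] at hDn
    nlinarith [norm_nonneg z]
  have hzz : z * star z = 1 := by
    rw [Complex.star_def, Complex.mul_conj']; simp [hzn]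
  set α := star z * M false false with hα
  set β := star z * M false true with hβ
  have e1 : M false false = z * α := by rw [hα, ← mul_assoc, hzz, one_mul]
  have e2 : M false true = z * β := by rw [hβ, ← mul_assoc, hzz, one_mul]
  have e3 : M true true = z * star α := by
    rw [d1, ← hz, e1, star_mul']
    linear_combination z * star α * hzz
  have e4 : M true false = z * -star β := by
    rw [d2, ← hz, e2, star_mul']
    linear_combination -z * star β * hzz
  clear_value α β
  refine ⟨z, α.re, α.im, β.re, β.im, hzn, hre, ?_, ?_⟩
  · have h3 : α * star α + β * star β = 1 := by
      rw [e1, e2, star_mul', star_mul'] at eff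
      linear_combination eff - (α * star α + β * star β) * hzz
    rw [Complex.star_def, Complex.mul_conj, Complex.mul_conj] at h3
    have h4 := congrArg Complex.re h3
    simp only [Complex.add_re, Complex.ofReal_re, Complex.one_re, Complex.normSq_apply] at h4
    linarith
  · have f1 : ∀ w : ℂ, (w.re : ℂ) - w.im * Complex.I = star w := fun w => by
      apply Complex.ext <;> simp
    have f2 : ∀ w : ℂ, -(w.re : ℂ) + w.im * Complex.I = -star w := fun w => by
      apply Complex.ext <;> simp
    intro x y
    cases x <;> cases y <;> simp only [Complex.re_add_im, f1, f2] <;> assumption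

/-- Rounding of single-qubit gates, up to a phase. -/
theorem exists_gate_near (u : U2) (B : ℕ) (hB : 4 ≤ B) : ∃ (z : ℂ) (g : Gate), ‖z‖ = 1 ∧
    g.Bounded B ∧ ∑ x, ∑ y, ‖(u : Matrix Bool Bool ℂ) x y - z * g.matrix x y‖ ^ 2 ≤
      16 / (B : ℝ) ^ 2 := by
  obtain ⟨z, a, b, c, d, hz, ha, hs, hu⟩ := exists_special u
  have hB' : (4 : ℝ) ≤ B := by exact_mod_cast hB
  have hab : ∀ x, x ^ 2 ≤ 1 → |x| ≤ (1 : ℝ) := fun x hx => by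
    rw [← one_pow 2] at hx; exact abs_le_of_sq_le_sq hx zero_le_one
  have qa : |a| ≤ 1 := hab a (by nlinarith)
  obtain ⟨b1, b2⟩ := floor_bound (B := B) (hab b (by nlinarith))
  obtain ⟨c1, c2⟩ := floor_bound (B := B) (hab c (by nlinarith))
  obtain ⟨d1, d2⟩ := floor_bound (B := B) (hab d (by nlinarith))
  have a1 : 1 ≤ ⌊B * a⌋ + 1 := by
    have : 0 ≤ ⌊B * a⌋ := Int.floor_nonneg.mpr (by positivity)
    omega
  have a2 : ⌊B * a⌋ + 1 ≤ B + 1 := by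
    have := (abs_le.mp (floor_bound (B := B) qa).1).2
    omega
  have a3 : |((⌊B * a⌋ + 1 : ℤ) : ℝ) - B * a| ≤ 1 := by
    rw [abs_le]
    have := Int.floor_le (B * a)
    have := Int.lt_floor_add_one (B * a)
    push_cast
    constructor <;> linarith
  set g : Gate := ⟨⌊B * a⌋ + 1, ⌊B * b⌋, ⌊B * c⌋, ⌊B * d⌋, by positivity⟩ with hg
  refine ⟨z, g, hz, ⟨a1, a2, b1, c1, d1⟩, ?_⟩
  have hr : g.norm ^ 2 = ((⌊B * a⌋ + 1 : ℤ) : ℝ) ^ 2 + (⌊B * b⌋ : ℝ) ^ 2 + (⌊B * c⌋ : ℝ) ^ 2 +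
      (⌊B * d⌋ : ℝ) ^ 2 := by
    rw [Gate.norm, Real.sq_sqrt (by exact_mod_cast g.pos.le)]
    push_cast
    simp [hg]
  have key := unit_quaternion_round a b c d hs _ _ _ _ B g.norm hB' hr (Real.sqrt_nonneg _)
    a3 b2 c2 d2
  set A' := ((⌊B * a⌋ + 1 : ℤ) : ℝ)
  have e : ∀ x y : ℝ, ‖z * (x + y * Complex.I)‖ ^ 2 = x ^ 2 + y ^ 2 := by
    intro x y
    rw [norm_mul, hz, one_mul, ← Complex.normSq_eq_norm_sq, Complex.normSq_add_mul_I]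
  have e00 : (u : Matrix Bool Bool ℂ) false false - z * g.matrix false false =
      z * (((a - A' / g.norm : ℝ) : ℂ) + ((b - ⌊B * b⌋ / g.norm : ℝ) : ℂ) * Complex.I) := by
    rw [hu]; simp [Gate.matrix, hg, A']; ring
  have e01 : (u : Matrix Bool Bool ℂ) false true - z * g.matrix false true =
      z * (((c - ⌊B * c⌋ / g.norm : ℝ) : ℂ) + ((d - ⌊B * d⌋ / g.norm : ℝ) : ℂ) * Complex.I) := by
    rw [hu]; simp [Gate.matrix, hg]; ring
  have e10 : (u : Matrix Bool Bool ℂ) true false - z * g.matrix true false =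
      z * (((-(c - ⌊B * c⌋ / g.norm) : ℝ) : ℂ) +
        ((d - ⌊B * d⌋ / g.norm : ℝ) : ℂ) * Complex.I) := by
    rw [hu]; simp [Gate.matrix, hg]; ring
  have e11 : (u : Matrix Bool Bool ℂ) true true - z * g.matrix true true =
      z * (((a - A' / g.norm : ℝ) : ℂ) +
        ((-(b - ⌊B * b⌋ / g.norm) : ℝ) : ℂ) * Complex.I) := by
    rw [hu]; simp [Gate.matrix, hg, A']; ring
  simp only [Fintype.sum_bool]
  rw [e00, e01, e10, e11, e, e, e, e]
  have : (16 : ℝ) / B ^ 2 = 2 * (8 / B ^ 2) := by ring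
  rw [this]
  linarith

variable {N : ℕ}

theorem tensor_update_sub (u : Fin N → Matrix Bool Bool ℂ) (j : Fin N) (a b : Matrix Bool Bool ℂ) :
    tensor (Function.update u j a) - tensor (Function.update u j b) =
      tensor (Function.update u j (a - b)) := by
  ext x y
  have h : ∀ c : Matrix Bool Bool ℂ, tensor (Function.update u j c) x y =
      c (x j) (y j) * ∏ i ∈ Finset.univ.erase j, u i (x i) (y i) := by
    intro c
    rw [tensor, Matrix.of_apply, ← Finset.mul_prod_erase _ _ (Finset.mem_univ j),
      Function.update_self]
    congr 1
    exact Finset.prod_congr rfl fun i hi => by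
      rw [Function.update_of_ne (Finset.ne_of_mem_erase hi)]
  rw [Matrix.sub_apply, h, h, h, Matrix.sub_apply, sub_mul]

theorem sum_norm_row {ι : Type*} [Fintype ι] [DecidableEq ι] (u : Matrix.unitaryGroup ι ℂ)
    (x : ι) : ∑ y, ‖(u : Matrix ι ι ℂ) x y‖ ^ 2 = 1 := by
  have h := congrFun (congrFun (Matrix.mem_unitaryGroup_iff.mp u.2) x) x
  rw [Matrix.mul_apply, Matrix.one_apply_eq] at h
  have : ((∑ y, ‖(u : Matrix ι ι ℂ) x y‖ ^ 2 : ℝ) : ℂ) = 1 := by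
    rw [← h]
    push_cast
    refine Finset.sum_congr rfl fun b _ => ?_
    rw [Matrix.star_apply, Complex.star_def, Complex.mul_conj']
  exact_mod_cast this

theorem sum_norm_sq_unitary (u : U2) : ∑ x, ∑ y, ‖(u : Matrix Bool Bool ℂ) x y‖ ^ 2 = 2 := by
  rw [Finset.sum_congr rfl fun x _ => sum_norm_row u x]
  simp

theorem nrm_update_sub (u : Fin N → U2) (j : Fin N) (a b : U2) (δ : ℝ)
    (h : ∑ x, ∑ y, ‖(a : Matrix Bool Bool ℂ) x y - (b : Matrix Bool Bool ℂ) x y‖ ^ 2 ≤ δ ^ 2)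
    (hδ : 0 ≤ δ) :
    nrm ((tensorU (Function.update u j a) : Op N) - (tensorU (Function.update u j b) : Op N)) ≤
      δ := by
  have e : ∀ c : U2, (tensorU (Function.update u j c) : Op N) =
      tensor (Function.update (fun i => (u i : Matrix Bool Bool ℂ)) j c) := by
    intro c
    rw [coe_tensorU]
    congr 1
    funext i
    by_cases hi : i = j
    · subst hi; simp
    · simp [Function.update_of_ne hi]
  rw [e, e, tensor_update_sub, nrm, Real.sqrt_le_left hδ, frobSq_tensor,
    ← Finset.mul_prod_erase _ _ (Finset.mem_univ j), Function.update_self]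
  have h2 : ∏ i ∈ Finset.univ.erase j, ∑ x, ∑ y, ‖Function.update
      (fun i => (u i : Matrix Bool Bool ℂ)) j ((a : Matrix Bool Bool ℂ) - b) i x y‖ ^ 2 =
      (2 : ℝ) ^ (N - 1) := by
    rw [Finset.prod_congr rfl fun i hi => by
      rw [Function.update_of_ne (Finset.ne_of_mem_erase hi), sum_norm_sq_unitary]]
    rw [Finset.prod_const, Finset.card_erase_of_mem (Finset.mem_univ j), Finset.card_univ,
      Fintype.card_fin]
  rw [h2, div_le_iff₀ (by positivity)]
  refine mul_le_mul (by simpa only [Matrix.sub_apply] using h)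
    (pow_le_pow_right₀ (by norm_num) (Nat.sub_le _ _)) (by positivity) (by positivity)

theorem nrm_tensorU_sub (u v : Fin N → U2) (δ : ℝ) (hδ : 0 ≤ δ)
    (h : ∀ j, ∑ x, ∑ y, ‖(u j : Matrix Bool Bool ℂ) x y - (v j : Matrix Bool Bool ℂ) x y‖ ^ 2 ≤
      δ ^ 2) : nrm ((tensorU u : Op N) - (tensorU v : Op N)) ≤ N * δ := by
  suffices hS : ∀ S : Finset (Fin N), nrm ((tensorU (fun j => if j ∈ S then u j else v j) : Op N) -
      (tensorU v : Op N)) ≤ S.card * δ by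
    simpa using hS Finset.univ
  intro S
  induction S using Finset.induction with
  | empty => simp [nrm_zero]
  | insert j S hj ih =>
    refine (nrm_sub_le _ (tensorU (fun j => if j ∈ S then u j else v j) : Op N) _).trans ?_
    rw [Finset.card_insert_of_notMem hj, Nat.cast_succ, add_mul, one_mul, add_comm]
    refine add_le_add ih ?_
    have h1 := nrm_update_sub (fun j => if j ∈ S then u j else v j) j (u j) (v j) δ (h j) hδ
    have e1 : Function.update (fun j => if j ∈ S then u j else v j) j (u j) =
        fun i => if i ∈ insert j S then u i else v i := by
      funext i
      by_cases hi : i = j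
      · subst hi; simp
      · simp [hi]
    have e2 : Function.update (fun j => if j ∈ S then u j else v j) j (v j) =
        fun i => if i ∈ S then u i else v i := by
      funext i
      by_cases hi : i = j
      · subst hi; simp [hj]
      · simp [Function.update_of_ne hi]
    rwa [e1, e2] at h1

theorem nrm_diagonal_zs_sub_one (B : Finset (Fin N)) :
    nrm (Matrix.diagonal (zs B) - (1 : Op N)) = 2 * Real.sqrt ((2⁻¹ : ℝ) ^ B.card) := by
  have e : Matrix.diagonal (zs B) - (1 : Op N) = (-2 : ℂ) • tensor fun j =>
      if j ∈ B then Matrix.diagonal fun b : Bool => if b then 1 else 0 else 1 := by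
    rw [diagonal_zs, neg_smul]; abel
  rw [e, nrm_smul, nrm, frobSq_tensor]
  have h : ∀ j, ∑ x, ∑ y, ‖(if j ∈ B then (Matrix.diagonal fun b : Bool => if b then (1 : ℂ) else 0)
      else 1 : Matrix Bool Bool ℂ) x y‖ ^ 2 = 2 * (if j ∈ B then (2⁻¹ : ℝ) else 1) := by
    intro j
    split_ifs
    · simp [Matrix.diagonal_apply]
    · simp [Matrix.one_apply]; norm_num
  simp only [h]
  rw [Finset.prod_mul_distrib, Finset.prod_const, Finset.card_univ, Fintype.card_fin,
    mul_div_cancel_left₀ _ (by positivity), Finset.prod_ite_mem, Finset.univ_inter,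
    Finset.prod_const]
  simp

theorem card_blocks_le (l : Fin N → ℕ) : (blocks l).card ≤ N := by
  refine Finset.card_image_le.trans ((Finset.card_filter_le _ _).trans ?_)
  rw [Finset.card_univ, Fintype.card_fin]

theorem zs_unitary (B : Finset (Fin N)) :
    Matrix.diagonal (zs B) ∈ Matrix.unitaryGroup (Fin N → Bool) ℂ := by
  rw [Matrix.mem_unitaryGroup_iff, Matrix.star_eq_conjTranspose,
    Matrix.diagonal_conjTranspose, Matrix.diagonal_mul_diagonal, ← Matrix.diagonal_one]
  congr 1
  funext x
  simp only [Pi.star_apply, zs]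
  split_ifs <;> simp

theorem nrm_czU_sub_one (l : Fin N → ℕ) (w : ℕ) (h : ∀ B ∈ blocks l, w ≤ B.card) :
    nrm ((czU l : Op N) - 1) ≤ N * (2 * Real.sqrt ((2⁻¹ : ℝ) ^ w)) := by
  rw [coe_czU]
  have key : ∀ F : Finset (Finset (Fin N)), (∀ B ∈ F, w ≤ B.card) →
      nrm (Matrix.diagonal (fun x => ∏ B ∈ F, zs B x) - (1 : Op N)) ≤
        F.card * (2 * Real.sqrt ((2⁻¹ : ℝ) ^ w)) := by
    intro F hF
    induction F using Finset.induction with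
    | empty => 
      simp only [Finset.prod_empty]
      rw [Matrix.diagonal_one, sub_self, nrm_zero]; simp
    | insert B F hB ih =>
      simp only [Finset.prod_insert hB]
      rw [← Matrix.diagonal_mul_diagonal]
      refine (nrm_sub_le _ (Matrix.diagonal (zs B)) _).trans ?_
      rw [Finset.card_insert_of_notMem hB, Nat.cast_succ, add_mul, one_mul]
      refine add_le_add ?_ ?_
      · have e : (Matrix.diagonal (zs B) : Op N) * Matrix.diagonal (fun x => ∏ B ∈ F, zs B x) -
            Matrix.diagonal (zs B) = ((⟨Matrix.diagonal (zs B), zs_unitary B⟩ : UN N) : Op N) *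
              (Matrix.diagonal (fun x => ∏ B ∈ F, zs B x) - 1) := by
          rw [mul_sub, mul_one]
        change nrm ((Matrix.diagonal (zs B) : Op N) * Matrix.diagonal (fun x => ∏ B ∈ F, zs B x) -
            Matrix.diagonal (zs B)) ≤ _
        rw [e, nrm_unitary_mul]
        exact ih fun B' hB' => hF B' (Finset.mem_insert_of_mem hB')
      · rw [nrm_diagonal_zs_sub_one]
        refine mul_le_mul_of_nonneg_left (Real.sqrt_le_sqrt ?_) (by norm_num)
        exact pow_le_pow_of_le_one (by norm_num) (by norm_num) (hF B (Finset.mem_insert_self _ _))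
  refine (key _ h).trans (mul_le_mul_of_nonneg_right ?_ (by positivity))
  exact_mod_cast card_blocks_le l

/-- The number of qubits with a given label. -/
def width (l : Fin N → ℕ) (v : ℕ) : ℕ := (Finset.univ.filter fun k => l k = v).card

theorem nrm_czU_truncate (l : Fin N → ℕ) (w : ℕ) :
    nrm ((czU l : Op N) - (czU (keepLabels (fun v => width l v ≤ w) l) : Op N)) ≤
      N * (2 * Real.sqrt ((2⁻¹ : ℝ) ^ w)) := by
  have hs := czU_split (fun v => width l v ≤ w) l
  have e : (czU l : Op N) - (czU (keepLabels (fun v => width l v ≤ w) l) : Op N) =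
      (czU (keepLabels (fun v => width l v ≤ w) l) : Op N) *
        ((czU (keepLabels (fun v => ¬ width l v ≤ w) l) : Op N) - 1) := by
    rw [mul_sub, mul_one]
    congr 1
    rw [hs]
    rfl
  rw [e, nrm_unitary_mul]
  refine nrm_czU_sub_one _ _ fun B hB => ?_
  obtain ⟨j, -, hp, rfl⟩ := (blocks_keepLabels _ _ _).mp hB
  exact (not_le.mp hp).le

/-- Labels `a + 1`, where `a` is the least qubit with the same label. -/
def canon (l : Fin N → ℕ) (j : Fin N) : ℕ :=
  if l j = 0 then 0 else
    ((Finset.univ.filter fun k => l k = l j).min' ⟨j, by simp⟩ : Fin N) + 1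

theorem canon_eq_iff {l : Fin N → ℕ} {j k : Fin N} (hj : l j ≠ 0) :
    canon l k = canon l j ↔ l k = l j := by
  constructor
  · intro h
    unfold canon at h
    rw [if_neg hj] at h
    split_ifs at h with hk
    have h2 := Finset.min'_mem (Finset.univ.filter fun i => l i = l j) ⟨j, by simp⟩
    have h3 := Finset.min'_mem (Finset.univ.filter fun i => l i = l k) ⟨k, by simp⟩
    have h4 := Fin.ext (Nat.succ_injective h)
    rw [← h4] at h2
    rw [Finset.mem_filter] at h2 h3
    rw [← h3.2, h2.2]
  · intro h
    simp only [canon, h]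

theorem blocks_canon (l : Fin N → ℕ) : blocks (canon l) = blocks l := by
  ext B
  rw [mem_blocks, mem_blocks]
  refine exists_congr fun j => ?_
  by_cases hj : l j = 0
  · simp [hj, canon]
  · have : canon l j ≠ 0 := by unfold canon; rw [if_neg hj]; omega
    simp only [hj, this, ne_eq, not_false_eq_true, true_and, canon_eq_iff hj]

theorem exists_canon_eq {l : Fin N → ℕ} {j : Fin N} (hj : canon l j ≠ 0) :
    ∃ a : Fin N, canon l j = a + 1 ∧ canon l a = canon l j := by
  by_cases h : l j = 0
  · simp [canon, h] at hj
  · refine ⟨(Finset.univ.filter fun k => l k = l j).min' ⟨j, by simp⟩, ?_, ?_⟩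
    · unfold canon; rw [if_neg h]
    · rw [canon_eq_iff h]
      have h2 := Finset.min'_mem (Finset.univ.filter fun i => l i = l j) ⟨j, by simp⟩
      exact (Finset.mem_filter.mp h2).2

end Approx

/-! ### Approximation by circuits with narrow `CZ` gates -/

section Circuits

variable {N : ℕ}

theorem smul_unitary {z : ℂ} (hz : ‖z‖ = 1) (U : UN N) :
    z • (U : Op N) ∈ Matrix.unitaryGroup (Fin N → Bool) ℂ := by
  have hzz : z * star z = 1 := by
    rw [Complex.star_def, Complex.mul_conj']; simp [hz]
  rw [Matrix.mem_unitaryGroup_iff, star_smul, smul_mul_smul_comm, hzz,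
    Matrix.mem_unitaryGroup_iff.mp U.2, one_smul]

theorem nrm_mul_sub_smul_le {A A' B B' : UN N} {z z' : ℂ} {a b : ℝ} (hz : ‖z‖ = 1)
    (h : nrm ((A : Op N) - z • (A' : Op N)) ≤ a) (h' : nrm ((B : Op N) - z' • (B' : Op N)) ≤ b) :
    nrm (((A * B : UN N) : Op N) - (z * z') • ((A' * B' : UN N) : Op N)) ≤ a + b := by
  have e : ((A * B : UN N) : Op N) - (z * z') • ((A' * B' : UN N) : Op N) =
      ((A : Op N) - z • (A' : Op N)) * (B : Op N) +
        z • ((A' : Op N) * ((B : Op N) - z' • (B' : Op N))) := by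
    change (A : Op N) * (B : Op N) - (z * z') • ((A' : Op N) * (B' : Op N)) = _
    rw [sub_mul, mul_sub, smul_sub, mul_smul_comm, smul_mul_assoc, smul_smul]
    abel
  rw [e]
  refine (nrm_add_le _ _).trans (add_le_add ?_ ?_)
  · rwa [nrm_mul_unitary]
  · rwa [nrm_smul, hz, one_mul, nrm_unitary_mul]

theorem nrm_conj_sub_smul_le (A B M : UN N) {z : ℂ} (hz : ‖z‖ = 1) :
    nrm (star (A : Op N) * (M : Op N) * (A : Op N) - star (B : Op N) * (M : Op N) * (B : Op N)) ≤
      2 * nrm ((A : Op N) - z • (B : Op N)) := by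
  have h := nrm_conj_sub_le A ⟨z • (B : Op N), smul_unitary hz B⟩ M
  have hzz : star z * z = 1 := by
    rw [Complex.star_def, Complex.conj_mul']; simp [hz]
  have e : (z • (B : Op N))ᴴ * (M : Op N) * (z • (B : Op N)) =
      star (B : Op N) * (M : Op N) * (B : Op N) := by
    rw [← Matrix.star_eq_conjTranspose, star_smul, smul_mul_assoc, smul_mul_smul_comm, hzz,
      one_smul]
  rw [← e]
  exact h

theorem exists_gates_near (u : Fin N → U2) (B : ℕ) (hB : 4 ≤ B) : ∃ (z : ℂ) (g : Fin N → Gate),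
    ‖z‖ = 1 ∧ (∀ j, (g j).Bounded B) ∧
      nrm ((tensorU u : Op N) - z • (tensorU (fun j => (g j).toU2) : Op N)) ≤ N * (4 / B) := by
  choose z g hz hg h using fun j => exists_gate_near (u j) B hB
  refine ⟨∏ j, z j, g, by rw [norm_prod]; simp [hz], hg, ?_⟩
  have hu : ∀ j, z j • (g j).matrix ∈ Matrix.unitaryGroup Bool ℂ := fun j => by
    have hzz : z j * star (z j) = 1 := by
      rw [Complex.star_def, Complex.mul_conj']; simp [hz]
    rw [Matrix.mem_unitaryGroup_iff, star_smul, smul_mul_smul_comm, hzz,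
      Matrix.mem_unitaryGroup_iff.mp (g j).matrix_mem, one_smul]
  have e : (∏ j, z j) • (tensorU (fun j => (g j).toU2) : Op N) =
      (tensorU (fun j => ⟨z j • (g j).matrix, hu j⟩) : Op N) := by
    ext x y
    simp only [coe_tensorU, tensor, Matrix.smul_apply, Matrix.of_apply, smul_eq_mul,
      Gate.toU2, Finset.prod_mul_distrib]
  rw [e]
  refine nrm_tensorU_sub _ _ _ (by positivity) fun j => (h j).trans_eq ?_
  rw [div_pow]; norm_num

/-- Layers of bounded gates and of `CZ` gates of width at most `w`, in a normal form. -/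
def Slot.Narrow (B w : ℕ) (sl : Slot N) : Prop :=
  (∀ j, (sl.1 j).Bounded B) ∧ (∀ b ∈ blocks sl.2, b.card ≤ w) ∧
    ∀ j, sl.2 j ≠ 0 → ∃ a : Fin N, sl.2 j = a + 1 ∧ sl.2 a = sl.2 j

theorem exists_slot_near (u : Fin N → U2) (l : Fin N → ℕ) (B w : ℕ) (hB : 4 ≤ B) :
    ∃ (z : ℂ) (sl : Slot N), ‖z‖ = 1 ∧ sl.Narrow B w ∧
      nrm (((czU l * tensorU u : UN N) : Op N) - z • (slotU sl : Op N)) ≤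
        N * (4 / B) + N * (2 * Real.sqrt ((2⁻¹ : ℝ) ^ w)) := by
  obtain ⟨z, g, hz, hg, h⟩ := exists_gates_near u B hB
  refine ⟨z, (g, canon (keepLabels (fun v => width l v ≤ w) l)), hz,
    ⟨hg, ?_, fun j hj => exists_canon_eq hj⟩, ?_⟩
  · intro b hb
    rw [blocks_canon] at hb
    obtain ⟨j, -, hp, rfl⟩ := (blocks_keepLabels _ _ _).mp hb
    exact hp
  · have h2 := nrm_czU_truncate l w
    rw [← czU_congr (blocks_canon (keepLabels (fun v => width l v ≤ w) l))] at h2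
    rw [← one_smul ℂ (czU (canon (keepLabels (fun v => width l v ≤ w) l)) : Op N)] at h2
    have h3 := nrm_mul_sub_smul_le norm_one h2 h
    rw [one_mul, add_comm] at h3
    exact h3

theorem blocks_zero : blocks (fun _ : Fin N => 0) = ∅ := by
  simp [blocks]

theorem czU_zero : czU (fun _ : Fin N => 0) = 1 := by
  refine Subtype.ext ?_
  rw [coe_czU, blocks_zero]
  exact Matrix.diagonal_one

theorem tensorU_one : tensorU (fun _ : Fin N => (1 : U2)) = 1 := Subtype.ext tensor_one

theorem slotU_id : slotU ((fun _ => idG, fun _ => 0) : Slot N) = 1 := by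
  rw [slotU, czU_zero, one_mul]
  simp only [idG_toU2]
  exact tensorU_one

theorem slotsU_replicate_id (m : ℕ) :
    slotsU (List.replicate m ((fun _ => idG, fun _ => 0) : Slot N)) = 1 := by
  induction m with
  | zero => rfl
  | succ m ih => rw [List.replicate_succ, slotsU_cons, ih, slotU_id, one_mul]

theorem idG_bounded (B : ℕ) : idG.Bounded B := by
  simp only [Gate.Bounded, idG, abs_zero]
  omega

theorem exists_layers_near (ls : List ((Fin N → U2) × (Fin N → ℕ))) (B w : ℕ) (hB : 4 ≤ B) :
    ∃ (z : ℂ) (ls' : List (Slot N)), ‖z‖ = 1 ∧ (∀ sl ∈ ls', sl.Narrow B w) ∧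
      ls'.length = ls.length ∧ nrm ((layersUnitary id ls : Op N) - z • (slotsU ls' : Op N)) ≤
        ls.length * (N * (4 / B) + N * (2 * Real.sqrt ((2⁻¹ : ℝ) ^ w))) := by
  induction ls with
  | nil =>
    refine ⟨1, [], norm_one, by simp, rfl, ?_⟩
    rw [one_smul]
    simp [layersUnitary, nrm_zero]
  | cons l ls ih =>
    obtain ⟨z, ls', hz, h, hlen, hn⟩ := ih
    obtain ⟨z', sl, hz', h', hn'⟩ := exists_slot_near l.1 l.2 B w hB
    refine ⟨z * z', sl :: ls', by rw [norm_mul, hz, hz', one_mul], ?_, by simp [hlen], ?_⟩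
    · intro s hs
      rcases List.mem_cons.mp hs with rfl | hs
      · exact h'
      · exact h s hs
    · have := nrm_mul_sub_smul_le hz hn hn'
      refine this.trans_eq ?_
      push_cast [List.length_cons]
      ring

/-- The total width of light cones of narrow circuits, in both directions. -/
structure NarrowCircuit (B w d : ℕ) (ls : List (Slot N)) : Prop where
  narrow : ∀ sl ∈ ls, sl.Narrow B w
  length : ls.length = d + 1
  cone : ∀ i, (cone {i} ls).card ≤ w ^ d
  load : ∀ q, (Finset.univ.filter fun i => q ∈ QACLearn.cone {i} ls).card ≤ w ^ d

theorem exists_narrow_near (C : QACCircuit N) (B w d : ℕ) (hB : 4 ≤ B) (hw : 1 ≤ w)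
    (hd : C.depth ≤ d) : ∃ (z : ℂ) (ls : List (Slot N)), ‖z‖ = 1 ∧ NarrowCircuit B w d ls ∧
      nrm ((C.unitary : Op N) - z • (slotsU ls : Op N)) ≤
        (d + 1) * (N * (4 / B) + N * (2 * Real.sqrt ((2⁻¹ : ℝ) ^ w))) := by
  obtain ⟨z, ls, hz, hls, hlen, hn⟩ := exists_layers_near C.layers B w hB
  obtain ⟨z', g, hz', hg, hn'⟩ := exists_gates_near C.last B hB
  have hd' : ls.length ≤ d := hlen ▸ hd
  set tl : List (Slot N) := (g, fun _ => 0) ::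
    List.replicate (d - ls.length) ((fun _ => idG, fun _ => 0) : Slot N) with htl
  have htl0 : ∀ sl ∈ tl, sl.2 = fun _ => 0 := by
    intro sl hsl
    rcases List.mem_cons.mp hsl with rfl | h
    · rfl
    · rw [List.eq_of_mem_replicate h]
  have hcone : ∀ i, cone {i} (ls ++ tl) = cone {i} ls := fun i => by
    rw [cone_append, cone_zero _ _ htl0]
  refine ⟨z' * z, ls ++ tl, by rw [norm_mul, hz, hz', one_mul], ⟨?_, ?_, ?_, ?_⟩, ?_⟩
  · intro sl hsl
    rcases List.mem_append.mp hsl with h | h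
    · exact hls sl h
    · refine ⟨?_, ?_, ?_⟩
      · rcases List.mem_cons.mp h with rfl | h
        · exact hg
        · rw [List.eq_of_mem_replicate h]
          exact fun _ => idG_bounded B
      · rw [htl0 sl h, blocks_zero]; simp
      · rw [htl0 sl h]; simp
  · simp [htl]; omega
  · intro i
    rw [hcone]
    have := card_cone_le hw {i} ls fun sl hsl => (hls sl hsl).2.1
    rw [Finset.card_singleton, mul_one] at this
    exact this.trans (Nat.pow_le_pow_right hw hd')
  · intro q
    simp only [hcone]
    exact (card_load_le hw ls (fun sl hsl => (hls sl hsl).2.1) q).trans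
      (Nat.pow_le_pow_right hw hd')
  · have e : slotsU (ls ++ tl) = (tensorU fun j => (g j).toU2) * slotsU ls := by
      rw [slotsU_append, htl, slotsU_cons, slotsU_replicate_id, one_mul, slotU, czU_zero, one_mul]
    rw [e]
    refine (nrm_mul_sub_smul_le hz' hn' hn).trans ?_
    have h1 : (0 : ℝ) ≤ N * (2 * Real.sqrt ((2⁻¹ : ℝ) ^ w)) := by positivity
    have h2 : (C.layers.length : ℝ) ≤ d := by exact_mod_cast hd
    have h3 : (0 : ℝ) ≤ N * (4 / B) := by positivity
    nlinarith

end Circuits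

/-! ### Lists of choices -/

section Sections

variable {α : Type}

theorem secs_cons (N : ℕ) (l : List α) (L : List (List α)) :
    secs N (l :: L) = (l.flatMap fun a => (secs N L).map fun v => a :: v).take N := by
  simp [secs, List.foldl_append]

theorem forall₂_of_mem_secs {N : ℕ} {L : List (List α)} {v : List α} (h : v ∈ secs N L) :
    List.Forall₂ (fun a l => a ∈ l) v L := by
  induction L generalizing v with
  | nil =>
    simp only [secs, List.reverse_nil, List.foldl_nil, List.mem_singleton] at h
    subst h
    exact List.Forall₂.nil
  | cons l L ih =>
    rw [secs_cons] at h
    obtain ⟨a, ha, h⟩ := List.mem_flatMap.mp (List.mem_of_mem_take h)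
    obtain ⟨v', hv', rfl⟩ := List.mem_map.mp h
    exact List.Forall₂.cons ha (ih hv')

/-- There are at most `N` choices, and there is one. -/
def FewChoices (N : ℕ) (L : List (List α)) : Prop :=
  (∀ l ∈ L, l ≠ []) ∧ (L.map List.length).prod ≤ N

theorem FewChoices.tail {N : ℕ} {l : List α} {L : List (List α)} (h : FewChoices N (l :: L)) :
    FewChoices N L := by
  refine ⟨fun l' hl' => h.1 l' (List.mem_cons_of_mem _ hl'), ?_⟩
  have h1 := h.2
  rw [List.map_cons, List.prod_cons] at h1
  have h2 : 1 ≤ l.length := List.length_pos_iff.mpr (h.1 l List.mem_cons_self)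
  nlinarith [Nat.zero_le (L.map List.length).prod]

theorem secs_length {N : ℕ} {L : List (List α)} (h : FewChoices N L) :
    (secs N L).length = (L.map List.length).prod ∧
      ∀ l, FewChoices N (l :: L) → secs N (l :: L) =
        l.flatMap fun a => (secs N L).map fun v => a :: v := by
  have key : ∀ L' : List (List α), (secs N L').length = (L'.map List.length).prod →
      ∀ l, FewChoices N (l :: L') → secs N (l :: L') =
        l.flatMap fun a => (secs N L').map fun v => a :: v := by
    intro L' hL' l hl
    rw [secs_cons, List.take_of_length_le]
    have h2 := hl.2
    rw [List.map_cons, List.prod_cons] at h2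
    simp only [List.length_flatMap, List.length_map, hL', List.map_const', List.sum_replicate,
      smul_eq_mul]
    exact h2
  have hl : (secs N L).length = (L.map List.length).prod := by
    induction L with
    | nil => simp [secs]
    | cons l L ih =>
      rw [key L (ih h.tail) l h]
      simp only [List.length_flatMap, List.length_map, ih h.tail, List.map_const',
        List.sum_replicate, smul_eq_mul, List.map_cons, List.prod_cons]
  exact ⟨hl, key L hl⟩

theorem mem_secs {N : ℕ} {L : List (List α)} (h : FewChoices N L) {v : List α} :
    v ∈ secs N L ↔ List.Forall₂ (fun a l => a ∈ l) v L := by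
  refine ⟨forall₂_of_mem_secs, fun hv => ?_⟩
  induction hv with
  | nil => simp [secs]
  | cons ha _ ih =>
    rw [(secs_length h.tail).2 _ h]
    exact List.mem_flatMap.mpr ⟨_, ha, List.mem_map.mpr ⟨_, ih h.tail, rfl⟩⟩

theorem secs_nodup {N : ℕ} {L : List (List α)} (h : FewChoices N L) (hL : ∀ l ∈ L, l.Nodup) :
    (secs N L).Nodup := by
  induction L with
  | nil => simp [secs]
  | cons l L ih =>
    rw [(secs_length h.tail).2 _ h, List.nodup_flatMap]
    refine ⟨fun a _ => (ih h.tail fun l' hl' => hL l' (List.mem_cons_of_mem _ hl')).map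
      (List.cons_injective), ?_⟩
    refine (hL l List.mem_cons_self).pairwise_of_forall_ne fun a _ b _ hab => ?_
    intro v hv hv'
    obtain ⟨v1, -, rfl⟩ := List.mem_map.mp hv
    obtain ⟨v2, -, e⟩ := List.mem_map.mp hv'
    exact hab (List.cons.inj e).1.symm

theorem forall₂_ofFn {n : ℕ} {c : Fin n → List α} {v : List α} :
    List.Forall₂ (fun a l => a ∈ l) v (List.ofFn c) ↔
      ∃ f : Fin n → α, v = List.ofFn f ∧ ∀ j, f j ∈ c j := by
  rw [List.forall₂_iff_get]
  constructor
  · rintro ⟨hl, h⟩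
    rw [List.length_ofFn] at hl
    subst hl
    refine ⟨fun j => v.get j, (List.ofFn_get v).symm, fun j => ?_⟩
    have := h j.1 j.2 (by simp)
    simpa using this
  · rintro ⟨f, rfl, h⟩
    refine ⟨by simp, fun i h1 h2 => ?_⟩
    have := h ⟨i, by simpa using h1⟩
    simpa using this

theorem secs_sum {M : Type} [AddCommMonoid M] [DecidableEq α] {N n : ℕ} {c : Fin n → List α}
    (h : FewChoices N (List.ofFn c)) (hc : ∀ j, (c j).Nodup) (g : List α → M) :
    ((secs N (List.ofFn c)).map g).sum =
      ∑ f ∈ Fintype.piFinset fun j => (c j).toFinset, g (List.ofFn f) := by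
  have hn : (secs N (List.ofFn c)).Nodup := secs_nodup h fun l hl => by
    obtain ⟨j, rfl⟩ := (List.mem_ofFn' c l).mp hl
    exact hc j
  rw [← List.sum_toFinset g hn]
  have e : (secs N (List.ofFn c)).toFinset =
      (Fintype.piFinset fun j => (c j).toFinset).image List.ofFn := by
    ext v
    rw [List.mem_toFinset, mem_secs h, forall₂_ofFn, Finset.mem_image]
    refine exists_congr fun f => ?_
    rw [Fintype.mem_piFinset]
    simp only [List.mem_toFinset]
    constructor
    · rintro ⟨rfl, h⟩; exact ⟨h, rfl⟩
    · rintro ⟨h, rfl⟩; exact ⟨rfl, h⟩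
  rw [e, Finset.sum_image fun f _ g _ h => List.ofFn_injective h]

theorem any_beq {A : List ℕ} {j : ℕ} : (A.any fun a => Nat.beq a j) = decide (j ∈ A) := by
  rw [Bool.eq_iff_iff, List.any_eq_true, decide_eq_true_iff]
  constructor
  · rintro ⟨a, ha, h⟩
    rwa [← Nat.eq_of_beq_eq_true h]
  · intro h
    exact ⟨j, h, Nat.beq_refl j⟩

theorem map_range_eq_ofFn {n : ℕ} (f : ℕ → α) :
    (List.range n).map f = List.ofFn fun j : Fin n => f j := by
  refine List.ext_get (by simp) fun i h1 h2 => by simp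

theorem choices_eq {n : ℕ} {A : List ℕ} {full : List α} {a : α} :
    choices n A full a = List.ofFn fun j : Fin n => if (j : ℕ) ∈ A then full else [a] := by
  rw [choices, map_range_eq_ofFn]
  congr 1
  funext j
  rw [any_beq]
  by_cases h : (j : ℕ) ∈ A <;> simp [h]

/-- The qubits in a list. -/
def supp (n : ℕ) (A : List ℕ) : Finset (Fin n) := Finset.univ.filter fun j => (j : ℕ) ∈ A

theorem mem_supp {n : ℕ} {A : List ℕ} {j : Fin n} : j ∈ supp n A ↔ (j : ℕ) ∈ A := by
  simp [supp]

theorem card_supp_le (n : ℕ) (A : List ℕ) : (supp n A).card ≤ A.length := by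
  have : ((supp n A).image fun j : Fin n => (j : ℕ)) ⊆ A.toFinset := by
    intro a ha
    obtain ⟨j, hj, rfl⟩ := Finset.mem_image.mp ha
    exact List.mem_toFinset.mpr (mem_supp.mp hj)
  have h2 := Finset.card_le_card this
  rw [Finset.card_image_of_injective _ Fin.val_injective] at h2
  exact h2.trans (List.toFinset_card_le A)

theorem fewChoices_choices {N n : ℕ} {A : List ℕ} {full : List α} {a : α} (hf : full ≠ [])
    (hN : full.length ^ A.length ≤ N) : FewChoices N (choices n A full a) := by
  rw [choices_eq]
  constructor
  · intro l hl
    obtain ⟨j, rfl⟩ := (List.mem_ofFn' _ l).mp hl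
    dsimp only
    split_ifs
    · exact hf
    · simp
  · refine le_trans ?_ hN
    rw [List.map_ofFn, List.prod_ofFn]
    have e : ∀ j : Fin n, (List.length ∘ fun j : Fin n => if (j : ℕ) ∈ A then full else [a]) j =
        if j ∈ supp n A then full.length else 1 := by
      intro j
      simp only [Function.comp, mem_supp]
      split_ifs <;> simp
    simp only [e]
    rw [Finset.prod_ite_mem, Finset.univ_inter, Finset.prod_const]
    exact Nat.pow_le_pow_right (List.length_pos_iff.mpr hf) (card_supp_le n A)

theorem mem_choices_iff {n : ℕ} {A : List ℕ} {full : List α} {a : α} {v : List α} :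
    List.Forall₂ (fun a l => a ∈ l) v (choices n A full a) ↔ ∃ f : Fin n → α, v = List.ofFn f ∧
      ∀ j : Fin n, ((j : ℕ) ∈ A → f j ∈ full) ∧ ((j : ℕ) ∉ A → f j = a) := by
  rw [choices_eq, forall₂_ofFn]
  refine exists_congr fun f => and_congr Iff.rfl (forall_congr' fun j => ?_)
  by_cases h : (j : ℕ) ∈ A <;> simp [h]

/-- Basis states that vanish outside of `A`. -/
def wset (n : ℕ) (A : List ℕ) : Finset (Fin n → Bool) :=
  Fintype.piFinset fun j => if (j : ℕ) ∈ A then Finset.univ else {false}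

/-- Pauli strings that are trivial outside of `A`. -/
def qset (n : ℕ) (A : List ℕ) : Finset (Fin n → ℕ) :=
  Fintype.piFinset fun j => if (j : ℕ) ∈ A then {0, 1, 2, 3} else {0}

theorem words_sum {M : Type} [AddCommMonoid M] {N n : ℕ} {A : List ℕ} (h : 2 ^ A.length ≤ N)
    (g : List Bool → M) : ((words N n A).map g).sum = ∑ x ∈ wset n A, g (List.ofFn x) := by
  have hf : FewChoices N (choices n A [false, true] false) := fewChoices_choices (by simp) h
  rw [words, wset]
  rw [choices_eq] at hf ⊢
  rw [secs_sum hf]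
  · refine Finset.sum_congr ?_ fun _ _ => rfl
    congr 1
    funext j
    split_ifs
    · decide
    · rfl
  · intro j; split_ifs <;> simp

theorem pwords_sum {M : Type} [AddCommMonoid M] {N n : ℕ} {A : List ℕ} (h : 4 ^ A.length ≤ N)
    (g : List ℕ → M) : ((pwords N n A).map g).sum = ∑ q ∈ qset n A, g (List.ofFn q) := by
  have hf : FewChoices N (choices n A [0, 1, 2, 3] 0) := fewChoices_choices (by simp) h
  rw [pwords, qset]
  rw [choices_eq] at hf ⊢
  rw [secs_sum hf]
  · refine Finset.sum_congr ?_ fun _ _ => rfl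
    congr 1
    funext j
    split_ifs
    · rfl
    · rfl
  · intro j; split_ifs <;> simp

theorem mem_pwords {N n : ℕ} {A : List ℕ} {v : List ℕ} (h : v ∈ pwords N n A) :
    ∃ f : Fin n → ℕ, v = List.ofFn f ∧ ∀ j, f j ≤ 3 := by
  obtain ⟨f, rfl, hf⟩ := mem_choices_iff.mp (forall₂_of_mem_secs h)
  refine ⟨f, rfl, fun j => ?_⟩
  by_cases hj : (j : ℕ) ∈ A
  · have := (hf j).1 hj
    simp at this
    omega
  · rw [(hf j).2 hj]; omega

end Sections

/-! ### Candidates -/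

/-- The entries of a gate. -/
def gdat (g : Gate) : List ℤ := [g.a, g.b, g.c, g.d]

/-- The lists that represent a layer. -/
def raw {n : ℕ} (sl : Slot n) : RSlot := (List.ofFn fun j => gdat (sl.1 j), List.ofFn sl.2)

/-- Layers that act on the qubits in `A` only. -/
structure Slot.On {n : ℕ} (b : ℕ) (A : List ℕ) (sl : Slot n) : Prop where
  bounded : ∀ j, (sl.1 j).Bounded b
  gate : ∀ j : Fin n, (j : ℕ) ∉ A → sl.1 j = idG
  label : ∀ j : Fin n, (j : ℕ) ∉ A → sl.2 j = 0
  label_mem : ∀ j : Fin n, sl.2 j = 0 ∨ ∃ a ∈ A, sl.2 j = a + 1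

theorem mem_gateList {b : ℕ} {l : List ℤ} :
    l ∈ gateList b ↔ ∃ g : Gate, g.Bounded b ∧ gdat g = l := by
  have hi : ∀ x : ℤ, x ∈ intRange b ↔ |x| ≤ b := by
    intro x
    simp only [intRange, List.mem_map, List.mem_range]
    constructor
    · rintro ⟨j, hj, rfl⟩
      rw [abs_le]; omega
    · intro h
      obtain ⟨h1, h2⟩ := abs_le.mp h
      exact ⟨(x + b).toNat, by omega, by omega⟩
  simp only [gateList, List.mem_flatMap, List.mem_map, hi, List.mem_range]
  constructor
  · rintro ⟨a, ha, x, hx, y, hy, z, hz, rfl⟩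
    exact ⟨⟨((a + 1 : ℕ) : ℤ), x, y, z, by positivity⟩, ⟨by push_cast; omega, by push_cast; omega, hx, hy, hz⟩, rfl⟩
  · rintro ⟨g, ⟨h1, h2, h3, h4, h5⟩, rfl⟩
    refine ⟨(g.a - 1).toNat, by omega, g.b, h3, g.c, h4, g.d, h5, ?_⟩
    have : (((g.a - 1).toNat + 1 : ℕ) : ℤ) = g.a := by omega
    rw [this, gdat]

theorem gateList_length (b : ℕ) : (gateList b).length = (b + 1) * (2 * b + 1) ^ 3 := by
  have hi : (intRange b).length = 2 * b + 1 := by simp [intRange]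
  simp only [gateList, List.length_flatMap, List.length_map, hi, List.map_const', List.sum_replicate,
    List.length_range, smul_eq_mul]
  ring

theorem exists_slot_of_mem {N n b : ℕ} {A : List ℕ} {r : RSlot} (h : r ∈ slotList N n b A) :
    ∃ sl : Slot n, raw sl = r ∧ sl.On b A := by
  simp only [slotList, List.mem_flatMap, List.mem_map] at h
  obtain ⟨g, hg, l, hl, rfl⟩ := h
  obtain ⟨f, rfl, hf⟩ := mem_choices_iff.mp (forall₂_of_mem_secs hg)
  obtain ⟨l, rfl, hl'⟩ := mem_choices_iff.mp (forall₂_of_mem_secs hl)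
  have hg : ∀ j, ∃ g : Gate, gdat g = f j ∧ g.Bounded b ∧ ((j : ℕ) ∉ A → g = idG) := by
    intro j
    by_cases hj : (j : ℕ) ∈ A
    · obtain ⟨g, h1, h2⟩ := mem_gateList.mp ((hf j).1 hj)
      exact ⟨g, h2, h1, fun h => absurd hj h⟩
    · exact ⟨idG, ((hf j).2 hj).symm, idG_bounded b, fun _ => rfl⟩
  choose g hg hb hid using hg
  refine ⟨(g, l), ?_, ⟨hb, hid, fun j hj => (hl' j).2 hj, fun j => ?_⟩⟩
  · simp only [raw, hg]
  · by_cases hj : (j : ℕ) ∈ A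
    · have := (hl' j).1 hj
      rw [List.mem_cons, List.mem_map] at this
      rcases this with h | ⟨a, ha, h⟩
      · exact Or.inl h
      · exact Or.inr ⟨a, ha, h.symm⟩
    · exact Or.inl ((hl' j).2 hj)

theorem exists_slots_of_mem {N n b : ℕ} {A : List ℕ} {D : ℕ} {V : List RSlot}
    (h : V ∈ vcands N n b A D) : ∃ ls : List (Slot n), ls.map raw = V ∧ ls.length = D ∧
      ∀ sl ∈ ls, sl.On b A := by
  induction D generalizing V with
  | zero =>
    rw [vcands, List.mem_singleton] at h
    exact ⟨[], h.symm ▸ rfl, rfl, by simp⟩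
  | succ D ih =>
    simp only [vcands, List.mem_flatMap, List.mem_map] at h
    obtain ⟨r, hr, V, hV, rfl⟩ := h
    obtain ⟨sl, rfl, hsl⟩ := exists_slot_of_mem hr
    obtain ⟨ls, rfl, hlen, hls⟩ := ih hV
    refine ⟨sl :: ls, rfl, by simp [hlen], fun s hs => ?_⟩
    rcases List.mem_cons.mp hs with rfl | hs
    · exact hsl
    · exact hls s hs

theorem raw_mem_slotList {N n b : ℕ} {A : List ℕ} (hb : ((b + 1) * (2 * b + 1) ^ 3) ^ A.length ≤ N)
    (hl : (A.length + 1) ^ A.length ≤ N) {sl : Slot n} (h : sl.On b A) :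
    raw sl ∈ slotList N n b A := by
  simp only [slotList, List.mem_flatMap, List.mem_map]
  refine ⟨_, ?_, _, ?_, rfl⟩
  · rw [mem_secs (fewChoices_choices ?_ (by rwa [gateList_length])), mem_choices_iff]
    · refine ⟨_, rfl, fun j => ⟨fun _ => mem_gateList.mpr ⟨_, h.bounded j, rfl⟩, fun hj => ?_⟩⟩
      rw [h.gate j hj]; rfl
    · exact List.ne_nil_of_mem (mem_gateList.mpr ⟨idG, idG_bounded b, rfl⟩)
  · rw [mem_secs (fewChoices_choices (by simp) (by simpa using hl)), mem_choices_iff]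
    refine ⟨_, rfl, fun j => ⟨fun _ => ?_, h.label j⟩⟩
    rw [List.mem_cons, List.mem_map]
    rcases h.label_mem j with h | ⟨a, ha, h⟩
    · exact Or.inl h
    · exact Or.inr ⟨a, ha, h.symm⟩

theorem raw_mem_vcands {N n b : ℕ} {A : List ℕ} (hb : ((b + 1) * (2 * b + 1) ^ 3) ^ A.length ≤ N)
    (hl : (A.length + 1) ^ A.length ≤ N) {ls : List (Slot n)} (h : ∀ sl ∈ ls, sl.On b A) :
    ls.map raw ∈ vcands N n b A ls.length := by
  induction ls with
  | nil => simp [vcands]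
  | cons sl ls ih =>
    simp only [List.length_cons, vcands, List.mem_flatMap, List.mem_map]
    exact ⟨raw sl, raw_mem_slotList hb hl (h sl List.mem_cons_self), ls.map raw,
      ih fun s hs => h s (List.mem_cons_of_mem _ hs), rfl⟩

/-! ### Exact evaluation of candidates -/

section Semantics

local notation "toC" => GaussianInt.toComplex

theorem clipG_eq {N : ℕ} {z : GaussianInt} (h : ‖toC z‖ ≤ N) : clipG N z = z := by
  have h1 : |(z.re : ℝ)| ≤ N := by
    have := Complex.abs_re_le_norm (toC z)
    rw [← GaussianInt.intCast_re] at this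
    exact this.trans h
  have h2 : |(z.im : ℝ)| ≤ N := by
    have := Complex.abs_im_le_norm (toC z)
    rw [← GaussianInt.intCast_im] at this
    exact this.trans h
  have key : ∀ x : ℤ, |(x : ℝ)| ≤ N → clipZ N x = x := by
    intro x hx
    have : x.natAbs ≤ N := by
      have : ((x.natAbs : ℕ) : ℝ) ≤ N := by rwa [Nat.cast_natAbs, Int.cast_abs]
      exact_mod_cast this
    rw [clipZ, Nat.ble_eq.mpr this, cond_true]
  rw [clipG, key _ h1, key _ h2]

theorem gprod_eq {N : ℕ} {l : List GaussianInt}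
    (h : (l.map fun z => max 1 ‖toC z‖).prod ≤ N) : gprod N l = l.prod := by
  have hp : ∀ l : List GaussianInt, 0 ≤ (l.map fun z => max 1 ‖toC z‖).prod ∧
      ‖toC l.prod‖ ≤ (l.map fun z => max 1 ‖toC z‖).prod := by
    intro l
    induction l with
    | nil => simp
    | cons z l ih =>
      simp only [List.map_cons, List.prod_cons]
      refine ⟨mul_nonneg (zero_le_one.trans (le_max_left _ _)) ih.1, ?_⟩
      rw [map_mul, norm_mul]
      exact mul_le_mul (le_max_right _ _) ih.2 (norm_nonneg _)
        (zero_le_one.trans (le_max_left _ _))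
  induction l using List.reverseRecOn with
  | nil => rfl
  | append_singleton l z ih =>
    have h1 : (l.map fun z => max 1 ‖toC z‖).prod ≤ N := by
      refine le_trans ?_ h
      rw [List.map_append, List.prod_append, List.map_singleton, List.prod_singleton]
      exact le_mul_of_one_le_right (hp l).1 (le_max_left _ _)
    have e : gprod N (l ++ [z]) = clipG N (gprod N l * z) := by
      simp [gprod, List.foldl_append]
    rw [e, ih h1, List.prod_append, List.prod_singleton]
    refine clipG_eq (le_trans ?_ h)
    have := (hp (l ++ [z])).2
    rwa [List.prod_append, List.prod_singleton] at this

theorem gprod_ofFn {N n : ℕ} {f : Fin n → GaussianInt} (h : ∏ j, max 1 ‖toC (f j)‖ ≤ N) :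
    toC (gprod N (List.ofFn f)) = ∏ j, toC (f j) := by
  rw [gprod_eq, List.prod_ofFn, map_prod]
  rw [List.map_ofFn, List.prod_ofFn]
  exact h

theorem Gate.norm_pos (g : Gate) : 0 < g.norm := Real.sqrt_pos.mpr (by exact_mod_cast g.pos)

theorem toC_gent (g : Gate) (x y : Bool) : toC (gent (gdat g) x y) = g.norm * g.matrix x y := by
  have hn : (g.norm : ℂ) ≠ 0 := by exact_mod_cast g.norm_pos.ne'
  cases x <;> cases y <;>
    simp [gent, gdat, Gate.matrix, GaussianInt.toComplex_def, hn, sub_eq_add_neg]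

theorem toC_gent_le {b : ℕ} {g : Gate} (h : g.Bounded b) (x y : Bool) :
    max 1 ‖toC (gent (gdat g) x y)‖ ≤ ((2 * b + 1 : ℕ) : ℝ) := by
  obtain ⟨h1, h2, h3, h4, h5⟩ := h
  have ha : |(g.a : ℝ)| ≤ b + 1 := by
    rw [abs_of_nonneg (by exact_mod_cast (by omega : 0 ≤ g.a))]; exact_mod_cast h2
  have hb : |(g.b : ℝ)| ≤ b := by exact_mod_cast h3
  have hc : |(g.c : ℝ)| ≤ b := by exact_mod_cast h4
  have hd : |(g.d : ℝ)| ≤ b := by exact_mod_cast h5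
  have hz : ∀ z : GaussianInt, |(z.re : ℝ)| ≤ b + 1 → |(z.im : ℝ)| ≤ b →
      ‖toC z‖ ≤ 2 * b + 1 := by
    intro z h1 h2
    have := Complex.norm_le_abs_re_add_abs_im (toC z)
    rw [← GaussianInt.intCast_re, ← GaussianInt.intCast_im] at this
    linarith
  refine max_le (by push_cast; linarith [(Nat.cast_nonneg b : (0 : ℝ) ≤ b)]) ?_
  push_cast
  cases x <;> cases y <;> refine hz _ ?_ ?_ <;> simp [gent, gdat] <;> linarith

theorem max_idG (x y : Bool) : max 1 ‖toC (gent (gdat idG) x y)‖ = 1 := by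
  cases x <;> cases y <;> simp [gent, gdat, idG, GaussianInt.toComplex_def]

theorem tgate_eq {N n b : ℕ} {A : List ℕ} (hN : (2 * b + 1) ^ A.length ≤ N) {g : Fin n → Gate}
    (hb : ∀ j, (g j).Bounded b) (hg : ∀ j : Fin n, (j : ℕ) ∉ A → g j = idG) (x y : Fin n → Bool) :
    toC (tgate N (List.ofFn fun j => gdat (g j)) (List.ofFn x) (List.ofFn y)) =
      (∏ j, ((g j).norm : ℂ)) * (tensorU (fun j => (g j).toU2) : Op n) x y := by
  rw [tgate, zip_ofFn, zip_ofFn, List.map_ofFn, gprod_ofFn]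
  · rw [coe_tensorU, tensor, Matrix.of_apply, ← Finset.prod_mul_distrib]
    refine Finset.prod_congr rfl fun j _ => ?_
    exact toC_gent _ _ _
  · refine le_trans ?_ (Nat.cast_le.mpr hN)
    have h1 : ∏ j, max 1 ‖toC (((fun p : List ℤ × Bool × Bool => gent p.1 p.2.1 p.2.2) ∘ fun i =>
        (gdat (g i), x i, y i)) j)‖ ≤ ∏ j, if j ∈ supp n A then ((2 * b + 1 : ℕ) : ℝ) else 1 := by
      refine Finset.prod_le_prod (fun j _ => zero_le_one.trans (le_max_left _ _)) fun j _ => ?_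
      simp only [Function.comp]
      split_ifs with hj
      · exact toC_gent_le (hb j) _ _
      · rw [hg j (mt mem_supp.mpr hj), max_idG]
    refine h1.trans ?_
    rw [Finset.prod_ite_mem, Finset.univ_inter, Finset.prod_const]
    push_cast
    exact pow_le_pow_right₀ (by linarith [(Nat.cast_nonneg b : (0 : ℝ) ≤ b)]) (card_supp_le n A)

theorem pmat_zero : pmat 0 = 1 := rfl

theorem pmat_one : pmat 1 = Pauli.X.matrix := rfl

theorem pmat_two : pmat 2 = Pauli.Y.matrix := rfl

theorem pmat_three (k : ℕ) : pmat (k + 3) = Pauli.Z.matrix := rfl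

theorem toC_pent (k : ℕ) (x y : Bool) : toC (pent k x y) = pmat k x y := by
  rcases k with _ | _ | _ | k <;>
    simp only [zero_add, Nat.reduceAdd, pmat_zero, pmat_one, pmat_two, pmat_three] <;>
    cases x <;> cases y <;>
    simp [pent, Pauli.matrix, GaussianInt.toComplex_def, Nat.beq]

theorem max_pent (k : ℕ) (x y : Bool) : max 1 ‖toC (pent k x y)‖ = 1 := by
  rw [toC_pent]
  rcases k with _ | _ | _ | k <;>
    simp only [zero_add, Nat.reduceAdd, pmat_zero, pmat_one, pmat_two, pmat_three] <;>
    cases x <;> cases y <;> simp [Pauli.matrix]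

theorem tpauli_eq {N n : ℕ} (hN : 1 ≤ N) (q : Fin n → ℕ) (x y : Fin n → Bool) :
    toC (tpauli N (List.ofFn q) (List.ofFn x) (List.ofFn y)) =
      (tensor (fun j => pmat (q j)) : Op n) x y := by
  rw [tpauli, zip_ofFn, zip_ofFn, List.map_ofFn, gprod_ofFn]
  · rw [tensor, Matrix.of_apply]
    exact Finset.prod_congr rfl fun j _ => toC_pent _ _ _
  · simp only [Function.comp, max_pent]
    rw [Finset.prod_const_one]
    exact_mod_cast hN

theorem sgn_eq {n : ℕ} {l : Fin n → ℕ} (hl : ∀ j, l j ≤ n) (x : Fin n → Bool) :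
    toC (sgn n (List.ofFn l) (List.ofFn x)) = czSign l x := by
  have h1 : ∀ b : Bool, toC (bif b then ⟨-1, 0⟩ else ⟨1, 0⟩) = bsign b := by
    intro b; cases b <;> simp [bsign, GaussianInt.toComplex_def]
  rw [sgn, h1, bsign_parity, List.map_map, czSign]
  have h2 : ((List.range n).map (bsign ∘ fun v => ((List.ofFn l).any fun m => Nat.beq m (v + 1)) &&
      ((List.ofFn l).zip (List.ofFn x)).all fun p => !(Nat.beq p.1 (v + 1)) || p.2)).prod =
      ∏ v ∈ Finset.range n, if (∃ j, l j = v + 1) ∧ ∀ j, l j = v + 1 → x j = true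
        then (-1 : ℂ) else 1 := by
    rw [← List.prod_toFinset _ List.nodup_range, List.toFinset_range]
    refine Finset.prod_congr rfl fun v _ => ?_
    have e : (((List.ofFn l).any fun m => Nat.beq m (v + 1)) &&
      ((List.ofFn l).zip (List.ofFn x)).all fun p => !(Nat.beq p.1 (v + 1)) || p.2) =
        decide ((∃ j, l j = v + 1) ∧ ∀ j, l j = v + 1 → x j = true) := by
      have hb : ∀ a c : ℕ, Nat.beq a c = decide (a = c) := by
        intro a c
        rw [Bool.eq_iff_iff, decide_eq_true_iff]
        exact ⟨Nat.eq_of_beq_eq_true, fun h => h ▸ Nat.beq_refl a⟩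
      rw [Bool.eq_iff_iff, Bool.and_eq_true, decide_eq_true_iff, List.any_eq_true, zip_ofFn,
        List.all_eq_true]
      simp only [List.mem_ofFn, hb, decide_eq_true_iff]
      refine and_congr ?_ ?_
      · simp
      · constructor
        · intro h j hj
          simpa [hj] using h _ ⟨j, rfl⟩
        · rintro h _ ⟨j, rfl⟩
          by_cases hj : l j = v + 1
          · simp [h j hj]
          · simp [hj]
    rw [Function.comp, e]
    by_cases h : (∃ j, l j = v + 1) ∧ ∀ j, l j = v + 1 → x j = true
    · rw [if_pos h, decide_eq_true h]; rfl
    · rw [if_neg h, decide_eq_false h]; rfl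
  rw [h2]
  have h3 : (Finset.univ.image l).erase 0 ⊆ (Finset.range n).image (· + 1) := by
    intro v hv
    obtain ⟨h0, hv⟩ := Finset.mem_erase.mp hv
    obtain ⟨j, -, rfl⟩ := Finset.mem_image.mp hv
    refine Finset.mem_image.mpr ⟨l j - 1, ?_, by omega⟩
    have := hl j
    rw [Finset.mem_range]
    omega
  have h4 : ∏ v ∈ Finset.range n, (if (∃ j, l j = v + 1) ∧ ∀ j, l j = v + 1 → x j = true
        then (-1 : ℂ) else 1) = ∏ v ∈ (Finset.range n).image (· + 1),
          if (∃ j, l j = v) ∧ ∀ j, l j = v → x j = true then (-1 : ℂ) else 1 := by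
    rw [Finset.prod_image fun a _ b _ h => Nat.succ_injective h]
  rw [h4, ← Finset.prod_subset h3]
  · refine Finset.prod_congr rfl fun v hv => ?_
    obtain ⟨h0, hv⟩ := Finset.mem_erase.mp hv
    obtain ⟨j, -, rfl⟩ := Finset.mem_image.mp hv
    have : (∃ i, l i = l j) := ⟨j, rfl⟩
    simp only [this, true_and]
  · intro v hv hv'
    rw [if_neg]
    rintro ⟨⟨j, rfl⟩, -⟩
    refine hv' (Finset.mem_erase.mpr ⟨?_, Finset.mem_image.mpr ⟨j, Finset.mem_univ _, rfl⟩⟩)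
    obtain ⟨v, -, e⟩ := Finset.mem_image.mp hv
    omega

variable {n : ℕ}

theorem Slot.On.label_zero_or {b : ℕ} {A : List ℕ} {sl : Slot n} (h : sl.On b A) (j : Fin n)
    (h0 : sl.2 j ≠ 0) : (j : ℕ) ∈ A := by
  by_contra hj
  exact h0 (h.label j hj)

theorem Slot.On.mem_loc {b : ℕ} {A : List ℕ} {sl : Slot n} (h : sl.On b A) :
    (slotU sl : Op n) ∈ loc (supp n A) := by
  refine mul_mem (czU_mem_loc fun B hB => ?_) (tensor_mem_loc fun j hj => ?_)
  · obtain ⟨j, hj, rfl⟩ := mem_blocks.mp hB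
    intro k hk
    rw [Finset.mem_filter] at hk
    exact mem_supp.mpr (h.label_zero_or k (hk.2 ▸ hj))
  · dsimp only
    rw [h.gate j (mt mem_supp.mpr hj), idG_toU2]
    rfl

theorem slotsU_mem_loc {b : ℕ} {A : List ℕ} {ls : List (Slot n)} (h : ∀ sl ∈ ls, sl.On b A) :
    (slotsU ls : Op n) ∈ loc (supp n A) := by
  induction ls with
  | nil => exact one_mem _
  | cons sl ls ih =>
    exact mul_mem (ih fun s hs => h s (List.mem_cons_of_mem _ hs)) (h sl List.mem_cons_self).mem_loc

/-- The normalization of the gates of a circuit. -/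
noncomputable def scale (ls : List (Slot n)) : ℝ := (ls.map fun sl => ∏ j, (sl.1 j).norm).prod

theorem scale_pos (ls : List (Slot n)) : 0 < scale ls := by
  induction ls with
  | nil => simp [scale]
  | cons sl ls ih =>
    rw [scale, List.map_cons, List.prod_cons]
    exact mul_pos (Finset.prod_pos fun j _ => (sl.1 j).norm_pos) ih

theorem mem_wset {A : List ℕ} {x : Fin n → Bool} :
    x ∈ wset n A ↔ ∀ j : Fin n, (j : ℕ) ∉ A → x j = false := by
  rw [wset, Fintype.mem_piFinset]
  refine forall_congr' fun j => ?_
  by_cases h : (j : ℕ) ∈ A <;> simp [h]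

theorem sum_wset {A : List ℕ} {M M' : Op n} (hM : M ∈ loc (supp n A)) {x y : Fin n → Bool}
    (hx : x ∈ wset n A) : ∑ z ∈ wset n A, M x z * M' z y = (M * M') x y := by
  rw [Matrix.mul_apply]
  refine Finset.sum_subset (Finset.subset_univ _) fun z _ hz => ?_
  rw [mem_wset] at hz
  push Not at hz
  obtain ⟨j, hj, hzj⟩ := hz
  rw [entry_eq_zero_of_mem_loc hM (mt mem_supp.mp hj), zero_mul]
  rw [mem_wset.mp hx j hj]
  exact fun h => hzj h.symm

/-- The fuel suffices for computations on `A`. -/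
structure Fuel (N n b : ℕ) (A : List ℕ) : Prop where
  lt : ∀ a ∈ A, a < n
  gates : (2 * b + 1) ^ A.length ≤ N
  paulis : 4 ^ A.length ≤ N

variable {N b : ℕ} {A : List ℕ}

theorem Fuel.one_le (h : Fuel N n b A) : 1 ≤ N := (Nat.one_le_pow _ _ (by norm_num)).trans h.paulis

theorem Fuel.words (h : Fuel N n b A) : 2 ^ A.length ≤ N :=
  (Nat.pow_le_pow_left (by norm_num) _).trans h.paulis

theorem vent_eq (hF : Fuel N n b A) {ls : List (Slot n)} (h : ∀ sl ∈ ls, sl.On b A)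
    {x : Fin n → Bool} (hx : x ∈ wset n A) (y : Fin n → Bool) :
    toC (vent N n (words N n A) ls.length (ls.map raw) (List.ofFn x) (List.ofFn y)) =
      scale ls * (slotsU ls : Op n) x y := by
  induction ls generalizing y with
  | nil =>
    rw [List.length_nil, vent, List.map_ofFn]
    have : (fun _ => 0) ∘ x = fun _ : Fin n => 0 := rfl
    rw [this, tpauli_eq hF.one_le]
    have e : (tensor (fun _ : Fin n => pmat 0) : Op n) = 1 := tensor_one
    rw [e]
    simp [scale, layersUnitary]
  | cons sl ls ih =>
    have hsl := h sl List.mem_cons_self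
    rw [List.length_cons, vent, words_sum hF.words, map_sum, slotsU_cons]
    have h1 : ∀ z ∈ wset n A, toC (vent N n (words N n A) ls.length ((sl :: ls).map raw).tail
        (List.ofFn x) (List.ofFn z) * (sgn n (((sl :: ls).map raw).headD ([], [])).2 (List.ofFn z) *
        tgate N (((sl :: ls).map raw).headD ([], [])).1 (List.ofFn z) (List.ofFn y))) =
        scale (sl :: ls) * ((slotsU ls : Op n) x z * (slotU sl : Op n) z y) := by
      intro z _
      rw [map_mul, map_mul, List.map_cons, List.tail_cons, List.headD_cons,
        ih fun s hs => h s (List.mem_cons_of_mem _ hs)]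
      have e1 : toC (sgn n (raw sl).2 (List.ofFn z)) = czSign sl.2 z := sgn_eq (fun j => by
        rcases hsl.label_mem j with h | ⟨a, ha, h⟩
        · omega
        · have := hF.lt a ha; omega) z
      have e2 := tgate_eq hF.gates hsl.bounded hsl.gate z y
      have e3 : (slotU sl : Op n) z y =
          czSign sl.2 z * (tensorU (fun j => (sl.1 j).toU2) : Op n) z y := by
        change ((Matrix.diagonal (czSign sl.2) : Op n) *
          (tensorU (fun j => (sl.1 j).toU2) : Op n)) z y = _
        rw [Matrix.diagonal_mul]
      rw [e1, e3]
      change _ * (_ * toC (tgate N (List.ofFn fun j => gdat (sl.1 j)) _ _)) = _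
      rw [e2]
      simp only [scale, List.map_cons, List.prod_cons]
      push_cast
      ring
    rw [Finset.sum_congr rfl h1, ← Finset.mul_sum,
      sum_wset (slotsU_mem_loc fun s hs => h s (List.mem_cons_of_mem _ hs)) hx]
    rfl

/-- The operator of a tuple of Pauli numbers. -/
noncomputable def pop (q : Fin n → ℕ) : Op n := tensor fun j => pmat (q j)

theorem pauliWord_eq (i : Fin n) (P : ℕ) : pauliWord n i P =
    List.ofFn fun j : Fin n => if j = i then P else 0 := by
  rw [pauliWord, map_range_eq_ofFn]
  congr 1
  funext j
  by_cases h : j = i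
  · subst h; simp
  · have : Nat.beq (j : ℕ) i = false := by
      rw [Bool.eq_false_iff]
      exact fun h' => h (Fin.ext (Nat.eq_of_beq_eq_true h'))
    simp [h, this]

/-- The Pauli operator with number `P` on qubit `i`. -/
noncomputable def popAt (i : Fin n) (P : ℕ) : Op n := pop fun j => if j = i then P else 0

theorem popAt_mem_loc (i : Fin n) (P : ℕ) (hi : (i : ℕ) ∈ A) : popAt i P ∈ loc (supp n A) := by
  refine tensor_mem_loc fun j hj => ?_
  have : j ≠ i := fun h => hj (h ▸ mem_supp.mpr hi)
  dsimp only
  rw [if_neg this]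
  rfl

/-- The evolved observable of a candidate. -/
noncomputable def candOp (ls : List (Slot n)) (i : Fin n) (P : ℕ) : Op n :=
  star (slotsU ls : Op n) * popAt i P * (slotsU ls : Op n)

theorem candOp_mem_loc {ls : List (Slot n)} (h : ∀ sl ∈ ls, sl.On b A) (i : Fin n) (P : ℕ)
    (hi : (i : ℕ) ∈ A) : candOp ls i P ∈ loc (supp n A) :=
  conj_mem_loc (slotsU_mem_loc h) (popAt_mem_loc i P hi)

theorem hent_eq (hF : Fuel N n b A) {ls : List (Slot n)} (h : ∀ sl ∈ ls, sl.On b A) (i : Fin n)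
    (P : ℕ) (hi : (i : ℕ) ∈ A) {x : Fin n → Bool} (hx : x ∈ wset n A) (y : Fin n → Bool) :
    toC (hent N n (words N n A) ls.length (ls.map raw) i P (List.ofFn x) (List.ofFn y)) =
      (scale ls : ℂ) ^ 2 * candOp ls i P x y := by
  rw [hent, words_sum hF.words, map_sum, candOp, mul_assoc]
  have hV := slotsU_mem_loc h
  rw [← sum_wset (star_mem_loc hV) hx, Finset.mul_sum]
  refine Finset.sum_congr rfl fun z hz => ?_
  rw [words_sum hF.words, map_sum, ← sum_wset (popAt_mem_loc i P hi) hz, Finset.mul_sum,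
    Finset.mul_sum]
  refine Finset.sum_congr rfl fun z' hz' => ?_
  rw [map_mul, map_mul, GaussianInt.toComplex_star, vent_eq hF h hz, vent_eq hF h hz',
    pauliWord_eq, tpauli_eq hF.one_le, map_mul, Complex.conj_ofReal, Matrix.star_apply,
    Complex.star_def, popAt, pop]
  ring

end Semantics

/-! ### Pauli expansions -/

section Expansion

local notation "toC" => GaussianInt.toComplex

variable {n : ℕ} {A : List ℕ}

theorem pauli_expansion_one (u : Matrix Bool Bool ℂ) (x y : Bool) :
    ∑ k ∈ ({0, 1, 2, 3} : Finset ℕ), (2 : ℂ)⁻¹ * (∑ a, ∑ b, pmat k a b * u b a) * pmat k x y =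
      u x y := by
  have hI : Complex.I ^ 2 = -1 := Complex.I_sq
  have h3 : pmat 3 = Pauli.Z.matrix := rfl
  rw [Finset.sum_insert (by decide), Finset.sum_insert (by decide), Finset.sum_insert (by decide),
    Finset.sum_singleton]
  simp only [Fintype.sum_bool, pmat_zero, pmat_one, pmat_two, h3]
  cases x <;> cases y <;> simp [Pauli.matrix] <;> ring_nf <;> simp only [hI] <;> ring

/-- The trace of `pop q * H` over `A`. -/
noncomputable def ptr (A : List ℕ) (q : Fin n → ℕ) (H : Op n) : ℂ :=
  ∑ x ∈ wset n A, ∑ y ∈ wset n A, pop q x y * H y x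

theorem pauli_expansion {H : Op n} (hH : H ∈ loc (supp n A)) :
    ∑ q ∈ qset n A, (((wset n A).card : ℂ)⁻¹ * ptr A q H) • pop q = H := by
  refine loc_induction (p := fun H => ∑ q ∈ qset n A,
    (((wset n A).card : ℂ)⁻¹ * ptr A q H) • pop q = H) (fun u hu => ?_) (fun H H' h h' => ?_)
    (fun c H h => ?_) hH
  · ext x y
    rw [Matrix.sum_apply]
    have e : ∀ q ∈ qset n A, ((((wset n A).card : ℂ)⁻¹ * ptr A q (tensor u)) • pop q) x y =
        ∏ j : Fin n, ((((if (j : ℕ) ∈ A then Finset.univ else {false} : Finset Bool).card : ℂ))⁻¹ *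
          (∑ a ∈ (if (j : ℕ) ∈ A then Finset.univ else {false} : Finset Bool),
            ∑ b ∈ (if (j : ℕ) ∈ A then Finset.univ else {false} : Finset Bool),
              pmat (q j) a b * u j b a) * pmat (q j) (x j) (y j)) := by
      intro q _
      rw [Matrix.smul_apply, smul_eq_mul, Finset.prod_mul_distrib, Finset.prod_mul_distrib,
        Finset.prod_inv_distrib]
      change _ * ∏ j, pmat (q j) (x j) (y j) = _
      congr 2
      · rw [wset, Fintype.card_piFinset]
        push_cast
        rfl
      · rw [ptr, Finset.prod_univ_sum]
        refine Finset.sum_congr rfl fun a _ => ?_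
        rw [Finset.prod_univ_sum]
        refine Finset.sum_congr rfl fun b _ => ?_
        simp only [pop, tensor, Matrix.of_apply, Finset.prod_mul_distrib]
    rw [Finset.sum_congr rfl e, qset]
    refine (Finset.prod_univ_sum (fun j : Fin n => if (j : ℕ) ∈ A then {0, 1, 2, 3} else {0})
      fun (j : Fin n) (k : ℕ) => (((if (j : ℕ) ∈ A then Finset.univ else {false} :
        Finset Bool).card : ℂ))⁻¹ *
          (∑ a ∈ (if (j : ℕ) ∈ A then Finset.univ else {false} : Finset Bool),
            ∑ b ∈ (if (j : ℕ) ∈ A then Finset.univ else {false} : Finset Bool),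
              pmat k a b * u j b a) * pmat k (x j) (y j)).symm.trans ?_
    refine Finset.prod_congr rfl fun j _ => ?_
    by_cases hj : (j : ℕ) ∈ A
    · simp only [if_pos hj]
      rw [← pauli_expansion_one (u j) (x j) (y j)]
      simp
    · simp only [if_neg hj]
      rw [hu j (mt mem_supp.mp hj)]
      simp [pmat_zero]
  · have e : ∀ q, ptr A q (H + H') = ptr A q H + ptr A q H' := by
      intro q
      simp only [ptr, Matrix.add_apply, mul_add, Finset.sum_add_distrib]
    simp only [e, mul_add, add_smul, Finset.sum_add_distrib, h, h']
  · have e : ∀ q, ptr A q (c • H) = c * ptr A q H := by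
      intro q
      simp only [ptr, Matrix.smul_apply, smul_eq_mul, Finset.mul_sum]
      refine Finset.sum_congr rfl fun x _ => Finset.sum_congr rfl fun y _ => by ring
    conv_rhs => rw [← h, Finset.smul_sum]
    refine Finset.sum_congr rfl fun q _ => ?_
    rw [e, smul_smul]
    congr 1
    ring

theorem pmat_star (k : ℕ) : star (pmat k) = pmat k := by
  rcases k with _ | _ | _ | k <;>
    simp only [zero_add, Nat.reduceAdd, pmat_zero, pmat_one, pmat_two, pmat_three, star_one] <;>
    ext x y <;> cases x <;> cases y <;> simp [Pauli.matrix, Matrix.star_apply]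

theorem pop_star (q : Fin n → ℕ) : star (pop q) = pop q := by
  rw [pop, tensor_star]
  simp only [pmat_star]

theorem pmat_mul_self (k : ℕ) : pmat k * pmat k = 1 := by
  rcases k with _ | _ | _ | k <;>
    simp only [zero_add, Nat.reduceAdd, pmat_zero, pmat_one, pmat_two, pmat_three, mul_one] <;>
    ext x y <;> cases x <;> cases y <;> simp [Pauli.matrix, Matrix.mul_apply]

theorem pop_mul_self (q : Fin n → ℕ) : pop q * pop q = 1 := by
  rw [pop, tensor_mul]
  simp only [pmat_mul_self]
  exact tensor_one

/-- Tensor products of Pauli matrices as unitaries. -/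
noncomputable def popU (q : Fin n → ℕ) : UN n :=
  ⟨pop q, by rw [Matrix.mem_unitaryGroup_iff, pop_star, pop_mul_self]⟩

/-- The evolved observable of a candidate as a unitary. -/
noncomputable def candU (ls : List (Slot n)) (i : Fin n) (P : ℕ) : UN n :=
  star (slotsU ls) * popU (fun j => if j = i then P else 0) * slotsU ls

theorem coe_candU (ls : List (Slot n)) (i : Fin n) (P : ℕ) :
    (candU ls i P : Op n) = candOp ls i P := rfl

theorem candOp_star (ls : List (Slot n)) (i : Fin n) (P : ℕ) :
    star (candOp ls i P) = candOp ls i P := by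
  rw [candOp, star_mul, star_mul, star_star, popAt, pop_star, mul_assoc]

theorem sum_norm_row_le (U : UN n) (x : Fin n → Bool) (W : Finset (Fin n → Bool)) :
    ∑ y ∈ W, ‖(U : Op n) x y‖ ^ 2 ≤ 1 := by
  rw [← sum_norm_row U x]
  exact Finset.sum_le_sum_of_subset_of_nonneg (Finset.subset_univ _) fun _ _ _ => sq_nonneg _

theorem norm_ptr_le (q : Fin n → ℕ) (U : UN n) : ‖ptr A q (U : Op n)‖ ≤ (wset n A).card := by
  have h1 : ‖ptr A q (U : Op n)‖ ≤ ∑ x ∈ wset n A, ∑ y ∈ wset n A,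
      (‖(popU q : Op n) x y‖ ^ 2 / 2 + ‖(U : Op n) y x‖ ^ 2 / 2) := by
    refine (norm_sum_le _ _).trans (Finset.sum_le_sum fun x _ => (norm_sum_le _ _).trans
      (Finset.sum_le_sum fun y _ => ?_))
    rw [norm_mul]
    change ‖(popU q : Op n) x y‖ * _ ≤ _
    nlinarith [sq_nonneg (‖(popU q : Op n) x y‖ - ‖(U : Op n) y x‖)]
  refine h1.trans ?_
  simp only [Finset.sum_add_distrib]
  have h2 : ∑ x ∈ wset n A, ∑ y ∈ wset n A, ‖(popU q : Op n) x y‖ ^ 2 / 2 ≤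
      ((wset n A).card : ℝ) * (1 / 2) := by
    rw [← nsmul_eq_mul]
    refine Finset.sum_le_card_nsmul _ _ _ fun x _ => ?_
    rw [← Finset.sum_div]
    linarith [sum_norm_row_le (popU q) x (wset n A)]
  have h3 : ∑ x ∈ wset n A, ∑ y ∈ wset n A, ‖(U : Op n) y x‖ ^ 2 / 2 ≤
      ((wset n A).card : ℝ) * (1 / 2) := by
    rw [Finset.sum_comm, ← nsmul_eq_mul]
    refine Finset.sum_le_card_nsmul _ _ _ fun x _ => ?_
    rw [← Finset.sum_div]
    linarith [sum_norm_row_le U x (wset n A)]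
  linarith

theorem ptr_real {H : Op n} (hH : star H = H) (q : Fin n → ℕ) : (ptr A q H).im = 0 := by
  refine Complex.conj_eq_iff_im.mp ?_
  have h : ∀ M : Op n, star M = M → ∀ x y, (starRingEnd ℂ) (M x y) = M y x := by
    intro M hM x y
    conv_rhs => rw [← hM]
    rw [Matrix.star_apply, Complex.star_def]
  rw [ptr, map_sum, Finset.sum_comm]
  refine Finset.sum_congr rfl fun x _ => ?_
  rw [map_sum]
  refine Finset.sum_congr rfl fun y _ => ?_
  rw [map_mul, h _ (pop_star q), h _ hH]

/-- The value of `coef`. -/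
theorem coef_eq {N b : ℕ} (hF : Fuel N n b A) {ls : List (Slot n)} (h : ∀ sl ∈ ls, sl.On b A)
    (i : Fin n) (P : ℕ) (hi : (i : ℕ) ∈ A) (q : Fin n → ℕ) :
    ((coef N n (words N n A) ls.length (ls.map raw) i P (List.ofFn q) : ℤ) : ℝ) =
      scale ls ^ 2 * (ptr A q (candOp ls i P)).re := by
  rw [coef, GaussianInt.intCast_re, words_sum hF.words, map_sum]
  have e : ∑ x ∈ wset n A, toC ((words N n A).map fun y => tpauli N (List.ofFn q) (List.ofFn x) y *
      hent N n (words N n A) ls.length (ls.map raw) i P y (List.ofFn x)).sum =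
        ((scale ls ^ 2 : ℝ) : ℂ) * ptr A q (candOp ls i P) := by
    rw [ptr, Finset.mul_sum]
    refine Finset.sum_congr rfl fun x _ => ?_
    rw [words_sum hF.words, map_sum, Finset.mul_sum]
    refine Finset.sum_congr rfl fun y hy => ?_
    rw [map_mul, tpauli_eq hF.one_le, hent_eq hF h i P hi hy, pop]
    push_cast
    ring
  rw [e, Complex.re_ofReal_mul]

theorem pop_zero : pop (fun _ : Fin n => 0) = 1 := by
  simp only [pop, pmat_zero]
  exact tensor_one

theorem candOp_zero (ls : List (Slot n)) (i : Fin n) : candOp ls i 0 = 1 := by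
  simp only [candOp, popAt, ite_self]
  rw [pop_zero, mul_one]
  exact Matrix.mem_unitaryGroup_iff'.mp (slotsU ls).2

theorem card_wset_pos : 0 < (wset n A).card :=
  Finset.card_pos.mpr ⟨fun _ => false, mem_wset.mpr fun _ _ => rfl⟩

theorem ptr_one : ptr A (fun _ => 0) (1 : Op n) = (wset n A).card := by
  rw [ptr, pop_zero]
  have : ∀ x ∈ wset n A, ∑ y ∈ wset n A, (1 : Op n) x y * (1 : Op n) y x = 1 := by
    intro x hx
    rw [Finset.sum_eq_single_of_mem x hx]
    · simp
    · intro y _ hy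
      rw [Matrix.one_apply_ne hy.symm, zero_mul]
  rw [Finset.sum_congr rfl this]
  simp

theorem denomOf_eq {N b : ℕ} (hF : Fuel N n b A) {ls : List (Slot n)} (h : ∀ sl ∈ ls, sl.On b A)
    (i : Fin n) (hi : (i : ℕ) ∈ A) :
    ((denomOf N n (words N n A) ls.length (ls.map raw) i : ℤ) : ℝ) =
      scale ls ^ 2 * (wset n A).card := by
  have hz : pauliWord n 0 0 = List.ofFn fun _ : Fin n => 0 := by
    rw [pauliWord, map_range_eq_ofFn]
    simp
  rw [denomOf, hz, coef_eq hF h i 0 hi, candOp_zero, ptr_one, Complex.natCast_re]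

theorem denomOf_pos {N b : ℕ} (hF : Fuel N n b A) {ls : List (Slot n)} (h : ∀ sl ∈ ls, sl.On b A)
    (i : Fin n) (hi : (i : ℕ) ∈ A) :
    0 < ((denomOf N n (words N n A) ls.length (ls.map raw) i : ℤ) : ℝ) := by
  rw [denomOf_eq hF h i hi]
  exact mul_pos (pow_pos (scale_pos ls) 2) (by exact_mod_cast card_wset_pos)

theorem abs_coef_le {N b : ℕ} (hF : Fuel N n b A) {ls : List (Slot n)} (h : ∀ sl ∈ ls, sl.On b A)
    (i : Fin n) (P : ℕ) (hi : (i : ℕ) ∈ A) (q : Fin n → ℕ) :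
    |((coef N n (words N n A) ls.length (ls.map raw) i P (List.ofFn q) : ℤ) : ℝ)| ≤
      ((denomOf N n (words N n A) ls.length (ls.map raw) i : ℤ) : ℝ) := by
  rw [coef_eq hF h i P hi, denomOf_eq hF h i hi, abs_mul, abs_of_nonneg (sq_nonneg _)]
  exact mul_le_mul_of_nonneg_left ((Complex.abs_re_le_norm _).trans
    (norm_ptr_le q (candU ls i P))) (sq_nonneg _)

theorem coef_div_denom {N b : ℕ} (hF : Fuel N n b A) {ls : List (Slot n)}
    (h : ∀ sl ∈ ls, sl.On b A) (i : Fin n) (P : ℕ) (hi : (i : ℕ) ∈ A) (q : Fin n → ℕ) :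
    ((coef N n (words N n A) ls.length (ls.map raw) i P (List.ofFn q) : ℤ) : ℂ) /
      ((denomOf N n (words N n A) ls.length (ls.map raw) i : ℤ) : ℂ) =
        ((wset n A).card : ℂ)⁻¹ * ptr A q (candOp ls i P) := by
  have h1 := congrArg (fun r : ℝ => (r : ℂ)) (coef_eq hF h i P hi q)
  have h2 := congrArg (fun r : ℝ => (r : ℂ)) (denomOf_eq hF h i hi)
  simp only [Complex.ofReal_intCast] at h1 h2
  have h3 : (((ptr A q (candOp ls i P)).re : ℝ) : ℂ) = ptr A q (candOp ls i P) :=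
    Complex.ext (by simp) (by simp [ptr_real (candOp_star ls i P)])
  have h4 : ((scale ls : ℝ) : ℂ) ≠ 0 := by exact_mod_cast (scale_pos ls).ne'
  have h5 : ((wset n A).card : ℂ) ≠ 0 := by exact_mod_cast card_wset_pos.ne'
  rw [h1, h2]
  push_cast
  rw [h3]
  field_simp

/-- The overlap of an observable with a unitary. -/
noncomputable def overlap (ls : List (Slot n)) (i : Fin n) (P : ℕ) (O : Op n) : ℂ :=
  ((2 : ℂ) ^ n)⁻¹ * (candOp ls i P * O).trace

theorem sum_coef {N b : ℕ} (hF : Fuel N n b A) {ls : List (Slot n)}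
    (h : ∀ sl ∈ ls, sl.On b A) (i : Fin n) (P : ℕ) (hi : (i : ℕ) ∈ A) (O : Op n) :
    ∑ q ∈ qset n A, ((coef N n (words N n A) ls.length (ls.map raw) i P (List.ofFn q) : ℤ) : ℂ) *
      (((2 : ℂ) ^ n)⁻¹ * (pop q * O).trace) =
      ((denomOf N n (words N n A) ls.length (ls.map raw) i : ℤ) : ℂ) * overlap ls i P O := by
  have hd : ((denomOf N n (words N n A) ls.length (ls.map raw) i : ℤ) : ℂ) ≠ 0 := by
    have := (denomOf_pos hF h i hi).ne'
    exact_mod_cast this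
  have hx := pauli_expansion (candOp_mem_loc h i P hi)
  rw [overlap, ← hx]
  rw [Finset.sum_mul, Matrix.trace_sum, Finset.mul_sum, Finset.mul_sum]
  refine Finset.sum_congr rfl fun q _ => ?_
  rw [smul_mul_assoc, Matrix.trace_smul, ← coef_div_denom hF h i P hi, smul_eq_mul]
  field_simp

theorem overlap_re (ls : List (Slot n)) (i : Fin n) (P : ℕ) (O : UN n) :
    (overlap ls i P (O : Op n)).re = 1 - distF (candOp ls i P) (O : Op n) / 2 := by
  have := distF_eq_overlap (candU ls i P) O
  rw [coe_candU, ← Matrix.star_eq_conjTranspose, candOp_star] at this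
  rw [this, overlap]
  have e : ((2 : ℂ) ^ n)⁻¹ = (((2 ^ n : ℝ)⁻¹ : ℝ) : ℂ) := by push_cast; rfl
  rw [e, Complex.re_ofReal_mul]
  ring

end Expansion

/-! ### The test of candidates -/

section Score

variable {n N b E : ℕ} {A : List ℕ}

theorem popAt_succ (i : Fin n) (k : ℕ) : popAt i (k + 1) = pauliAt (pauliOf k) i := by
  rw [popAt, pop, pauliAt, PauliString.op]
  congr 1
  funext j
  split_ifs <;> rfl

theorem sum_estimates {β : Type} {l : List β} {r : List (β × ℕ)} (c : β → ℤ) (α : β → ℝ)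
    {G : ℕ} {δ D : ℝ} (hD : 0 ≤ D)
    (h : List.Forall₂ (fun it e => e.1 = it ∧ |2 * (e.2 : ℝ) - G - G * α it| ≤ δ) l r)
    (hc : ∀ it ∈ l, |(c it : ℝ)| ≤ D) :
    |(((r.map fun e => c e.1 * (2 * (e.2 : ℤ) - (G : ℤ))).sum : ℤ) : ℝ) -
      G * (l.map fun it => (c it : ℝ) * α it).sum| ≤ l.length * (D * δ) := by
  induction h with
  | nil => simp
  | cons h _ ih =>
    rename_i it e l r _
    obtain ⟨h1, h2⟩ := h
    have ih := ih fun it hit => hc it (List.mem_cons_of_mem _ hit)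
    simp only [List.map_cons, List.sum_cons, List.length_cons, h1]
    push_cast at ih ⊢
    have h3 : |(c it : ℝ) * (2 * (e.2 : ℝ) - G - G * α it)| ≤ D * δ := by
      rw [abs_mul]
      exact mul_le_mul (hc it List.mem_cons_self) h2 (abs_nonneg _) hD
    have h4 := abs_add_le ((c it : ℝ) * (2 * (e.2 : ℝ) - G - G * α it))
      ((((r.map fun e => c e.1 * (2 * (e.2 : ℤ) - (G : ℤ))).sum : ℤ) : ℝ) -
      G * (l.map fun it => (c it : ℝ) * α it).sum)
    push_cast at h4
    refine le_trans (le_of_eq ?_) (h4.trans ((add_le_add h3 ih).trans (le_of_eq (by ring))))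
    congr 1
    ring

theorem pwords_length (h : 4 ^ A.length ≤ N) : (pwords N n A).length ≤ 4 ^ A.length := by
  have h1 : FewChoices N (choices n A [0, 1, 2, 3] 0) := fewChoices_choices (by simp) h
  have h2 : FewChoices (4 ^ A.length) (choices n A [0, 1, 2, 3] 0) :=
    fewChoices_choices (by simp) le_rfl
  rw [pwords, (secs_length h1).1]
  exact h2.2

theorem items_length (h : 4 ^ A.length ≤ N) : (items N n A).length ≤ 3 * 4 ^ A.length := by
  have := pwords_length (n := n) h
  simp [items, List.flatMap]
  omega

/-- The sum of the overlaps of a candidate with the observables. -/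
noncomputable def quality (U : UN n) (ls : List (Slot n)) (i : Fin n) : ℝ :=
  ∑ k ∈ Finset.range 3, (1 - distF (candOp ls i (k + 1)) (heisenberg (U : Op n) (pauliOf k) i) / 2)

theorem heisenberg_unitary (U : UN n) (P : Pauli) (i : Fin n) :
    ∃ O : UN n, (O : Op n) = heisenberg (U : Op n) P i := by
  obtain ⟨k, rfl⟩ : ∃ k, P = pauliOf k := by
    cases P
    exacts [⟨0, rfl⟩, ⟨1, rfl⟩, ⟨2, rfl⟩]
  refine ⟨star U * popU (fun j => if j = i then k + 1 else 0) * U, ?_⟩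
  rw [heisenberg, ← popAt_succ]
  rfl

theorem score_near (hF : Fuel N n b A) (hN : 2 ≤ N) {ls : List (Slot n)}
    (h : ∀ sl ∈ ls, sl.On b A) (i : Fin n) (hi : (i : ℕ) ∈ A) (U : UN n)
    {row : List ((ℕ × List ℕ) × ℕ)} (hrow : List.Forall₂ (fun it e => e.1 = it ∧
      GoodEst (bitK U (mkExper n (i, A) it)) N e.2) (items N n A) row) :
    |((score N n ls.length (N ^ 2) (words N n A) (ls.map raw) i row : ℤ) : ℝ) - (N : ℝ) ^ 2 *
      (((denomOf N n (words N n A) ls.length (ls.map raw) i : ℤ) : ℝ) * quality U ls i)| ≤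
      (3 * 4 ^ A.length) * (((denomOf N n (words N n A) ls.length (ls.map raw) i : ℤ) : ℝ) *
        (10 * N)) := by
  set c : ℕ × List ℕ → ℤ := fun it => coef N n (words N n A) ls.length (ls.map raw) i it.1 it.2
  set α : ℕ × List ℕ → ℝ := fun it => 2 * (bitK U (mkExper n (i, A) it) true).toReal - 1
  have hd := denomOf_pos hF h i hi
  set den := ((denomOf N n (words N n A) ls.length (ls.map raw) i : ℤ) : ℝ)
  have hN' : (0 : ℝ) < N := by exact_mod_cast (by omega : 0 < N)
  have hrow' : List.Forall₂ (fun it e => e.1 = it ∧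
      |2 * (e.2 : ℝ) - (N ^ 2 : ℕ) - (N ^ 2 : ℕ) * α it| ≤ 10 * N) (items N n A) row := by
    refine hrow.imp fun it e he => ⟨he.1, ?_⟩
    have h1 := he.2
    rw [GoodEst] at h1
    have e1 : 2 * (e.2 : ℝ) - (N ^ 2 : ℕ) - (N ^ 2 : ℕ) * α it =
        (N : ℝ) ^ 2 * (2 * (e.2 : ℝ) / (N : ℝ) ^ 2 - 1 - α it) := by
      push_cast
      field_simp
    rw [e1, abs_mul, abs_of_pos (by positivity)]
    refine (mul_le_mul_of_nonneg_left h1 (by positivity)).trans (le_of_eq ?_)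
    field_simp
  have hc : ∀ it ∈ items N n A, |(c it : ℝ)| ≤ den := by
    intro it hit
    simp only [items, List.mem_flatMap, List.mem_map] at hit
    obtain ⟨P, -, Q, hQ, rfl⟩ := hit
    obtain ⟨q, rfl, -⟩ := mem_pwords hQ
    exact abs_coef_le hF h i P hi q
  have h1 := sum_estimates c α hd.le hrow' hc
  have h2 : ((items N n A).map fun it => (c it : ℝ) * α it).sum = den * quality U ls i := by
    have hP : ∀ k, ((pwords N n A).map fun Q => (c (k + 1, Q) : ℝ) * α (k + 1, Q)).sum =
        den * (1 - distF (candOp ls i (k + 1)) (heisenberg (U : Op n) (pauliOf k) i) / 2) := by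
      intro k
      obtain ⟨O, hO⟩ := heisenberg_unitary U (pauliOf k) i
      rw [pwords_sum hF.paulis, ← hO, ← overlap_re]
      have h3 := congrArg Complex.re (sum_coef hF h i (k + 1) hi (O : Op n))
      rw [← Complex.ofReal_intCast, Complex.re_ofReal_mul] at h3
      rw [← h3, Complex.re_sum]
      refine Finset.sum_congr rfl fun q _ => ?_
      have h4 := bitK_expect U q i k
      rw [← hO] at h4
      rw [pop, ← h4, ← Complex.ofReal_intCast, Complex.re_ofReal_mul, Complex.ofReal_re]
      rfl
    have e : ((items N n A).map fun it => (c it : ℝ) * α it).sum =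
        ((pwords N n A).map fun Q => (c (0 + 1, Q) : ℝ) * α (0 + 1, Q)).sum +
        (((pwords N n A).map fun Q => (c (1 + 1, Q) : ℝ) * α (1 + 1, Q)).sum +
        ((pwords N n A).map fun Q => (c (2 + 1, Q) : ℝ) * α (2 + 1, Q)).sum) := by
      simp [items, List.map_append, List.sum_append, Function.comp_def]
    rw [e, hP, hP, hP, quality, Finset.sum_range_succ, Finset.sum_range_succ,
      Finset.sum_range_one]
    ring
  rw [h2] at h1
  change |((score N n ls.length (N ^ 2) (words N n A) (ls.map raw) i row : ℤ) : ℝ) -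
    ((N ^ 2 : ℕ) : ℝ) * (den * quality U ls i)| ≤ _ at h1
  rw [Nat.cast_pow] at h1
  refine h1.trans (mul_le_mul_of_nonneg_right ?_ (by positivity))
  exact_mod_cast items_length hF.paulis

theorem passes_iff {V : List RSlot} {D i : ℕ} {row : List ((ℕ × List ℕ) × ℕ)} :
    passes N n D (N ^ 2) E ((i, A), row) V = true ↔
      (3 * (E : ℝ) - 1) * ((denomOf N n (words N n A) D V i : ℤ) : ℝ) * (N : ℝ) ^ 2 ≤
        E * ((score N n D (N ^ 2) (words N n A) V i row : ℤ) : ℝ) := by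
  rw [passes, decide_eq_true_iff]
  refine (Int.cast_le (R := ℝ)).symm.trans ?_
  push_cast
  rfl

theorem quality_of_passes (hF : Fuel N n b A) (hN : 2 ≤ N) (hE : 1 ≤ E)
    (hNE : 60 * 4 ^ A.length * E ≤ N) {ls : List (Slot n)}
    (h : ∀ sl ∈ ls, sl.On b A) (i : Fin n) (hi : (i : ℕ) ∈ A) (U : UN n)
    {row : List ((ℕ × List ℕ) × ℕ)} (hrow : List.Forall₂ (fun it e => e.1 = it ∧
      GoodEst (bitK U (mkExper n (i, A) it)) N e.2) (items N n A) row) :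
    (passes N n ls.length (N ^ 2) E ((i, A), row) (ls.map raw) = true →
      3 - 2 / (E : ℝ) ≤ quality U ls i) ∧
    (3 - 1 / (2 * (E : ℝ)) ≤ quality U ls i →
      passes N n ls.length (N ^ 2) E ((i, A), row) (ls.map raw) = true) := by
  have hs := score_near hF hN h i hi U hrow
  have hd := denomOf_pos hF h i hi
  rw [passes_iff]
  set den := ((denomOf N n (words N n A) ls.length (ls.map raw) i : ℤ) : ℝ)
  set s := ((score N n ls.length (N ^ 2) (words N n A) (ls.map raw) i row : ℤ) : ℝ)
  set Q := quality U ls i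
  have hN' : (0 : ℝ) < N := by exact_mod_cast (by omega : 0 < N)
  have hE' : (0 : ℝ) < E := by exact_mod_cast (by omega : 0 < E)
  have h60 : (60 * 4 ^ A.length * E : ℝ) ≤ N := by exact_mod_cast hNE
  have h1 : E * |s - N ^ 2 * (den * Q)| ≤ den * N ^ 2 / 2 := by
    refine (mul_le_mul_of_nonneg_left hs hE'.le).trans ?_
    have : E * ((3 * 4 ^ A.length) * (den * (10 * N))) = (60 * 4 ^ A.length * E) * (den * N / 2) := by
      ring
    rw [this]
    refine (mul_le_mul_of_nonneg_right h60 (by positivity)).trans (le_of_eq (by ring))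
  have h2 : 0 < den * (N : ℝ) ^ 2 := by positivity
  constructor
  · intro hp
    have h3 : E * (s - N ^ 2 * (den * Q)) ≤ den * N ^ 2 / 2 :=
      (mul_le_mul_of_nonneg_left (le_abs_self _) hE'.le).trans h1
    have h4 : (3 * E - 2) * (den * (N : ℝ) ^ 2) ≤ (E * Q) * (den * (N : ℝ) ^ 2) := by nlinarith
    have h5 := le_of_mul_le_mul_right h4 h2
    have h6 : 3 - 2 / (E : ℝ) = (3 * E - 2) / E := by field_simp
    rw [h6, div_le_iff₀ hE']
    linarith
  · intro hp
    have h3 : E * -(s - N ^ 2 * (den * Q)) ≤ den * N ^ 2 / 2 :=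
      (mul_le_mul_of_nonneg_left (neg_le_abs _) hE'.le).trans h1
    have h6 : 3 - 1 / (2 * (E : ℝ)) = (3 * E - 1 / 2) / E := by field_simp
    rw [h6, div_le_iff₀ hE'] at hp
    have h4 : (3 * E - 1 / 2) * (den * (N : ℝ) ^ 2) ≤ (Q * E) * (den * (N : ℝ) ^ 2) :=
      mul_le_mul_of_nonneg_right hp h2.le
    nlinarith

theorem distF_le_of_quality {U : UN n} {ls : List (Slot n)} {i : Fin n} {ε : ℝ}
    (h : 3 - ε ≤ quality U ls i) {k : ℕ} (hk : k < 3) :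
    distF (candOp ls i (k + 1)) (heisenberg (U : Op n) (pauliOf k) i) ≤ 2 * ε := by
  have h0 : ∀ k, 0 ≤ distF (candOp ls i (k + 1)) (heisenberg (U : Op n) (pauliOf k) i) := fun k =>
    div_nonneg (frobSq_nonneg _) (by positivity)
  rw [quality, Finset.sum_range_succ, Finset.sum_range_succ, Finset.sum_range_one] at h
  have h1 := h0 0
  have h2 := h0 1
  have h3 := h0 2
  interval_cases k <;> linarith

theorem quality_of_distF_le {U : UN n} {ls : List (Slot n)} {i : Fin n} {ε : ℝ}
    (h : ∀ k, distF (candOp ls i (k + 1)) (heisenberg (U : Op n) (pauliOf k) i) ≤ ε) :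
    3 - 3 * ε / 2 ≤ quality U ls i := by
  rw [quality, Finset.sum_range_succ, Finset.sum_range_succ, Finset.sum_range_one]
  linarith [h 0, h 1, h 2]

end Score

/-! ### Operators on two copies of the qubits -/

section Pairs

variable {n : ℕ}

theorem sum_append (f : (Fin (n + n) → Bool) → ℂ) : ∑ z, f z =
    ∑ a : Fin n → Bool, ∑ b : Fin n → Bool, f (Fin.append a b) := by
  rw [← Fintype.sum_prod_type' (f := fun a b => f (Fin.append a b))]
  exact (Equiv.sum_comp (Fin.appendEquiv n n) f).symm

theorem tensor2_mul (A B C D : Op n) : tensor2 A B * tensor2 C D = tensor2 (A * C) (B * D) := by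
  ext x y
  rw [Matrix.mul_apply, sum_append]
  simp only [tensor2, Matrix.of_apply, Fin.append_left, Fin.append_right, Matrix.mul_apply]
  rw [Finset.sum_mul_sum]
  refine Finset.sum_congr rfl fun a _ => Finset.sum_congr rfl fun b _ => by ring

theorem tensor2_one : tensor2 (1 : Op n) 1 = 1 := by
  ext x y
  simp only [tensor2, Matrix.of_apply, Matrix.one_apply]
  by_cases h : x = y
  · simp [h]
  · rw [if_neg h]
    by_cases h1 : (fun i => x (Fin.castAdd n i)) = fun i => y (Fin.castAdd n i)
    · rw [if_neg (c := (fun i => x (Fin.natAdd n i)) = fun i => y (Fin.natAdd n i)), mul_zero]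
      intro h2
      refine h (funext fun i => ?_)
      refine Fin.addCases (fun j => congrFun h1 j) (fun j => congrFun h2 j) i
    · rw [if_neg h1, zero_mul]

theorem tensor2_star (A B : Op n) : star (tensor2 A B) = tensor2 (star A) (star B) := by
  ext x y
  simp [tensor2, Matrix.star_apply]

/-- `U ⊗ V` for unitaries. -/
noncomputable def tensor2U (U V : UN n) : UN (n + n) :=
  ⟨tensor2 (U : Op n) (V : Op n), by
    rw [Matrix.mem_unitaryGroup_iff, tensor2_star, tensor2_mul,
      Matrix.mem_unitaryGroup_iff.mp U.2, Matrix.mem_unitaryGroup_iff.mp V.2, tensor2_one]⟩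

theorem tensor2_tensor (u v : Fin n → Matrix Bool Bool ℂ) :
    tensor2 (tensor u) (tensor v) = tensor (Fin.append u v) := by
  ext x y
  simp only [tensor2, tensor, Matrix.of_apply]
  rw [Fin.prod_univ_add]
  simp only [Fin.append_left, Fin.append_right]

/-- Tensor products of two-qubit operators on the pairs of qubits `j`, `n + j`. -/
def ptensor (m : Fin n → Matrix (Bool × Bool) (Bool × Bool) ℂ) : Op (n + n) :=
  Matrix.of fun x y => ∏ j, m j (x (Fin.castAdd n j), x (Fin.natAdd n j))
    (y (Fin.castAdd n j), y (Fin.natAdd n j))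

theorem ptensor_mul (m m' : Fin n → Matrix (Bool × Bool) (Bool × Bool) ℂ) :
    ptensor m * ptensor m' = ptensor fun j => m j * m' j := by
  ext x y
  have e : ∀ f : (Fin n → Bool × Bool) → ℂ, ∑ z : Fin (n + n) → Bool,
      f (fun j => (z (Fin.castAdd n j), z (Fin.natAdd n j))) = ∑ z, f z := by
    intro f
    refine Fintype.sum_equiv ((Fin.appendEquiv n n).symm.trans (Equiv.arrowProdEquivProdArrow _ _ _).symm)
      _ _ fun z => ?_
    congr 1
  rw [Matrix.mul_apply]
  simp only [ptensor, Matrix.of_apply]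
  rw [← Finset.prod_congr rfl fun j _ => (Matrix.mul_apply).symm]
  rw [Finset.prod_univ_sum, Fintype.piFinset_univ, ← e]
  exact Finset.sum_congr rfl fun z _ => Finset.prod_mul_distrib.symm

theorem ptensor_one : ptensor (fun _ : Fin n => 1) = 1 := by
  rw [← tensor2_one]
  ext x y
  have h : ∀ f g : Fin n → Bool, (1 : Op n) f g = ∏ j, (1 : Matrix Bool Bool ℂ) (f j) (g j) := by
    intro f g
    rw [← tensor_one]
    rfl
  rw [tensor2, Matrix.of_apply, h, h, ← Finset.prod_mul_distrib, ptensor, Matrix.of_apply]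
  refine Finset.prod_congr rfl fun j _ => ?_
  simp only [Matrix.one_apply, Prod.mk.injEq]
  split_ifs <;> simp_all

open Kronecker in
theorem tensor2_tensor_eq (u v : Fin n → Matrix Bool Bool ℂ) :
    tensor2 (tensor u) (tensor v) = ptensor fun j => u j ⊗ₖ v j := by
  ext x y
  simp only [tensor2, tensor, ptensor, Matrix.of_apply, Matrix.kroneckerMap_apply]
  rw [← Finset.prod_mul_distrib]

/-- The exchange of two qubits. -/
def swap4 : Matrix (Bool × Bool) (Bool × Bool) ℂ :=
  Matrix.of fun a b => if a.1 = b.2 ∧ a.2 = b.1 then 1 else 0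

theorem swapAll_eq : swapAll n = ptensor fun _ => swap4 := by
  ext x y
  simp only [swapAll, ptensor, swap4, Matrix.of_apply]
  split_ifs with h
  · rw [Finset.prod_eq_one]
    intro j _
    rw [if_pos (h j)]
  · push Not at h
    obtain ⟨j, hj⟩ := h
    rw [Finset.prod_eq_zero (Finset.mem_univ j)]
    rw [if_neg]
    exact fun h => hj h.1 h.2

/-- The exchange of the qubits in `I` with those of the second copy. -/
noncomputable def swapOn (I : Finset (Fin n)) : Op (n + n) :=
  ptensor fun j => if j ∈ I then swap4 else 1

theorem swap4_mul_self : swap4 * swap4 = 1 := by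
  ext ⟨a, b⟩ ⟨c, d⟩
  cases a <;> cases b <;> cases c <;> cases d <;>
    simp [swap4, Matrix.mul_apply, Fintype.sum_prod_type]

theorem swapOn_mul_of_disjoint {I J : Finset (Fin n)} (h : Disjoint I J) :
    swapOn I * swapOn J = swapOn (I ∪ J) := by
  rw [swapOn, swapOn, swapOn, ptensor_mul]
  congr 1
  funext j
  by_cases hI : j ∈ I
  · have := Finset.disjoint_left.mp h hI
    simp [hI, this]
  · simp [hI]

theorem swapOn_prod {l : List (Fin n)} (h : l.Nodup) :
    (l.map fun i => swapOn {i}).prod = swapOn l.toFinset := by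
  induction l with
  | nil =>
    simp only [List.map_nil, List.prod_nil, List.toFinset_nil, swapOn, Finset.notMem_empty,
      if_false]
    exact ptensor_one.symm
  | cons i l ih =>
    obtain ⟨h1, h2⟩ := List.nodup_cons.mp h
    rw [List.map_cons, List.prod_cons, ih h2, swapOn_mul_of_disjoint (by simpa using h1),
      List.toFinset_cons, Finset.insert_eq]

theorem swapOn_univ : swapOn (Finset.univ : Finset (Fin n)) = swapAll n := by
  rw [swapAll_eq, swapOn]
  simp

theorem swapAll_conj (A B : Op n) : swapAll n * tensor2 A B = tensor2 B A * swapAll n := by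
  have h : ∀ x y : Fin (n + n) → Bool, swapAll n x y =
      if y = Fin.append (fun i => x (Fin.natAdd n i)) (fun i => x (Fin.castAdd n i)) then 1 else 0 := by
    intro x y
    rw [swapAll, Matrix.of_apply]
    refine if_congr ⟨fun h => funext fun i => ?_, ?_⟩ rfl rfl
    · refine Fin.addCases (fun j => ?_) (fun j => ?_) i
      · rw [Fin.append_left, (h j).2]
      · rw [Fin.append_right, (h j).1]
    · rintro rfl i
      simp only [Fin.append_left, Fin.append_right, and_self]
  have h' : ∀ x y : Fin (n + n) → Bool, swapAll n x y =
      if x = Fin.append (fun i => y (Fin.natAdd n i)) (fun i => y (Fin.castAdd n i)) then 1 else 0 := by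
    intro x y
    rw [← h y x, swapAll, Matrix.of_apply, Matrix.of_apply]
    exact if_congr (forall_congr' fun i => ⟨fun h => ⟨h.2.symm, h.1.symm⟩,
      fun h => ⟨h.2.symm, h.1.symm⟩⟩) rfl rfl
  ext x y
  rw [Matrix.mul_apply, Matrix.mul_apply]
  simp only [h x, h' _ y]
  simp only [ite_mul, one_mul, zero_mul, mul_ite, mul_one, mul_zero, Finset.sum_ite_eq',
    Finset.mem_univ, if_true]
  simp only [tensor2, Matrix.of_apply, Fin.append_left, Fin.append_right]
  ring

theorem swapAll_mul_self : swapAll n * swapAll n = 1 := by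
  rw [swapAll_eq, ptensor_mul]
  simp only [swap4_mul_self]
  exact ptensor_one

/-- A two-qubit operator on the pair `i`, `n + i`. -/
theorem ptensor_single (i : Fin n) (m : Matrix (Bool × Bool) (Bool × Bool) ℂ)
    (x y : Fin (n + n) → Bool) : ptensor (fun j => if j = i then m else 1) x y =
      m (x (Fin.castAdd n i), x (Fin.natAdd n i)) (y (Fin.castAdd n i), y (Fin.natAdd n i)) *
        ∏ j ∈ Finset.univ.erase i, (1 : Matrix (Bool × Bool) (Bool × Bool) ℂ)
          (x (Fin.castAdd n j), x (Fin.natAdd n j)) (y (Fin.castAdd n j), y (Fin.natAdd n j)) := by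
  rw [ptensor, Matrix.of_apply, ← Finset.mul_prod_erase _ _ (Finset.mem_univ i), if_pos rfl]
  congr 1
  refine Finset.prod_congr rfl fun j hj => ?_
  rw [if_neg (Finset.ne_of_mem_erase hj)]

open Kronecker in
theorem tensor2_pauliAt (P : Pauli) (i : Fin n) : tensor2 (pauliAt P i) (pauliAt P i) =
    ptensor fun j => if j = i then P.matrix ⊗ₖ P.matrix else 1 := by
  rw [pauliAt, PauliString.op, tensor2_tensor_eq]
  congr 1
  funext j
  split_ifs with h
  · rfl
  · exact Matrix.one_kronecker_one

theorem sum_pauli {M : Type} [AddCommMonoid M] (f : Pauli → M) :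
    ∑ P, f P = f .X + (f .Y + f .Z) := by
  change (Multiset.map f (Pauli.X ::ₘ Pauli.Y ::ₘ {Pauli.Z})).sum = _
  simp

theorem sewOp_pauliAt (i : Fin n) : sewOp (fun P => pauliAt P i) i = swapOn {i} := by
  have hone : (1 : Op (n + n)) = ptensor fun j : Fin n => if j = i then 1 else 1 := by
    simp only [ite_self]
    exact ptensor_one.symm
  ext x y
  simp only [sewOp, sum_pauli, tensor2_pauliAt, swapOn, Finset.mem_singleton]
  rw [hone, Matrix.smul_apply, Matrix.add_apply, Matrix.add_apply, Matrix.add_apply]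
  simp only [ptensor_single]
  rw [← add_mul, ← add_mul, ← add_mul, smul_eq_mul, ← mul_assoc]
  congr 1
  have hI : Complex.I * Complex.I = -1 := Complex.I_mul_I
  generalize x (Fin.castAdd n i) = a
  generalize x (Fin.natAdd n i) = b
  generalize y (Fin.castAdd n i) = c
  generalize y (Fin.natAdd n i) = d
  cases a <;> cases b <;> cases c <;> cases d <;>
    simp [swap4, Pauli.matrix, Matrix.kroneckerMap_apply, hI] <;> norm_num

theorem sewOp_conj (V : UN n) (i : Fin n) :
    sewOp (fun P => star (V : Op n) * pauliAt P i * (V : Op n)) i =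
      tensor2 (star (V : Op n)) 1 * swapOn {i} * tensor2 (V : Op n) 1 := by
  rw [← sewOp_pauliAt, sewOp, sewOp, mul_smul_comm, smul_mul_assoc, mul_add, add_mul, mul_one,
    tensor2_mul, Finset.mul_sum, Finset.sum_mul]
  congr 2
  · rw [Matrix.mem_unitaryGroup_iff'.mp V.2, one_mul, tensor2_one]
  · refine Finset.sum_congr rfl fun P _ => ?_
    rw [tensor2_mul, tensor2_mul, one_mul, mul_one]

end Pairs

/-! ### Compiled circuits -/

section Compile

variable {n : ℕ}

/-- A layer on the first copy of the qubits. -/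
def extSlot (sl : Slot n) : Slot (n + n) :=
  (Fin.append sl.1 fun _ => idG, Fin.append sl.2 fun _ => 0)

theorem ofFn_append {α : Type} (f g : Fin n → α) :
    List.ofFn (Fin.append f g) = List.ofFn f ++ List.ofFn g := List.ofFn_fin_append f g

theorem append_comp {α β : Type} (F : α → β) (f g : Fin n → α) :
    (fun j => F (Fin.append f g j)) = Fin.append (fun j => F (f j)) fun j => F (g j) := by
  funext j
  refine Fin.addCases (fun j => ?_) (fun j => ?_) j
  · rw [Fin.append_left, Fin.append_left]
  · rw [Fin.append_right, Fin.append_right]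

theorem raw_extSlot (sl : Slot n) : raw (extSlot sl) = ext n (raw sl) := by
  simp only [raw, extSlot, ext, append_comp, ofFn_append, List.ofFn_const]
  rfl

theorem tensor2_diagonal (f : (Fin n → Bool) → ℂ) : tensor2 (Matrix.diagonal f) 1 =
    Matrix.diagonal fun x : Fin (n + n) → Bool => f fun i => x (Fin.castAdd n i) := by
  have h : (Matrix.diagonal f : Op n) = Matrix.diagonal f * 1 := (mul_one _).symm
  ext x y
  have h1 := congrFun (congrFun (tensor2_one (n := n)) x) y
  rw [tensor2, Matrix.of_apply] at h1 ⊢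
  rw [h, Matrix.diagonal_mul, mul_assoc, h1]
  conv_rhs => rw [← mul_one (Matrix.diagonal _)]
  rw [Matrix.diagonal_mul]

theorem czSign_append (l : Fin n → ℕ) (x : Fin (n + n) → Bool) :
    czSign (Fin.append l fun _ => 0) x = czSign l fun i => x (Fin.castAdd n i) := by
  have e : (Finset.univ.image (Fin.append l fun _ : Fin n => 0)).erase 0 =
      (Finset.univ.image l).erase 0 := by
    ext v
    simp only [Finset.mem_erase, Finset.mem_image, Finset.mem_univ, true_and]
    refine and_congr_right fun hv => ⟨?_, ?_⟩
    · rintro ⟨j, rfl⟩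
      revert hv
      refine Fin.addCases (fun j => ?_) (fun j => ?_) j
      · intro _; exact ⟨j, by rw [Fin.append_left]⟩
      · rw [Fin.append_right]; intro h; exact absurd rfl h
    · rintro ⟨j, rfl⟩
      exact ⟨Fin.castAdd n j, by rw [Fin.append_left]⟩
  rw [czSign, e, czSign]
  refine Finset.prod_congr rfl fun v hv => ?_
  have hv0 := (Finset.mem_erase.mp hv).1
  refine if_congr ⟨fun h i hi => h _ (by rwa [Fin.append_left]), fun h i => ?_⟩ rfl rfl
  refine Fin.addCases (fun j => ?_) (fun j => ?_) i
  · rw [Fin.append_left]; exact h j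
  · rw [Fin.append_right]; intro h; exact absurd h.symm hv0

theorem slotU_extSlot (sl : Slot n) : slotU (extSlot sl) = tensor2U (slotU sl) 1 := by
  refine Subtype.ext ?_
  have h1 : (czU (extSlot sl).2 : Op (n + n)) = tensor2 (czU sl.2 : Op n) 1 := by
    change Matrix.diagonal (czSign (Fin.append sl.2 fun _ => 0)) =
      tensor2 (Matrix.diagonal (czSign sl.2)) 1
    rw [tensor2_diagonal]
    congr 1
    funext x
    exact czSign_append _ _
  have h2 : (tensorU (fun j => ((extSlot sl).1 j).toU2) : Op (n + n)) =
      tensor2 (tensorU (fun j => (sl.1 j).toU2) : Op n) 1 := by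
    rw [← tensor_one, coe_tensorU, coe_tensorU, tensor2_tensor]
    congr 1
    simp only [extSlot]
    rw [append_comp (fun g : Gate => (g.toU2 : Matrix Bool Bool ℂ)), idG_toU2]
    rfl
  change (czU (extSlot sl).2 : Op (n + n)) *
    (tensorU (fun j => ((extSlot sl).1 j).toU2) : Op (n + n)) = _
  rw [h1, h2, tensor2_mul, mul_one]
  rfl

theorem tensor2U_mul (A B C D : UN n) :
    tensor2U A B * tensor2U C D = tensor2U (A * C) (B * D) := Subtype.ext (tensor2_mul _ _ _ _)

theorem tensor2U_one : tensor2U (1 : UN n) 1 = 1 := Subtype.ext tensor2_one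

theorem slotsU_map_extSlot (ls : List (Slot n)) :
    slotsU (ls.map extSlot) = tensor2U (slotsU ls) 1 := by
  induction ls with
  | nil => exact tensor2U_one.symm
  | cons sl ls ih =>
    rw [List.map_cons, slotsU_cons, ih, slotU_extSlot, tensor2U_mul, mul_one, slotsU_cons]

/-- The inverse of a gate. -/
def invG (g : Gate) : Gate := ⟨g.a, -g.b, -g.c, -g.d, by simpa using g.pos⟩

theorem invG_toU2 (g : Gate) : (invG g).toU2 = star g.toU2 := by
  refine Subtype.ext ?_
  change (invG g).matrix = star g.matrix
  have h : (invG g).norm = g.norm := by simp [invG, Gate.norm]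
  ext x y
  rw [Gate.matrix, h]
  cases x <;> cases y <;> simp [Gate.matrix, invG, Matrix.star_apply]

theorem gdat_invG (g : Gate) : gdat (invG g) = ginv (gdat g) := rfl

/-- Layers that invert a layer. -/
def invLayers (sl : Slot n) : List (Slot n) :=
  [(fun _ => idG, sl.2), (fun j => invG (sl.1 j), fun _ => 0)]

theorem map_raw_invLayers (sl : Slot n) : (invLayers sl).map raw = invSlots (raw sl) := by
  simp only [invLayers, List.map_cons, List.map_nil, invSlots, raw, List.map_ofFn, Function.comp_def,
    gdat_invG]
  rfl

theorem star_czU (l : Fin n → ℕ) : star (czU l) = czU l := by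
  refine Subtype.ext ?_
  change star (Matrix.diagonal (czSign l)) = Matrix.diagonal (czSign l)
  rw [Matrix.star_eq_conjTranspose, Matrix.diagonal_conjTranspose]
  congr 1
  funext x
  rw [Pi.star_apply, czSign, star_prod]
  refine Finset.prod_congr rfl fun v _ => ?_
  split_ifs <;> simp

theorem slotsU_invLayers (sl : Slot n) : slotsU (invLayers sl) = star (slotU sl) := by
  rw [invLayers, slotsU_cons, slotsU_cons, slotsU_nil, one_mul, slotU, slotU, slotU, czU_zero,
    one_mul, star_mul, star_czU]
  simp only [idG_toU2, invG_toU2]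
  rw [tensorU_one, mul_one]
  congr 1
  refine Subtype.ext ?_
  exact (tensor_star _).symm

theorem slotsU_inverse (ls : List (Slot n)) :
    slotsU (ls.reverse.flatMap invLayers) = star (slotsU ls) := by
  induction ls with
  | nil => exact (star_one _).symm
  | cons sl ls ih =>
    rw [List.reverse_cons, List.flatMap_append, slotsU_append, ih, slotsU_cons, star_mul]
    congr 1
    rw [List.flatMap_cons, List.flatMap_nil, List.append_nil, slotsU_invLayers]

/-! ### Exchanging qubits -/

/-- The Hadamard gate, up to a phase. -/
def hadG : Gate := ⟨0, 1, 0, 1, by norm_num⟩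

/-- Gates `g` and `h` on the pairs of qubits in `I`. -/
def pairGates (I : Finset (Fin n)) (g h : Gate) : Fin (n + n) → Gate :=
  Fin.append (fun q => if q ∈ I then g else idG) fun q => if q ∈ I then h else idG

/-- Labels for `CZ` gates on the pairs of qubits in `I`. -/
def pairLabels (I : Finset (Fin n)) : Fin (n + n) → ℕ :=
  Fin.append (fun q => if q ∈ I then (q : ℕ) + 1 else 0) fun q => if q ∈ I then (q : ℕ) + 1 else 0

/-- Layers that exchange the pairs of qubits in `I`. -/
def swapLayers (I : Finset (Fin n)) : List (Slot (n + n)) :=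
  [(pairGates I idG hadG, pairLabels I), (pairGates I hadG (invG hadG), pairLabels I),
    (pairGates I (invG hadG) hadG, pairLabels I), (pairGates I idG (invG hadG), fun _ => 0)]

theorem map_raw_swapLayers {I : Finset (Fin n)} {l : List ℕ}
    (h : ∀ q : Fin n, q ∈ I ↔ (q : ℕ) ∈ l) : (swapLayers I).map raw = swapSlots n l := by
  have key : ∀ {α : Type} (f : ℕ → α) (a : α), ((List.range n).map fun q =>
      bif l.any fun a => Nat.beq a q then f q else a) =
        List.ofFn fun q : Fin n => if q ∈ I then f q else a := by
    intro α f a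
    rw [map_range_eq_ofFn]
    congr 1
    funext q
    rw [any_beq]
    by_cases hq : q ∈ I
    · rw [decide_eq_true ((h q).mp hq), if_pos hq]; rfl
    · rw [decide_eq_false (mt (h q).mpr hq), if_neg hq]; rfl
  have hg : ∀ g k : Gate, (List.ofFn fun j => gdat (pairGates I g k j)) =
      swapGates n l (gdat g) (gdat k) := by
    intro g k
    have e : ∀ g : Gate, ((List.range n).map fun q => bif l.any fun a => Nat.beq a q then gdat g
        else idGate) = List.ofFn fun q : Fin n => gdat (if q ∈ I then g else idG) := by
      intro g
      simp only [apply_ite gdat]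
      exact key _ _
    rw [swapGates, e, e, ← ofFn_append]
    congr 1
    exact append_comp gdat _ _
  have hl : List.ofFn (pairLabels I) = swapLabels n l := by
    rw [swapLabels, key fun q => q + 1, ← ofFn_append]
    rfl
  simp only [swapLayers, List.map_cons, List.map_nil, raw, hg, hl, swapSlots, List.ofFn_const]
  rfl

/-- The `CZ` gate on two qubits. -/
def cz4 : Matrix (Bool × Bool) (Bool × Bool) ℂ :=
  Matrix.diagonal fun a => if a.1 && a.2 then -1 else 1

theorem coe_czU_pairLabels (I : Finset (Fin n)) :
    (czU (pairLabels I) : Op (n + n)) = ptensor fun j => if j ∈ I then cz4 else 1 := by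
  have hs : ∀ x, czSign (pairLabels I) x = ∏ j ∈ I,
      if x (Fin.castAdd n j) && x (Fin.natAdd n j) then (-1 : ℂ) else 1 := by
    intro x
    have e : (Finset.univ.image (pairLabels I)).erase 0 = I.image fun j : Fin n => (j : ℕ) + 1 := by
      ext v
      simp only [Finset.mem_erase, Finset.mem_image, Finset.mem_univ, true_and]
      constructor
      · rintro ⟨hv, j, rfl⟩
        revert hv
        refine Fin.addCases (fun j => ?_) (fun j => ?_) j
        · rw [pairLabels, Fin.append_left]
          split_ifs with hj
          · intro _; exact ⟨j, hj, rfl⟩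
          · intro h; exact absurd rfl h
        · rw [pairLabels, Fin.append_right]
          split_ifs with hj
          · intro _; exact ⟨j, hj, rfl⟩
          · intro h; exact absurd rfl h
      · rintro ⟨j, hj, rfl⟩
        exact ⟨by omega, Fin.castAdd n j, by rw [pairLabels, Fin.append_left, if_pos hj]⟩
    rw [czSign, e, Finset.prod_image fun a _ b _ h => Fin.ext (Nat.succ_injective h)]
    refine Finset.prod_congr rfl fun j hj => ?_
    refine if_congr ?_ rfl rfl
    rw [Bool.and_eq_true]
    constructor
    · intro h
      exact ⟨h _ (by rw [pairLabels, Fin.append_left, if_pos hj]),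
        h _ (by rw [pairLabels, Fin.append_right, if_pos hj])⟩
    · rintro ⟨h1, h2⟩ i
      refine Fin.addCases (fun k => ?_) (fun k => ?_) i
      · rw [pairLabels, Fin.append_left]
        split_ifs
        · intro h; rw [Fin.ext (Nat.succ_injective h)]; exact h1
        · intro h; exact h.elim
      · rw [pairLabels, Fin.append_right]
        split_ifs
        · intro h; rw [Fin.ext (Nat.succ_injective h)]; exact h2
        · intro h; exact h.elim
  have h1 : (czU (pairLabels I) : Op (n + n)) = Matrix.diagonal fun x => ∏ j ∈ I,
      if x (Fin.castAdd n j) && x (Fin.natAdd n j) then (-1 : ℂ) else 1 := by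
    change Matrix.diagonal (czSign (pairLabels I)) = _
    congr 1
    exact funext hs
  rw [h1]
  ext x y
  rw [ptensor, Matrix.of_apply]
  by_cases hxy : x = y
  · subst hxy
    rw [Matrix.diagonal_apply_eq, ← Finset.prod_subset (Finset.subset_univ I)]
    · refine Finset.prod_congr rfl fun j hj => ?_
      rw [if_pos hj, cz4, Matrix.diagonal_apply_eq]
    · intro j _ hj
      rw [if_neg hj, Matrix.one_apply_eq]
  · rw [Matrix.diagonal_apply_ne _ hxy]
    obtain ⟨i, hi⟩ := Function.ne_iff.mp hxy
    obtain ⟨j, hj⟩ : ∃ j : Fin n, (x (Fin.castAdd n j), x (Fin.natAdd n j)) ≠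
        (y (Fin.castAdd n j), y (Fin.natAdd n j)) := by
      revert hi
      refine Fin.addCases (fun k => ?_) (fun k => ?_) i
      · intro h; exact ⟨k, fun h' => h (congrArg Prod.fst h')⟩
      · intro h; exact ⟨k, fun h' => h (congrArg Prod.snd h')⟩
    rw [Finset.prod_eq_zero (Finset.mem_univ j)]
    split_ifs
    · exact Matrix.diagonal_apply_ne _ hj
    · exact Matrix.one_apply_ne hj

open Kronecker

theorem coe_pairGates (I : Finset (Fin n)) (g h : Gate) :
    (tensorU (fun j => (pairGates I g h j).toU2) : Op (n + n)) =
      ptensor fun j => if j ∈ I then g.matrix ⊗ₖ h.matrix else 1 := by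
  rw [coe_tensorU]
  have e : (fun j => ((pairGates I g h j).toU2 : Matrix Bool Bool ℂ)) =
      Fin.append (fun q => if q ∈ I then g.matrix else 1) fun q => if q ∈ I then h.matrix else 1 := by
    unfold pairGates
    rw [append_comp fun g : Gate => (g.toU2 : Matrix Bool Bool ℂ)]
    congr 1
    all_goals
      funext q
      split_ifs
      · rfl
      · rw [idG_toU2]; rfl
  rw [e, ← tensor2_tensor, tensor2_tensor_eq]
  congr 1
  funext j
  split_ifs
  · rfl
  · exact Matrix.one_kronecker_one

theorem swap4_eq : ((1 : Matrix Bool Bool ℂ) ⊗ₖ (invG hadG).matrix) *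
    ((cz4 * ((invG hadG).matrix ⊗ₖ hadG.matrix)) * ((cz4 * (hadG.matrix ⊗ₖ (invG hadG).matrix)) *
      (cz4 * ((1 : Matrix Bool Bool ℂ) ⊗ₖ hadG.matrix)))) = swap4 := by
  set h := hadG.matrix with hh
  set k := (invG hadG).matrix with hk
  have hn : hadG.norm = Real.sqrt 2 := by simp [hadG, Gate.norm]
  have hkn : (invG hadG).norm = Real.sqrt 2 := by simp [hadG, invG, Gate.norm]
  have s2 := sqrt_two_inv_sq
  have hI : Complex.I * Complex.I = -1 := Complex.I_mul_I
  have c1 : ((1 : Matrix Bool Bool ℂ) ⊗ₖ k) * (cz4 * ((1 : Matrix Bool Bool ℂ) ⊗ₖ h)) =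
      Matrix.of fun a b => if a.1 = b.1 ∧ a.2 = (b.2 ^^ b.1) then 1 else 0 := by
    ext ⟨a, b⟩ ⟨c, d⟩
    rw [Matrix.mul_apply]
    simp only [cz4, Matrix.diagonal_mul, Fintype.sum_prod_type, Fintype.sum_bool,
      Matrix.kroneckerMap_apply, hh, hk, Gate.matrix, hn, hkn, Matrix.smul_apply, Matrix.of_apply]
    cases a <;> cases b <;> cases c <;> cases d <;> simp [hadG, invG] <;>
      linear_combination (-2 * Complex.I * Complex.I) * s2 - hI
  have c2 : (k ⊗ₖ (1 : Matrix Bool Bool ℂ)) * (cz4 * (h ⊗ₖ (1 : Matrix Bool Bool ℂ))) =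
      Matrix.of fun a b => if a.2 = b.2 ∧ a.1 = (b.1 ^^ b.2) then 1 else 0 := by
    ext ⟨a, b⟩ ⟨c, d⟩
    rw [Matrix.mul_apply]
    simp only [cz4, Matrix.diagonal_mul, Fintype.sum_prod_type, Fintype.sum_bool,
      Matrix.kroneckerMap_apply, hh, hk, Gate.matrix, hn, hkn, Matrix.smul_apply, Matrix.of_apply]
    cases a <;> cases b <;> cases c <;> cases d <;> simp [hadG, invG] <;>
      linear_combination (-2 * Complex.I * Complex.I) * s2 - hI
  have e1 : k ⊗ₖ h = ((1 : Matrix Bool Bool ℂ) ⊗ₖ h) * (k ⊗ₖ (1 : Matrix Bool Bool ℂ)) := by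
    rw [← Matrix.mul_kronecker_mul, one_mul, mul_one]
  have e2 : h ⊗ₖ k = (h ⊗ₖ (1 : Matrix Bool Bool ℂ)) * ((1 : Matrix Bool Bool ℂ) ⊗ₖ k) := by
    rw [← Matrix.mul_kronecker_mul, one_mul, mul_one]
  have e3 : ∀ a b c d e f g : Matrix (Bool × Bool) (Bool × Bool) ℂ,
      a * ((b * (c * d)) * ((b * (e * f)) * g)) = (a * (b * c)) * ((d * (b * e)) * (f * g)) := by
    intros; simp only [mul_assoc]
  rw [e1, e2, e3, c1, c2]
  ext ⟨a, b⟩ ⟨c, d⟩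
  simp only [Matrix.mul_apply, Fintype.sum_prod_type, Fintype.sum_bool, Matrix.of_apply, swap4]
  cases a <;> cases b <;> cases c <;> cases d <;> simp

theorem slotsU_swapLayers (I : Finset (Fin n)) :
    (slotsU (swapLayers I) : Op (n + n)) = swapOn I := by
  have hid : idG.matrix = 1 := congrArg Subtype.val idG_toU2
  change ((((1 : Op (n + n)) * ((czU fun _ => 0 : UN (n + n)) * (tensorU (fun j => (pairGates I idG (invG hadG) j).toU2) : Op (n + n)))) *
    ((czU (pairLabels I) : Op (n + n)) * (tensorU (fun j => (pairGates I (invG hadG) hadG j).toU2) : Op (n + n)))) *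
    ((czU (pairLabels I) : Op (n + n)) * (tensorU (fun j => (pairGates I hadG (invG hadG) j).toU2) : Op (n + n)))) *
    ((czU (pairLabels I) : Op (n + n)) * (tensorU (fun j => (pairGates I idG hadG j).toU2) : Op (n + n))) = _
  have hz : ((czU fun _ => 0 : UN (n + n)) : Op (n + n)) = 1 := congrArg Subtype.val czU_zero
  rw [hz, coe_czU_pairLabels]
  simp only [coe_pairGates, one_mul, ptensor_mul, hid, mul_assoc]
  rw [swapOn]
  congr 1
  funext j
  by_cases hj : j ∈ I
  · simp only [if_pos hj]
    rw [← swap4_eq]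
    simp only [mul_assoc]
  · simp [hj]

end Compile

/-! ### Parallel composition -/

section Merge

variable {M : ℕ} {O O' : Finset (Fin M)} {A A' : List ℕ}

/-- A layer that acts only on the qubits in `O` and has its labels in `A`, shifted by one. -/
structure Slot.In (O : Finset (Fin M)) (A : List ℕ) (sl : Slot M) : Prop where
  gate : ∀ j, j ∉ O → sl.1 j = idG
  label : ∀ j, j ∉ O → sl.2 j = 0
  label_mem : ∀ j, sl.2 j = 0 ∨ ∃ a ∈ A, sl.2 j = a + 1

theorem Slot.In.block_subset {s : Slot M} (h : s.In O A) {B : Finset (Fin M)}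
    (hB : B ∈ blocks s.2) : B ⊆ O := by
  obtain ⟨j, hj, rfl⟩ := mem_blocks.mp hB
  intro k hk
  by_contra hk'
  exact hj ((Finset.mem_filter.mp hk).2.symm.trans (h.label k hk'))

theorem Slot.In.czU_mem_loc {s : Slot M} (h : s.In O A) : (czU s.2 : Op M) ∈ loc O :=
  QACLearn.czU_mem_loc fun _ hB => h.block_subset hB

theorem Slot.In.tensorU_mem_loc {s : Slot M} (h : s.In O A) :
    (tensorU (fun j => (s.1 j).toU2) : Op M) ∈ loc O := by
  rw [coe_tensorU]
  refine tensor_mem_loc fun j hj => ?_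
  rw [h.gate j hj, idG_toU2]
  rfl

theorem Slot.In.slotU_mem_loc {s : Slot M} (h : s.In O A) : (slotU s : Op M) ∈ loc O :=
  mul_mem h.czU_mem_loc h.tensorU_mem_loc

theorem slotsU_mem_loc_of_in {ls : List (Slot M)} (h : ∀ s ∈ ls, s.In O A) :
    (slotsU ls : Op M) ∈ loc O := by
  induction ls with
  | nil => exact one_mem _
  | cons s ls ih =>
    rw [slotsU_cons]
    exact mul_mem (ih fun s' hs => h s' (List.mem_cons_of_mem _ hs))
      (h s List.mem_cons_self).slotU_mem_loc

/-- The layer that acts as `s` on `O` and as `t` elsewhere. -/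
def combine (O : Finset (Fin M)) (s t : Slot M) : Slot M :=
  (fun q => if q ∈ O then s.1 q else t.1 q, fun q => if q ∈ O then s.2 q else t.2 q)

theorem combine_in {s t : Slot M} (hs : s.In O A) (ht : t.In O' A') :
    (combine O s t).In (O ∪ O') (A ++ A') := by
  refine ⟨fun j hj => ?_, fun j hj => ?_, fun j => ?_⟩
  · rw [Finset.mem_union, not_or] at hj
    exact (if_neg hj.1).trans (ht.gate j hj.2)
  · rw [Finset.mem_union, not_or] at hj
    exact (if_neg hj.1).trans (ht.label j hj.2)
  · change (if j ∈ O then s.2 j else t.2 j) = 0 ∨ ∃ a ∈ A ++ A',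
      (if j ∈ O then s.2 j else t.2 j) = a + 1
    split_ifs
    · exact (hs.label_mem j).imp_right fun ⟨a, ha, h⟩ => ⟨a, List.mem_append_left _ ha, h⟩
    · exact (ht.label_mem j).imp_right fun ⟨a, ha, h⟩ => ⟨a, List.mem_append_right _ ha, h⟩

theorem label_ne {s t : Slot M} (hs : s.In O A) (ht : t.In O' A') (hA : A.Disjoint A') {j k : Fin M}
    (hj : s.2 j ≠ 0) : t.2 k ≠ s.2 j := by
  intro h
  obtain ⟨a, ha, h1⟩ := (hs.label_mem j).resolve_left hj
  obtain ⟨a', ha', h2⟩ := (ht.label_mem k).resolve_left (h ▸ hj)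
  obtain rfl : a = a' := by omega
  exact hA ha ha'

theorem slotU_combine {s t : Slot M} (hs : s.In O A) (ht : t.In O' A') (hO : Disjoint O O')
    (hA : A.Disjoint A') : slotU (combine O s t) = slotU s * slotU t := by
  have h0 : ∀ j, j ∈ O → t.2 j = 0 := fun j hj => ht.label j (Finset.disjoint_left.mp hO hj)
  have hb : blocks (combine O s t).2 = blocks s.2 ∪ blocks t.2 := by
    have e1 : ∀ j, s.2 j ≠ 0 → (Finset.univ.filter fun k => (combine O s t).2 k = s.2 j) =
        Finset.univ.filter fun k => s.2 k = s.2 j := by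
      intro j hj
      refine Finset.filter_congr fun k _ => ?_
      change (if k ∈ O then s.2 k else t.2 k) = s.2 j ↔ _
      split_ifs with hk
      · rfl
      · rw [hs.label k hk]
        exact ⟨fun h => absurd h (label_ne hs ht hA hj), fun h => absurd h.symm hj⟩
    have e2 : ∀ j, t.2 j ≠ 0 → (Finset.univ.filter fun k => (combine O s t).2 k = t.2 j) =
        Finset.univ.filter fun k => t.2 k = t.2 j := by
      intro j hj
      refine Finset.filter_congr fun k _ => ?_
      change (if k ∈ O then s.2 k else t.2 k) = t.2 j ↔ _
      split_ifs with hk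
      · rw [h0 k hk]
        exact ⟨fun h => absurd h (label_ne ht hs hA.symm hj), fun h => absurd h.symm hj⟩
      · rfl
    ext B
    rw [Finset.mem_union, mem_blocks, mem_blocks, mem_blocks]
    constructor
    · rintro ⟨j, hj, rfl⟩
      by_cases h : j ∈ O
      · have e : (combine O s t).2 j = s.2 j := if_pos h
        rw [e] at hj
        exact Or.inl ⟨j, hj, by rw [e, e1 j hj]⟩
      · have e : (combine O s t).2 j = t.2 j := if_neg h
        rw [e] at hj
        exact Or.inr ⟨j, hj, by rw [e, e2 j hj]⟩
    · rintro (⟨j, hj, rfl⟩ | ⟨j, hj, rfl⟩)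
      · have e : (combine O s t).2 j = s.2 j := if_pos (by_contra fun h => hj (hs.label j h))
        exact ⟨j, by rwa [e], by rw [e, e1 j hj]⟩
      · have e : (combine O s t).2 j = t.2 j := if_neg fun h => hj (h0 j h)
        exact ⟨j, by rwa [e], by rw [e, e2 j hj]⟩
  have hd : Disjoint (blocks s.2) (blocks t.2) := by
    refine Finset.disjoint_left.mpr fun B h1 h2 => ?_
    obtain ⟨j, hj, rfl⟩ := mem_blocks.mp h1
    have hm : j ∈ Finset.univ.filter fun k => s.2 k = s.2 j := by simp
    exact Finset.disjoint_left.mp hO (hs.block_subset h1 hm) (ht.block_subset h2 hm)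
  have ht' : tensorU (fun j => ((combine O s t).1 j).toU2) =
      tensorU (fun j => (s.1 j).toU2) * tensorU fun j => (t.1 j).toU2 := by
    rw [tensorU_mul]
    congr 1
    funext j
    change (if j ∈ O then s.1 j else t.1 j).toU2 = _
    split_ifs with h
    · rw [ht.gate j (Finset.disjoint_left.mp hO h), idG_toU2, mul_one]
    · rw [hs.gate j h, idG_toU2, one_mul]
  have hc : tensorU (fun j => (s.1 j).toU2) * czU t.2 = czU t.2 * tensorU fun j => (s.1 j).toU2 :=
    Subtype.ext (commute_of_disjoint hO hs.tensorU_mem_loc ht.czU_mem_loc)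
  rw [slotU, ht', czU_mul hb hd, slotU, slotU, mul_assoc (czU s.2), mul_assoc (czU s.2),
    ← mul_assoc (czU t.2), ← hc, mul_assoc (tensorU _)]

theorem slotsU_zipWith_combine {a b : List (Slot M)} (hl : a.length = b.length)
    (ha : ∀ s ∈ a, s.In O A) (hb : ∀ s ∈ b, s.In O' A') (hO : Disjoint O O')
    (hA : A.Disjoint A') :
    slotsU (List.zipWith (combine O) a b) = slotsU a * slotsU b := by
  induction a generalizing b with
  | nil =>
    obtain rfl := List.length_eq_zero_iff.mp hl.symm
    exact (mul_one _).symm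
  | cons s a ih =>
    obtain ⟨t, b, rfl⟩ := List.exists_cons_of_length_eq_add_one hl.symm
    rw [List.forall_mem_cons] at ha hb
    rw [List.zipWith_cons_cons, slotsU_cons, slotsU_cons, slotsU_cons,
      ih (Nat.succ_injective hl) ha.2 hb.2, slotU_combine ha.1 hb.1 hO hA]
    have hc : slotU s * slotsU b = slotsU b * slotU s :=
      Subtype.ext (commute_of_disjoint hO ha.1.slotU_mem_loc (slotsU_mem_loc_of_in hb.2))
    rw [mul_assoc (slotsU a), mul_assoc (slotsU a), ← mul_assoc (slotU s), hc, mul_assoc (slotsU b)]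

theorem zipWith_combine_in {a b : List (Slot M)} (ha : ∀ s ∈ a, s.In O A)
    (hb : ∀ s ∈ b, s.In O' A') :
    ∀ s ∈ List.zipWith (combine O) a b, s.In (O ∪ O') (A ++ A') := by
  induction a generalizing b with
  | nil => intro s hs; rw [List.zipWith_nil_left] at hs; exact absurd hs List.not_mem_nil
  | cons s a ih =>
    cases b with
    | nil => intro s hs; rw [List.zipWith_nil_right] at hs; exact absurd hs List.not_mem_nil
    | cons t b =>
      rw [List.forall_mem_cons] at ha hb
      rw [List.zipWith_cons_cons, List.forall_mem_cons]
      exact ⟨combine_in ha.1 hb.1, ih ha.2 hb.2⟩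

end Merge

/-! ### The circuits of the candidates -/

section Parts

variable {n : ℕ}

/-- A candidate: a qubit, the qubits on which the circuit acts, and the circuit. -/
structure TCand (n : ℕ) where
  idx : Fin n
  A : List ℕ
  ls : List (Slot n)

/-- The description of a candidate. -/
def TCand.raw (c : TCand n) : Cand := ((c.idx, c.A), c.ls.map QACLearn.raw)

/-- A well-formed candidate. -/
structure TCand.Good (N b D : ℕ) (c : TCand n) : Prop where
  fuel : Fuel N n b c.A
  on : ∀ sl ∈ c.ls, sl.On b c.A
  mem : (c.idx : ℕ) ∈ c.A
  length : c.ls.length = D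

/-- The layers of `V† SWAP_i V`. -/
def TCand.part (c : TCand n) : List (Slot (n + n)) :=
  c.ls.map extSlot ++ (swapLayers {c.idx} ++
    (c.ls.reverse.flatMap invLayers).map extSlot)

/-- The operator `V† SWAP_i V`. -/
noncomputable def TCand.op (c : TCand n) : Op (n + n) :=
  tensor2 (star (slotsU c.ls : Op n)) 1 * swapOn {c.idx} * tensor2 (slotsU c.ls : Op n) 1

theorem TCand.coe_part (c : TCand n) : (slotsU c.part : Op (n + n)) = c.op := by
  rw [part, slotsU_append, slotsU_append, slotsU_map_extSlot, slotsU_map_extSlot, slotsU_inverse,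
    op, ← slotsU_swapLayers]
  rfl

theorem TCand.op_eq (c : TCand n) : c.op =
    sewOp (fun P => star (slotsU c.ls : Op n) * pauliAt P c.idx * (slotsU c.ls : Op n)) c.idx :=
  (sewOp_conj _ _).symm

theorem TCand.map_raw_part (c : TCand n) : c.part.map QACLearn.raw = partSlots n c.raw := by
  have h1 : (swapLayers {c.idx}).map QACLearn.raw = swapSlots n [(c.idx : ℕ)] :=
    map_raw_swapLayers fun q => by rw [Finset.mem_singleton, List.mem_singleton, Fin.ext_iff]
  have h2 : ∀ l : List (Slot n), ((l.flatMap invLayers).map extSlot).map QACLearn.raw =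
      (l.map QACLearn.raw).flatMap fun sl => (invSlots sl).map fun sl => ext n sl := by
    intro l
    induction l with
    | nil => rfl
    | cons s l ih =>
      rw [List.flatMap_cons, List.map_append, List.map_append, ih, List.map_cons, List.flatMap_cons,
        ← map_raw_invLayers, List.map_map, List.map_map]
      congr 2
      exact funext fun s => raw_extSlot s
  rw [part, partSlots, List.map_append, List.map_append, h1, h2, raw, List.map_reverse,
    List.map_map, List.map_map]
  congr 2
  exact funext fun s => raw_extSlot s

theorem TCand.part_length (c : TCand n) : c.part.length = c.ls.length + 4 + 2 * c.ls.length := by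
  have h : ∀ l : List (Slot n), (l.flatMap invLayers).length = 2 * l.length := by
    intro l
    induction l with
    | nil => rfl
    | cons s l ih => rw [List.flatMap_cons, List.length_append, ih, List.length_cons]
                     simp [invLayers]; omega
  rw [part, List.length_append, List.length_append, List.length_map, List.length_map, h,
    List.length_reverse]
  simp [swapLayers]
  omega

/-- The qubits on which the circuit of a candidate acts. -/
def TCand.own (c : TCand n) : Finset (Fin (n + n)) :=
  insert (Fin.natAdd n c.idx) ((supp n c.A).map (Fin.castAddEmb n))

theorem TCand.castAdd_mem_own (c : TCand n) (j : Fin n) :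
    Fin.castAdd n j ∈ c.own ↔ (j : ℕ) ∈ c.A := by
  rw [own, Finset.mem_insert, Finset.mem_map]
  constructor
  · rintro (h | ⟨k, hk, h⟩)
    · have := congrArg Fin.val h; simp at this; omega
    · have := congrArg Fin.val h
      simp only [Fin.castAddEmb_apply, Fin.val_castAdd] at this
      rw [← this]; exact mem_supp.mp hk
  · exact fun h => Or.inr ⟨j, mem_supp.mpr h, rfl⟩

theorem TCand.natAdd_mem_own (c : TCand n) (j : Fin n) : Fin.natAdd n j ∈ c.own ↔ j = c.idx := by
  rw [own, Finset.mem_insert, Finset.mem_map]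
  constructor
  · rintro (h | ⟨k, hk, h⟩)
    · have := congrArg Fin.val h; simp at this; exact Fin.ext this
    · have := congrArg Fin.val h; simp at this; omega
  · exact fun h => Or.inl (by rw [h])

theorem TCand.own_iff {c : TCand n} (hA : ∀ a ∈ c.A, a < n) (q : Fin (n + n)) :
    q ∈ c.own ↔ owns n c.raw q = true := by
  have h : owns n c.raw q = true ↔ (q : ℕ) ∈ c.A ∨ (q : ℕ) = n + c.idx := by
    rw [owns, raw, any_beq, Bool.or_eq_true, decide_eq_true_iff, Nat.beq_eq]
  rw [h]
  refine Fin.addCases (fun j => ?_) (fun j => ?_) q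
  · rw [castAdd_mem_own, Fin.val_castAdd]
    exact ⟨Or.inl, fun h => h.resolve_right (by omega)⟩
  · rw [natAdd_mem_own, Fin.val_natAdd]
    constructor
    · rintro rfl; exact Or.inr rfl
    · rintro (h | h)
      · exact absurd (hA _ h) (by omega)
      · exact Fin.ext (by omega)

theorem TCand.Good.part_in {N b D : ℕ} {c : TCand n} (h : c.Good N b D) :
    ∀ s ∈ c.part, s.In c.own c.A := by
  have h1 : ∀ s : Slot n, (∀ j : Fin n, (j : ℕ) ∉ c.A → s.1 j = idG) →
      (∀ j : Fin n, (j : ℕ) ∉ c.A → s.2 j = 0) → (∀ j : Fin n, s.2 j = 0 ∨ ∃ a ∈ c.A, s.2 j = a + 1) →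
      (extSlot s).In c.own c.A := by
    intro s hg hl hm
    refine ⟨fun j => ?_, fun j => ?_, fun j => ?_⟩
    · refine Fin.addCases (fun j hj => ?_) (fun j hj => ?_) j
      · rw [c.castAdd_mem_own] at hj
        simp only [extSlot, Fin.append_left]; exact hg j hj
      · simp only [extSlot, Fin.append_right]
    · refine Fin.addCases (fun j hj => ?_) (fun j hj => ?_) j
      · rw [c.castAdd_mem_own] at hj
        simp only [extSlot, Fin.append_left]; exact hl j hj
      · simp only [extSlot, Fin.append_right]
    · refine Fin.addCases (fun j => ?_) (fun j => ?_) j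
      · simp only [extSlot, Fin.append_left]; exact hm j
      · simp only [extSlot, Fin.append_right]; exact Or.inl trivial
  have h2 : ∀ (g k : Gate) (l : Fin (n + n) → ℕ), (l = pairLabels {c.idx} ∨ l = fun _ => 0) →
      Slot.In c.own c.A (pairGates {c.idx} g k, l) := by
    intro g k l hl
    refine ⟨fun j => ?_, fun j => ?_, fun j => ?_⟩
    · refine Fin.addCases (fun j hj => ?_) (fun j hj => ?_) j
      · rw [c.castAdd_mem_own] at hj
        simp only [pairGates, Fin.append_left, Finset.mem_singleton]
        exact if_neg fun e : j = c.idx => hj (e ▸ h.mem)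
      · rw [c.natAdd_mem_own] at hj
        simp only [pairGates, Fin.append_right, Finset.mem_singleton]
        exact if_neg hj
    · obtain rfl | rfl := hl
      · refine Fin.addCases (fun j hj => ?_) (fun j hj => ?_) j
        · rw [c.castAdd_mem_own] at hj
          simp only [pairLabels, Fin.append_left, Finset.mem_singleton]
          exact if_neg fun e : j = c.idx => hj (e ▸ h.mem)
        · rw [c.natAdd_mem_own] at hj
          simp only [pairLabels, Fin.append_right, Finset.mem_singleton]
          exact if_neg hj
      · exact fun _ => rfl
    · obtain rfl | rfl := hl
      · refine Fin.addCases (fun j => ?_) (fun j => ?_) j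
        · simp only [pairLabels, Fin.append_left, Finset.mem_singleton]
          split_ifs with e
          · exact Or.inr ⟨j, e ▸ h.mem, rfl⟩
          · exact Or.inl rfl
        · simp only [pairLabels, Fin.append_right, Finset.mem_singleton]
          split_ifs with e
          · exact Or.inr ⟨j, e ▸ h.mem, rfl⟩
          · exact Or.inl rfl
      · exact Or.inl rfl
  intro s hs
  rw [TCand.part, List.mem_append, List.mem_append, List.mem_map, List.mem_map] at hs
  obtain ⟨s, hs, rfl⟩ | hs | ⟨s, hs, rfl⟩ := hs
  · exact h1 s (h.on s hs).gate (h.on s hs).label (h.on s hs).label_mem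
  · simp only [swapLayers, List.mem_cons, List.not_mem_nil, or_false] at hs
    obtain rfl | rfl | rfl | rfl := hs
    · exact h2 _ _ _ (Or.inl rfl)
    · exact h2 _ _ _ (Or.inl rfl)
    · exact h2 _ _ _ (Or.inl rfl)
    · exact h2 _ _ _ (Or.inr rfl)
  · obtain ⟨s', hs', hs⟩ := List.mem_flatMap.mp hs
    have ho := h.on s' (List.mem_reverse.mp hs')
    simp only [invLayers, List.mem_cons, List.not_mem_nil, or_false] at hs
    obtain rfl | rfl := hs
    · exact h1 _ (fun _ _ => rfl) ho.label ho.label_mem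
    · refine h1 _ (fun j hj => ?_) (fun _ _ => rfl) fun _ => Or.inl rfl
      change invG (s'.1 j) = idG
      rw [ho.gate j hj]
      rfl

theorem TCand.Good.op_mem_loc {N b D : ℕ} {c : TCand n} (h : c.Good N b D) : c.op ∈ loc c.own := by
  rw [← c.coe_part]
  exact slotsU_mem_loc_of_in h.part_in

/-- The parallel composition of the circuits of candidates. -/
def mergeT (M : ℕ) : List (TCand n) → List (Slot (n + n))
  | [] => List.replicate M (fun _ => idG, fun _ => 0)
  | c :: r => List.zipWith (combine c.own) c.part (mergeT M r)

/-- Candidates that act on disjoint sets of qubits. -/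
def Apart (c c' : TCand n) : Prop := c.idx ≠ c'.idx ∧ c.A.Disjoint c'.A

theorem disjoint_own {c c' : TCand n} (h : Apart c c') : Disjoint c.own c'.own := by
  refine Finset.disjoint_left.mpr fun q => ?_
  refine Fin.addCases (fun j => ?_) (fun j => ?_) q
  · rw [c.castAdd_mem_own, c'.castAdd_mem_own]
    exact fun h1 h2 => h.2 h1 h2
  · rw [c.natAdd_mem_own, c'.natAdd_mem_own]
    exact fun h1 h2 => h.1 (h1.symm.trans h2)

theorem mergeT_spec {N b D M : ℕ} (hM : M = D + 4 + 2 * D) {r : List (TCand n)}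
    (h : ∀ c ∈ r, c.Good N b D) (hr : r.Pairwise Apart) :
    (mergeT M r).length = M ∧ (slotsU (mergeT M r) : Op (n + n)) = (r.map TCand.op).prod := by
  suffices hs : (mergeT M r).length = M ∧
      (slotsU (mergeT M r) : Op (n + n)) = (r.map TCand.op).prod ∧
      ∃ (O : Finset (Fin (n + n))) (A : List ℕ), (∀ s ∈ mergeT M r, s.In O A) ∧
        ∀ c : TCand n, (∀ c' ∈ r, Apart c c') → Disjoint c.own O ∧ c.A.Disjoint A from
    ⟨hs.1, hs.2.1⟩
  induction r with
  | nil =>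
    refine ⟨List.length_replicate, ?_, ∅, [], fun s hs => ?_, fun c _ => ?_⟩
    · rw [mergeT, slotsU_replicate_id]; rfl
    · rw [List.eq_of_mem_replicate hs]
      exact ⟨fun _ _ => rfl, fun _ _ => rfl, fun _ => Or.inl rfl⟩
    · exact ⟨Finset.disjoint_empty_right _, List.disjoint_nil_right _⟩
  | cons c r ih =>
    rw [List.forall_mem_cons] at h
    rw [List.pairwise_cons] at hr
    obtain ⟨hl, hu, O, A, hin, hd⟩ := ih h.2 hr.2
    have hcl : c.part.length = M := by rw [c.part_length, h.1.length, hM]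
    obtain ⟨d1, d2⟩ := hd c hr.1
    refine ⟨?_, ?_, c.own ∪ O, c.A ++ A, zipWith_combine_in h.1.part_in hin, fun c' hc' => ?_⟩
    · rw [mergeT, List.length_zipWith, hcl, hl, min_self]
    · rw [mergeT, slotsU_zipWith_combine (hcl.trans hl.symm) h.1.part_in hin d1 d2,
        List.map_cons, List.prod_cons, ← hu, ← c.coe_part]
      rfl
    · rw [List.forall_mem_cons] at hc'
      obtain ⟨e1, e2⟩ := hd c' hc'.2
      exact ⟨Finset.disjoint_union_right.mpr ⟨disjoint_own hc'.1, e1⟩,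
        List.disjoint_append_right.mpr ⟨hc'.1.2, e2⟩⟩

theorem getD_raw {m : ℕ} (sl : Slot n) (l : List (Slot n)) (h : l[m]? = some sl) :
    (l.map QACLearn.raw).getD m ([], []) = QACLearn.raw sl := by
  rw [List.getD_eq_getElem?_getD, List.getElem?_map, h]
  rfl

theorem map_raw_mergeT {N b D M : ℕ} (hM : M = D + 4 + 2 * D) {r : List (TCand n)}
    (h : ∀ c ∈ r, c.Good N b D) :
    (mergeT M r).map QACLearn.raw = mergeSlots n M (r.map TCand.raw) := by
  suffices hs : (mergeT M r).length = M ∧ ∀ m (hm : m < (mergeT M r).length),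
      (∀ q : Fin (n + n), gdat ((mergeT M r)[m].1 q) = (((r.map TCand.raw).filter fun c => owns n c q).map
        fun c => ((partSlots n c).getD m ([], [])).1.getD q idGate).headD idGate) ∧
      ∀ q : Fin (n + n), (mergeT M r)[m].2 q = (((r.map TCand.raw).filter fun c => owns n c q).map
        fun c => ((partSlots n c).getD m ([], [])).2.getD q 0).headD 0 by
    refine List.ext_getElem ?_ fun m h1 h2 => ?_
    · rw [List.length_map, hs.1, mergeSlots, List.length_map, List.length_range]
    · rw [List.length_map] at h1
      obtain ⟨e1, e2⟩ := hs.2 m h1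
      have e3 : (mergeT M r)[m].2 = _ := funext e2
      simp only [mergeSlots, List.getElem_map, List.getElem_range, QACLearn.raw, e1, e3]
      rw [map_range_eq_ofFn, map_range_eq_ofFn]
  induction r with
  | nil =>
    refine ⟨List.length_replicate, fun m hm => ?_⟩
    simp only [mergeT, List.getElem_replicate]
    exact ⟨fun _ => rfl, fun _ => rfl⟩
  | cons c r ih =>
    rw [List.forall_mem_cons] at h
    obtain ⟨hl, hm⟩ := ih h.2
    have hcl : c.part.length = M := by rw [c.part_length, h.1.length, hM]
    have hl' : (mergeT M (c :: r)).length = M := by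
      rw [mergeT, List.length_zipWith, hcl, hl, min_self]
    refine ⟨hl', fun m h' => ?_⟩
    rw [hl'] at h'
    have hc : (partSlots n c.raw).getD m ([], []) = QACLearn.raw (c.part[m]'(hcl ▸ h')) := by
      rw [← c.map_raw_part]
      exact getD_raw _ _ (List.getElem?_eq_getElem _)
    obtain ⟨e1, e2⟩ := hm m (h'.trans_eq hl.symm)
    simp only [mergeT, List.getElem_zipWith, combine, List.map_cons]
    refine ⟨fun q => ?_, fun q => ?_⟩
    · by_cases hq : q ∈ c.own
      · rw [if_pos hq, List.filter_cons_of_pos (p := fun c => owns n c q) ((c.own_iff h.1.fuel.lt q).mp hq), List.map_cons,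
          List.headD_cons, hc, QACLearn.raw, getD_ofFn]
      · rw [if_neg hq, List.filter_cons_of_neg (p := fun c => owns n c q) (mt (c.own_iff h.1.fuel.lt q).mpr hq), e1]
    · by_cases hq : q ∈ c.own
      · rw [if_pos hq, List.filter_cons_of_pos (p := fun c => owns n c q) ((c.own_iff h.1.fuel.lt q).mp hq), List.map_cons,
          List.headD_cons, hc, QACLearn.raw, getD_ofFn]
      · rw [if_neg hq, List.filter_cons_of_neg (p := fun c => owns n c q) (mt (c.own_iff h.1.fuel.lt q).mpr hq), e2]

/-- The layers of the sewn circuit. -/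
def sewnT (M : ℕ) (rs : List (List (TCand n))) : List (Slot (n + n)) :=
  rs.reverse.flatMap (mergeT M) ++ swapLayers Finset.univ

theorem map_raw_sewnT {N b D M : ℕ} (hM : M = D + 4 + 2 * D) {rs : List (List (TCand n))}
    (h : ∀ r ∈ rs, ∀ c ∈ r, c.Good N b D) :
    (sewnT M rs).map QACLearn.raw = sewnSlots n M (rs.map fun r => r.map TCand.raw) := by
  rw [sewnT, sewnSlots, List.map_append, map_raw_swapLayers (l := List.range n)
    fun q => by simp, ← List.map_reverse, List.map_flatMap, List.flatMap_map]
  congr 1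
  refine List.flatMap_congr fun r hr => ?_
  exact map_raw_mergeT hM (h r (List.mem_reverse.mp hr))

theorem sewnT_spec {N b D M : ℕ} (hM : M = D + 4 + 2 * D) {rs : List (List (TCand n))}
    (h : ∀ r ∈ rs, ∀ c ∈ r, c.Good N b D) (hr : ∀ r ∈ rs, r.Pairwise Apart) :
    (sewnT M rs).length = rs.length * M + 4 ∧ (slotsU (sewnT M rs) : Op (n + n)) =
      swapAll n * ((rs.flatMap fun r => r).map TCand.op).prod := by
  have key : (rs.reverse.flatMap (mergeT M)).length = rs.length * M ∧
      (slotsU (rs.reverse.flatMap (mergeT M)) : Op (n + n)) =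
        ((rs.flatMap fun r => r).map TCand.op).prod := by
    induction rs with
    | nil => exact ⟨(Nat.zero_mul M).symm, rfl⟩
    | cons r rs ih =>
      rw [List.forall_mem_cons] at h hr
      obtain ⟨i1, i2⟩ := ih h.2 hr.2
      obtain ⟨m1, m2⟩ := mergeT_spec hM h.1 hr.1
      rw [List.reverse_cons, List.flatMap_append, List.length_append, i1, slotsU_append,
        List.flatMap_cons, List.flatMap_nil, List.append_nil, m1, List.flatMap_cons,
        List.map_append, List.prod_append, ← i2, ← m2, List.length_cons, Nat.succ_mul]
      exact ⟨rfl, rfl⟩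
  rw [sewnT, List.length_append, key.1, slotsU_append, ← key.2, ← swapOn_univ, ← slotsU_swapLayers]
  exact ⟨rfl, rfl⟩

end Parts

/-! ### Selecting candidates -/

section Greedy

theorem disj_iff {A A' : List ℕ} : disj A A' = true ↔ A.Disjoint A' := by
  simp only [disj, any_beq, List.all_eq_true, Bool.not_eq_true', decide_eq_false_iff_not]
  exact ⟨fun h a ha => h a ha, fun h a ha => h ha⟩

theorem isFree_iff {prev r : List Cand} {c : Cand} : isFree prev r c = true ↔
    (∀ c' ∈ prev, c'.1.1 ≠ c.1.1) ∧ ∀ c' ∈ r, c.1.2.Disjoint c'.1.2 := by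
  simp only [isFree, Bool.and_eq_true, Bool.not_eq_true', List.any_eq_false, List.all_eq_true,
    disj_iff, Nat.beq_eq, ne_eq]

/-- The properties of a selected set of candidates. -/
structure Selected (pass prev r : List Cand) : Prop where
  mem : ∀ c ∈ r, c ∈ pass
  new : ∀ c ∈ r, ∀ c' ∈ prev, c'.1.1 ≠ c.1.1
  apart : r.Pairwise fun c c' => c.1.2.Disjoint c'.1.2
  maximal : ∀ c ∈ pass, (∃ c' ∈ prev, c'.1.1 = c.1.1) ∨ ∃ c' ∈ r, ∃ q ∈ c.1.2, q ∈ c'.1.2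

theorem greedy_selected {pass : List Cand} (hp : ∀ c ∈ pass, c.1.1 ∈ c.1.2) (prev : List Cand) :
    Selected pass prev (greedy pass prev) := by
  suffices h : ∀ l r : List Cand, (∀ c ∈ l, c.1.1 ∈ c.1.2) →
      r.Pairwise (fun c c' => c.1.2.Disjoint c'.1.2) →
      let f := l.foldl (fun r c => bif isFree prev r c then c :: r else r) r
      (∀ c ∈ r, c ∈ f) ∧ (∀ c ∈ f, c ∈ r ∨ (c ∈ l ∧ ∀ c' ∈ prev, c'.1.1 ≠ c.1.1)) ∧
      f.Pairwise (fun c c' => c.1.2.Disjoint c'.1.2) ∧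
      ∀ c ∈ l, (∃ c' ∈ prev, c'.1.1 = c.1.1) ∨ ∃ c' ∈ f, ∃ q ∈ c.1.2, q ∈ c'.1.2 by
    obtain ⟨-, h1, h2, h3⟩ := h pass [] hp List.Pairwise.nil
    exact ⟨fun c hc => ((h1 c hc).resolve_left List.not_mem_nil).1,
      fun c hc => ((h1 c hc).resolve_left List.not_mem_nil).2, h2, h3⟩
  intro l
  induction l with
  | nil => exact fun r _ hr => ⟨fun _ h => h, fun _ h => Or.inl h, hr, fun _ h => absurd h List.not_mem_nil⟩
  | cons c l ih =>
    intro r hl hr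
    rw [List.forall_mem_cons] at hl
    by_cases hf : isFree prev r c = true
    · have hf' := isFree_iff.mp hf
      rw [List.foldl_cons, hf, cond_true]
      obtain ⟨h1, h2, h3, h4⟩ := ih (c :: r) hl.2 (List.pairwise_cons.mpr ⟨hf'.2, hr⟩)
      refine ⟨fun c' h => h1 c' (List.mem_cons_of_mem _ h), fun c' h => ?_, h3, ?_⟩
      · obtain h | h := h2 c' h
        · obtain rfl | h := List.mem_cons.mp h
          · exact Or.inr ⟨List.mem_cons_self, hf'.1⟩
          · exact Or.inl h
        · exact Or.inr ⟨List.mem_cons_of_mem _ h.1, h.2⟩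
      · rw [List.forall_mem_cons]
        exact ⟨Or.inr ⟨c, h1 c List.mem_cons_self, _, hl.1, hl.1⟩, h4⟩
    · rw [List.foldl_cons, Bool.eq_false_iff.mpr hf, cond_false]
      obtain ⟨h1, h2, h3, h4⟩ := ih r hl.2 hr
      refine ⟨h1, fun c' h => (h2 c' h).imp_right fun h => ⟨List.mem_cons_of_mem _ h.1, h.2⟩, h3, ?_⟩
      rw [List.forall_mem_cons]
      refine ⟨?_, h4⟩
      rw [isFree_iff, not_and_or] at hf
      push Not at hf
      obtain ⟨c', hc', h⟩ | ⟨c', hc', h⟩ := hf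
      · exact Or.inl ⟨c', hc', h⟩
      · refine Or.inr ⟨c', h1 c' hc', ?_⟩
        by_contra hq
        push Not at hq
        exact h fun q h h' => hq q h h'

theorem rounds_succ (pass : List Cand) (R : ℕ) : rounds pass (R + 1) =
    greedy pass ((rounds pass R).flatMap fun r => r) :: rounds pass R := by
  rw [rounds, List.replicate_succ', List.foldl_append]
  rfl

theorem rounds_length (pass : List Cand) (R : ℕ) : (rounds pass R).length = R := by
  induction R with
  | zero => rfl
  | succ R ih => rw [rounds_succ, List.length_cons, ih]

theorem rounds_spec {pass : List Cand} (hp : ∀ c ∈ pass, c.1.1 ∈ c.1.2) (R : ℕ) :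
    (∀ r ∈ rounds pass R, (∀ c ∈ r, c ∈ pass) ∧
      r.Pairwise fun c c' => c.1.1 ≠ c'.1.1 ∧ c.1.2.Disjoint c'.1.2) ∧
    (((rounds pass R).flatMap fun r => r).map fun c => c.1.1).Nodup := by
  have hgr : ∀ prev, (greedy pass prev).Pairwise
      fun c c' => c.1.1 ≠ c'.1.1 ∧ c.1.2.Disjoint c'.1.2 := by
    intro prev
    obtain ⟨h1, -, h3, -⟩ := greedy_selected hp prev
    refine h3.imp_of_mem fun {a b} ha hb h => ⟨fun e => ?_, h⟩
    exact h (hp a (h1 a ha)) (e ▸ hp b (h1 b hb))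
  induction R with
  | zero => exact ⟨fun r hr => absurd hr List.not_mem_nil, List.nodup_nil⟩
  | succ R ih =>
    obtain ⟨h1, h2, -, -⟩ := greedy_selected hp ((rounds pass R).flatMap fun r => r)
    rw [rounds_succ, List.forall_mem_cons, List.flatMap_cons, List.map_append]
    refine ⟨⟨⟨h1, hgr _⟩, ih.1⟩, List.nodup_append.mpr ⟨?_, ih.2, ?_⟩⟩
    · exact List.pairwise_map.mpr ((hgr _).imp fun h => h.1)
    · intro a ha b hb e
      obtain ⟨c, hc, rfl⟩ := List.mem_map.mp ha
      obtain ⟨c', hc', rfl⟩ := List.mem_map.mp hb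
      exact h2 c hc c' hc' e.symm

/-- The qubits for which no candidate was selected. -/
def missing (n : ℕ) (l : List Cand) : Finset ℕ :=
  (Finset.range n).filter fun i => ∀ c ∈ l, c.1.1 ≠ i

theorem missing_step {n a w : ℕ} {pass : List Cand} (hp : ∀ c ∈ pass, c.1.1 ∈ c.1.2)
    (hn : ∀ c ∈ pass, c.1.1 < n) (ha : ∀ c ∈ pass, c.1.2.length ≤ a) (T : ℕ → Cand)
    (hT : ∀ i < n, T i ∈ pass ∧ (T i).1.1 = i)
    (hw : ∀ q, ((Finset.range n).filter fun i => q ∈ (T i).1.2).card ≤ w) (prev : List Cand) :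
    (a * w) * (missing n (greedy pass prev ++ prev)).card + (missing n prev).card ≤
      (a * w) * (missing n prev).card := by
  have hg := greedy_selected hp prev
  set r := greedy pass prev with hr
  have hnd : (r.map fun c => c.1.1).Nodup := by
    refine List.pairwise_map.mpr (hg.apart.imp_of_mem fun {x y} hx hy h e => ?_)
    exact h (hp x (hg.mem x hx)) (e ▸ hp y (hg.mem y hy))
  have h1 : (missing n prev).card ≤ r.length * (a * w) := by
    have hsub : missing n prev ⊆ (r.flatMap fun c => c.1.2).toFinset.biUnion fun q =>
        (Finset.range n).filter fun i => q ∈ (T i).1.2 := by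
      intro i hi
      obtain ⟨hi, hi'⟩ := Finset.mem_filter.mp hi
      obtain ⟨t1, t2⟩ := hT i (Finset.mem_range.mp hi)
      obtain ⟨c', hc', q, hq, hq'⟩ := (hg.maximal _ t1).resolve_left
        fun ⟨c', hc', e⟩ => hi' c' hc' (e.trans t2)
      exact Finset.mem_biUnion.mpr ⟨q, List.mem_toFinset.mpr (List.mem_flatMap.mpr ⟨c', hc', hq'⟩),
        Finset.mem_filter.mpr ⟨hi, hq⟩⟩
    refine (Finset.card_le_card hsub).trans ((Finset.card_biUnion_le_card_mul _ _ w
      fun q _ => hw q).trans ?_)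
    rw [← mul_assoc]
    refine Nat.mul_le_mul_right w ((List.toFinset_card_le _).trans ?_)
    rw [List.length_flatMap]
    refine (List.sum_le_card_nsmul _ a fun x hx => ?_).trans ?_
    · obtain ⟨c, hc, rfl⟩ := List.mem_map.mp hx
      exact ha c (hg.mem c hc)
    · rw [List.length_map, smul_eq_mul]
  have h2 : (missing n (r ++ prev)).card + r.length ≤ (missing n prev).card := by
    rw [← List.length_map (f := fun c : Cand => c.1.1), ← List.toFinset_card_of_nodup hnd,
      ← Finset.card_union_of_disjoint]
    · refine Finset.card_le_card (Finset.union_subset (fun i hi => ?_) fun i hi => ?_)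
      · obtain ⟨hi, hi'⟩ := Finset.mem_filter.mp hi
        exact Finset.mem_filter.mpr ⟨hi, fun c hc => hi' c (List.mem_append_right _ hc)⟩
      · obtain ⟨c, hc, rfl⟩ := List.mem_map.mp (List.mem_toFinset.mp hi)
        exact Finset.mem_filter.mpr ⟨Finset.mem_range.mpr (hn c (hg.mem c hc)), hg.new c hc⟩
    · refine Finset.disjoint_left.mpr fun i hi hi' => ?_
      obtain ⟨c, hc, rfl⟩ := List.mem_map.mp (List.mem_toFinset.mp hi')
      exact (Finset.mem_filter.mp hi).2 c (List.mem_append_left _ hc) rfl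
  nlinarith [Nat.mul_le_mul_left (a * w) h2]

theorem missing_rounds {n a w l : ℕ} {pass : List Cand} (hp : ∀ c ∈ pass, c.1.1 ∈ c.1.2)
    (hn : ∀ c ∈ pass, c.1.1 < n) (ha : ∀ c ∈ pass, c.1.2.length ≤ a) (T : ℕ → Cand)
    (hT : ∀ i < n, T i ∈ pass ∧ (T i).1.1 = i) (haw : 0 < a * w)
    (hw : ∀ q, ((Finset.range n).filter fun i => q ∈ (T i).1.2).card ≤ w) (hl : n < 2 ^ l) :
    missing n ((rounds pass (a * w * l)).flatMap fun r => r) = ∅ := by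
  have hX : (0 : ℝ) < (a * w : ℕ) := Nat.cast_pos.mpr haw
  have key : ∀ R, ((missing n ((rounds pass R).flatMap fun r => r)).card : ℝ) ≤
      n * Real.exp (-(R / (a * w : ℕ))) := by
    intro R
    induction R with
    | zero =>
      rw [Nat.cast_zero, zero_div, neg_zero, Real.exp_zero, mul_one, Nat.cast_le]
      exact (Finset.card_filter_le _ _).trans_eq (Finset.card_range n)
    | succ R ih =>
      rw [rounds_succ, List.flatMap_cons]
      have h := missing_step hp hn ha T hT hw ((rounds pass R).flatMap fun r => r)
      set x := (missing n ((rounds pass R).flatMap fun r => r)).card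
      set y := (missing n (greedy pass ((rounds pass R).flatMap fun r => r) ++
        (rounds pass R).flatMap fun r => r)).card
      have h' : ((a * w : ℕ) : ℝ) * y + x ≤ (a * w : ℕ) * x := by exact_mod_cast h
      have e : Real.exp (-((R + 1 : ℕ) / ((a * w : ℕ) : ℝ))) =
          Real.exp (-(R / (a * w : ℕ))) * Real.exp (-(1 / (a * w : ℕ))) := by
        rw [← Real.exp_add]
        congr 1
        push_cast
        ring
      have h3 : (y : ℝ) ≤ x * (1 - 1 / (a * w : ℕ)) := by
        rw [← mul_le_mul_iff_right₀ hX]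
        have : ((a * w : ℕ) : ℝ) * (x * (1 - 1 / (a * w : ℕ))) = (a * w : ℕ) * x - x := by
          field_simp
        linarith
      have h4 : 1 - 1 / ((a * w : ℕ) : ℝ) ≤ Real.exp (-(1 / (a * w : ℕ))) := by
        have := Real.add_one_le_exp (-(1 / ((a * w : ℕ) : ℝ)))
        linarith
      rw [e, ← mul_assoc]
      exact h3.trans ((mul_le_mul_of_nonneg_left h4 (Nat.cast_nonneg _)).trans
        (mul_le_mul_of_nonneg_right ih (Real.exp_pos _).le))
  have h := key (a * w * l)
  rw [Nat.cast_mul (a * w) l, mul_div_cancel_left₀ _ hX.ne'] at h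
  have h2 : Real.exp (-(l : ℝ)) * 2 ^ l ≤ 1 := by
    have : (2 : ℝ) ^ l ≤ Real.exp l := by
      rw [← Real.exp_one_pow]
      exact pow_le_pow_left₀ (by norm_num) (by linarith [Real.add_one_le_exp (1 : ℝ)]) l
    calc _ ≤ Real.exp (-(l : ℝ)) * Real.exp l := mul_le_mul_of_nonneg_left this (Real.exp_pos _).le
      _ = 1 := by rw [← Real.exp_add, neg_add_cancel, Real.exp_zero]
  have h3 : (n : ℝ) * Real.exp (-(l : ℝ)) < 1 := by
    have : (n : ℝ) < 2 ^ l := by exact_mod_cast hl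
    nlinarith [Real.exp_pos (-(l : ℝ))]
  rw [← Finset.card_eq_zero]
  exact Nat.lt_one_iff.mp (by exact_mod_cast h.trans_lt h3)

end Greedy

/-! ### The output -/

section Output

variable {n : ℕ}

/-- The code of a Pauli operator. -/
def Pauli.code : Pauli → ℕ
  | .X => 0
  | .Y => 1
  | .Z => 2

theorem pauliOf_code (P : Pauli) : pauliOf P.code = P := by cases P <;> rfl

theorem pauliData_optOf {k : ℕ} (h : k ≤ 3) : pauliData (optOf k) = .ofNat k := by
  interval_cases k <;> rfl

/-- A learned observable. -/
def TCand.obs (N : ℕ) (c : TCand n) (P : ℕ) : ObsCode n :=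
  ⟨(pwords N n c.A).map fun Q => (strOf n Q, coef N n (words N n c.A) c.ls.length
    (c.ls.map QACLearn.raw) c.idx P Q), (denomOf N n (words N n c.A) c.ls.length
    (c.ls.map QACLearn.raw) c.idx).toNat⟩

theorem TCand.Good.obs_op {N b D : ℕ} {c : TCand n} (h : c.Good N b D) (P : ℕ) :
    (c.obs N P).op = candOp c.ls c.idx P := by
  have hd : (((c.obs N P).denom : ℕ) : ℂ) = ((denomOf N n (words N n c.A) c.ls.length
      (c.ls.map QACLearn.raw) c.idx : ℤ) : ℂ) := by
    have h0 : 0 ≤ denomOf N n (words N n c.A) c.ls.length (c.ls.map QACLearn.raw) c.idx := by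
      exact_mod_cast (denomOf_pos h.fuel h.on c.idx h.mem).le
    rw [obs, ← Int.cast_natCast, Int.toNat_of_nonneg h0]
  rw [ObsCode.op, hd, obs, List.map_map]
  refine (pwords_sum h.fuel.paulis _).trans ?_
  rw [← pauli_expansion (candOp_mem_loc h.on c.idx P h.mem)]
  refine Finset.sum_congr rfl fun q _ => ?_
  simp only [Function.comp_apply]
  rw [coef_div_denom h.fuel h.on c.idx P h.mem, strOf_op, pop]
  simp only [getD_ofFn]

theorem ofFn_eq_enc {α : Type} [Enc α] {n : ℕ} (f : Fin n → α) :
    Data.ofFn (fun j => enc (f j)) = enc (List.ofFn f) := by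
  change Data.ofList _ = Data.ofList _
  rw [List.map_ofFn]
  rfl

theorem TCand.data_obs {N D : ℕ} (c : TCand n) (hD : c.ls.length = D) (P : ℕ) :
    (c.obs N P).data = enc (obsOf N n D c.raw P) := by
  subst hD
  change Data.cons (Data.ofList (List.map _ (List.map _ _))) _ =
    Data.cons (Data.ofList (List.map enc (List.map _ _))) _
  rw [List.map_map, List.map_map]
  congr 2
  refine List.map_congr_left fun Q hQ => ?_
  obtain ⟨f, rfl, hf⟩ := mem_pwords hQ
  change Data.cons (Data.ofFn _) _ = Data.cons (enc (List.ofFn f)) _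
  rw [← ofFn_eq_enc]
  congr 2
  funext j
  change pauliData (optOf ((List.ofFn f).getD j 0)) = _
  rw [getD_ofFn]
  exact pauliData_optOf (hf j)

/-- The circuit with the layers `ls`. -/
def codeOf {M : ℕ} (ls : List (Slot M)) : CircuitCode M := ⟨ls, fun _ => idG⟩

theorem codeOf_unitary {M : ℕ} (ls : List (Slot M)) : (codeOf ls).unitary = slotsU ls := by
  change tensorU (fun _ => idG.toU2) * slotsU ls = _
  rw [idG_toU2, tensorU_one, one_mul]

theorem data_codeOf (ls : List (Slot (n + n))) :
    (codeOf ls).data = enc (toCircuit n (ls.map raw)) := by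
  change Data.cons (Data.ofList (List.map _ ls)) _ =
    Data.cons (Data.ofList (List.map enc (List.map raw ls))) (enc (List.replicate (n + n) idGate))
  rw [← List.ofFn_const, ← ofFn_eq_enc, List.map_map]
  congr 2
  refine List.map_congr_left fun sl _ => ?_
  change Data.cons _ _ = Data.cons (enc (List.ofFn _)) (enc (List.ofFn _))
  rw [← ofFn_eq_enc, ← ofFn_eq_enc]
  rfl

/-- Rounds of candidates that can be sewn. -/
structure Chosen (N b D : ℕ) (rs : List (List (TCand n))) : Prop where
  good : ∀ r ∈ rs, ∀ c ∈ r, c.Good N b D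
  apart : ∀ r ∈ rs, r.Pairwise Apart
  nodup : ((rs.flatMap fun r => r).map TCand.idx).Nodup
  all : ∀ i, ∃ c ∈ rs.flatMap fun r => r, c.idx = i

variable {N b D : ℕ} {rs : List (List (TCand n))}

theorem Chosen.good' (h : Chosen N b D rs) {c : TCand n} (hc : c ∈ rs.flatMap fun r => r) :
    c.Good N b D := by
  obtain ⟨r, hr, hc⟩ := List.mem_flatMap.mp hc
  exact h.good r hr c hc

theorem map_raw_flatMap : ((rs.map fun r => r.map TCand.raw).flatMap fun r => r) =
    (rs.flatMap fun r => r).map TCand.raw := by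
  rw [List.flatMap_map, List.map_flatMap]

theorem Chosen.exists_candFor (h : Chosen N b D rs) (i : Fin n) :
    ∃ c ∈ rs.flatMap fun r => r, c.idx = i ∧
      candFor ((rs.map fun r => r.map TCand.raw).flatMap fun r => r) i = c.raw := by
  obtain ⟨c, hc, hi⟩ := h.all i
  rw [map_raw_flatMap, candFor]
  set l := ((rs.flatMap fun r => r).map TCand.raw).filter fun c => Nat.beq c.1.1 i with hl
  have hm : c.raw ∈ l :=
    List.mem_filter.mpr ⟨List.mem_map_of_mem hc, Nat.beq_eq.mpr (congrArg Fin.val hi)⟩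
  obtain ⟨a, l', e⟩ := List.exists_cons_of_ne_nil (List.ne_nil_of_mem hm)
  have ha : a ∈ l := e ▸ List.mem_cons_self
  obtain ⟨h1, h2⟩ := List.mem_filter.mp ha
  obtain ⟨c', hc', rfl⟩ := List.mem_map.mp h1
  exact ⟨c', hc', Fin.ext (Nat.beq_eq.mp h2), by rw [e, List.headD_cons]⟩

theorem Chosen.exists_output (h : Chosen N b D rs) : ∃ (o : Output n) (f : Fin n → TCand n),
    enc (outputOf N n D (rs.map fun r => r.map TCand.raw)) = o.data ∧
    (∀ i, (f i).Good N b D ∧ (f i).idx = i ∧ f i ∈ rs.flatMap fun r => r) ∧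
    (∀ i P, (o.obs i P).op = candOp (f i).ls i (P.code + 1)) ∧
    (∀ i, ((o.part i).unitary : Op (n + n)) = (f i).op ∧ (o.part i).depth = D + 4 + 2 * D) ∧
    o.sewn.depth = rs.length * (D + 4 + 2 * D) + 4 ∧
    (o.sewn.unitary : Op (n + n)) =
      swapAll n * (List.ofFn fun j => (f (o.order j)).op).prod := by
  choose f hf hfi hfr using h.exists_candFor
  set l := (rs.flatMap fun r => r).map TCand.idx with hl
  have hall : ∀ i, i ∈ l := fun i => List.mem_map.mpr ⟨f i, hf i, hfi i⟩
  let e := h.nodup.getEquivOfForallMemList l hall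
  have hlen : n = l.length := by
    have := Fintype.card_congr e
    rwa [Fintype.card_fin, Fintype.card_fin, eq_comm] at this
  let order : Equiv.Perm (Fin n) := (finCongr hlen).trans e
  have hord : List.ofFn order = l := by
    refine List.ext_getElem (by rw [List.length_ofFn, ← hlen]) fun m h1 h2 => ?_
    rw [List.getElem_ofFn]
    rfl
  obtain ⟨s1, s2⟩ := sewnT_spec (M := D + 4 + 2 * D) rfl h.good h.apart
  refine ⟨⟨fun i P => (f i).obs N (P.code + 1), fun i => codeOf (f i).part, order,
    codeOf (sewnT (D + 4 + 2 * D) rs)⟩, f, ?_, fun i => ⟨h.good' (hf i), hfi i, hf i⟩,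
    fun i P => ?_, fun i => ⟨?_, ?_⟩, s1, ?_⟩
  · have h1 : Data.ofFn (fun i => Data.ofList [((f i).obs N 1).data, ((f i).obs N 2).data,
        ((f i).obs N 3).data]) = enc (outputOf N n D (rs.map fun r => r.map TCand.raw)).1 := by
      change _ = enc (List.map _ (List.range n))
      rw [map_range_eq_ofFn, ← ofFn_eq_enc]
      congr 1
      funext i
      rw [(f i).data_obs (h.good' (hf i)).length, (f i).data_obs (h.good' (hf i)).length,
        (f i).data_obs (h.good' (hf i)).length, hfr]
      rfl
    have h2 : Data.ofFn (fun i => (codeOf (f i).part).data) =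
        enc (outputOf N n D (rs.map fun r => r.map TCand.raw)).2.1 := by
      change _ = enc (List.map _ (List.range n))
      rw [map_range_eq_ofFn, ← ofFn_eq_enc]
      congr 1
      funext i
      rw [data_codeOf, TCand.map_raw_part, hfr]
    have h3 : Data.ofFn (fun i => enc ((order i : ℕ))) =
        enc (outputOf N n D (rs.map fun r => r.map TCand.raw)).2.2.1 := by
      change _ = enc (List.map _ (List.flatMap _ _))
      rw [ofFn_eq_enc, map_raw_flatMap, List.map_map]
      have : List.ofFn (fun i => (order i : ℕ)) = (List.ofFn order).map Fin.val := by
        rw [List.map_ofFn]; rfl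
      rw [this, hord, hl, List.map_map]
      rfl
    have h4 : (codeOf (sewnT (D + 4 + 2 * D) rs)).data =
        enc (outputOf N n D (rs.map fun r => r.map TCand.raw)).2.2.2.1 := by
      rw [data_codeOf, map_raw_sewnT rfl h.good]
      rfl
    change Data.ofList [enc _, enc _, enc _, enc _] = _
    rw [← h1, ← h2, ← h3, ← h4]
    rfl
  · rw [(h.good' (hf i)).obs_op, hfi]
  · rw [codeOf_unitary, TCand.coe_part]
  · exact (f i).part_length.trans (by rw [(h.good' (hf i)).length])
  · rw [codeOf_unitary, s2]
    congr 2
    have : List.ofFn (fun j => (f (order j)).op) = (List.ofFn order).map fun i => (f i).op := by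
      rw [List.map_ofFn]; rfl
    change _ = List.ofFn (fun j => (f (order j)).op)
    rw [this, hord, hl, List.map_map]
    refine List.map_congr_left fun c hc => ?_
    change c.op = (f c.idx).op
    exact congrArg TCand.op (List.inj_on_of_nodup_map h.nodup hc (hf c.idx) (hfi c.idx).symm)

end Output

/-! ### The accuracy of the output -/

section Accuracy

variable {n : ℕ}

theorem sewOp_sub_sewOp (A B : Pauli → Op n) (i : Fin n) : sewOp A i - sewOp B i =
    (1 / 2 : ℂ) • ∑ P, tensor2 (A P - B P) (pauliAt P i) := by
  have h : ∀ P, tensor2 (A P - B P) (pauliAt P i) =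
      tensor2 (A P) (pauliAt P i) - tensor2 (B P) (pauliAt P i) := by
    intro P
    ext x y
    exact sub_mul _ _ _
  simp only [h]
  rw [sewOp, sewOp, ← smul_sub, add_sub_add_left_eq_sub, Finset.sum_sub_distrib]

theorem exists_unitary_pauliAt (P : Pauli) (i : Fin n) : ∃ M : UN n, (M : Op n) = pauliAt P i := by
  obtain ⟨V, hV⟩ := heisenberg_unitary (1 : UN n) P i
  have : heisenberg ((1 : UN n) : Op n) P i = pauliAt P i := by
    rw [heisenberg]
    change (1 : Op n)ᴴ * _ * (1 : Op n) = _
    rw [Matrix.conjTranspose_one, one_mul, mul_one]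
  exact ⟨V, hV.trans this⟩

theorem nrm_pauliAt (P : Pauli) (i : Fin n) : nrm (pauliAt P i) = 1 := by
  obtain ⟨V, hV⟩ := exists_unitary_pauliAt P i
  rw [← hV, nrm_unitary]

theorem nrm_sewOp_sub_le (A B : Pauli → Op n) (i : Fin n) {δ : ℝ}
    (h : ∀ P, nrm (A P - B P) ≤ δ) : nrm (sewOp A i - sewOp B i) ≤ 3 / 2 * δ := by
  have e : ∀ P, nrm (tensor2 (A P - B P) (pauliAt P i)) ≤ δ := fun P => by
    rw [nrm_tensor2, nrm_pauliAt, mul_one]; exact h P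
  rw [sewOp_sub_sewOp, nrm_smul, sum_pauli]
  have h2 : ‖(1 / 2 : ℂ)‖ = 1 / 2 := by norm_num
  rw [h2]
  linarith [nrm_add_le (tensor2 (A .X - B .X) (pauliAt .X i))
    (tensor2 (A .Y - B .Y) (pauliAt .Y i) + tensor2 (A .Z - B .Z) (pauliAt .Z i)),
    nrm_add_le (tensor2 (A .Y - B .Y) (pauliAt .Y i)) (tensor2 (A .Z - B .Z) (pauliAt .Z i)),
    e .X, e .Y, e .Z]

/-- The operator `U† SWAP_i U`. -/
noncomputable def conjSwap (U : UN n) (i : Fin n) : UN (n + n) :=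
  tensor2U (star U) 1 * slotsU (swapLayers {i}) * tensor2U U 1

theorem coe_conjSwap (U : UN n) (i : Fin n) : (conjSwap U i : Op (n + n)) =
    tensor2 (star (U : Op n)) 1 * swapOn {i} * tensor2 (U : Op n) 1 := by
  rw [← slotsU_swapLayers]
  rfl

theorem prod_conjSwap (U : UN n) (l : List (Fin n)) :
    (l.map fun i => (conjSwap U i : Op (n + n))).prod =
      tensor2 (star (U : Op n)) 1 * (l.map fun i => swapOn {i}).prod * tensor2 (U : Op n) 1 := by
  induction l with
  | nil =>
    rw [List.map_nil, List.prod_nil, List.map_nil, List.prod_nil, mul_one, tensor2_mul, one_mul,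
      Matrix.mem_unitaryGroup_iff'.mp U.2, tensor2_one]
  | cons i l ih =>
    have h : ∀ a b c d : Op (n + n), c * a = 1 → a * b * c * (a * d * c) = a * (b * d) * c := by
      intro a b c d h
      calc a * b * c * (a * d * c) = a * b * (c * a) * d * c := by simp only [mul_assoc]
        _ = a * (b * d) * c := by rw [h, mul_one, mul_assoc a]
    rw [List.map_cons, List.prod_cons, List.map_cons, List.prod_cons, ih, coe_conjSwap]
    refine h _ _ _ _ ?_
    rw [tensor2_mul, one_mul, Matrix.mem_unitaryGroup_iff.mp U.2, tensor2_one]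

theorem swapAll_mul_prod_conjSwap (U : UN n) (e : Equiv.Perm (Fin n)) :
    swapAll n * (List.ofFn fun j => (conjSwap U (e j) : Op (n + n))).prod =
      tensor2 (U : Op n) (U : Op n)ᴴ := by
  have h : (List.ofFn fun j => (conjSwap U (e j) : Op (n + n))) =
      (List.ofFn e).map fun i => (conjSwap U i : Op (n + n)) := by rw [List.map_ofFn]; rfl
  have h2 : (List.ofFn e).toFinset = Finset.univ := by
    ext i
    rw [List.mem_toFinset, List.mem_ofFn']
    exact ⟨fun _ => Finset.mem_univ _, fun _ => e.surjective i⟩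
  rw [h, prod_conjSwap, swapOn_prod (List.nodup_ofFn.mpr e.injective), h2, swapOn_univ,
    ← mul_assoc, ← mul_assoc, swapAll_conj, mul_assoc (tensor2 _ _), swapAll_mul_self, mul_one,
    tensor2_mul, one_mul, mul_one]
  rfl

theorem error_le {n k : ℕ} (hn : 1 ≤ n) :
    4 / ((n + 2 : ℕ) ^ (k + 6) : ℝ) ≤ 1 / (n : ℝ) ^ k ∧
      (n * (3 / 2 * Real.sqrt (4 / ((n + 2 : ℕ) ^ (k + 6) : ℝ)))) ^ 2 ≤ 1 / (n : ℝ) ^ k := by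
  have hn1 : (1 : ℝ) ≤ n := by exact_mod_cast hn
  have hE : (0 : ℝ) < (n + 2 : ℕ) ^ (k + 6) := by positivity
  have hnk : (0 : ℝ) < (n : ℝ) ^ k := by positivity
  have key : 9 * (n : ℝ) ^ 2 * n ^ k ≤ (n + 2 : ℕ) ^ (k + 6) := by
    have h2 : ((n + 2 : ℕ) : ℝ) = n + 2 := by push_cast; rfl
    rw [h2, pow_add, mul_comm]
    refine mul_le_mul (pow_le_pow_left₀ (by positivity) (by linarith) k) ?_ (by positivity)
      (by positivity)
    have h3 : (9 : ℝ) ≤ (n + 2) ^ 2 := by nlinarith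
    have h4 : (n : ℝ) ^ 2 ≤ (n + 2) ^ 4 := by nlinarith [sq_nonneg ((n : ℝ) + 2)]
    calc 9 * (n : ℝ) ^ 2 ≤ (n + 2) ^ 2 * (n + 2) ^ 4 := mul_le_mul h3 h4 (by positivity) (by positivity)
      _ = (n + 2) ^ 6 := by ring
  constructor
  · rw [div_le_div_iff₀ hE hnk, one_mul]
    nlinarith [one_le_pow₀ hn1 (n := 2)]
  · rw [mul_pow, mul_pow, Real.sq_sqrt (by positivity), show (n : ℝ) ^ 2 * ((3 / 2) ^ 2 *
      (4 / ((n + 2 : ℕ) ^ (k + 6) : ℝ))) = 9 * (n : ℝ) ^ 2 / (n + 2 : ℕ) ^ (k + 6) by ring,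
      div_le_div_iff₀ hE hnk, one_mul]
    exact key

theorem Chosen.exists_correct {N b D d k K a : ℕ} {rs : List (List (TCand n))}
    (h : Chosen N b D rs) (hn : 1 ≤ n) (U : UN n)
    (hq : ∀ c ∈ rs.flatMap fun r => r, ∀ m < 3, distF (candOp c.ls c.idx (m + 1))
      (heisenberg (U : Op n) (pauliOf m) c.idx) ≤ 4 / ((n + 2 : ℕ) ^ (k + 6) : ℝ))
    (ha : ∀ c ∈ rs.flatMap fun r => r, c.A.length ≤ a) (haK : a ≤ K * lg n ^ d)
    (hD : D + 4 + 2 * D ≤ K) (hK : rs.length * (D + 4 + 2 * D) + 4 ≤ K * lg n ^ K) :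
    ∃ o : Output n, enc (outputOf N n D (rs.map fun r => r.map TCand.raw)) = o.data ∧
      o.Correct (U : Op n) d K (1 / (n : ℝ) ^ k) := by
  obtain ⟨o, f, ho, hf, hobs, hpart, hdep, hsew⟩ := h.exists_output
  obtain ⟨he1, he2⟩ := error_le (k := k) hn
  have hε : (0 : ℝ) ≤ 1 / (n : ℝ) ^ k := by positivity
  have hclose : ∀ i P, distF (o.obs i P).op (heisenberg (U : Op n) P i) ≤
      4 / ((n + 2 : ℕ) ^ (k + 6) : ℝ) := by
    intro i P
    have := hq (f i) (hf i).2.2 P.code (by cases P <;> decide)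
    rwa [(hf i).2.1, pauliOf_code, ← hobs] at this
  have hop : ∀ i, (f i).op = sewOp (fun P => (o.obs i P).op) i := by
    intro i
    rw [TCand.op_eq, (hf i).2.1]
    congr 1
    funext P
    rw [hobs, candOp, popAt_succ, pauliOf_code]
  have hnear : ∀ i, nrm (((o.part i).unitary : Op (n + n)) - (conjSwap U i : Op (n + n))) ≤
      3 / 2 * Real.sqrt (4 / ((n + 2 : ℕ) ^ (k + 6) : ℝ)) := by
    intro i
    rw [(hpart i).1, hop, coe_conjSwap, ← sewOp_conj]
    refine nrm_sewOp_sub_le _ _ i fun P => Real.le_sqrt_of_sq_le ?_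
    rw [← distF_eq]
    exact hclose i P
  have hsewn : (o.sewn.unitary : Op (n + n)) =
      swapAll n * (List.ofFn fun j => ((o.part (o.order j)).unitary : Op (n + n))).prod := by
    simp only [hsew, (hpart _).1]
  have hdist : distF (o.sewn.unitary : Op (n + n)) (tensor2 (U : Op n) (U : Op n)ᴴ) ≤
      1 / (n : ℝ) ^ k := by
    refine le_trans ?_ he2
    rw [distF_eq]
    refine pow_le_pow_left₀ (nrm_nonneg _) ?_ 2
    rw [hsewn, ← swapAll_mul_prod_conjSwap U o.order, ← mul_sub, ← swapOn_univ,
      ← slotsU_swapLayers, nrm_unitary_mul]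
    have := nrm_prod_sub_le (List.ofFn fun j => ((o.part (o.order j)).unitary, conjSwap U (o.order j)))
    rw [List.map_ofFn, List.map_ofFn, List.map_ofFn, List.sum_ofFn] at this
    refine this.trans ((Finset.sum_le_card_nsmul _ _ _ fun j _ => hnear (o.order j)).trans ?_)
    rw [Finset.card_univ, Fintype.card_fin, nsmul_eq_mul]
  refine ⟨o, ho, hdist, ?_, hdep.le.trans hK, hsewn, fun i => (hpart i).2.le.trans hD, fun i => ?_,
    fun i P => (hclose i P).trans he1, fun i W hW => ?_⟩
  · exact (distAvg_le_distF o.sewn.unitary (tensor2U U (star U))).trans hdist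
  · refine ⟨supp n (f i).A, (card_supp_le _ _).trans ((ha _ (hf i).2.2).trans haK), fun P => ?_, ?_⟩
    · rw [hobs]
      have := candOp_mem_loc (hf i).1.on (f i).idx (P.code + 1) (hf i).1.mem
      rw [(hf i).2.1] at this
      exact supportedOn_of_mem_loc this
    · rw [(hpart i).1]
      have := supportedOn_of_mem_loc (hf i).1.op_mem_loc
      rwa [TCand.own, (hf i).2.1] at this
  · have h0 := hW.2 _ (o.part i).unitary.2
    rw [← hop, (hpart i).1, sub_self] at h0
    have h1 : frobSq (0 : Op (n + n)) = 0 := by simp [frobSq]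
    rw [h1] at h0
    rw [(hpart i).1, ← eq_of_nrm_sub_eq_zero h0, distF, sub_self, h1, zero_div]
    exact hε

end Accuracy

/-! ### Correctness of the selection -/

section Select

theorem exists_of_forall₂ {α β : Type} {R : α → β → Prop} {l : List α} {l' : List β}
    (h : List.Forall₂ R l l') :
    (∀ a ∈ l, ∃ b ∈ l', R a b) ∧ ∀ b ∈ l', ∃ a ∈ l, R a b := by
  induction h with
  | nil => simp
  | cons h _ ih =>
    simp only [List.forall_mem_cons, List.exists_mem_cons_iff]
    exact ⟨⟨Or.inl h, fun a ha => Or.inr (ih.1 a ha)⟩, Or.inl h, fun b hb => Or.inr (ih.2 b hb)⟩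

/-- The Pauli coefficients to estimate. -/
def planOf (N n s : ℕ) : Plan := (groups N n s).map fun g => (g, items N n g.2)

/-- The requirements on the parameters of the learner. -/
structure Params (N n b s E : ℕ) : Prop where
  two : 2 ≤ N
  pos : 1 ≤ E
  est : 60 * 4 ^ (s + 1) * E ≤ N
  gates : ((b + 1) * (2 * b + 1) ^ 3) ^ (s + 1) ≤ N
  labels : (s + 2) ^ (s + 1) ≤ N
  groups : n ^ s ≤ N

variable {N n b s E D : ℕ}

theorem fewChoices_groups (hn : 1 ≤ n) (h : n ^ s ≤ N) :
    FewChoices N (List.replicate s (List.range n)) := by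
  refine ⟨fun l hl => ?_, ?_⟩
  · rw [List.eq_of_mem_replicate hl]
    exact List.ne_nil_of_length_pos (by rw [List.length_range]; omega)
  · rwa [List.map_replicate, List.prod_replicate, List.length_range]

theorem mem_groups (hn : 1 ≤ n) (h : n ^ s ≤ N) {g : ℕ × List ℕ} : g ∈ groups N n s ↔
    ∃ A : List ℕ, g = (g.1, g.1 :: A) ∧ g.1 < n ∧ A.length = s ∧ ∀ a ∈ A, a < n := by
  have key : ∀ A : List ℕ, A ∈ secs N (List.replicate s (List.range n)) ↔
      A.length = s ∧ ∀ a ∈ A, a < n := by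
    intro A
    rw [mem_secs (fewChoices_groups hn h), List.forall₂_iff_get]
    simp only [List.length_replicate, List.get_eq_getElem, List.getElem_replicate, List.mem_range]
    refine and_congr_right fun hl => ⟨fun h a ha => ?_, fun h i hi _ => h _ (List.getElem_mem _)⟩
    obtain ⟨i, hi, rfl⟩ := List.getElem_of_mem ha
    exact h i hi (hl ▸ hi)
  rw [groups, List.mem_flatMap]
  constructor
  · rintro ⟨i, hi, hg⟩
    obtain ⟨A, hA, rfl⟩ := List.mem_map.mp hg
    obtain ⟨h1, h2⟩ := (key A).mp hA
    exact ⟨A, rfl, List.mem_range.mp hi, h1, h2⟩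
  · rintro ⟨A, hg, hi, h1, h2⟩
    exact ⟨g.1, List.mem_range.mpr hi, List.mem_map.mpr ⟨A, (key A).mpr ⟨h1, h2⟩, hg.symm⟩⟩

theorem Params.fuel (h : Params N n b s E) {A : List ℕ} (hl : A.length = s + 1)
    (hA : ∀ a ∈ A, a < n) : Fuel N n b A := by
  refine ⟨hA, ?_, ?_⟩
  · refine le_trans ?_ h.gates
    rw [hl]
    refine Nat.pow_le_pow_left ?_ _
    calc 2 * b + 1 ≤ (2 * b + 1) ^ 3 := Nat.le_self_pow (by norm_num) _
      _ ≤ (b + 1) * (2 * b + 1) ^ 3 := Nat.le_mul_of_pos_left _ (Nat.succ_pos b)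
  · rw [hl]
    exact (Nat.le_mul_of_pos_left _ (by norm_num)).trans
      ((Nat.le_mul_of_pos_right _ h.pos).trans h.est)

theorem planOf_bounds (hn : 1 ≤ n) (h : Params N n b s E) : (planOf N n s).length ≤ n * N ∧
    ∀ g ∈ planOf N n s, g.2.length ≤ N := by
  constructor
  · rw [planOf, List.length_map, groups, List.length_flatMap]
    refine (List.sum_le_card_nsmul _ N fun x hx => ?_).trans_eq ?_
    · obtain ⟨i, -, rfl⟩ := List.mem_map.mp hx
      have hf := fewChoices_groups hn h.groups
      rw [List.length_map, (secs_length hf).1]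
      exact hf.2
    · rw [List.length_map, List.length_range, smul_eq_mul]
  · intro g hg
    obtain ⟨g', hg', rfl⟩ := List.mem_map.mp hg
    obtain ⟨A, e, h1, h2, h3⟩ := (mem_groups hn h.groups).mp hg'
    have hl : g'.2.length = s + 1 := by rw [e, List.length_cons, h2]
    have hF := h.fuel hl fun a ha => by
      rw [e] at ha
      obtain rfl | ha := List.mem_cons.mp ha
      · exact h1
      · exact h3 a ha
    refine (items_length hF.paulis).trans ?_
    rw [hl]
    refine le_trans ?_ h.est
    rw [mul_assoc]
    exact Nat.mul_le_mul (by norm_num) (Nat.le_mul_of_pos_right _ h.pos)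

variable {U : UN n} {t : Table}

theorem mem_passList_iff (hn : 1 ≤ n) (h : Params N n b s E) (ht : GoodTable U N (planOf N n s) t)
    {c : TCand n} (hD : c.ls.length = D) (hl : c.A.length = s + 1) (hc : c.Good N b D)
    (hh : ∃ A, c.A = (c.idx : ℕ) :: A) :
    (c.raw ∈ passList N n D b (N ^ 2) E t → 3 - 2 / (E : ℝ) ≤ quality U c.ls c.idx) ∧
    (3 - 1 / (2 * (E : ℝ)) ≤ quality U c.ls c.idx → c.raw ∈ passList N n D b (N ^ 2) E t) := by
  subst hD
  have key := fun row => quality_of_passes (row := row) hc.fuel h.two h.pos (hl ▸ h.est) hc.on c.idx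
    hc.mem U
  constructor
  · intro hm
    obtain ⟨g, hg, hm⟩ := List.mem_flatMap.mp hm
    obtain ⟨V, hV, e⟩ := List.mem_map.mp hm
    obtain ⟨e1, e2⟩ := Prod.mk.inj e
    obtain ⟨g', hg', hgg⟩ := (exists_of_forall₂ ht).2 g hg
    obtain ⟨g'', -, rfl⟩ := List.mem_map.mp hg'
    obtain ⟨rfl, hrow⟩ : g'' = (c.raw.1) ∧ _ := ⟨hgg.1.symm.trans e1, hgg.2⟩
    refine (key g.2 hrow).1 ?_
    have := (List.mem_filter.mp hV).2
    rw [e2] at this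
    rwa [← Prod.mk.eta (p := g), e1] at this
  · intro hq
    obtain ⟨A, hA⟩ := hh
    have hg : c.raw.1 ∈ groups N n s := by
      refine (mem_groups hn h.groups).mpr ⟨A, ?_, c.idx.2, ?_, fun a ha => ?_⟩
      · change ((c.idx : ℕ), c.A) = _
        rw [hA]
        rfl
      · rw [hA, List.length_cons] at hl
        omega
      · exact hc.fuel.lt a (hA ▸ List.mem_cons_of_mem _ ha)
    obtain ⟨g, hg, hgg⟩ := (exists_of_forall₂ ht).1 _
      (List.mem_map_of_mem (f := fun g => (g, items N n g.2)) hg)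
    refine List.mem_flatMap.mpr ⟨g, hg, List.mem_map.mpr ⟨c.ls.map raw, List.mem_filter.mpr ⟨?_, ?_⟩, ?_⟩⟩
    · rw [hgg.1]
      exact raw_mem_vcands (hl.symm ▸ h.gates) (hl.symm ▸ h.labels) hc.on
    · have := (key g.2 hgg.2).2 hq
      rw [← Prod.mk.eta (p := g), hgg.1]
      exact this
    · rw [hgg.1]
      rfl

theorem exists_of_mem_passList (hn : 1 ≤ n) (h : Params N n b s E)
    (ht : GoodTable U N (planOf N n s) t) {c : Cand} (hc : c ∈ passList N n D b (N ^ 2) E t) :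
    ∃ c' : TCand n, c'.raw = c ∧ c'.Good N b D ∧ c'.A.length = s + 1 ∧
      3 - 2 / (E : ℝ) ≤ quality U c'.ls c'.idx := by
  have hc0 := hc
  obtain ⟨g, hg, hm⟩ := List.mem_flatMap.mp hc
  obtain ⟨V, hV, rfl⟩ := List.mem_map.mp hm
  have hg1 : g.1 ∈ groups N n s := by
    obtain ⟨g₀, hg₀, h2⟩ := (exists_of_forall₂ ht).2 g hg
    obtain ⟨g', hg', rfl⟩ := List.mem_map.mp hg₀
    rw [h2.1]
    exact hg'
  obtain ⟨A, e, h1, h2, h3⟩ := (mem_groups hn h.groups).mp hg1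
  obtain ⟨ls, rfl, hD, hon⟩ := exists_slots_of_mem (List.mem_filter.mp hV).1
  have e2 : g.1.2 = g.1.1 :: A := congrArg Prod.snd e
  have hl : g.1.2.length = s + 1 := by rw [e2, List.length_cons, h2]
  have hgood : TCand.Good N b D ⟨⟨g.1.1, h1⟩, g.1.2, ls⟩ := by
    refine ⟨h.fuel hl fun a ha => ?_, hon, ?_, hD⟩
    · dsimp only at ha
      rw [e2] at ha
      obtain rfl | ha := List.mem_cons.mp ha
      · exact h1
      · exact h3 a ha
    · dsimp only
      rw [e2]
      exact List.mem_cons_self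
  exact ⟨⟨⟨g.1.1, h1⟩, g.1.2, ls⟩, rfl, hgood, hl,
    (mem_passList_iff hn h ht hD hl hgood ⟨A, e2⟩).1 hc0⟩

end Select

/-! ### Light cones as candidates -/

section Cones

variable {n b w d : ℕ}

/-- The elements of a set of qubits, after the element `i` and repetitions of it. -/
noncomputable def padList (s : ℕ) (i : Fin n) (S : Finset (Fin n)) : List ℕ :=
  (i : ℕ) :: (List.replicate (s - S.card) (i : ℕ) ++ S.toList.map Fin.val)

theorem padList_length {s : ℕ} {i : Fin n} {S : Finset (Fin n)} (h : S.card ≤ s) :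
    (padList s i S).length = s + 1 := by
  rw [padList, List.length_cons, List.length_append, List.length_replicate, List.length_map,
    Finset.length_toList]
  omega

theorem mem_padList {s : ℕ} {i : Fin n} {S : Finset (Fin n)} (hi : i ∈ S) {q : ℕ} :
    q ∈ padList s i S ↔ ∃ j ∈ S, (j : ℕ) = q := by
  rw [padList, List.mem_cons, List.mem_append, List.mem_map]
  constructor
  · rintro (rfl | h | ⟨j, hj, rfl⟩)
    · exact ⟨i, hi, rfl⟩
    · exact ⟨i, hi, (List.eq_of_mem_replicate h).symm⟩
    · exact ⟨j, Finset.mem_toList.mp hj, rfl⟩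
  · rintro ⟨j, hj, rfl⟩
    exact Or.inr (Or.inr ⟨j, Finset.mem_toList.mpr hj, rfl⟩)

theorem restrictSlot_on {S : Finset (Fin n)} {A : List ℕ} (hA : ∀ j : Fin n, (j : ℕ) ∈ A ↔ j ∈ S)
    {sl : Slot n} (h : sl.Narrow b w) : (restrictSlot S sl).On b A := by
  have hk : ∀ j, (restrictSlot S sl).2 j = 0 ∨
      ((∀ k, sl.2 k = sl.2 j → k ∈ S) ∧ (restrictSlot S sl).2 j = sl.2 j) := by
    intro j
    change (if _ then _ else _) = 0 ∨ (_ ∧ (if _ then _ else _) = _)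
    by_cases hp : ∀ k, sl.2 k = sl.2 j → k ∈ S
    · exact Or.inr ⟨hp, if_pos hp⟩
    · exact Or.inl (if_neg hp)
  refine ⟨fun j => ?_, fun j hj => if_neg (mt (hA j).mpr hj), fun j hj => ?_, fun j => ?_⟩
  · change (if j ∈ S then sl.1 j else idG).Bounded b
    split_ifs
    · exact h.1 j
    · exact idG_bounded b
  · exact (hk j).resolve_right fun h' => hj ((hA j).mpr (h'.1 j rfl))
  · obtain h0 | ⟨h1, h2⟩ := hk j
    · exact Or.inl h0
    · by_cases h0 : sl.2 j = 0
      · exact Or.inl (h2.trans h0)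
      · obtain ⟨a, ha, ha'⟩ := h.2.2 j h0
        exact Or.inr ⟨a, (hA a).mpr (h1 a ha'), h2.trans ha⟩

/-- The candidate for the light cone of a qubit. -/
noncomputable def coneCand (s : ℕ) (ls : List (Slot n)) (i : Fin n) : TCand n :=
  ⟨i, padList s i (cone {i} ls), ls.map (restrictSlot (cone {i} ls))⟩

theorem mem_coneCand {s : ℕ} {ls : List (Slot n)} {i : Fin n} {q : ℕ} :
    q ∈ (coneCand s ls i).A ↔ ∃ j ∈ cone {i} ls, (j : ℕ) = q :=
  mem_padList (subset_cone {i} ls (Finset.mem_singleton_self i))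

theorem coneCand_good {N E : ℕ} (h : Params N n b (w ^ d) E) {ls : List (Slot n)}
    (hls : NarrowCircuit b w d ls) (i : Fin n) : (coneCand (w ^ d) ls i).Good N b (d + 1) ∧
      (coneCand (w ^ d) ls i).A.length = w ^ d + 1 := by
  have hl : (coneCand (w ^ d) ls i).A.length = w ^ d + 1 := padList_length (hls.cone i)
  have hA : ∀ j : Fin n, (j : ℕ) ∈ (coneCand (w ^ d) ls i).A ↔ j ∈ cone {i} ls := by
    intro j
    rw [mem_coneCand]
    exact ⟨fun ⟨k, hk, e⟩ => Fin.ext e ▸ hk, fun hj => ⟨j, hj, rfl⟩⟩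
  refine ⟨⟨h.fuel hl fun a ha => ?_, fun sl hsl => ?_, ?_, ?_⟩, hl⟩
  · obtain ⟨j, -, rfl⟩ := mem_coneCand.mp ha
    exact j.2
  · obtain ⟨sl', hsl', rfl⟩ := List.mem_map.mp hsl
    exact restrictSlot_on hA (hls.narrow sl' hsl')
  · exact (hA i).mpr (subset_cone {i} ls (Finset.mem_singleton_self i))
  · exact List.length_map _ |>.trans hls.length

theorem coneCand_quality (s : ℕ) {U : UN n} {z : ℂ} (hz : ‖z‖ = 1) {ls : List (Slot n)} {η : ℝ}
    (h : nrm ((U : Op n) - z • (slotsU ls : Op n)) ≤ η) (i : Fin n) :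
    3 - 6 * η ^ 2 ≤ quality U (coneCand s ls i).ls (coneCand s ls i).idx := by
  have := quality_of_distF_le (U := U) (ls := (coneCand s ls i).ls) (i := i) (ε := (2 * η) ^ 2)
    fun k => by
      obtain ⟨M, hM⟩ := exists_unitary_pauliAt (pauliOf k) i
      have e := (conj_restrict (pauliAt_mem_loc (pauliOf k) i) ls subset_rfl).1
      rw [candOp, popAt_succ, distF_eq, nrm_sub_comm]
      refine pow_le_pow_left₀ (nrm_nonneg _) ?_ 2
      change nrm (star (U : Op n) * _ * (U : Op n) - star (slotsU (ls.map (restrictSlot _)) : Op n) * _ *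
        (slotsU (ls.map (restrictSlot _)) : Op n)) ≤ _
      rw [← e, ← hM]
      exact (nrm_conj_sub_smul_le U (slotsU ls) M hz).trans (by linarith)
  refine le_trans (le_of_eq ?_) this
  ring

theorem exists_map_eq {α β : Type} {f : α → β} {p : α → Prop} {q : β → Prop}
    (h : ∀ b, q b → ∃ a, f a = b ∧ p a) (l : List β) (hl : ∀ b ∈ l, q b) :
    ∃ l' : List α, l'.map f = l ∧ ∀ a ∈ l', p a := by
  induction l with
  | nil => exact ⟨[], rfl, fun a ha => absurd ha List.not_mem_nil⟩
  | cons b l ih =>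
    rw [List.forall_mem_cons] at hl
    obtain ⟨l', rfl, h'⟩ := ih hl.2
    obtain ⟨a, rfl, ha⟩ := h b hl.1
    exact ⟨a :: l', rfl, List.forall_mem_cons.mpr ⟨ha, h'⟩⟩

theorem exists_chosen {N E l : ℕ} {U : UN n} {t : Table} (hn : 1 ≤ n) (hw : 1 ≤ w)
    (h : Params N n b (w ^ d) E) (ht : GoodTable U N (planOf N n (w ^ d)) t) (hl : n < 2 ^ l)
    {z : ℂ} (hz : ‖z‖ = 1) {ls : List (Slot n)} (hls : NarrowCircuit b w d ls) {η : ℝ}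
    (hU : nrm ((U : Op n) - z • (slotsU ls : Op n)) ≤ η) (hη : 6 * η ^ 2 ≤ 1 / (2 * E)) :
    ∃ rs : List (List (TCand n)), rs.map (fun r => r.map TCand.raw) =
      rounds (passList N n (d + 1) b (N ^ 2) E t) ((w ^ d + 1) * w ^ d * l) ∧
      Chosen N b (d + 1) rs ∧ rs.length = (w ^ d + 1) * w ^ d * l ∧
      ∀ c ∈ rs.flatMap fun r => r, c.A.length = w ^ d + 1 ∧ 3 - 2 / (E : ℝ) ≤ quality U c.ls c.idx := by
  set pass := passList N n (d + 1) b (N ^ 2) E t with hpass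
  have hall := fun c (hc : c ∈ pass) => exists_of_mem_passList hn h ht hc
  have hp : ∀ c ∈ pass, c.1.1 ∈ c.1.2 := fun c hc => by
    obtain ⟨c', rfl, hg, -⟩ := hall c hc
    exact hg.mem
  obtain ⟨h1, h2⟩ := rounds_spec hp ((w ^ d + 1) * w ^ d * l)
  obtain ⟨rs, hrs, hgood⟩ := exists_map_eq (exists_map_eq hall) _ fun r hr => (h1 r hr).1
  refine ⟨rs, hrs, ⟨fun r hr c hc => (hgood r hr c hc).1, fun r hr => ?_, ?_, fun i => ?_⟩, ?_, ?_⟩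
  · have := (h1 (r.map TCand.raw) (hrs ▸ List.mem_map_of_mem hr)).2
    exact (List.pairwise_map.mp this).imp fun h => ⟨fun e => h.1 (congrArg Fin.val e), h.2⟩
  · rw [← hrs, map_raw_flatMap, List.map_map] at h2
    refine List.Nodup.of_map Fin.val ?_
    rw [List.map_map]
    exact h2
  · let T : ℕ → Cand := fun i => if hi : i < n then (coneCand (w ^ d) ls ⟨i, hi⟩).raw else ((0, []), [])
    have hTe : ∀ i : Fin n, T i = (coneCand (w ^ d) ls i).raw := fun i => dif_pos i.2
    have hm := missing_rounds (n := n) (a := w ^ d + 1) (w := w ^ d) (l := l) hp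
      (fun c hc => by obtain ⟨c', rfl, -⟩ := hall c hc; exact c'.idx.2)
      (fun c hc => by obtain ⟨c', rfl, -, hl, -⟩ := hall c hc; exact hl.le) T
      (fun i hi => by
        rw [hTe ⟨i, hi⟩]
        obtain ⟨g1, g2⟩ := coneCand_good h hls ⟨i, hi⟩
        refine ⟨(mem_passList_iff hn h ht g1.length g2 g1 ⟨_, rfl⟩).2 ?_, rfl⟩
        exact le_trans (by linarith) (coneCand_quality (w ^ d) hz hU ⟨i, hi⟩))
      (Nat.mul_pos (Nat.succ_pos _) (pow_pos hw d))
      (fun q => by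
        by_cases hq : q < n
        · refine le_trans ?_ (hls.load ⟨q, hq⟩)
          rw [← Finset.card_map Fin.valEmbedding]
          refine Finset.card_le_card fun i hi => ?_
          obtain ⟨hi, hiq⟩ := Finset.mem_filter.mp hi
          rw [Finset.mem_range] at hi
          rw [hTe ⟨i, hi⟩] at hiq
          obtain ⟨j, hj, e⟩ := mem_coneCand.mp hiq
          refine Finset.mem_map.mpr ⟨⟨i, hi⟩, Finset.mem_filter.mpr ⟨Finset.mem_univ _, ?_⟩, rfl⟩
          rwa [show (⟨q, hq⟩ : Fin n) = j from Fin.ext e.symm]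
        · rw [Finset.filter_false_of_mem fun i hi hiq => ?_]
          · exact Nat.zero_le _
          · rw [hTe ⟨i, Finset.mem_range.mp hi⟩] at hiq
            obtain ⟨j, -, e⟩ := mem_coneCand.mp hiq
            exact hq (e ▸ j.2)) hl
    by_contra hi
    push Not at hi
    have : (i : ℕ) ∈ (∅ : Finset ℕ) := by
      rw [← hm, ← hrs, map_raw_flatMap]
      refine Finset.mem_filter.mpr ⟨Finset.mem_range.mpr i.2, fun c hc e => ?_⟩
      obtain ⟨c', hc', rfl⟩ := List.mem_map.mp hc
      exact hi c' hc' (Fin.ext e)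
    exact absurd this (Finset.notMem_empty _)
  · rw [← List.length_map, hrs, rounds_length]
  · intro c hc
    obtain ⟨r, hr, hc⟩ := List.mem_flatMap.mp hc
    exact (hgood r hr c hc).2

end Cones

/-! ### Parameters -/

section Parameters

/-- The exponent of the precision of the gates. -/
def gateExp (d k : ℕ) : ℕ := k + d + 10

/-- The width of the `CZ` gates. -/
def czWidth (d k n : ℕ) : ℕ := 4 * gateExp d k * lg n

/-- A bound for the sizes of the light cones, up to powers of logarithms. -/
def coneConst (d k : ℕ) : ℕ := (4 * gateExp d k) ^ d + 1

/-- The constant that governs the running time. -/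
def fuelConst (d k : ℕ) : ℕ :=
  (8 * (gateExp d k + 1) + (coneConst d k + 1 + d) + 2 + (2 * k + 20)) * coneConst d k + 2

theorem czWidth_pow_le (d k n : ℕ) : czWidth d k n ^ d + 1 ≤ coneConst d k * lg n ^ d := by
  rw [czWidth, mul_pow, coneConst, add_mul, one_mul]
  exact Nat.add_le_add_left (Nat.one_le_pow _ _ (lg_pos n)) _

theorem czWidth_pos (d k n : ℕ) : 1 ≤ czWidth d k n :=
  Nat.mul_pos (Nat.mul_pos (by norm_num) (by unfold gateExp; omega)) (lg_pos n)

theorem add_two_le (n : ℕ) : n + 2 ≤ 2 ^ (2 * lg n) :=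
  (add_two_lt n).le.trans (Nat.pow_le_pow_right (by norm_num) (by have := lg_pos n; omega))

theorem pow_le_fuel {c d n x m y z : ℕ} (hx : x ≤ 2 ^ (y * lg n)) (hm : m ≤ z * lg n ^ d)
    (hc : y * z ≤ c) : x ^ m ≤ fuel c d n := by
  refine (Nat.pow_le_pow_left hx m).trans ?_
  rw [← pow_mul, fuel]
  refine Nat.pow_le_pow_right (by norm_num) ?_
  calc y * lg n * m ≤ y * lg n * (z * lg n ^ d) := Nat.mul_le_mul_left _ hm
    _ = y * z * lg n ^ (d + 1) := by ring
    _ ≤ c * lg n ^ (d + 1) := Nat.mul_le_mul_right _ hc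

theorem params (d k : ℕ) {n : ℕ} (hn : 1 ≤ n) : Params (fuel (fuelConst d k) d n) n
    ((n + 2) ^ gateExp d k) (czWidth d k n ^ d) ((n + 2) ^ (k + 6)) := by
  have hs := czWidth_pow_le d k n
  have hl := lg_pos n
  have hn2 := add_two_le n
  set s := czWidth d k n ^ d with hsdef
  set z := coneConst d k with hz
  set e := gateExp d k with he
  have hc : ∀ y, y ≤ 8 * (e + 1) + (z + 1 + d) + 2 + (2 * k + 20) → y * z ≤ fuelConst d k :=
    fun y hy => (Nat.mul_le_mul_right z hy).trans (Nat.le_add_right _ 2)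
  have hpow : ∀ j, (n + 2) ^ j ≤ 2 ^ (2 * j * lg n) := fun j =>
    (Nat.pow_le_pow_left hn2 j).trans_eq (by rw [← pow_mul]; congr 1; ring)
  refine ⟨(by omega : 2 ≤ n + 2).trans (le_fuel (Nat.le_add_left _ _) n),
    Nat.one_le_pow _ _ (by omega), ?_, ?_, ?_, ?_⟩
  · refine le_trans ?_ (pow_le_fuel (x := 2 ^ ((2 * k + 20) * lg n)) le_rfl hs
      (hc (2 * k + 20) (by omega)))
    have e1 : 2 ^ ((2 * k + 20) * lg n) = 2 ^ (6 * lg n) * 2 ^ (2 * lg n) * 2 ^ (2 * (k + 6) * lg n) := by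
      rw [← pow_add, ← pow_add]; congr 1; ring
    rw [e1, mul_pow, mul_pow]
    refine Nat.mul_le_mul (Nat.mul_le_mul ?_ ?_) ?_
    · exact ((by norm_num : 60 ≤ 2 ^ 6).trans (Nat.pow_le_pow_right (by norm_num) (by omega))).trans
        (Nat.le_self_pow (by omega) _)
    · exact Nat.pow_le_pow_left ((by norm_num : 4 ≤ 2 ^ 2).trans
        (Nat.pow_le_pow_right (by norm_num) (by omega))) _
    · exact (hpow _).trans (Nat.le_self_pow (by omega) _)
  · refine pow_le_fuel (y := 8 * (e + 1)) ?_ hs (hc _ (by omega))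
    have hb : 1 ≤ (n + 2) ^ e := Nat.one_le_pow _ _ (by omega)
    have h1 : 3 * (n + 2) ^ e ≤ (n + 2) ^ (e + 1) := by
      rw [pow_succ, mul_comm]; exact Nat.mul_le_mul_left _ (by omega)
    calc ((n + 2) ^ e + 1) * (2 * (n + 2) ^ e + 1) ^ 3
        ≤ (n + 2) ^ (e + 1) * ((n + 2) ^ (e + 1)) ^ 3 :=
          Nat.mul_le_mul (by omega) (Nat.pow_le_pow_left (by omega) 3)
      _ = (n + 2) ^ (4 * (e + 1)) := by rw [← pow_mul, ← pow_add]; congr 1; ring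
      _ ≤ _ := (hpow _).trans_eq (by congr 1; ring)
  · refine pow_le_fuel (y := z + 1 + d) ?_ hs (hc _ (by omega))
    have h1 : 1 ≤ lg n ^ d := Nat.one_le_pow _ _ hl
    calc s + 2 ≤ (z + 1) * lg n ^ d := by rw [add_mul]; omega
      _ ≤ 2 ^ (z + 1) * (2 ^ lg n) ^ d := Nat.mul_le_mul Nat.lt_two_pow_self.le
          (Nat.pow_le_pow_left Nat.lt_two_pow_self.le d)
      _ = 2 ^ (z + 1 + lg n * d) := by rw [← pow_mul, ← pow_add]
      _ ≤ 2 ^ ((z + 1 + d) * lg n) := Nat.pow_le_pow_right (by norm_num) (by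
          rw [add_mul, mul_comm d]; exact Nat.add_le_add_right (Nat.le_mul_of_pos_right _ hl) _)
  · exact pow_le_fuel (y := 2) ((by omega : n ≤ n + 2).trans hn2) (by omega) (hc _ (by omega))

theorem precision (d k n : ℕ) (hn : 1 ≤ n) :
    6 * ((d + 1) * (n * (4 / ((n + 2) ^ gateExp d k : ℕ)) +
      n * (2 * Real.sqrt ((2⁻¹ : ℝ) ^ czWidth d k n)))) ^ 2 ≤
        1 / (2 * ((n + 2) ^ (k + 6) : ℕ) : ℝ) := by
  obtain ⟨M, hM⟩ : ∃ M : ℝ, M = n + 2 := ⟨_, rfl⟩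
  have hM3 : 3 ≤ M := by
    have : (1 : ℝ) ≤ n := by exact_mod_cast hn
    linarith
  have hM0 : 0 < M := by linarith
  have hs : Real.sqrt ((2⁻¹ : ℝ) ^ czWidth d k n) ≤ 1 / M ^ gateExp d k := by
    refine Real.sqrt_le_iff.mpr ⟨by positivity, ?_⟩
    have h1 : M ≤ 2 ^ (2 * lg n) := by rw [hM]; exact_mod_cast add_two_le n
    have h2 : (2⁻¹ : ℝ) ^ czWidth d k n = 1 / ((2 : ℝ) ^ (2 * lg n)) ^ (2 * gateExp d k) := by
      rw [inv_pow, one_div, ← pow_mul, czWidth]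
      congr 2
      ring
    rw [h2, div_pow, one_pow, ← pow_mul (M), mul_comm (gateExp d k)]
    exact one_div_le_one_div_of_le (by positivity) (pow_le_pow_left₀ hM0.le h1 _)
  have hn0 : (0 : ℝ) ≤ n := Nat.cast_nonneg n
  have hnM : (n : ℝ) ≤ M := by linarith
  have hcast : (((n + 2) ^ gateExp d k : ℕ) : ℝ) = M ^ gateExp d k := by rw [hM]; push_cast; rfl
  have hcast2 : (((n + 2) ^ (k + 6) : ℕ) : ℝ) = M ^ (k + 6) := by rw [hM]; push_cast; rfl
  rw [hcast, hcast2]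
  set η := ((d : ℝ) + 1) * (n * (4 / M ^ gateExp d k) +
    n * (2 * Real.sqrt ((2⁻¹ : ℝ) ^ czWidth d k n))) with hηdef
  have hη0 : 0 ≤ η := by positivity
  have hη : η ≤ 1 / (4 * M ^ (k + 6)) := by
    have h1 : η ≤ (d + 1) * (M * (6 / M ^ gateExp d k)) := by
      refine mul_le_mul_of_nonneg_left ?_ (by positivity)
      calc _ ≤ (n : ℝ) * (4 / M ^ gateExp d k) + n * (2 * (1 / M ^ gateExp d k)) := by gcongr
        _ = n * (6 / M ^ gateExp d k) := by ring
        _ ≤ _ := by gcongr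
    refine h1.trans ?_
    have h2 : (d : ℝ) + 1 ≤ M ^ d := by
      have : d + 1 ≤ 2 ^ d := Nat.lt_two_pow_self
      calc (d : ℝ) + 1 ≤ 2 ^ d := by exact_mod_cast this
        _ ≤ M ^ d := pow_le_pow_left₀ (by norm_num) (by linarith) d
    have h3 : (24 : ℝ) ≤ M ^ 3 :=
      (by norm_num : (24 : ℝ) ≤ 3 ^ 3).trans (pow_le_pow_left₀ (by norm_num) hM3 3)
    have h4 : M ^ gateExp d k = M ^ d * M ^ 3 * (M * M ^ (k + 6)) := by rw [gateExp]; ring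
    have h5 : ((d : ℝ) + 1) * (M * (6 / M ^ gateExp d k)) = (d + 1) * (6 * M) / M ^ gateExp d k := by
      ring
    rw [h5, div_le_div_iff₀ (by positivity) (by positivity), h4, one_mul]
    calc ((d : ℝ) + 1) * (6 * M) * (4 * M ^ (k + 6)) = (d + 1) * 24 * (M * M ^ (k + 6)) := by ring
      _ ≤ _ := by gcongr
  have hP : 1 ≤ M ^ (k + 6) := one_le_pow₀ (by linarith)
  calc 6 * η ^ 2 ≤ 6 * (1 / (4 * M ^ (k + 6))) ^ 2 := by gcongr
    _ ≤ 1 / (2 * M ^ (k + 6)) := by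
      rw [div_pow, one_pow, ← mul_div_assoc, mul_one, div_le_div_iff₀ (by positivity) (by positivity)]
      nlinarith

/-- The number of rounds. -/
def roundCount (d k n : ℕ) : ℕ :=
  (czWidth d k n ^ d + 1) * czWidth d k n ^ d * (lg n + 1)

theorem roundCount_le (d k n : ℕ) :
    roundCount d k n ≤ 2 * coneConst d k ^ 2 * lg n ^ (2 * d + 1) := by
  have hs := czWidth_pow_le d k n
  have hl := lg_pos n
  calc roundCount d k n ≤ coneConst d k * lg n ^ d * (coneConst d k * lg n ^ d) * (2 * lg n) :=
        Nat.mul_le_mul (Nat.mul_le_mul hs (by omega)) (by omega)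
    _ = _ := by ring

end Parameters

/-! ### The learner -/

section Learner

/-- The output of the learner, as a function of the estimates. -/
def learned (d k n N : ℕ) (t : Table) :=
  outputOf N n (d + 1) (rounds (passList N n (d + 1) ((n + 2) ^ gateExp d k) (N ^ 2)
    ((n + 2) ^ (k + 6)) t) (roundCount d k n))

theorem fp_plan (d k : ℕ) : FP fun x : ℕ × ℕ => planOf x.2 x.1 (czWidth d k x.1 ^ d) := by
  have h : FP fun x : ℕ × ℕ => czWidth d k x.1 ^ d := by
    unfold czWidth
    exact FP.npow (by fun_prop) d
  unfold planOf
  fun_prop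

theorem fp_learned (d k : ℕ) :
    FP fun x : ℕ × ℕ × Table => learned d k x.1 x.2.1 x.2.2 := by
  have h : FP fun x : ℕ × ℕ × Table => czWidth d k x.1 ^ d := by
    unfold czWidth
    exact FP.npow (by fun_prop) d
  have h1 : FP fun x : ℕ × ℕ × Table => (x.1 + 2) ^ gateExp d k := FP.npow (by fun_prop) _
  have h2 : FP fun x : ℕ × ℕ × Table => (x.1 + 2) ^ (k + 6) := FP.npow (by fun_prop) _
  have h3 : FP fun x : ℕ × ℕ × Table => x.2.1 ^ 2 := FP.npow (by fun_prop) _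
  unfold learned roundCount
  fun_prop

theorem learned_correct {d k n K : ℕ} (hn : 1 ≤ n) (C : QACCircuit n) (hC : C.depth ≤ d)
    (hK : 2 * coneConst d k ^ 2 * (3 * d + 7) + 2 * d + 5 ≤ K) (hKc : coneConst d k ≤ K) {t : Table}
    (ht : GoodTable C.unitary (fuel (fuelConst d k) d n)
      (planOf (fuel (fuelConst d k) d n) n (czWidth d k n ^ d)) t) :
    ∃ o : Output n, enc (learned d k n (fuel (fuelConst d k) d n) t) = o.data ∧
      o.Correct (C.unitary : Op n) d K (1 / (n : ℝ) ^ k) := by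
  have hl := lg_pos n
  have hb : 4 ≤ (n + 2) ^ gateExp d k :=
    calc 4 = 2 ^ 2 := by norm_num
      _ ≤ (n + 2) ^ 2 := Nat.pow_le_pow_left (by omega) 2
      _ ≤ _ := Nat.pow_le_pow_right (by omega) (by unfold gateExp; omega)
  obtain ⟨z, ls, hz, hls, hU⟩ := exists_narrow_near C _ _ d hb (czWidth_pos d k n) hC
  obtain ⟨rs, e, hrs, hlen, hq⟩ := exists_chosen hn (czWidth_pos d k n) (params d k hn) ht
    ((by omega : n < n + 2).trans (add_two_lt n)) hz hls hU (precision d k n hn)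
  rw [learned, roundCount, ← e]
  refine hrs.exists_correct (a := czWidth d k n ^ d + 1) hn C.unitary (fun c hc m hm => ?_)
    (fun c hc => (hq c hc).1.le) ((czWidth_pow_le d k n).trans (Nat.mul_le_mul_right _ hKc)) ?_ ?_
  · refine (distF_le_of_quality (hq c hc).2 hm).trans_eq ?_
    push_cast
    ring
  · have : 1 ≤ coneConst d k ^ 2 := Nat.one_le_pow _ _ (Nat.succ_pos _)
    nlinarith
  · have hr : rs.length ≤ _ := hlen.le.trans (roundCount_le d k n)
    have h1 : 1 ≤ lg n ^ (2 * d + 1) := Nat.one_le_pow _ _ hl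
    calc rs.length * (d + 1 + 4 + 2 * (d + 1)) + 4
        ≤ 2 * coneConst d k ^ 2 * lg n ^ (2 * d + 1) * (d + 1 + 4 + 2 * (d + 1)) +
          4 * lg n ^ (2 * d + 1) := Nat.add_le_add (Nat.mul_le_mul_right _ hr) (by omega)
      _ = (2 * coneConst d k ^ 2 * (3 * d + 7) + 4) * lg n ^ (2 * d + 1) := by ring
      _ ≤ K * lg n ^ K := Nat.mul_le_mul (by omega) (Nat.pow_le_pow_right hl (by omega))

end Learner

end QACLearn

theorem mainTheorem2 (d k : ℕ) :
    ∃ (p : QACLearn.Prog) (K : ℕ), ∀ n : ℕ, 1 ≤ n →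
      ∀ C : QACLearn.QACCircuit n, C.depth ≤ d → ∀ t : ℕ,
        ∃ μ : PMF (QACLearn.Data × ℕ),
          QACLearn.Exec (QACLearn.oracle C.unitary) (n + 1) p
            (.cons (.ofNat n) (.ofNat t)) μ ∧
          (∀ r ∈ μ.support, r.2 ≤ 2 ^ (K * QACLearn.lg n ^ K) * (t + 1)) ∧
          μ.toOuterMeasure {r | ¬ ∃ o : QACLearn.Output n, r.1 = o.data ∧
            o.Correct (C.unitary : QACLearn.Op n) d K (1 / (n : ℝ) ^ k)} ≤ (2⁻¹ : ℝ≥0∞) ^ t := by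
  obtain ⟨p, K₀, hp⟩ := QACLearn.exists_learner (QACLearn.fuelConst d k) d (Nat.le_add_left _ _)
    (L := fun n N => QACLearn.planOf N n (QACLearn.czWidth d k n ^ d)) (F := QACLearn.learned d k)
    (QACLearn.fp_plan d k) (QACLearn.fp_learned d k)
  let K := K₀ + (2 * QACLearn.coneConst d k ^ 2 * (3 * d + 7) + 2 * d + 5) + QACLearn.coneConst d k
  refine ⟨p, K, fun n hn C hC t => ?_⟩
  have hl := QACLearn.lg_pos n
  obtain ⟨μ, hμ, hμf, hT⟩ := hp n C.unitary t
  refine ⟨μ, hμ, fun r hr => (hT r hr).trans (Nat.mul_le_mul_right _ (Nat.pow_le_pow_right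
    (by norm_num) (Nat.mul_le_mul (by omega) (Nat.pow_le_pow_right hl (by omega))))), ?_⟩
  set N := QACLearn.fuel (QACLearn.fuelConst d k) d n with hN
  have hP := QACLearn.params d k hn
  obtain ⟨hb1, hb2⟩ := QACLearn.planOf_bounds hn hP
  have hnN : n ≤ N := (by omega : n ≤ n + 2).trans (QACLearn.le_fuel (Nat.le_add_left _ _) n)
  have hgood := QACLearn.tableK_fails C.unitary N t (n * N) N hP.two
    (QACLearn.planOf N n (QACLearn.czWidth d k n ^ d)) hb1 hb2 (by
      have h1 : N ≤ 2 ^ N := Nat.lt_two_pow_self.le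
      calc 2 * (n * N * N) ≤ 2 ^ N * (2 ^ N * 2 ^ N * 2 ^ N) :=
            Nat.mul_le_mul (hP.two.trans h1) (Nat.mul_le_mul (Nat.mul_le_mul (hnN.trans h1) h1) h1)
        _ = 2 ^ (4 * N) := by rw [← pow_add, ← pow_add, ← pow_add]; congr 1; ring)
  have h2 : QACLearn.Fails (μ.map Prod.fst) (fun x => ∃ o : QACLearn.Output n, x = o.data ∧
      o.Correct (C.unitary : QACLearn.Op n) d K (1 / (n : ℝ) ^ k)) ((2⁻¹ : ℝ≥0∞) ^ t) := by
    rw [hμf]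
    refine QACLearn.Fails.map (QACLearn.Fails.map (hgood.mono (fun T hT => ?_) le_rfl))
    exact QACLearn.learned_correct hn C hC (by omega) (by omega) hT
  rw [QACLearn.Fails, PMF.toOuterMeasure_map_apply] at h2
  exact h2
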